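/- **Conventions.** A *rational polyhedral cone* is a pair $(N,\sigma)$ of a finitely generated free abelian group $N$ and a finite intersection $\sigma\subseteq N_{\mathbb R}=N\otimes\mathbb R$ of rational half-spaces which spans $N_{\mathbb R}$ and contains no nontrivial linear subspace; $S_\sigma\subseteq\mathrm{Hom}(N,\mathbb Z)$ denotes the monoid of integral functionals that are non-negative on $\sigma$. Morphisms are the homomorphisms of lattices that map the cones into each other; they form the category $\mathbf{RPC}$. A *face morphism* is an isomorphism onto a face $F$ (with the lattice $N\cap\mathrm{Span}\,F$). A *rational polyhedral cone complex* $\Sigma$ is a collection of cones $\sigma_\alpha$ and a collection of face morphisms between them, closed under composition and containing the identities, such that every face of every $\sigma_\alpha$ is the image of exactly one face morphism of the collection and there is at most one morphism between any two cones. A morphism $f:\Sigma\to\Sigma'$ assigns to every cone $\sigma_\alpha$ of $\Sigma$ a cone $\sigma'_{f(\alpha)}$ of $\Sigma'$ and a morphism of cones $f_\alpha:\sigma_\alpha\to\sigma'_{f(\alpha)}$ that does not factor through a proper face, compatibly with face morphisms. This is the category $\mathbf{RPCC}$; it contains $\mathbf{RPC}$ (a cone is identified with the complex of its faces). A morphism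 $f$ is *strict* if all $f_\alpha$ are isomorphisms. The *face topology* on $\mathbf{RPCC}$ is generated by the coverings $\{\sigma_\alpha\to\Sigma\}_\alpha$ of complexes by their cones. *Geometric stacks.* A *geometric space* is a sheaf on $\mathbf{RPCC}$ for the face topology whose diagonal is representable by cone complexes and which has a strict covering, representable by cone complexes, by a cone complex. A *cone stack* (a geometric stack in the context ($\mathbf{RPCC}$, face topology, strict morphisms)) is a stack in groupoids over $\mathbf{RPCC}$ for the face topology whose diagonal is representable by geometric spaces and which has a strict covering by a geometric space. Here a covering is a locally surjective morphism. *Tropical curves.* An $n$-marked weighted graph $G$ is a finite graph, possibly with loops and multiple edges, with vertex weights $h(v)\in\mathbb Z_{\ge0}$ and $n$ legs marked bijectively by $1,\dots,n$; its genus is $b_1(G)+\sum_v h(v)$, and it is *stable* if $2h(v)-2+\mathrm{val}(v)>0$ for all vertices $v$. A morphism $G\to H$ contracts some edges of $G$ such that the preimage of each vertex $v$ of $H$ is connected of genus $h(v)$, and is a bijection on the remaining edges and on the legs, respecting incidences and markings. A *stable tropical curve of genus $g$ with $n$ markings over a cone $\sigma$* is a connected stable $n$-marked weighted graph $G$ of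 genus $g$ together with an edge length $d(e)\in S_\sigma\setminus\{0\}$ for every edge $e$. A morphism $(\sigma,\Gamma)\to(\sigma',\Gamma')$ is a morphism of cones $f:\sigma\to\sigma'$ together with a morphism of graphs $\pi:G'\to G$ that contracts exactly the edges $e'$ with $f^*d'(e')=0$ and satisfies $d(\pi(e'))=f^*d'(e')$ for all other edges $e'$. Let $\mathcal M^{trop}_{g,n}$ be the category, over $\mathbf{RPC}$, of these pairs; its fiber over $\sigma$ is the groupoid of stable tropical curves of genus $g$ with $n$ markings with edge lengths in $S_\sigma$. It is extended to $\mathbf{RPCC}$: an object over a cone complex $\Sigma$ is a family of tropical curves $\Gamma_\alpha$ over the cones $\sigma_\alpha$ of $\Sigma$ with isomorphisms $\Gamma_\alpha\cong\varphi^*\Gamma_\beta$ for all face morphisms $\varphi:\sigma_\alpha\to\sigma_\beta$ of $\Sigma$, compatible with compositions. **Theorem.** Let $g,n\ge0$ be integers with $2g-2+n>0$. Then $\mathcal M^{trop}_{g,n}$ is fibered in groupoids over $\mathbf{RPC}$, its extension to $\mathbf{RPCC}$ restricts to it on $\mathbf{RPC}$, and this extension is a cone stack, i.e. a geometric stack in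 the context ($\mathbf{RPCC}$, face topology, strict morphisms). Moreover, if $G$ runs through any set of connected stable $n$-marked weighted graphs of genus $g$ that contains at least one representative of each isomorphism class, then the tropical curves over $\mathbb R_{\ge0}^{E(G)}$ with underlying graph $G$ and with the coordinate functions as edge lengths define a morphism $$\bigsqcup_G\mathbb R_{\ge0}^{E(G)}\longrightarrow\mathcal M^{trop}_{g,n}$$ that is representable by cone complexes, strict and surjective (that is, a covering). -/

import Mathlib

open CategoryTheory TensorProduct

noncomputable section

namespace Trop

/-! ### Geometric stacks -/

section Stacks

open Limits Opposite

universe v u v₁ u₁ v₂ u₂ v₃ u₃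

variable {C : Type u} [Category.{v} C] {𝒳 : Type u₁} [Category.{v₁} 𝒳] {𝒴 : Type u₂}
  [Category.{v₂} 𝒴] {𝒵 : Type u₃} [Category.{v₃} 𝒵]

/-- `p : 𝒳 ⥤ C` is a category fibered in groupoids. -/
structure IsFiberedInGroupoids (p : 𝒳 ⥤ C) : Prop where
  exists_lift : ∀ (x : 𝒳) {V : C} (f : V ⟶ p.obj x), ∃ (y : 𝒳) (φ : y ⟶ x), p.IsHomLift f φ
  isStronglyCartesian : ∀ {x y : 𝒳} (φ : y ⟶ x), p.IsStronglyCartesian (p.map φ) φ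

/-- A category fibered in groupoids `p : 𝒳 ⥤ C` is a stack for the topology `J` if morphisms can be
glued uniquely along covering sieves and all descent data for objects are effective. A descent
datum for a covering sieve `S` of `U` is a functor `D : S ⥤ 𝒳` over `C`. -/
structure IsStack (J : GrothendieckTopology C) (p : 𝒳 ⥤ C) : Prop where
  fibered : IsFiberedInGroupoids p
  existsUnique_hom : ∀ (x y : 𝒳) (f : p.obj x ⟶ p.obj y), ∀ S ∈ J (p.obj x),
    ∀ m : ∀ {z : 𝒳} (φ : z ⟶ x), S (p.map φ) → (z ⟶ y),
      (∀ {z : 𝒳} (φ : z ⟶ x) (h : S (p.map φ)), p.map (m φ h) = p.map φ ≫ f) →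
      (∀ {w z : 𝒳} (ψ : w ⟶ z) (φ : z ⟶ x) (h : S (p.map φ)) (h' : S (p.map (ψ ≫ φ))),
        m (ψ ≫ φ) h' = ψ ≫ m φ h) →
      ∃! k : x ⟶ y, p.map k = f ∧ ∀ {z : 𝒳} (φ : z ⟶ x) (h : S (p.map φ)), φ ≫ k = m φ h
  exists_obj : ∀ (U : C), ∀ S ∈ J U, ∀ (D : S.arrows.category ⥤ 𝒳) (a : D ⋙ p ≅ S.arrows.diagram),
    ∃ (x : 𝒳) (e : p.obj x ≅ U) (c : ∀ s, D.obj s ⟶ x),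
      (∀ {s t} (h : s ⟶ t), D.map h ≫ c t = c s) ∧
        ∀ s, p.map (c s) ≫ e.hom = a.hom.app s ≫ s.obj.hom

/-- A geometric space in the context `(C, J, P)`: a sheaf with representable diagonal and with a
representable covering in `P` by an object of `C`. -/
structure IsGeometricSpace (J : GrothendieckTopology C) (P : MorphismProperty C)
    (X : Cᵒᵖ ⥤ Type v) : Prop where
  isSheaf : Presheaf.IsSheaf J X
  diag : yoneda.relativelyRepresentable (diag X)
  atlas : ∃ (U : C) (a : yoneda.obj U ⟶ X), P.presheaf a ∧ Presheaf.IsLocallySurjective J a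

/-- A morphism of categories over `C`. -/
structure OverFunctor (p : 𝒳 ⥤ C) (q : 𝒴 ⥤ C) where
  functor : 𝒳 ⥤ 𝒴
  comm : functor ⋙ q ≅ p

/-- The category `C/X` over `C` associated to a presheaf `X`: its objects over `S` are the
morphisms `S ⟶ X`. -/
abbrev overProj (X : Cᵒᵖ ⥤ Type v) : CostructuredArrow yoneda X ⥤ C :=
  CostructuredArrow.proj yoneda X

/-- The `2`-fiber product `𝒳 ×_𝒵 𝒴` of two categories over `C`, as a category over `C`. -/
abbrev fiberProductProj {p : 𝒳 ⥤ C} {q : 𝒴 ⥤ C} {r : 𝒵 ⥤ C} (F : OverFunctor p r)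
    (G : OverFunctor q r) : CategoricalPullback F.functor G.functor ⥤ C :=
  CategoricalPullback.π₂ F.functor G.functor ⋙ q

/-- The product `𝒳 × 𝒳` of a category over `C` with itself, as a category over `C`. -/
abbrev squareProj (p : 𝒳 ⥤ C) : CategoricalPullback p p ⥤ C :=
  CategoricalPullback.π₁ p p ⋙ p

/-- The diagonal `𝒳 → 𝒳 × 𝒳`. -/
def diagonal (p : 𝒳 ⥤ C) : OverFunctor p (squareProj p) where
  functor :=
    { obj := fun x => ⟨x, x, Iso.refl _⟩
      map := fun f => ⟨f, f, by simp⟩ }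
  comm := Iso.refl _

/-- A representation of a category `r : 𝒵 ⥤ C` over `C` by a presheaf `W`: an equivalence over `C`
with `C/W`. -/
structure Representation (r : 𝒵 ⥤ C) (W : Cᵒᵖ ⥤ Type v) where
  equiv : 𝒵 ≌ CostructuredArrow yoneda W
  comm : equiv.functor ⋙ overProj W ≅ r

/-- If the `2`-fiber product `𝒳 ×_𝒵 V` is represented by `W`, then this is the condition on
`f : W ⟶ V` to be the projection to `V`. -/
def IsProjection {p : 𝒳 ⥤ C} {r : 𝒵 ⥤ C} {V W : Cᵒᵖ ⥤ Type v} {F : OverFunctor p r}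
    {G : OverFunctor (overProj V) r} (ρ : Representation (fiberProductProj F G) W)
    (f : W ⟶ V) : Prop :=
  ∀ z, (ρ.equiv.functor.obj z).hom ≫ f = yoneda.map (ρ.comm.hom.app z) ≫ z.snd.hom

/-- A morphism `𝒳 → 𝒵` is representable by geometric spaces if for every morphism `V → 𝒵` from a
geometric space the fiber product `𝒳 ×_𝒵 V` is representable by a geometric space. -/
def RepresentableByGeometricSpaces (J : GrothendieckTopology C) (P : MorphismProperty C)
    {p : 𝒳 ⥤ C} {r : 𝒵 ⥤ C} (F : OverFunctor p r) : Prop :=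
  ∀ (V : Cᵒᵖ ⥤ Type v), IsGeometricSpace J P V → ∀ G : OverFunctor (overProj V) r,
    ∃ W, IsGeometricSpace J P W ∧ Nonempty (Representation (fiberProductProj F G) W)

/-- A morphism `W → S` from a geometric space to an object `S` of `C` is in `P` if its composition
with a covering `T → W` in `P` by an object `T` of `C` is in `P`. -/
def SpaceMorphismIn (J : GrothendieckTopology C) (P : MorphismProperty C) {W : Cᵒᵖ ⥤ Type v} {S : C}
    (f : W ⟶ yoneda.obj S) : Prop :=
  ∃ (T : C) (a : yoneda.obj T ⟶ W), P.presheaf a ∧ Presheaf.IsLocallySurjective J a ∧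
    ∃ b : T ⟶ S, P b ∧ yoneda.map b = a ≫ f

/-- A morphism `𝒳 → 𝒵` is (representable by geometric spaces,) a covering and in `P` if this holds
for all its base changes `𝒳 ×_𝒵 S → S` along morphisms `S → 𝒵` from objects `S` of `C`. -/
def IsCoveringIn (J : GrothendieckTopology C) (P : MorphismProperty C) {p : 𝒳 ⥤ C} {r : 𝒵 ⥤ C}
    (F : OverFunctor p r) : Prop :=
  ∀ (S : C) (G : OverFunctor (overProj (yoneda.obj S)) r), ∃ W, IsGeometricSpace J P W ∧
    ∃ (ρ : Representation (fiberProductProj F G) W) (f : W ⟶ yoneda.obj S), IsProjection ρ f ∧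
      Presheaf.IsLocallySurjective J f ∧ SpaceMorphismIn J P f

/-- A geometric stack in the context `(C, J, P)`: a stack `p : 𝒳 ⥤ C` whose diagonal is
representable by geometric spaces and which has a covering in `P` by a geometric space. -/
structure IsGeometricStack (J : GrothendieckTopology C) (P : MorphismProperty C) (p : 𝒳 ⥤ C) :
    Prop where
  isStack : IsStack J p
  diagonal : RepresentableByGeometricSpaces J P (diagonal p)
  atlas : ∃ (U : Cᵒᵖ ⥤ Type v) (F : OverFunctor (overProj U) p), IsGeometricSpace J P U ∧
    IsCoveringIn J P F

/-- A morphism `𝒳 → 𝒵` is representable by objects of `C`, a covering and in `P`: for every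
morphism `S → 𝒵` from an object `S` of `C`, the fiber product `𝒳 ×_𝒵 S` is representable by an
object `W` of `C`, and `W → S` is a covering and in `P`. -/
def IsRepresentableCoveringIn (J : GrothendieckTopology C) (P : MorphismProperty C) {p : 𝒳 ⥤ C}
    {r : 𝒵 ⥤ C} (F : OverFunctor p r) : Prop :=
  ∀ (S : C) (G : OverFunctor (overProj (yoneda.obj S)) r), ∃ (W : C)
    (ρ : Representation (fiberProductProj F G) (yoneda.obj W)) (f : W ⟶ S),
      IsProjection ρ (yoneda.map f) ∧ Presheaf.IsLocallySurjective J (yoneda.map f) ∧ P f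

end Stacks

/-! ### Rational polyhedral cones -/

/-- The `ℝ`-linear extension `N_ℝ = ℝ ⊗ N → ℝ` of an integral functional `u ∈ M = Hom(N, ℤ)`. -/
def realExt {N : Type} [AddCommGroup N] (u : N →ₗ[ℤ] ℤ) : (ℝ ⊗[ℤ] N) →ₗ[ℝ] ℝ :=
  (TensorProduct.AlgebraTensorModule.rid ℤ ℝ ℝ).toLinearMap ∘ₗ u.baseChange ℝ

/-- A rational polyhedral cone `(N, σ)`: a lattice `N` (finitely generated free abelian group)
and a finite intersection `σ` of rational half spaces in `N_ℝ = ℝ ⊗ N` which contains no nontrivial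
linear space and spans `N_ℝ` (that is, `S_σ` is sharp). -/
structure RPC where
  N : Type
  [addCommGroup : AddCommGroup N]
  [free : Module.Free ℤ N]
  [finite : Module.Finite ℤ N]
  cone : PointedCone ℝ (ℝ ⊗[ℤ] N)
  rational : ∃ s : Finset (N →ₗ[ℤ] ℤ), ∀ x, x ∈ cone ↔ ∀ u ∈ s, 0 ≤ realExt u x
  salient : ∀ x ∈ cone, -x ∈ cone → x = 0
  span_eq_top : Submodule.span ℝ (cone : Set (ℝ ⊗[ℤ] N)) = ⊤

attribute [instance] RPC.addCommGroup RPC.free RPC.finite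

namespace RPC

/-- A `ℤ`-linear morphism of cones: a homomorphism of lattices mapping `σ` into `τ`. -/
@[ext]
structure Hom (σ τ : RPC) where
  lin : σ.N →ₗ[ℤ] τ.N
  mapsTo : ∀ x ∈ σ.cone, lin.baseChange ℝ x ∈ τ.cone

instance : Category RPC where
  Hom := Hom
  id σ := ⟨LinearMap.id, fun x hx => by simpa using hx⟩
  comp f g := ⟨g.lin ∘ₗ f.lin, fun x hx => by
    rw [LinearMap.baseChange_comp]
    exact g.mapsTo _ (f.mapsTo x hx)⟩

/-- The map `σ → τ` on real points, as a linear map `N_ℝ → N'_ℝ`. -/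
def real {σ τ : RPC} (f : σ ⟶ τ) : (ℝ ⊗[ℤ] σ.N) →ₗ[ℝ] (ℝ ⊗[ℤ] τ.N) :=
  f.lin.baseChange ℝ

theorem real_mem {σ τ : RPC} (f : σ ⟶ τ) {x : ℝ ⊗[ℤ] σ.N} (hx : x ∈ σ.cone) :
    real f x ∈ τ.cone := f.mapsTo x hx

@[simp] theorem id_lin (σ : RPC) : (𝟙 σ : σ ⟶ σ).lin = LinearMap.id := rfl

@[simp] theorem comp_lin {σ τ ρ : RPC} (f : σ ⟶ τ) (g : τ ⟶ ρ) :
    (f ≫ g).lin = g.lin ∘ₗ f.lin := rfl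

theorem real_id (σ : RPC) : real (𝟙 σ) = LinearMap.id := by
  simp [real]

theorem real_comp {σ τ ρ : RPC} (f : σ ⟶ τ) (g : τ ⟶ ρ) :
    real (f ≫ g) = real g ∘ₗ real f := by
  simp [real, LinearMap.baseChange_comp]

theorem hom_ext {σ τ : RPC} {f g : σ ⟶ τ} (h : ∀ n, f.lin n = g.lin n) : f = g :=
  Hom.ext (LinearMap.ext h)

/-- The toric monoid `S_σ = σ^∨ ∩ M`. -/
def dualMonoid (σ : RPC) : AddSubmonoid (σ.N →ₗ[ℤ] ℤ) where
  carrier := {u | ∀ x ∈ σ.cone, 0 ≤ realExt u x}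
  zero_mem' := fun x _ => by simp [realExt]
  add_mem' := fun {u v} hu hv x hx => by
    have : realExt (u + v) x = realExt u x + realExt v x := by
      simp [realExt, LinearMap.baseChange_add]
    rw [this]
    exact add_nonneg (hu x hx) (hv x hx)

theorem realExt_comp {σ τ : RPC} (f : σ ⟶ τ) (u : τ.N →ₗ[ℤ] ℤ) (x : ℝ ⊗[ℤ] σ.N) :
    realExt (u ∘ₗ f.lin) x = realExt u (real f x) := by
  simp [realExt, real, LinearMap.baseChange_comp]

/-- The map of toric monoids `f^* : S_τ → S_σ` associated to `f : σ → τ`. -/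
def pullback {σ τ : RPC} (f : σ ⟶ τ) : τ.dualMonoid →+ σ.dualMonoid where
  toFun u := ⟨u.1 ∘ₗ f.lin, fun x hx => by
    rw [realExt_comp]; exact u.2 _ (real_mem f hx)⟩
  map_zero' := by ext; simp
  map_add' u v := by ext; simp

theorem pullback_id (σ : RPC) (u : σ.dualMonoid) : pullback (𝟙 σ) u = u := by
  ext; simp [pullback]

theorem pullback_comp {σ τ ρ : RPC} (f : σ ⟶ τ) (g : τ ⟶ ρ) (u : ρ.dualMonoid) :
    pullback (f ≫ g) u = pullback f (pullback g u) := by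
  ext; simp [pullback]

/-- The lattice `N ∩ Span(F)` of a face `F` of `σ`. -/
def faceLattice (σ : RPC) (F : PointedCone ℝ (ℝ ⊗[ℤ] σ.N)) : Submodule ℤ σ.N :=
  ((Submodule.span ℝ (F : Set (ℝ ⊗[ℤ] σ.N))).restrictScalars ℤ).comap
    (TensorProduct.mk ℤ ℝ σ.N 1)

theorem mem_faceLattice {σ : RPC} {F : PointedCone ℝ (ℝ ⊗[ℤ] σ.N)} {n : σ.N} :
    n ∈ σ.faceLattice F ↔ (1 : ℝ) ⊗ₜ[ℤ] n ∈ Submodule.span ℝ (F : Set (ℝ ⊗[ℤ] σ.N)) := Iff.rfl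

/-- `τ → σ` is a face morphism if it induces an isomorphism of `τ` onto a face `F` of `σ`, where `F`
is considered as a cone in the lattice `N ∩ Span(F)`. -/
structure IsFaceMorphism {τ σ : RPC} (f : τ ⟶ σ) : Prop where
  isFace : (PointedCone.map (real f) τ.cone).IsFaceOf σ.cone
  injective : Function.Injective f.lin
  range_eq : LinearMap.range f.lin = σ.faceLattice (PointedCone.map (real f) τ.cone)

/-- The morphism `f : σ → τ` does not factor through any proper face of `τ`. -/
def Interior {σ τ : RPC} (f : σ ⟶ τ) : Prop :=
  ∀ F : PointedCone ℝ (ℝ ⊗[ℤ] τ.N), F.IsFaceOf τ.cone → (∀ x ∈ σ.cone, real f x ∈ F) → F = τ.cone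

theorem Interior.id (σ : RPC) : Interior (𝟙 σ) := fun F hF h =>
  le_antisymm hF.le fun x hx => by simpa [real_id] using h x hx

/-- The preimage of a face under a morphism of cones is a face. -/
theorem isFaceOf_preimage {σ τ : RPC} (f : σ ⟶ τ) {F : PointedCone ℝ (ℝ ⊗[ℤ] τ.N)}
    (hF : F.IsFaceOf τ.cone) : (σ.cone ⊓ F.comap (real f)).IsFaceOf σ.cone where
  le := inf_le_left
  mem_of_smul_add_mem := by
    intro x y a hx hy ha h
    refine ⟨hx, ?_⟩
    have h2 := h.2
    rw [SetLike.mem_coe, PointedCone.mem_comap, map_add, map_smul] at h2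
    exact hF.mem_of_smul_add_mem (real_mem f hx) (real_mem f hy) ha h2

theorem Interior.comp {σ τ ρ : RPC} {f : σ ⟶ τ} {g : τ ⟶ ρ} (hf : Interior f) (hg : Interior g) :
    Interior (f ≫ g) := fun F hF h => by
  refine hg F hF fun y hy => ?_
  have := hf _ (isFaceOf_preimage g hF) fun x hx => ⟨real_mem f hx, by
    have := h x hx
    rw [real_comp] at this
    exact this⟩
  rw [← this] at hy
  exact hy.2

/-- Every face has a point at which all functionals that define the cone and do not vanish
identically on the face are positive. -/
theorem exists_interior_point (σ : RPC) {F : PointedCone ℝ (ℝ ⊗[ℤ] σ.N)}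
    (hF : F.IsFaceOf σ.cone) (s : Finset (σ.N →ₗ[ℤ] ℤ))
    (hs : ∀ x, x ∈ σ.cone ↔ ∀ u ∈ s, 0 ≤ realExt u x) :
    ∃ x₀ ∈ F, ∀ u ∈ s, (∀ x ∈ F, realExt u x = 0) ∨ 0 < realExt u x₀ := by
  classical
  have hex : ∀ u : σ.N →ₗ[ℤ] ℤ, ∃ x ∈ F, (∃ y ∈ F, realExt u y ≠ 0) → realExt u x ≠ 0 := by
    intro u
    by_cases h : ∃ y ∈ F, realExt u y ≠ 0
    · obtain ⟨y, hy, hne⟩ := h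
      exact ⟨y, hy, fun _ => hne⟩
    · exact ⟨0, F.zero_mem, fun h' => absurd h' h⟩
  choose p hpF hp using hex
  refine ⟨∑ u ∈ s, p u, F.sum_mem fun u _ => hpF u, fun u hu => ?_⟩
  by_cases h : ∃ y ∈ F, realExt u y ≠ 0
  · right
    rw [map_sum]
    refine Finset.sum_pos' (fun v _ => (hs _).1 (hF.le (hpF v)) u hu) ⟨u, hu, ?_⟩
    exact lt_of_le_of_ne ((hs _).1 (hF.le (hpF u)) u hu) (hp u h).symm
  · left
    push Not at h
    exact h

/-- A face of a rational polyhedral cone is cut out by the vanishing of the functionals which vanish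
on the face. -/
theorem mem_face_iff (σ : RPC) {F : PointedCone ℝ (ℝ ⊗[ℤ] σ.N)} (hF : F.IsFaceOf σ.cone)
    (s : Finset (σ.N →ₗ[ℤ] ℤ)) (hs : ∀ x, x ∈ σ.cone ↔ ∀ u ∈ s, 0 ≤ realExt u x)
    (x : ℝ ⊗[ℤ] σ.N) : x ∈ F ↔ (∀ u ∈ s, 0 ≤ realExt u x) ∧
      ∀ u ∈ s, (∀ y ∈ F, realExt u y = 0) → realExt u x = 0 := by
  classical
  constructor
  · exact fun hx => ⟨(hs x).1 (hF.le hx), fun u _ h => h x hx⟩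
  rintro ⟨hx, h0⟩
  obtain ⟨x₀, hx₀, hpos⟩ := exists_interior_point σ hF s hs
  -- `x₀ - ε x` lies in the cone for a small `ε`
  have hε : ∃ ε : ℝ, 0 < ε ∧ ∀ u ∈ s, ε * realExt u x ≤ realExt u x₀ := by
    have hx₀' := (hs x₀).1 (hF.le hx₀)
    suffices H : ∀ t : Finset (σ.N →ₗ[ℤ] ℤ), t ⊆ s → ∃ ε : ℝ, 0 < ε ∧ ∀ u ∈ t,
        ε * realExt u x ≤ realExt u x₀ from H s subset_rfl
    intro t
    induction t using Finset.induction_on with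
    | empty => exact fun _ => ⟨1, one_pos, by simp⟩
    | insert a t _ ih =>
      intro hts
      obtain ⟨ε, hε, h⟩ := ih fun v hv => hts (Finset.mem_insert_of_mem hv)
      have ha : a ∈ s := hts (Finset.mem_insert_self a t)
      rcases hpos a ha with h1 | h1
      · refine ⟨ε, hε, fun u hu => ?_⟩
        rcases Finset.mem_insert.1 hu with rfl | hu
        · rw [h0 u ha h1, h1 x₀ hx₀, mul_zero]
        · exact h u hu
      · have hxa := hx a ha
        refine ⟨min ε (realExt a x₀ / (realExt a x + 1)), lt_min hε (by positivity),
          fun u hu => ?_⟩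
        rcases Finset.mem_insert.1 hu with rfl | hu
        · calc _ ≤ (realExt u x₀ / (realExt u x + 1)) * realExt u x :=
                mul_le_mul_of_nonneg_right (min_le_right _ _) hxa
            _ ≤ (realExt u x₀ / (realExt u x + 1)) * (realExt u x + 1) := by
                apply mul_le_mul_of_nonneg_left (by linarith) (by positivity)
            _ = realExt u x₀ := by field_simp
        · exact (mul_le_mul_of_nonneg_right (min_le_left _ _)
            (hx u (hts (Finset.mem_insert_of_mem hu)))).trans (h u hu)
  obtain ⟨ε, hε, h⟩ := hε
  refine hF.mem_of_smul_add_mem (y := x₀ - ε • x) ((hs x).2 hx) ((hs _).2 fun u hu => ?_) hε ?_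
  · have := h u hu
    rw [map_sub, map_smul, smul_eq_mul]
    linarith
  · simpa using hx₀

theorem realExt_subtype (σ : RPC) (L : Submodule ℤ σ.N) (u : σ.N →ₗ[ℤ] ℤ) (x : ℝ ⊗[ℤ] L) :
    realExt (u ∘ₗ L.subtype) x = realExt u (L.subtype.baseChange ℝ x) := by
  simp [realExt, LinearMap.baseChange_comp]

theorem baseChange_subtype_injective (σ : RPC) (L : Submodule ℤ σ.N) :
    Function.Injective (L.subtype.baseChange ℝ) :=
  Module.Flat.lTensor_preserves_injective_linearMap L.subtype L.injective_subtype

/-- The span of a face is the real span of the lattice of the face. -/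
theorem mem_range_of_mem_face (σ : RPC) {F : PointedCone ℝ (ℝ ⊗[ℤ] σ.N)} (hF : F.IsFaceOf σ.cone)
    {x : ℝ ⊗[ℤ] σ.N} (hx : x ∈ F) :
    ∃ y, (σ.faceLattice F).subtype.baseChange ℝ y = x := by
  classical
  obtain ⟨s, hs⟩ := σ.rational
  obtain ⟨x₀, hx₀, hpos⟩ := exists_interior_point σ hF s hs
  let I : Type := {u // u ∈ s ∧ ∀ y ∈ F, realExt u y = 0}
  have : Finite I := Finite.of_injective (β := {u // u ∈ s}) (fun u => ⟨u.1, u.2.1⟩)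
    fun u v h => Subtype.ext (congrArg (fun w : {u // u ∈ s} => w.1) h)
  have : Fintype I := Fintype.ofFinite I
  let A : σ.N →ₗ[ℤ] (I → ℤ) := LinearMap.pi fun u => u.1
  have hcoord : ∀ (z : ℝ ⊗[ℤ] σ.N) (u : I),
      TensorProduct.piScalarRight ℤ ℝ ℝ I (A.baseChange ℝ z) u = realExt u.1 z := by
    intro z u
    induction z using TensorProduct.induction_on with
    | zero => simp
    | tmul a n => simp [realExt, A]
    | add y z hy hz => simp only [map_add, Pi.add_apply, hy, hz]
  have hker : x ∈ LinearMap.ker (AlgebraTensorModule.lTensor ℝ ℝ A) := by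
    rw [LinearMap.mem_ker]
    apply (TensorProduct.piScalarRight ℤ ℝ ℝ I).injective
    rw [map_zero]
    funext u
    exact (hcoord x u).trans (u.2.2 x hx)
  rw [Module.Flat.ker_lTensor_eq] at hker
  obtain ⟨y, hy⟩ := hker
  have hle : LinearMap.ker A ≤ σ.faceLattice F := by
    intro n hn
    rw [mem_faceLattice]
    have hn' : ∀ u : I, realExt u.1 ((1 : ℝ) ⊗ₜ[ℤ] n) = 0 := by
      intro u
      have := congrFun (LinearMap.mem_ker.1 hn) u
      simp only [A, LinearMap.pi_apply, Pi.zero_apply] at this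
      simp [realExt, this]
    obtain ⟨t, ht0, ht⟩ : ∃ t : ℝ, 0 ≤ t ∧ ∀ u ∈ s, (∀ y ∈ F, realExt u y = 0) ∨
        0 ≤ realExt u ((1 : ℝ) ⊗ₜ[ℤ] n) + t * realExt u x₀ := by
      have hx₀' := (hs x₀).1 (hF.le hx₀)
      refine ⟨∑ u ∈ s, |realExt u ((1 : ℝ) ⊗ₜ[ℤ] n)| / realExt u x₀,
        Finset.sum_nonneg fun u hu => div_nonneg (abs_nonneg _) (hx₀' u hu), fun u hu => ?_⟩
      rcases hpos u hu with h | h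
      · exact Or.inl h
      right
      have h1 : |realExt u ((1 : ℝ) ⊗ₜ[ℤ] n)| / realExt u x₀ ≤
          ∑ u ∈ s, |realExt u ((1 : ℝ) ⊗ₜ[ℤ] n)| / realExt u x₀ :=
        Finset.single_le_sum (f := fun u => |realExt u ((1 : ℝ) ⊗ₜ[ℤ] n)| / realExt u x₀)
          (fun u hu => div_nonneg (abs_nonneg _) (hx₀' u hu)) hu
      rw [div_le_iff₀ h] at h1
      have := neg_abs_le (realExt u ((1 : ℝ) ⊗ₜ[ℤ] n))
      linarith
    have hmem : (1 : ℝ) ⊗ₜ[ℤ] n + t • x₀ ∈ F := by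
      rw [mem_face_iff σ hF s hs]
      constructor
      · intro u hu
        rcases ht u hu with h | h
        · rw [map_add, map_smul, h x₀ hx₀, hn' ⟨u, hu, h⟩]; simp
        · rwa [map_add, map_smul, smul_eq_mul]
      · intro u hu h
        rw [map_add, map_smul, h x₀ hx₀, hn' ⟨u, hu, h⟩]; simp
    have := Submodule.sub_mem _ (Submodule.subset_span hmem)
      (Submodule.smul_mem _ t (Submodule.subset_span hx₀))
    simpa using this
  refine ⟨(Submodule.inclusion hle).baseChange ℝ y, ?_⟩
  rw [← LinearMap.comp_apply, ← LinearMap.baseChange_comp, Submodule.subtype_comp_inclusion]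
  exact hy

/-- A face of the cone `σ`. -/
@[ext]
structure Face (σ : RPC) where
  carrier : PointedCone ℝ (ℝ ⊗[ℤ] σ.N)
  isFace : carrier.IsFaceOf σ.cone

/-- A face `F` of `σ`, as a cone in the lattice `N ∩ Span(F)`. -/
def ofFace (σ : RPC) (F : σ.Face) : RPC where
  N := σ.faceLattice F.1
  cone := F.1.comap ((σ.faceLattice F.1).subtype.baseChange ℝ)
  rational := by
    classical
    obtain ⟨s, hs⟩ := σ.rational
    refine ⟨s.image (fun u => u ∘ₗ (σ.faceLattice F.1).subtype) ∪
      (s.filter fun u => ∀ y ∈ F.1, realExt u y = 0).image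
        (fun u => -(u ∘ₗ (σ.faceLattice F.1).subtype)), fun x => ?_⟩
    have hneg : ∀ u : σ.N →ₗ[ℤ] ℤ, realExt (-(u ∘ₗ (σ.faceLattice F.1).subtype)) x =
        - realExt u ((σ.faceLattice F.1).subtype.baseChange ℝ x) := fun u => by
      rw [← realExt_subtype]
      simp [realExt, LinearMap.baseChange_neg]
    rw [PointedCone.mem_comap, mem_face_iff σ F.2 s hs]
    constructor
    · rintro ⟨h1, h2⟩ v hv
      rcases Finset.mem_union.1 hv with hv | hv
      · obtain ⟨u, hu, rfl⟩ := Finset.mem_image.1 hv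
        rw [realExt_subtype]
        exact h1 u hu
      · obtain ⟨u, hu, rfl⟩ := Finset.mem_image.1 hv
        rw [Finset.mem_filter] at hu
        rw [hneg, h2 u hu.1 hu.2, neg_zero]
    · intro h
      have h1 : ∀ u ∈ s, 0 ≤ realExt u ((σ.faceLattice F.1).subtype.baseChange ℝ x) := by
        intro u hu
        rw [← realExt_subtype]
        exact h _ (Finset.mem_union_left _ (Finset.mem_image_of_mem _ hu))
      refine ⟨h1, fun u hu h2 => le_antisymm ?_ (h1 u hu)⟩
      have := h _ (Finset.mem_union_right _ (Finset.mem_image_of_mem _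
        (Finset.mem_filter.2 ⟨hu, h2⟩)))
      rw [hneg] at this
      linarith
  salient := fun x hx hnx => by
    apply baseChange_subtype_injective σ (σ.faceLattice F.1)
    rw [map_zero]
    refine σ.salient _ (F.2.le hx) (F.2.le ?_)
    rw [← map_neg]
    exact hnx
  span_eq_top := by
    apply Submodule.map_injective_of_injective (baseChange_subtype_injective σ (σ.faceLattice F.1))
    apply le_antisymm (Submodule.map_mono le_top)
    rw [Submodule.map_top, Submodule.map_span]
    rintro _ ⟨y, rfl⟩
    have himg : (F.1 : Set (ℝ ⊗[ℤ] σ.N)) ⊆ ((σ.faceLattice F.1).subtype.baseChange ℝ) ''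
        (F.1.comap ((σ.faceLattice F.1).subtype.baseChange ℝ) : PointedCone ℝ _) := by
      intro x hx
      obtain ⟨y, hy⟩ := mem_range_of_mem_face σ F.2 hx
      exact ⟨y, by rw [SetLike.mem_coe, PointedCone.mem_comap, hy]; exact hx, hy⟩
    refine Submodule.span_mono himg ?_
    induction y using TensorProduct.induction_on with
    | zero => simp
    | tmul a n =>
      have h : (1 : ℝ) ⊗ₜ[ℤ] (n : σ.N) ∈ Submodule.span ℝ (F.1 : Set (ℝ ⊗[ℤ] σ.N)) := n.2
      have := Submodule.smul_mem _ a h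
      simpa [TensorProduct.smul_tmul'] using this
    | add y z hy hz => rw [map_add]; exact Submodule.add_mem _ hy hz

end RPC

/-! ### Cone complexes -/

/-- A rational polyhedral cone complex: a collection of cones together with a collection `mor` of
face morphisms, closed under composition and containing the identities, such that every face of a
cone is the image of exactly one face morphism, and there is at most one morphism between two
cones. -/
structure RPCC where
  Idx : Type
  cone : Idx → RPC
  mor : ∀ α β, Set (cone α ⟶ cone β)
  isFaceMorphism : ∀ {α β} {φ : cone α ⟶ cone β}, φ ∈ mor α β → RPC.IsFaceMorphism φ
  id_mem : ∀ α, 𝟙 (cone α) ∈ mor α α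
  comp_mem : ∀ {α β γ} {φ : cone α ⟶ cone β} {ψ : cone β ⟶ cone γ},
    φ ∈ mor α β → ψ ∈ mor β γ → φ ≫ ψ ∈ mor α γ
  face_unique : ∀ β (F : PointedCone ℝ (ℝ ⊗[ℤ] (cone β).N)), F.IsFaceOf (cone β).cone →
    ∃! p : (Σ α, cone α ⟶ cone β),
      p.2 ∈ mor p.1 β ∧ PointedCone.map (RPC.real p.2) (cone p.1).cone = F
  mor_subsingleton : ∀ α β, (mor α β).Subsingleton

namespace RPCC

/-- A morphism of cone complexes. -/
structure Hom (S T : RPCC) where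
  idx : S.Idx → T.Idx
  hom : ∀ α, S.cone α ⟶ T.cone (idx α)
  interior : ∀ α, RPC.Interior (hom α)
  exists_mor : ∀ {α β} (φ : S.cone α ⟶ S.cone β), φ ∈ S.mor α β →
    ∃ ψ ∈ T.mor (idx α) (idx β), φ ≫ hom β = hom α ≫ ψ

theorem Hom.ext' {S T : RPCC} {f g : Hom S T} (h : ∀ α, f.idx α = g.idx α)
    (h' : ∀ α, HEq (f.hom α) (g.hom α)) : f = g := by
  obtain ⟨fi, fh, _, _⟩ := f
  obtain ⟨gi, gh, _, _⟩ := g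
  obtain rfl : fi = gi := funext h
  obtain rfl : fh = gh := funext fun α => eq_of_heq (h' α)
  rfl

instance : Category RPCC where
  Hom := Hom
  id S := ⟨fun α => α, fun α => 𝟙 _, fun α => RPC.Interior.id _, fun {α β} φ hφ => ⟨φ, hφ, by simp⟩⟩
  comp {S T U} f g := ⟨fun α => g.idx (f.idx α), fun α => f.hom α ≫ g.hom (f.idx α),
    fun α => (f.interior α).comp (g.interior _), fun {α β} φ hφ => by
      obtain ⟨ψ, hψ, h⟩ := f.exists_mor φ hφ
      obtain ⟨χ, hχ, h'⟩ := g.exists_mor ψ hψ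
      exact ⟨χ, hχ, by rw [← Category.assoc, h, Category.assoc, h', Category.assoc]⟩⟩
  id_comp f := Hom.ext' (fun _ => rfl) fun α => heq_of_eq (Category.id_comp (f.hom α))
  comp_id f := Hom.ext' (fun _ => rfl) fun α => heq_of_eq (Category.comp_id (f.hom α))
  assoc f g h := Hom.ext' (fun _ => rfl) fun α => heq_of_eq (Category.assoc _ _ _)

/-- A morphism of cone complexes is strict if it maps every cone isomorphically onto a cone. -/
def strict : MorphismProperty RPCC := fun _ _ f => ∀ α, IsIso (f.hom α)

@[simp] theorem id_idx (S : RPCC) (α : S.Idx) : (𝟙 S : S ⟶ S).idx α = α := rfl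

@[simp] theorem comp_idx {S T U : RPCC} (f : S ⟶ T) (g : T ⟶ U) (α : S.Idx) :
    (f ≫ g).idx α = g.idx (f.idx α) := rfl

theorem id_hom (S : RPCC) (α : S.Idx) : (𝟙 S : S ⟶ S).hom α = 𝟙 _ := rfl

theorem comp_hom {S T U : RPCC} (f : S ⟶ T) (g : T ⟶ U) (α : S.Idx) :
    (f ≫ g).hom α = f.hom α ≫ g.hom (f.idx α) := rfl

end RPCC

namespace RPC

/-- The cone `σ` as a face of itself. -/
def topFace (σ : RPC) : σ.Face := ⟨σ.cone, .refl _⟩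

/-- The inclusion of a face. -/
def faceι (σ : RPC) (F : σ.Face) : σ.ofFace F ⟶ σ where
  lin := (σ.faceLattice F.1).subtype
  mapsTo := fun _ hx => F.2.le hx

theorem faceι_injective (σ : RPC) (F : σ.Face) : Function.Injective (σ.faceι F).lin :=
  Subtype.val_injective

theorem real_faceι_injective (σ : RPC) (F : σ.Face) : Function.Injective (real (σ.faceι F)) :=
  baseChange_subtype_injective σ _

theorem mem_ofFace_cone (σ : RPC) (F : σ.Face) (x) :
    x ∈ (σ.ofFace F).cone ↔ real (σ.faceι F) x ∈ F.1 := Iff.rfl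

theorem map_faceι (σ : RPC) (F : σ.Face) :
    PointedCone.map (real (σ.faceι F)) (σ.ofFace F).cone = F.1 := by
  ext x
  rw [PointedCone.mem_map]
  constructor
  · rintro ⟨y, hy, rfl⟩
    exact hy
  · intro hx
    obtain ⟨y, hy⟩ := mem_range_of_mem_face σ F.2 hx
    refine ⟨y, ?_, hy⟩
    change (σ.faceLattice F.1).subtype.baseChange ℝ y ∈ F.1
    rwa [hy]

theorem comp_faceι_inj {ρ σ : RPC} (F : σ.Face) {f g : ρ ⟶ σ.ofFace F}
    (h : f ≫ σ.faceι F = g ≫ σ.faceι F) : f = g :=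
  hom_ext fun n => faceι_injective σ F (by
    have := congrArg (fun k : ρ ⟶ σ => k.lin n) h
    exact this)

/-- A morphism `ρ → σ` that maps `ρ` into the face `F` factors through `F`. -/
def faceLift {ρ σ : RPC} (F : σ.Face) (f : ρ ⟶ σ) (h : ∀ x ∈ ρ.cone, real f x ∈ F.1) :
    ρ ⟶ σ.ofFace F where
  lin := f.lin.codRestrict _ fun n => by
    rw [mem_faceLattice]
    have : (1 : ℝ) ⊗ₜ[ℤ] n ∈ Submodule.span ℝ (ρ.cone : Set (ℝ ⊗[ℤ] ρ.N)) := by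
      rw [ρ.span_eq_top]; exact Submodule.mem_top
    have h2 : real f ((1 : ℝ) ⊗ₜ[ℤ] n) ∈
        (Submodule.span ℝ (ρ.cone : Set (ℝ ⊗[ℤ] ρ.N))).map (real f) := ⟨_, this, rfl⟩
    rw [Submodule.map_span] at h2
    have h3 := Submodule.span_mono (R := ℝ) (s := real f '' (ρ.cone : Set (ℝ ⊗[ℤ] ρ.N)))
      (t := (F.1 : Set (ℝ ⊗[ℤ] σ.N))) (by rintro _ ⟨x, hx, rfl⟩; exact h x hx) h2
    simpa [real] using h3
  mapsTo := fun x hx => by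
    have key : ∀ g : ρ.N →ₗ[ℤ] σ.faceLattice F.1, (σ.faceLattice F.1).subtype ∘ₗ g = f.lin →
        (σ.faceLattice F.1).subtype.baseChange ℝ (g.baseChange ℝ x) ∈ F.1 := by
      intro g hg
      rw [← LinearMap.comp_apply, ← LinearMap.baseChange_comp, hg]
      exact h x hx
    exact key _ rfl

@[simp] theorem faceLift_faceι {ρ σ : RPC} (F : σ.Face) (f : ρ ⟶ σ)
    (h : ∀ x ∈ ρ.cone, real f x ∈ F.1) : faceLift F f h ≫ σ.faceι F = f :=
  hom_ext fun _ => rfl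

theorem faceι_mem (σ : RPC) (F : σ.Face) {x} (hx : x ∈ (σ.ofFace F).cone) :
    real (σ.faceι F) x ∈ F.1 := hx

theorem mem_of_comp_faceι {σ : RPC} {F G : σ.Face} {φ : σ.ofFace F ⟶ σ.ofFace G}
    (h : φ ≫ σ.faceι G = σ.faceι F) : F.1 ≤ G.1 := by
  intro x hx
  rw [← map_faceι σ F, PointedCone.mem_map] at hx
  obtain ⟨y, hy, rfl⟩ := hx
  rw [← h, real_comp]
  exact faceι_mem σ G (real_mem φ hy)

/-- A face of a face `G` of `σ` is a face of `σ`. -/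
theorem isFaceOf_map_faceι (σ : RPC) (G : σ.Face)
    {F : PointedCone ℝ (ℝ ⊗[ℤ] (σ.ofFace G).N)}
    (hF : F.IsFaceOf (σ.ofFace G).cone) :
    (PointedCone.map (real (σ.faceι G)) F).IsFaceOf σ.cone where
  le := by
    intro x hx
    rw [PointedCone.mem_map] at hx
    obtain ⟨y, hy, rfl⟩ := hx
    exact real_mem _ (hF.le hy)
  mem_of_smul_add_mem := by
    intro x y a hx hy ha h
    rw [PointedCone.mem_map] at h
    obtain ⟨z, hz, hzxy⟩ := h
    have hG : a • x + y ∈ G.1 := by rw [← hzxy]; exact faceι_mem σ G (hF.le hz)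
    have hxG : x ∈ G.1 := G.2.mem_of_smul_add_mem hx hy ha hG
    have hyG : y ∈ G.1 := by
      have := G.2.mem_of_smul_add_smul_mem_right (a := a) (b := 1) hx hy ha one_pos
        (by rwa [one_smul])
      exact this
    rw [← map_faceι σ G, PointedCone.mem_map] at hxG hyG
    obtain ⟨x', hx', rfl⟩ := hxG
    obtain ⟨y', hy', rfl⟩ := hyG
    have hz' : z = a • x' + y' := by
      apply real_faceι_injective σ G
      rw [hzxy, map_add, map_smul]
    rw [PointedCone.mem_map]
    exact ⟨x', hF.mem_of_smul_add_mem hx' hy' ha (hz' ▸ hz), rfl⟩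

theorem map_map_faceι {σ : RPC} {F G : σ.Face} {φ : σ.ofFace F ⟶ σ.ofFace G}
    (h : φ ≫ σ.faceι G = σ.faceι F) :
    PointedCone.map (real (σ.faceι G)) (PointedCone.map (real φ) (σ.ofFace F).cone) = F.1 := by
  rw [PointedCone.map_map, ← real_comp, h, map_faceι]

theorem map_faceι_injective (σ : RPC) (G : σ.Face) :
    Function.Injective (PointedCone.map (real (σ.faceι G))) := by
  intro A B h
  ext x
  constructor
  · intro hx
    have : real (σ.faceι G) x ∈ PointedCone.map (real (σ.faceι G)) A :=
      PointedCone.mem_map.2 ⟨x, hx, rfl⟩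
    rw [h, PointedCone.mem_map] at this
    obtain ⟨y, hy, hxy⟩ := this
    exact real_faceι_injective σ G hxy ▸ hy
  · intro hx
    have : real (σ.faceι G) x ∈ PointedCone.map (real (σ.faceι G)) B :=
      PointedCone.mem_map.2 ⟨x, hx, rfl⟩
    rw [← h, PointedCone.mem_map] at this
    obtain ⟨y, hy, hxy⟩ := this
    exact real_faceι_injective σ G hxy ▸ hy

theorem isFaceMorphism_of_comp_faceι {σ : RPC} {F G : σ.Face}
    {φ : σ.ofFace F ⟶ σ.ofFace G} (h : φ ≫ σ.faceι G = σ.faceι F) :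
    IsFaceMorphism φ where
  isFace :=
    { le := by
        intro x hx
        rw [PointedCone.mem_map] at hx
        obtain ⟨y, hy, rfl⟩ := hx
        exact real_mem φ hy
      mem_of_smul_add_mem := by
        intro x y a hx hy ha hxy
        have h1 : real (σ.faceι G) x ∈ F.1 := by
          refine F.2.mem_of_smul_add_mem (real_mem (σ.faceι G) hx) (real_mem (σ.faceι G) hy) ha ?_
          rw [← map_smul, ← map_add, ← map_map_faceι h]
          exact PointedCone.mem_map.2 ⟨_, hxy, rfl⟩
        rw [← map_map_faceι h, PointedCone.mem_map] at h1
        obtain ⟨z, hz, hzx⟩ := h1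
        exact real_faceι_injective σ G hzx ▸ hz }
  injective := by
    intro m n hmn
    apply faceι_injective σ F
    rw [← h]
    exact congrArg (σ.faceι G).lin hmn
  range_eq := by
    have key : ∀ n : (σ.ofFace G).N,
        n ∈ (σ.ofFace G).faceLattice (PointedCone.map (real φ) (σ.ofFace F).cone) ↔
        (σ.faceι G).lin n ∈ σ.faceLattice F.1 := by
      intro n
      rw [mem_faceLattice, mem_faceLattice]
      have h1 : (1 : ℝ) ⊗ₜ[ℤ] (σ.faceι G).lin n = real (σ.faceι G) ((1 : ℝ) ⊗ₜ[ℤ] n) := by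
        simp [real]
      have h2 : (F.1 : Set (ℝ ⊗[ℤ] σ.N)) = real (σ.faceι G) ''
          (PointedCone.map (real φ) (σ.ofFace F).cone : PointedCone ℝ _) := by
        rw [← PointedCone.coe_map, map_map_faceι h]
      rw [h1, h2, ← Submodule.map_span]
      constructor
      · exact fun hn => ⟨_, hn, rfl⟩
      · rintro ⟨y, hy, hyn⟩
        exact real_faceι_injective σ G hyn ▸ hy
    ext n
    rw [key]
    constructor
    · rintro ⟨m, rfl⟩
      have : (σ.faceι G).lin (φ.lin m) = (φ ≫ σ.faceι G).lin m := rfl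
      rw [this, h]
      exact m.2
    · intro hn
      refine ⟨⟨_, hn⟩, faceι_injective σ G ?_⟩
      have : (σ.faceι G).lin (φ.lin ⟨_, hn⟩) = (φ ≫ σ.faceι G).lin ⟨_, hn⟩ := rfl
      rw [this, h]
      rfl

/-- The cone complex consisting of all faces of a cone `σ`. -/
def faceComplex (σ : RPC) : RPCC where
  Idx := σ.Face
  cone F := σ.ofFace F
  mor F G := {φ | φ ≫ σ.faceι G = σ.faceι F}
  isFaceMorphism h := isFaceMorphism_of_comp_faceι h
  id_mem F := Category.id_comp _
  comp_mem {F G H φ ψ} h h' := by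
    simp only [Set.mem_ofPred_eq] at h h' ⊢
    rw [Category.assoc, h', h]
  face_unique G F hF := by
    let F' : σ.Face := ⟨_, isFaceOf_map_faceι σ G hF⟩
    have hle : F'.1 ≤ G.1 := by
      intro x hx
      rw [PointedCone.mem_map] at hx
      obtain ⟨y, hy, rfl⟩ := hx
      exact faceι_mem σ G (hF.le hy)
    have hφ := faceLift_faceι G (σ.faceι F') fun x hx => hle (faceι_mem σ F' hx)
    refine ⟨⟨F', faceLift G (σ.faceι F') fun x hx => hle (faceι_mem σ F' hx)⟩, ⟨hφ, ?_⟩, ?_⟩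
    · apply map_faceι_injective σ G
      rw [map_map_faceι hφ]
    · rintro ⟨H, ψ⟩ ⟨hψ, hψF⟩
      obtain rfl : H = F' := by
        apply Face.ext
        rw [← map_map_faceι hψ, hψF]
      congr 1
      apply comp_faceι_inj
      rw [hφ]
      exact hψ
  mor_subsingleton F G φ hφ ψ hψ := comp_faceι_inj G (Eq.trans hφ (Eq.symm hψ))

/-- The smallest face of `τ` that contains the image of a face of `σ`. -/
def imageFace {σ τ : RPC} (f : σ ⟶ τ) (F : σ.Face) : τ.Face :=
  ⟨τ.cone ⊓ sInf {G | G.IsFaceOf τ.cone ∧ ∀ x ∈ F.1, real f x ∈ G}, .sInf _ fun _ h => h.1⟩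

theorem real_mem_imageFace {σ τ : RPC} (f : σ ⟶ τ) (F : σ.Face) {x} (hx : x ∈ F.1) :
    real f x ∈ (imageFace f F).1 :=
  ⟨real_mem f (F.2.le hx), Submodule.mem_sInf.2 fun _ hG => hG.2 x hx⟩

theorem imageFace_le {σ τ : RPC} {f : σ ⟶ τ} {F : σ.Face} {G : τ.Face}
    (h : ∀ x ∈ F.1, real f x ∈ G.1) : (imageFace f F).1 ≤ G.1 :=
  fun _ hx => Submodule.mem_sInf.1 hx.2 _ ⟨G.2, h⟩

theorem imageFace_id (σ : RPC) (F : σ.Face) : imageFace (𝟙 σ) F = F :=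
  Face.ext (le_antisymm (imageFace_le fun x hx => by simpa [real_id] using hx)
    fun x hx => by simpa [real_id] using real_mem_imageFace (𝟙 σ) F hx)

theorem imageFace_comp {σ τ ρ : RPC} (f : σ ⟶ τ) (g : τ ⟶ ρ) (F : σ.Face) :
    imageFace (f ≫ g) F = imageFace g (imageFace f F) := by
  apply Face.ext
  apply le_antisymm
  · apply imageFace_le
    intro x hx
    rw [real_comp]
    exact real_mem_imageFace g _ (real_mem_imageFace f F hx)
  · apply imageFace_le
    have hle : (imageFace f F).1 ≤ (⟨_, isFaceOf_preimage g (imageFace (f ≫ g) F).2⟩ : τ.Face).1 :=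
      imageFace_le fun x hx => ⟨real_mem f (F.2.le hx), by
        have := real_mem_imageFace (f ≫ g) F hx
        rw [real_comp] at this
        exact this⟩
    exact fun x hx => (hle hx).2

/-- The restriction of `f : σ → τ` to a face of `σ`, as a morphism to the smallest possible face
of `τ`. -/
def faceMap {σ τ : RPC} (f : σ ⟶ τ) (F : σ.Face) :
    σ.ofFace F ⟶ τ.ofFace (imageFace f F) :=
  faceLift (imageFace f F) (σ.faceι F ≫ f) fun x hx => by
    rw [real_comp]
    exact real_mem_imageFace f F (faceι_mem σ F hx)

theorem faceMap_faceι {σ τ : RPC} (f : σ ⟶ τ) (F : σ.Face) :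
    faceMap f F ≫ τ.faceι (imageFace f F) = σ.faceι F ≫ f :=
  faceLift_faceι _ _ _

theorem heq_of_comp_faceι {ρ τ : RPC} {F G : τ.Face} (h : F = G) {φ : ρ ⟶ τ.ofFace F}
    {ψ : ρ ⟶ τ.ofFace G} (h' : φ ≫ τ.faceι F = ψ ≫ τ.faceι G) : HEq φ ψ := by
  subst h
  exact heq_of_eq (comp_faceι_inj F h')

theorem faceMap_interior {σ τ : RPC} (f : σ ⟶ τ) (F : σ.Face) : Interior (faceMap f F) := by
  intro G hG h
  have hle : (imageFace f F).1 ≤ PointedCone.map (real (τ.faceι (imageFace f F))) G := by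
    refine imageFace_le (G := ⟨_, isFaceOf_map_faceι τ _ hG⟩) fun x hx => ?_
    rw [← map_faceι σ F, PointedCone.mem_map] at hx
    obtain ⟨y, hy, rfl⟩ := hx
    have h1 : real f (real (σ.faceι F) y) =
        real (τ.faceι (imageFace f F)) (real (faceMap f F) y) := by
      rw [← LinearMap.comp_apply, ← LinearMap.comp_apply, ← real_comp, ← real_comp, faceMap_faceι]
    rw [h1]
    exact PointedCone.mem_map.2 ⟨_, h y hy, rfl⟩
  apply le_antisymm hG.le
  intro x hx
  have := hle (faceι_mem τ (imageFace f F) hx)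
  rw [PointedCone.mem_map] at this
  obtain ⟨y, hy, hxy⟩ := this
  exact real_faceι_injective τ _ hxy ▸ hy

theorem faceMap_exists_mor {σ τ : RPC} (f : σ ⟶ τ) {F G : σ.Face} (φ : σ.ofFace F ⟶ σ.ofFace G)
    (hφ : φ ≫ σ.faceι G = σ.faceι F) :
    ∃ ψ : τ.ofFace (imageFace f F) ⟶ τ.ofFace (imageFace f G),
      ψ ≫ τ.faceι (imageFace f G) = τ.faceι (imageFace f F) ∧
        φ ≫ faceMap f G = faceMap f F ≫ ψ := by
  have hle : (imageFace f F).1 ≤ (imageFace f G).1 :=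
    imageFace_le fun x hx => real_mem_imageFace f G (mem_of_comp_faceι hφ hx)
  have hψ := faceLift_faceι (imageFace f G) (τ.faceι (imageFace f F))
    fun x hx => hle (faceι_mem τ _ hx)
  refine ⟨_, hψ, ?_⟩
  apply comp_faceι_inj
  rw [Category.assoc, Category.assoc, hψ, faceMap_faceι, faceMap_faceι, ← Category.assoc, hφ]

theorem faceMap_id (σ : RPC) (F : σ.Face) : HEq (faceMap (𝟙 σ) F) (𝟙 (σ.ofFace F)) :=
  heq_of_comp_faceι (imageFace_id σ F) (by
    rw [faceMap_faceι, Category.comp_id, Category.id_comp])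

theorem faceMap_comp {σ τ ρ : RPC} (f : σ ⟶ τ) (g : τ ⟶ ρ) (F : σ.Face) :
    HEq (faceMap (f ≫ g) F) (faceMap f F ≫ faceMap g (imageFace f F)) :=
  heq_of_comp_faceι (imageFace_comp f g F) (by
    rw [faceMap_faceι, Category.assoc, faceMap_faceι, ← Category.assoc, ← Category.assoc,
      faceMap_faceι])

/-- The embedding `RPC → RPCC` that sends a cone to the complex of all its faces. -/
def toRPCC : RPC ⥤ RPCC where
  obj := faceComplex
  map f :=
    { idx := imageFace f
      hom := faceMap f
      interior := faceMap_interior f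
      exists_mor := faceMap_exists_mor f }
  map_id σ := RPCC.Hom.ext' (imageFace_id σ) (faceMap_id σ)
  map_comp f g := RPCC.Hom.ext' (imageFace_comp f g) (faceMap_comp f g)

/-- The canonical isomorphism of `σ` with its improper face, as a morphism. -/
def toTop (σ : RPC) : σ ⟶ σ.ofFace σ.topFace :=
  faceLift σ.topFace (𝟙 σ) fun x hx => by rw [real_id]; exact hx

end RPC

namespace RPCC

/-- The cone of `S` to which `σ` is sent by a morphism `σ → S` from a cone. -/
def topIdx {σ : RPC} {S : RPCC} (j : RPC.toRPCC.obj σ ⟶ S) : S.Idx := j.idx σ.topFace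

/-- A morphism `σ → S` from a cone to a cone complex, as a morphism of cones. -/
def topHom {σ : RPC} {S : RPCC} (j : RPC.toRPCC.obj σ ⟶ S) : σ ⟶ S.cone (topIdx j) :=
  σ.toTop ≫ j.hom σ.topFace

/-- The face topology on cone complexes. It is generated by the families of the natural morphisms
`σ_α → S`, where `σ_α` runs through the cones of `S`. Since these morphisms are jointly universal
among the morphisms from cones to `S`, a sieve on `S` is a covering if and only if it contains
all morphisms from cones to `S`. -/
def faceTopology : GrothendieckTopology RPCC where
  sieves S := {R | ∀ (σ : RPC) (j : RPC.toRPCC.obj σ ⟶ S), R j}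
  top_mem' _ _ _ := trivial
  pullback_stable' _ _ _ f hR σ j := hR σ (j ≫ f)
  transitive' S R hR R' h σ j := by
    have := h (hR σ j) σ (𝟙 _)
    rwa [Sieve.pullback_apply, Category.id_comp] at this

end RPCC

/-! ### Graphs -/

/-- A finite weighted graph: a finite set `X = V ⊔ F` of vertices and flags, an idempotent root map
`r` with image `V`, an involution `inv` that fixes the vertices, and a vertex weighting `h`. -/
structure WeightedGraph where
  X : Type
  [finite : Finite X]
  r : X → X
  inv : X → X
  r_r : ∀ x, r (r x) = r x
  inv_inv : ∀ x, inv (inv x) = x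
  inv_r : ∀ x, inv (r x) = r x
  h : {v : X // r v = v} → ℕ

attribute [instance] WeightedGraph.finite

namespace WeightedGraph

variable (G : WeightedGraph)

/-- The vertices, i.e. the elements of the image of the (idempotent) root map. -/
def IsVertex (x : G.X) : Prop := G.r x = x

/-- The set of (finite) edges `{f, inv f}`, `f ≠ inv f`, as unordered pairs of flags. -/
def edgeSet : Set (Sym2 G.X) := {e | ∃ f, G.inv f ≠ f ∧ e = s(f, G.inv f)}

/-- The set of legs: the flags fixed by the involution. -/
def legSet : Set G.X := {f | ¬ G.IsVertex f ∧ G.inv f = f}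

/-- The valence of a vertex. -/
def valence (v : G.X) : ℕ := {f | ¬ G.IsVertex f ∧ G.r f = v}.ncard

/-! Below, `S` is a set of vertices and flags which is closed under the root map and the involution;
it is regarded as a subgraph of `G`. -/

/-- The vertices of the subgraph `S`. -/
def Vertices (S : Set G.X) : Type := {v : {v : G.X // G.r v = v} // v.1 ∈ S}

/-- The relation on the vertices of `S` of being joined by an edge of `S`. -/
def Joined (S : Set G.X) (v w : G.Vertices S) : Prop :=
  ∃ f ∈ S, G.r f = v.1.1 ∧ G.r (G.inv f) = w.1.1

/-- The subgraph `S` is connected (in particular, nonempty). -/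
def ConnectedOn (S : Set G.X) : Prop :=
  Nonempty (G.Vertices S) ∧ ∀ v w : G.Vertices S, Relation.ReflTransGen (G.Joined S) v w

/-- The first Betti number of the subgraph `S`: the number of edges minus the number of vertices
plus the number of connected components. -/
def bettiOn (S : Set G.X) : ℤ :=
  ({e ∈ G.edgeSet | ∀ f ∈ e, f ∈ S}.ncard : ℤ) - Nat.card (G.Vertices S)
    + Nat.card (Quot (G.Joined S))

/-- The genus of the weighted graph `S`. -/
def genusOn (S : Set G.X) : ℤ := G.bettiOn S + ∑ᶠ v : G.Vertices S, (G.h v.1 : ℤ)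

def Connected : Prop := G.ConnectedOn Set.univ

def genus : ℤ := G.genusOn Set.univ

/-- Stability: `2h(v) - 2 + val(v) > 0` for all vertices `v`. -/
def Stable : Prop := ∀ v : {v : G.X // G.r v = v}, (0 : ℤ) < 2 * (G.h v : ℤ) - 2 + G.valence v.1

variable {G}

theorem isVertex_r (x : G.X) : G.IsVertex (G.r x) := G.r_r x

theorem inv_vertex {v : G.X} (hv : G.IsVertex v) : G.inv v = v := by
  have := G.inv_r v
  rwa [show G.r v = v from hv] at this

variable (G) in
open Classical in
/-- The contribution of a vertex or flag to twice the genus minus two. -/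
def contribution (x : G.X) : ℤ :=
  if hx : G.r x = x then 2 * (G.h ⟨x, hx⟩ : ℤ) - 2 else if G.inv x = x then 0 else 1

theorem card_quot_joined {S : Set G.X} (hS : G.ConnectedOn S) :
    Nat.card (Quot (G.Joined S)) = 1 := by
  obtain ⟨⟨v⟩, h⟩ := hS
  rw [Nat.card_eq_one_iff_unique]
  refine ⟨⟨fun a b => ?_⟩, ⟨Quot.mk _ v⟩⟩
  induction a using Quot.ind with | _ a =>
  induction b using Quot.ind with | _ b =>
  have := h a b
  induction this with
  | refl => rfl
  | tail _ hbc ih => exact ih.trans (Quot.sound hbc)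

instance (S : Set G.X) : Finite (G.Vertices S) :=
  inferInstanceAs (Finite {v : {v : G.X // G.r v = v} // v.1 ∈ S})

/-- Every edge has exactly two flags. -/
theorem two_mul_card_edges {S : Set G.X} (hi : ∀ x ∈ S, G.inv x ∈ S) :
    2 * {e ∈ G.edgeSet | ∀ f ∈ e, f ∈ S}.ncard = {f ∈ S | G.inv f ≠ f}.ncard := by
  classical
  have : Fintype G.X := Fintype.ofFinite _
  have h1 : {e ∈ G.edgeSet | ∀ f ∈ e, f ∈ S} =
      (((Finset.univ.filter fun f => f ∈ S ∧ G.inv f ≠ f).image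
        fun f => s(f, G.inv f) : Finset (Sym2 G.X)) : Set (Sym2 G.X)) := by
    ext e
    simp only [Finset.coe_image, Finset.coe_filter, Finset.mem_univ, true_and, Set.mem_image]
    constructor
    · rintro ⟨⟨f, hf, rfl⟩, h⟩
      exact ⟨f, ⟨h f (Sym2.mem_mk_left _ _), hf⟩, rfl⟩
    · rintro ⟨f, ⟨hf, hf'⟩, rfl⟩
      refine ⟨⟨f, hf', rfl⟩, fun x hx => ?_⟩
      rcases Sym2.mem_iff.1 hx with rfl | rfl
      · exact hf
      · exact hi _ hf
  have h2 : {f ∈ S | G.inv f ≠ f} =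
      ((Finset.univ.filter fun f => f ∈ S ∧ G.inv f ≠ f : Finset G.X) : Set G.X) := by
    ext; simp
  rw [h1, h2, Set.ncard_coe_finset, Set.ncard_coe_finset,
    Finset.card_eq_sum_card_image (fun f => s(f, G.inv f)), Finset.sum_const_nat (m := 2),
    mul_comm]
  intro e he
  obtain ⟨f, hf, rfl⟩ := Finset.mem_image.1 he
  simp only [Finset.mem_filter, Finset.mem_univ, true_and] at hf
  have : (Finset.univ.filter fun x => x ∈ S ∧ G.inv x ≠ x).filter
      (fun x => s(x, G.inv x) = s(f, G.inv f)) = {f, G.inv f} := by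
    ext x
    simp only [Finset.mem_filter, Finset.mem_univ, true_and, Finset.mem_insert,
      Finset.mem_singleton, Sym2.eq_iff]
    constructor
    · rintro ⟨-, ⟨rfl, -⟩ | ⟨rfl, -⟩⟩ <;> simp
    · rintro (rfl | rfl)
      · exact ⟨hf, Or.inl ⟨rfl, rfl⟩⟩
      · refine ⟨⟨hi _ hf.1, ?_⟩, Or.inr ⟨rfl, G.inv_inv _⟩⟩
        rw [G.inv_inv]
        exact hf.2.symm
  rw [this, Finset.card_pair hf.2.symm]

theorem two_mul_genusOn {S : Set G.X} (hi : ∀ x ∈ S, G.inv x ∈ S) (hS : G.ConnectedOn S) :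
    2 * G.genusOn S = ∑ᶠ x : S, G.contribution x.1 + 2 := by
  classical
  have : Fintype G.X := Fintype.ofFinite _
  have : Fintype (G.Vertices S) := Fintype.ofFinite _
  have e1 : (2 : ℤ) * ({e ∈ G.edgeSet | ∀ f ∈ e, f ∈ S}.ncard : ℤ) =
      ({f ∈ S | G.inv f ≠ f}.ncard : ℤ) := by
    exact_mod_cast two_mul_card_edges hi
  have e2 : ({f ∈ S | G.inv f ≠ f}.ncard : ℤ) =
      ∑ x : S, if G.r x.1 = x.1 then 0 else if G.inv x.1 = x.1 then 0 else (1 : ℤ) := by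
    have h : {f ∈ S | G.inv f ≠ f} =
      (((Finset.univ : Finset S).filter fun f => G.inv f.1 ≠ f.1).map
        (Function.Embedding.subtype _) : Finset G.X) := by
      ext; simp [and_comm]
    rw [h, Set.ncard_coe_finset, Finset.card_map, Finset.card_filter, Nat.cast_sum]
    refine Finset.sum_congr rfl fun x _ => ?_
    by_cases hx : G.r x.1 = x.1
    · simp [hx, inv_vertex hx]
    · by_cases hx' : G.inv x.1 = x.1 <;> simp [hx, hx']
  have e3 : ∑ v : G.Vertices S, (2 * (G.h v.1 : ℤ) - 2) =
      ∑ x : S, if hx : G.r x.1 = x.1 then 2 * (G.h ⟨x.1, hx⟩ : ℤ) - 2 else 0 := by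
    rw [Finset.sum_dite, Finset.sum_const_zero, add_zero]
    refine Finset.sum_bij' (fun v _ => ⟨⟨v.1.1, v.2⟩, by simpa using v.1.2⟩)
      (fun x _ => ⟨⟨x.1.1, (Finset.mem_filter.1 x.2).2⟩, x.1.2⟩) ?_ ?_ ?_ ?_ ?_ <;> intros <;>
      first | exact Finset.mem_attach _ _ | exact Finset.mem_univ _ | rfl
  have e4 : ∑ x : S, G.contribution x.1 =
      ∑ v : G.Vertices S, (2 * (G.h v.1 : ℤ) - 2) + ({f ∈ S | G.inv f ≠ f}.ncard : ℤ) := by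
    rw [e3, e2, ← Finset.sum_add_distrib]
    refine Finset.sum_congr rfl fun x _ => ?_
    unfold contribution
    by_cases hx : G.r x.1 = x.1 <;> simp [hx]
  rw [genusOn, bettiOn, card_quot_joined hS, finsum_eq_sum_of_fintype, finsum_eq_sum_of_fintype, e4,
    ← e1, Finset.sum_sub_distrib, ← Finset.mul_sum, Nat.card_eq_fintype_card]
  simp
  ring

end WeightedGraph

/-- A weighted graph with `n` marked legs. -/
structure MarkedGraph (n : ℕ) extends WeightedGraph where
  mark : Fin n ≃ toWeightedGraph.legSet

namespace MarkedGraph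

variable {n : ℕ}

/-- A morphism of weighted marked graphs: a map of vertices and flags which commutes with root maps
and involutions and preserves the markings of the legs, such that every flag of the target has
exactly one preimage and the preimage of every vertex `v` is connected of genus `h(v)`. -/
@[ext]
structure Hom (G H : MarkedGraph n) where
  toFun : G.X → H.X
  map_r : ∀ x, toFun (G.r x) = H.r (toFun x)
  map_inv : ∀ x, toFun (G.inv x) = H.inv (toFun x)
  map_mark : ∀ i, toFun (G.mark i) = H.mark i
  existsUnique_flag : ∀ f, ¬ H.IsVertex f → ∃! x, toFun x = f
  connected : ∀ v, H.IsVertex v → G.ConnectedOn (toFun ⁻¹' {v})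
  genus_eq : ∀ v : {v : H.X // H.r v = v}, G.genusOn (toFun ⁻¹' {v.1}) = H.h v

namespace Hom

variable {G H K : MarkedGraph n}

theorem isVertex_map (π : Hom G H) {v : G.X} (hv : G.IsVertex v) : H.IsVertex (π.toFun v) := by
  unfold WeightedGraph.IsVertex at *
  rw [← π.map_r, hv]

theorem not_isVertex_of_map (π : Hom G H) {x : G.X} (hx : ¬ H.IsVertex (π.toFun x)) :
    ¬ G.IsVertex x := fun h => hx (π.isVertex_map h)

theorem inv_eq_iff (π : Hom G H) {x : G.X} (hx : ¬ H.IsVertex (π.toFun x)) :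
    G.inv x = x ↔ H.inv (π.toFun x) = π.toFun x := by
  rw [← π.map_inv]
  constructor
  · intro h
    rw [h]
  · intro h
    exact (π.existsUnique_flag _ hx).unique h rfl

/-- The contributions to the genus are preserved. -/
theorem sum_contribution (π : Hom G H) (y : H.X) :
    ∑ᶠ x : π.toFun ⁻¹' {y}, G.contribution x.1 = H.contribution y := by
  classical
  by_cases hy : H.IsVertex y
  · have h1 := WeightedGraph.two_mul_genusOn (G := G.toWeightedGraph) (S := π.toFun ⁻¹' {y})
      (fun x hx => by
        rw [Set.mem_preimage, Set.mem_singleton_iff] at hx ⊢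
        rw [π.map_inv, hx, WeightedGraph.inv_vertex hy]) (π.connected y hy)
    rw [π.genus_eq ⟨y, hy⟩] at h1
    have h2 : H.contribution y = 2 * (H.h ⟨y, hy⟩ : ℤ) - 2 := dif_pos hy
    rw [h2]
    linarith
  · obtain ⟨x, hx, hux⟩ := π.existsUnique_flag y hy
    let _ : Unique (π.toFun ⁻¹' {y}) := ⟨⟨⟨x, hx⟩⟩, fun z => Subtype.ext (hux z.1 z.2)⟩
    rw [finsum_unique]
    change G.contribution x = _
    subst hx
    have hx : ¬ G.r x = x := π.not_isVertex_of_map hy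
    have hy' : ¬ H.r (π.toFun x) = π.toFun x := hy
    unfold WeightedGraph.contribution
    rw [dif_neg hx, dif_neg hy']
    by_cases h : G.inv x = x
    · rw [if_pos h, if_pos ((π.inv_eq_iff hy).1 h)]
    · rw [if_neg h, if_neg (mt (π.inv_eq_iff hy).2 h)]

/-- Preimages of connected subgraphs are connected. -/
theorem connectedOn_preimage (π : Hom G H) {S : Set H.X} (hr : ∀ x ∈ S, H.r x ∈ S)
    (hi : ∀ x ∈ S, H.inv x ∈ S) (hS : H.ConnectedOn S) : G.ConnectedOn (π.toFun ⁻¹' S) := by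
  have hfib : ∀ v w : G.Vertices (π.toFun ⁻¹' S), π.toFun v.1.1 = π.toFun w.1.1 →
      Relation.ReflTransGen (G.Joined (π.toFun ⁻¹' S)) v w := by
    intro v w hvw
    let y := π.toFun w.1.1
    have hsub : π.toFun ⁻¹' {y} ⊆ π.toFun ⁻¹' S := by
      intro x hx
      have : π.toFun x = y := hx
      rw [Set.mem_preimage, this]
      exact w.2
    have := (π.connected y (π.isVertex_map w.1.2)).2 ⟨v.1, hvw⟩ ⟨w.1, rfl⟩
    let incl : G.Vertices (π.toFun ⁻¹' {y}) → G.Vertices (π.toFun ⁻¹' S) :=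
      fun u => ⟨u.1, hsub u.2⟩
    have hincl : ∀ a b, G.Joined (π.toFun ⁻¹' {y}) a b →
        G.Joined (π.toFun ⁻¹' S) (incl a) (incl b) :=
      fun a b ⟨f, hf, h1, h2⟩ => ⟨f, hsub hf, h1, h2⟩
    exact Relation.ReflTransGen.lift incl hincl _ _ this
  refine ⟨?_, ?_⟩
  · obtain ⟨v⟩ := hS.1
    obtain ⟨w⟩ := (π.connected v.1.1 v.1.2).1
    exact ⟨⟨w.1, by
      have : π.toFun w.1.1 = v.1.1 := w.2
      rw [Set.mem_preimage, this]
      exact v.2⟩⟩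
  · intro v w
    have key : ∀ b : H.Vertices S, Relation.ReflTransGen (H.Joined S)
        ⟨⟨π.toFun v.1.1, π.isVertex_map v.1.2⟩, v.2⟩ b →
        ∀ w : G.Vertices (π.toFun ⁻¹' S), π.toFun w.1.1 = b.1.1 →
          Relation.ReflTransGen (G.Joined (π.toFun ⁻¹' S)) v w := by
      intro b hb
      induction hb with
      | refl => exact fun w hw => hfib v w hw.symm
      | @tail b c _ hbc ih =>
        intro w hw
        obtain ⟨f, hf, hfb, hfc⟩ := hbc
        by_cases hfv : H.IsVertex f
        · refine ih w ?_
          rw [hw, ← hfc, ← hfb, WeightedGraph.inv_vertex hfv]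
        · obtain ⟨x, hx, -⟩ := π.existsUnique_flag f hfv
          let a₁ : G.Vertices (π.toFun ⁻¹' S) := ⟨⟨G.r x, G.r_r x⟩, by
            rw [Set.mem_preimage, π.map_r, hx]; exact hr _ hf⟩
          let a₂ : G.Vertices (π.toFun ⁻¹' S) := ⟨⟨G.r (G.inv x), G.r_r _⟩, by
            rw [Set.mem_preimage, π.map_r, π.map_inv, hx]; exact hr _ (hi _ hf)⟩
          have h1 : Relation.ReflTransGen (G.Joined (π.toFun ⁻¹' S)) v a₁ := ih a₁ (by
            change π.toFun (G.r x) = _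
            rw [π.map_r, hx, hfb])
          have h2 : G.Joined (π.toFun ⁻¹' S) a₁ a₂ :=
            ⟨x, by rw [Set.mem_preimage, hx]; exact hf, rfl, rfl⟩
          have h3 : Relation.ReflTransGen (G.Joined (π.toFun ⁻¹' S)) a₂ w := hfib a₂ w (by
            change π.toFun (G.r (G.inv x)) = _
            rw [π.map_r, π.map_inv, hx, hfc, hw])
          exact (h1.tail h2).trans h3
    exact key ⟨⟨π.toFun w.1.1, π.isVertex_map w.1.2⟩, w.2⟩ (hS.2 _ _) w rfl

/-- Preimages of connected subgraphs have the same genus. -/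
theorem genusOn_preimage (π : Hom G H) {S : Set H.X} (hr : ∀ x ∈ S, H.r x ∈ S)
    (hi : ∀ x ∈ S, H.inv x ∈ S) (hS : H.ConnectedOn S) :
    G.genusOn (π.toFun ⁻¹' S) = H.genusOn S := by
  classical
  have : Fintype G.X := Fintype.ofFinite _
  have : Fintype H.X := Fintype.ofFinite _
  have h1 := WeightedGraph.two_mul_genusOn (G := G.toWeightedGraph) (S := π.toFun ⁻¹' S)
    (fun x hx => by rw [Set.mem_preimage, π.map_inv]; exact hi _ hx)
    (π.connectedOn_preimage hr hi hS)
  have h2 := WeightedGraph.two_mul_genusOn hi hS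
  have h3 : ∑ᶠ x : π.toFun ⁻¹' S, G.contribution x.1 = ∑ᶠ y : S, H.contribution y.1 := by
    let e : (Σ y : S, π.toFun ⁻¹' {y.1}) ≃ π.toFun ⁻¹' S :=
      { toFun := fun p => ⟨p.2.1, by
          have : π.toFun p.2.1 = p.1.1 := p.2.2
          rw [Set.mem_preimage, this]; exact p.1.2⟩
        invFun := fun x => ⟨⟨π.toFun x.1, x.2⟩, ⟨x.1, rfl⟩⟩
        left_inv := by
          rintro ⟨⟨y, hy⟩, ⟨x, hx⟩⟩
          obtain rfl : π.toFun x = y := hx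
          rfl
        right_inv := fun x => rfl }
    have : ∀ T : Set G.X, Fintype T := fun T => Fintype.ofFinite _
    have : Fintype S := Fintype.ofFinite _
    rw [finsum_eq_sum_of_fintype, finsum_eq_sum_of_fintype, ← e.sum_comp, Fintype.sum_sigma]
    refine Finset.sum_congr rfl fun y _ => ?_
    rw [← π.sum_contribution, finsum_eq_sum_of_fintype]
    rfl
  rw [h3] at h1
  linarith

/-- The identity. -/
def id (G : MarkedGraph n) : Hom G G where
  toFun x := x
  map_r _ := rfl
  map_inv _ := rfl
  map_mark _ := rfl
  existsUnique_flag f _ := ⟨f, rfl, fun _ h => h⟩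
  connected v hv := ⟨⟨⟨⟨v, hv⟩, rfl⟩⟩, fun a b => by
    obtain rfl : a = b := Subtype.ext (Subtype.ext (Eq.trans a.2 (Eq.symm b.2)))
    exact .refl⟩
  genus_eq v := by
    have hc : G.ConnectedOn ((fun x => x) ⁻¹' {v.1}) := ⟨⟨⟨v, rfl⟩⟩, fun a b => by
      obtain rfl : a = b := Subtype.ext (Subtype.ext (Eq.trans a.2 (Eq.symm b.2)))
      exact .refl⟩
    have h1 := WeightedGraph.two_mul_genusOn (G := G.toWeightedGraph)
      (S := (fun x => x) ⁻¹' {v.1}) (fun x hx => by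
        obtain rfl : x = v.1 := hx
        exact WeightedGraph.inv_vertex v.2) hc
    let _ : Unique ((fun x : G.X => x) ⁻¹' {v.1}) := ⟨⟨⟨v.1, rfl⟩⟩, fun z => Subtype.ext z.2⟩
    rw [finsum_unique] at h1
    have h2 : G.contribution v.1 = 2 * (G.h v : ℤ) - 2 := dif_pos v.2
    change 2 * _ = G.contribution v.1 + 2 at h1
    rw [h2] at h1
    linarith

/-- The composition of two morphisms. -/
def comp (π : Hom G H) (ρ : Hom H K) : Hom G K where
  toFun x := ρ.toFun (π.toFun x)
  map_r x := by rw [π.map_r, ρ.map_r]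
  map_inv x := by rw [π.map_inv, ρ.map_inv]
  map_mark i := by rw [π.map_mark, ρ.map_mark]
  existsUnique_flag f hf := by
    obtain ⟨y, hy, huy⟩ := ρ.existsUnique_flag f hf
    obtain ⟨x, hx, hux⟩ := π.existsUnique_flag y (ρ.not_isVertex_of_map (by rwa [hy]))
    exact ⟨x, by simp only [hx, hy], fun z hz => hux z (huy _ hz)⟩
  connected v hv := π.connectedOn_preimage (S := ρ.toFun ⁻¹' {v})
    (fun x hx => by
      rw [Set.mem_preimage, Set.mem_singleton_iff] at hx ⊢
      rw [ρ.map_r, hx]; exact hv)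
    (fun x hx => by
      rw [Set.mem_preimage, Set.mem_singleton_iff] at hx ⊢
      rw [ρ.map_inv, hx, WeightedGraph.inv_vertex hv]) (ρ.connected v hv)
  genus_eq v := (π.genusOn_preimage (S := ρ.toFun ⁻¹' {v.1})
    (fun x hx => by
      rw [Set.mem_preimage, Set.mem_singleton_iff] at hx ⊢
      rw [ρ.map_r, hx]; exact v.2)
    (fun x hx => by
      rw [Set.mem_preimage, Set.mem_singleton_iff] at hx ⊢
      rw [ρ.map_inv, hx, WeightedGraph.inv_vertex v.2]) (ρ.connected v.1 v.2)).trans (ρ.genus_eq v)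

/-- The edge `e` is contracted (to a vertex). -/
def Contracts (π : Hom G H) (e : G.edgeSet) : Prop :=
  ∃ v, H.IsVertex v ∧ Sym2.map π.toFun e.1 = s(v, v)

theorem contracts_or (π : Hom G H) (e : G.edgeSet) :
    π.Contracts e ∨ Sym2.map π.toFun e.1 ∈ H.edgeSet := by
  obtain ⟨_, f, hf, rfl⟩ := e
  by_cases h : H.IsVertex (π.toFun f)
  · left
    refine ⟨_, h, ?_⟩
    rw [Sym2.map_mk, π.map_inv, WeightedGraph.inv_vertex h]
  · right
    exact ⟨π.toFun f, fun h' => hf ((π.inv_eq_iff h).2 h'), by rw [Sym2.map_mk, π.map_inv]⟩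

theorem not_mem_edgeSet_of_contracts (π : Hom G H) {e : G.edgeSet} (h : π.Contracts e) :
    Sym2.map π.toFun e.1 ∉ H.edgeSet := by
  obtain ⟨v, hv, h⟩ := h
  rw [h]
  rintro ⟨f, hf, h⟩
  rcases Sym2.eq_iff.1 h with ⟨h1, h2⟩ | ⟨h1, h2⟩ <;> first | exact hf (h2.symm.trans h1) | exact hf (h1.symm.trans h2)

end Hom

instance : Category (MarkedGraph n) where
  Hom := Hom
  id := Hom.id
  comp := Hom.comp

end MarkedGraph

/-- The objects of the category `J_{g,n}`: stable (connected) weighted `n`-marked graphs of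
genus `g`. -/
structure StableGraph (g n : ℕ) where
  graph : MarkedGraph n
  connected : graph.Connected
  genus_eq : graph.genus = g
  stable : graph.Stable

instance (g n : ℕ) : Category (StableGraph g n) where
  Hom G H := G.graph ⟶ H.graph
  id G := 𝟙 G.graph
  comp {G H K} (π : G.graph ⟶ H.graph) (ρ : H.graph ⟶ K.graph) := (π ≫ ρ : G.graph ⟶ K.graph)
  id_comp _ := rfl
  comp_id _ := rfl
  assoc _ _ _ := rfl

/-- The set of edges of a graph. -/
abbrev StableGraph.Edge {g n : ℕ} (G : StableGraph g n) : Type := G.graph.edgeSet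

/-! ### Tropical curves -/

/-- A stable tropical curve of genus `g` with `n` marked legs over a rational polyhedral cone `σ`,
i.e. with edge lengths in the monoid `S_σ`. -/
structure TropCurve (g n : ℕ) (σ : RPC) where
  graph : StableGraph g n
  length : graph.Edge → σ.dualMonoid
  length_ne_zero : ∀ e, length e ≠ 0

variable {g n : ℕ}

/-- The condition on a morphism `π : 𝔾(Γ') → 𝔾(Γ)` of weighted marked graphs to define a morphism
`(σ, Γ) → (σ', Γ')` of tropical curves over the morphism of cones `f : σ → σ'`. -/
structure TropCurve.IsHomOver {σ σ' : RPC} (f : σ ⟶ σ') (Γ : TropCurve g n σ)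
    (Γ' : TropCurve g n σ') (π : Γ'.graph ⟶ Γ.graph) : Prop where
  contracts_iff : ∀ e', MarkedGraph.Hom.Contracts π e' ↔ RPC.pullback f (Γ'.length e') = 0
  length_eq : ∀ (e' : Γ'.graph.Edge) (e : Γ.graph.Edge),
    Sym2.map (MarkedGraph.Hom.toFun π) e'.1 = e.1 → RPC.pullback f (Γ'.length e') = Γ.length e

theorem TropCurve.IsHomOver.id {σ : RPC} (Γ : TropCurve g n σ) :
    IsHomOver (𝟙 σ) Γ Γ (𝟙 Γ.graph) where
  contracts_iff e := by
    rw [RPC.pullback_id]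
    refine ⟨fun h => absurd ?_ (MarkedGraph.Hom.not_mem_edgeSet_of_contracts _ h),
      fun h => absurd h (Γ.length_ne_zero e)⟩
    change Sym2.map (fun x => x) e.1 ∈ _
    rw [Sym2.map_id']
    exact e.2
  length_eq e' e h := by
    change Sym2.map (fun x => x) e'.1 = e.1 at h
    rw [Sym2.map_id'] at h
    rw [RPC.pullback_id, Subtype.ext h]

theorem TropCurve.IsHomOver.comp {σ σ' σ'' : RPC} {f : σ ⟶ σ'} {f' : σ' ⟶ σ''}
    {Γ : TropCurve g n σ} {Γ' : TropCurve g n σ'} {Γ'' : TropCurve g n σ''}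
    {π : Γ'.graph ⟶ Γ.graph} {π' : Γ''.graph ⟶ Γ'.graph} (h : IsHomOver f Γ Γ' π)
    (h' : IsHomOver f' Γ' Γ'' π') : IsHomOver (f ≫ f') Γ Γ'' (π' ≫ π) := by
  have hmap : ∀ e'' : Γ''.graph.Edge, Sym2.map (MarkedGraph.Hom.toFun (π' ≫ π)) e''.1 =
      Sym2.map (MarkedGraph.Hom.toFun π) (Sym2.map (MarkedGraph.Hom.toFun π') e''.1) :=
    fun e'' => by rw [Sym2.map_map]; rfl
  have hcon : ∀ e'' : Γ''.graph.Edge, MarkedGraph.Hom.Contracts π' e'' →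
      MarkedGraph.Hom.Contracts (π' ≫ π) e'' := by
    rintro e'' ⟨v, hv, hve⟩
    exact ⟨_, MarkedGraph.Hom.isVertex_map π hv, by rw [hmap, hve, Sym2.map_mk]⟩
  constructor
  · intro e''
    rw [RPC.pullback_comp]
    rcases MarkedGraph.Hom.contracts_or π' e'' with hc | he
    · rw [(h'.contracts_iff e'').1 hc, map_zero]
      exact ⟨fun _ => rfl, fun _ => hcon e'' hc⟩
    · rw [h'.length_eq e'' ⟨_, he⟩ rfl, ← h.contracts_iff ⟨_, he⟩]
      exact exists_congr fun v => and_congr Iff.rfl (by rw [hmap])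
  · intro e'' e hee
    rcases MarkedGraph.Hom.contracts_or π' e'' with hc | he
    · refine absurd ?_ (MarkedGraph.Hom.not_mem_edgeSet_of_contracts _ (hcon e'' hc))
      rw [hee]
      exact e.2
    · rw [RPC.pullback_comp, h'.length_eq e'' ⟨_, he⟩ rfl]
      exact h.length_eq ⟨_, he⟩ e (by rw [← hee, hmap])

/-- The category of pairs `(σ, Γ)` of a cone `σ` and a stable tropical curve `Γ` over `σ`. -/
structure MtropRPC (g n : ℕ) where
  base : RPC
  curve : TropCurve g n base

namespace MtropRPC

/-- A morphism `(σ, Γ) → (σ', Γ')`: a morphism of cones `σ → σ'` together with a morphism of graphs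
`𝔾(Γ') → 𝔾(Γ)` which contracts exactly the edges whose lengths become `0` on `σ` and which is
compatible with the lengths of the other edges. -/
@[ext]
structure Hom (X Y : MtropRPC g n) where
  base : X.base ⟶ Y.base
  graph : Y.curve.graph ⟶ X.curve.graph
  isHomOver : TropCurve.IsHomOver base X.curve Y.curve graph

instance : Category (MtropRPC g n) where
  Hom := Hom
  id X := ⟨𝟙 _, 𝟙 _, .id _⟩
  comp p q := ⟨p.base ≫ q.base, q.graph ≫ p.graph, p.isHomOver.comp q.isHomOver⟩

/-- The tropical moduli functor over `RPC`, as a category over `RPC`: the fiber over a cone `σ`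
is the groupoid of stable tropical curves of genus `g` with `n` marked legs over `σ`. -/
def proj (g n : ℕ) : MtropRPC g n ⥤ RPC where
  obj X := X.base
  map p := p.base

end MtropRPC

/-- The category of pairs `(S, (Γ_α))` of a cone complex `S` and a family of stable tropical curves
`Γ_α` over its cones `σ_α`, together with isomorphisms `Γ_α ≅ φ^* Γ_β` for all face morphisms
`φ : σ_α → σ_β` of `S` that are compatible with compositions. Such an isomorphism is the same as
a morphism `(σ_α, Γ_α) → (σ_β, Γ_β)` over `φ`. -/
structure Mtrop (g n : ℕ) where
  base : RPCC
  curve : ∀ α, TropCurve g n (base.cone α)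
  res : ∀ {α β} (φ : base.cone α ⟶ base.cone β), φ ∈ base.mor α β →
    ((curve β).graph ⟶ (curve α).graph)
  res_isHomOver : ∀ {α β} (φ : base.cone α ⟶ base.cone β) (hφ : φ ∈ base.mor α β),
    TropCurve.IsHomOver φ (curve α) (curve β) (res φ hφ)
  res_id : ∀ α, res (𝟙 _) (base.id_mem α) = 𝟙 _
  res_comp : ∀ {α β γ} (φ : base.cone α ⟶ base.cone β) (hφ : φ ∈ base.mor α β)
    (ψ : base.cone β ⟶ base.cone γ) (hψ : ψ ∈ base.mor β γ),
    res (φ ≫ ψ) (base.comp_mem hφ hψ) = res ψ hψ ≫ res φ hφ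

namespace Mtrop

/-- A morphism `(S, (Γ_α)) → (T, (Γ'_β))`: a morphism of cone complexes `f : S → T` together with
compatible isomorphisms of `Γ_α` with the pullback of `Γ'_{f(α)}` along `σ_α → σ_{f(α)}`. -/
structure Hom (X Y : Mtrop g n) where
  base : X.base ⟶ Y.base
  graph : ∀ α, (Y.curve (base.idx α)).graph ⟶ (X.curve α).graph
  isHomOver : ∀ α, TropCurve.IsHomOver (base.hom α) (X.curve α) (Y.curve (base.idx α)) (graph α)
  naturality : ∀ {α β} (φ : X.base.cone α ⟶ X.base.cone β) (hφ : φ ∈ X.base.mor α β)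
    (ψ : Y.base.cone (base.idx α) ⟶ Y.base.cone (base.idx β))
    (hψ : ψ ∈ Y.base.mor (base.idx α) (base.idx β)),
    graph β ≫ X.res φ hφ = Y.res ψ hψ ≫ graph α

theorem Hom.ext' {X Y : Mtrop g n} {p q : Hom X Y} (h : p.base = q.base)
    (h' : ∀ α, HEq (p.graph α) (q.graph α)) : p = q := by
  obtain ⟨pb, pg, _, _⟩ := p
  obtain ⟨qb, qg, _, _⟩ := q
  obtain rfl : pb = qb := h
  obtain rfl : pg = qg := funext fun α => eq_of_heq (h' α)
  rfl

instance : Category (Mtrop g n) where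
  Hom := Hom
  id X := ⟨𝟙 _, fun α => 𝟙 (X.curve α).graph, fun _ => .id _, fun {α β} φ hφ ψ hψ => by
    obtain rfl : φ = ψ := X.base.mor_subsingleton _ _ hφ hψ
    rfl⟩
  comp {X Y Z} p q := ⟨p.base ≫ q.base, fun α => q.graph (p.base.idx α) ≫ p.graph α,
    fun α => (p.isHomOver α).comp (q.isHomOver _), fun {α β} φ hφ ψ hψ => by
      obtain ⟨χ, hχ, -⟩ := p.base.exists_mor φ hφ
      rw [Category.assoc, p.naturality φ hφ χ hχ, ← Category.assoc, q.naturality χ hχ ψ hψ,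
        Category.assoc]⟩
  id_comp p := Hom.ext' (Category.id_comp p.base) fun _ => HEq.rfl
  comp_id p := Hom.ext' (Category.comp_id p.base) fun _ => HEq.rfl
  assoc p q r := Hom.ext' (Category.assoc p.base q.base r.base) fun _ => HEq.rfl

/-- The moduli stack `M_{g,n}^trop` of stable tropical curves, as a category over `RPCC`. -/
def proj (g n : ℕ) : Mtrop g n ⥤ RPCC where
  obj X := X.base
  map p := p.base

/-- The tropical curve `Γ` over the cone `σ` is (isomorphic to) the pullback of the family `ξ` along
the morphism `j` from `σ` to the base of `ξ`, which is given by the morphism of cones `f`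
followed by the canonical morphism of `τ` into the base. -/
def IsPullback {σ τ : RPC} (ξ : Mtrop g n) (f : σ ⟶ τ) (j : RPC.toRPCC.obj τ ⟶ ξ.base)
    (Γ : TropCurve g n σ) : Prop :=
  ∃ π, TropCurve.IsHomOver (f ≫ RPCC.topHom j) Γ (ξ.curve (RPCC.topIdx j)) π

end Mtrop

/-! ### The atlas -/

/-- The smooth cone `ℝ_{≥0}^E`, with the lattice `ℤ^E`. -/
def orthant (E : Type) [Finite E] : RPC where
  N := E → ℤ
  cone :=
    { carrier := {x | ∀ e, 0 ≤ realExt (LinearMap.proj e) x}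
      zero_mem' := fun e => by simp
      add_mem' := fun hx hy e => by rw [map_add]; exact add_nonneg (hx e) (hy e)
      smul_mem' := fun c x hx e => by
        have : c • x = (c : ℝ) • x := rfl
        rw [this, map_smul]
        exact mul_nonneg c.2 (hx e) }
  rational := by
    classical
    have : Fintype E := Fintype.ofFinite E
    exact ⟨Finset.univ.image fun e => LinearMap.proj e, fun x => by
      simp only [Finset.mem_image, Finset.mem_univ, true_and, forall_exists_index,
        forall_apply_eq_imp_iff]
      rfl⟩
  salient := by
    classical
    have : Fintype E := Fintype.ofFinite E
    intro x hx hnx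
    have hcoord : ∀ (z : ℝ ⊗[ℤ] (E → ℤ)) (e : E),
        TensorProduct.piScalarRight ℤ ℝ ℝ E z e = realExt (LinearMap.proj e) z := by
      intro z e
      induction z using TensorProduct.induction_on with
      | zero => simp
      | tmul a m => simp [realExt]
      | add y z hy hz => simp only [map_add, Pi.add_apply, hy, hz]
    apply (TensorProduct.piScalarRight ℤ ℝ ℝ E).injective
    rw [map_zero]
    funext e
    rw [hcoord]
    have h1 : 0 ≤ realExt (LinearMap.proj e) x := hx e
    have h2 : 0 ≤ realExt (LinearMap.proj e) (-x) := hnx e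
    rw [map_neg] at h2
    exact le_antisymm (neg_nonneg.1 h2) h1
  span_eq_top := by
    classical
    have : Fintype E := Fintype.ofFinite E
    rw [eq_top_iff]
    rintro x -
    induction x using TensorProduct.induction_on with
    | zero => exact Submodule.zero_mem _
    | tmul a m =>
      have : a ⊗ₜ[ℤ] m = ∑ e, (a * m e) • ((1 : ℝ) ⊗ₜ[ℤ] (Pi.single e (1 : ℤ) : E → ℤ)) := by
        conv_lhs => rw [pi_eq_sum_univ' m]
        rw [TensorProduct.tmul_sum]
        refine Finset.sum_congr rfl fun e _ => ?_
        rw [TensorProduct.smul_tmul', smul_eq_mul, mul_one, ← TensorProduct.smul_tmul,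
          zsmul_eq_mul, mul_comm]
      rw [this]
      refine Submodule.sum_mem _ fun e _ => Submodule.smul_mem _ _ (Submodule.subset_span ?_)
      intro e'
      by_cases h : e' = e
      · subst h; simp [realExt]
      · simp [realExt, h]
    | add y z hy hz => exact Submodule.add_mem _ hy hz

instance {g n : ℕ} (G : StableGraph g n) : Finite G.Edge :=
  inferInstanceAs (Finite G.graph.edgeSet)

/-- The tautological tropical curve over `σ_G = ℝ_{≥0}^{E(G)}`: its graph is `G`, and the length of
an edge `e` is the corresponding coordinate. -/
def tautological {g n : ℕ} (G : StableGraph g n) : TropCurve g n (orthant G.Edge) where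
  graph := G
  length e := ⟨LinearMap.proj e, fun _ hx => hx e⟩
  length_ne_zero e h := by
    classical
    have h1 := congrArg (fun u : (orthant G.Edge).dualMonoid =>
      (show (G.Edge → ℤ) →ₗ[ℤ] ℤ from u.1) (Pi.single e 1)) h
    have h2 : (Pi.single e 1 : G.Edge → ℤ) e = 0 := h1
    simp at h2

/-- A cone stack is a geometric stack in the context of cone complexes, the face topology and
strict morphisms. -/
def IsConeStack {𝒳 : Type 1} [Category.{0} 𝒳] (p : 𝒳 ⥤ RPCC) : Prop :=
  IsGeometricStack RPCC.faceTopology RPCC.strict p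

end Trop

end

/-! ### Interior points of cones, face morphisms, sections by sublattices -/

noncomputable section

namespace Trop

/-! Two facts drive everything. On the cone side, a non-negative functional that is nonzero on `τ`
stays nonzero after pullback along a morphism `σ ⟶ τ` that meets no proper face only partially, i.e.
an interior one (`Interior.pullback_eq_zero`); hence such a pullback contracts no edge and every
morphism of curves over it is an isomorphism on graphs. On the graph side, morphisms are surjective,
hence epimorphisms, and one morphism factors through another as soon as it contracts at least the
same flags (`StableGraph.exists_factor`). Since a morphism of curves contracts exactly the edges
whose length pulls back to zero, lifts exist and are unique (`IsHomOver.exists_lift`), which gives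
the fibrations over `RPC` and over `RPCC`.

Every covering sieve contains all morphisms from cones. A family over a complex is therefore studied
through its values `ev` at these morphisms. Morphisms of families are the same as natural families
of morphisms between the values (`existsUnique_hom`), and a compatible system of values, a
`ConeFamily`, defines a family. Gluing of morphisms and effectivity of descent amount to evaluating
the local data at cones. The same evaluation identifies the restriction to `RPC`, because `toRPCC`
is fully faithful.

Three objects must be shown to be cone complexes: the equalizer of two morphisms, the space of
isomorphisms between two families over a given morphism of bases, and the product of a family with
the atlas. All have one shape: over each cone there is a set of discrete choices, and each choice
imposes linear conditions that cut out a sublattice. The sections of the cones by these sublattices,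
restricted to those that meet the interior of their cone, form a complex with the expected universal
property (`SectionData.complex`, `SectionData.lift`). The point is that a face of a section is again
the section of the unique smallest face containing it.

For the atlas, a morphism from `σ` to the orthant of `G` that makes `Γ` a pullback of the
tautological curve is the same as a graph morphism from `G` to the graph of `Γ`, contractions
included: the coordinates are the lengths. So the product of the atlas with a family consists of
copies of the cones of the base, indexed by such markings. No linear condition occurs, so the
projection is strict. It is surjective because an isomorphism with a member of the list is a marking
(`exists_product`).

The remaining part is formal. The base change of the diagonal along a morphism from a geometric
space `V` is the presheaf of isomorphisms between two families over `V`. It is a sheaf because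
morphisms glue, it is representable over `V` by `exists_isom`, and a sheaf that is representable
over a geometric space is again one (`IsGeometricSpace.of_hom`). -/

@[simp] theorem realExt_tmul {N : Type} [AddCommGroup N] (u : N →ₗ[ℤ] ℤ) (a : ℝ) (n : N) :
    realExt u (a ⊗ₜ[ℤ] n) = a * u n := by
  simp [realExt, mul_comm]

namespace RPC

@[simp] theorem real_tmul {σ τ : RPC} (f : σ ⟶ τ) (a : ℝ) (n : σ.N) :
    real f (a ⊗ₜ[ℤ] n) = a ⊗ₜ[ℤ] f.lin n := rfl

theorem real_comp_apply {σ τ ρ : RPC} (f : σ ⟶ τ) (g : τ ⟶ ρ) (x : ℝ ⊗[ℤ] σ.N) :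
    real (f ≫ g) x = real g (real f x) := by
  rw [real_comp]; rfl

/-- Flatness of `ℝ` over `ℤ`. -/
theorem real_injective {σ τ : RPC} {f : σ ⟶ τ} (hf : Function.Injective f.lin) :
    Function.Injective (real f) :=
  Module.Flat.lTensor_preserves_injective_linearMap f.lin hf

/-- A functional that vanishes on the cone is zero. -/
theorem eq_zero_of_vanish {σ : RPC} {u : σ.N →ₗ[ℤ] ℤ} (h : ∀ x ∈ σ.cone, realExt u x = 0) :
    u = 0 := by
  have h1 : Submodule.span ℝ (σ.cone : Set (ℝ ⊗[ℤ] σ.N)) ≤ LinearMap.ker (realExt u) :=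
    Submodule.span_le.2 h
  rw [σ.span_eq_top] at h1
  ext n
  have := h1 (show (1 : ℝ) ⊗ₜ[ℤ] n ∈ ⊤ from trivial)
  simpa using this

theorem realExt_eq_zero {σ : RPC} {u : σ.N →ₗ[ℤ] ℤ} (h : u = 0) (x) : realExt u x = 0 := by
  subst h; simp [realExt]

/-- The face of a cone where a non-negative functional vanishes. -/
def zeroFace (σ : RPC) (u : σ.N →ₗ[ℤ] ℤ) (hu : u ∈ σ.dualMonoid) : σ.Face where
  carrier := σ.cone ⊓ (LinearMap.ker (realExt u)).restrictScalars _
  isFace :=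
    { le := inf_le_left
      mem_of_smul_add_mem := by
        intro x y a hx hy ha h
        refine ⟨hx, ?_⟩
        have h1 : realExt u (a • x + y) = 0 := h.2
        rw [map_add, map_smul, smul_eq_mul] at h1
        have h2 := hu x hx
        have h3 := hu y hy
        change realExt u x = 0
        have h4 : 0 ≤ a * realExt u x := mul_nonneg ha.le h2
        have h5 : a * realExt u x = 0 := by linarith
        exact (mul_eq_zero.1 h5).resolve_left ha.ne' }

theorem mem_zeroFace {σ : RPC} {u : σ.N →ₗ[ℤ] ℤ} {hu : u ∈ σ.dualMonoid} {x} :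
    x ∈ (zeroFace σ u hu).1 ↔ x ∈ σ.cone ∧ realExt u x = 0 := Iff.rfl

/-- Used contrapositively: a nonzero element of the dual monoid cuts out a proper face, so a subset
contained in no proper face has a point where it is positive. -/
theorem eq_zero_of_zeroFace_eq {σ : RPC} {u : σ.N →ₗ[ℤ] ℤ} {hu : u ∈ σ.dualMonoid}
    (h : (zeroFace σ u hu).1 = σ.cone) : u = 0 :=
  eq_zero_of_vanish fun x hx => by rw [← h] at hx; exact hx.2

/-- A subcone which is not contained in a proper face contains an interior point. -/
theorem exists_interior {σ : RPC} {A : PointedCone ℝ (ℝ ⊗[ℤ] σ.N)} (hA : A ≤ σ.cone)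
    (hF : ∀ F : PointedCone ℝ (ℝ ⊗[ℤ] σ.N), F.IsFaceOf σ.cone → A ≤ F → F = σ.cone) :
    ∃ x ∈ A, ∀ z, ∃ ε : ℝ, 0 < ε ∧ x + ε • z ∈ σ.cone := by
  classical
  obtain ⟨s, hs⟩ := σ.rational
  have hdual : ∀ u ∈ s, u ∈ σ.dualMonoid := fun u hu x hx => (hs x).1 hx u hu
  -- The zero face of a nonzero defining functional is proper, so it does not contain `A` and `u` is
  -- positive somewhere on `A`. The sum of the chosen points is positive on all nonzero defining
  -- functionals at once.
  have hex : ∀ u : σ.N →ₗ[ℤ] ℤ, ∃ x ∈ A, u ∈ s → u ≠ 0 → 0 < realExt u x := by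
    intro u
    by_cases h : u ∈ s ∧ u ≠ 0
    · by_contra! hne
      refine h.2 (eq_zero_of_zeroFace_eq (hu := hdual u h.1) (hF _ (zeroFace _ _ _).2 ?_))
      intro x hx
      exact ⟨hA hx, le_antisymm (hne x hx).2.2 (hdual u h.1 x (hA hx))⟩
    · exact ⟨0, A.zero_mem, fun h1 h2 => absurd ⟨h1, h2⟩ h⟩
  choose p hpA hp using hex
  refine ⟨∑ u ∈ s, p u, A.sum_mem fun u _ => hpA u, fun z => ?_⟩
  have hpos : ∀ u ∈ s, u ≠ 0 → 0 < realExt u (∑ u ∈ s, p u) := by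
    intro u hu h0
    rw [map_sum]
    exact Finset.sum_pos' (fun v _ => (hs _).1 (hA (hpA v)) u hu) ⟨u, hu, hp u hu h0⟩
  -- Finitely many inequalities, each strict at `ε = 0` or trivial, hold together for all small
  -- positive `ε`.
  have hev : ∀ᶠ ε : ℝ in nhdsWithin 0 (Set.Ioi 0), ∀ u ∈ s,
      0 ≤ realExt u (∑ u ∈ s, p u) + ε * realExt u z := by
    rw [Filter.eventually_all_finset]
    intro u hu
    by_cases h0 : u = 0
    · exact Filter.Eventually.of_forall fun ε => by
        rw [realExt_eq_zero h0, realExt_eq_zero h0]; simp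
    have h1 : Filter.Tendsto (fun ε : ℝ => realExt u (∑ u ∈ s, p u) + ε * realExt u z)
        (nhdsWithin 0 (Set.Ioi 0)) (nhds (realExt u (∑ u ∈ s, p u) + 0 * realExt u z)) :=
      ((continuous_const.add (continuous_id.mul continuous_const)).tendsto 0).mono_left
        nhdsWithin_le_nhds
    rw [zero_mul, add_zero] at h1
    exact (h1.eventually_const_lt (hpos u hu h0)).mono fun _ h => h.le
  obtain ⟨ε, hε, h0⟩ := (hev.and self_mem_nhdsWithin).exists
  refine ⟨ε, h0, (hs _).2 fun u hu => ?_⟩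
  rw [map_add, map_smul, smul_eq_mul]
  exact hε u hu

theorem IsFaceMorphism.real_injective {τ σ : RPC} {φ : τ ⟶ σ} (h : IsFaceMorphism φ) :
    Function.Injective (real φ) := RPC.real_injective h.injective

theorem IsFaceMorphism.cancel {ρ τ σ : RPC} {φ : τ ⟶ σ} (h : IsFaceMorphism φ) {f g : ρ ⟶ τ}
    (hfg : f ≫ φ = g ≫ φ) : f = g :=
  hom_ext fun n => h.injective (congrArg (fun k : ρ ⟶ σ => k.lin n) hfg)

/-- The image of a face under a face morphism is a face. -/
theorem IsFaceMorphism.isFaceOf_map {τ σ : RPC} {φ : τ ⟶ σ} (h : IsFaceMorphism φ)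
    {F : PointedCone ℝ (ℝ ⊗[ℤ] τ.N)} (hF : F.IsFaceOf τ.cone) :
    (PointedCone.map (real φ) F).IsFaceOf σ.cone where
  le := by
    intro x hx
    rw [PointedCone.mem_map] at hx
    obtain ⟨y, hy, rfl⟩ := hx
    exact real_mem _ (hF.le hy)
  mem_of_smul_add_mem := by
    intro x y a hx hy ha hxy
    rw [PointedCone.mem_map] at hxy
    obtain ⟨z, hz, hzxy⟩ := hxy
    have hG : a • x + y ∈ PointedCone.map (real φ) τ.cone :=
      PointedCone.mem_map.2 ⟨z, hF.le hz, hzxy⟩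
    have hxG := h.isFace.mem_of_smul_add_mem hx hy ha hG
    have hyG := h.isFace.mem_of_smul_add_smul_mem_right (a := a) (b := 1) hx hy ha one_pos
      (by rwa [one_smul])
    rw [PointedCone.mem_map] at hxG hyG
    obtain ⟨x', hx', rfl⟩ := hxG
    obtain ⟨y', hy', rfl⟩ := hyG
    have hz' : z = a • x' + y' := by
      apply h.real_injective
      rw [hzxy, map_add, map_smul]
    rw [PointedCone.mem_map]
    exact ⟨x', hF.mem_of_smul_add_mem hx' hy' ha (hz' ▸ hz), rfl⟩

/-- A morphism into the image of a face morphism factors through it. -/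
theorem IsFaceMorphism.exists_lift {ρ τ σ : RPC} {φ : τ ⟶ σ} (h : IsFaceMorphism φ) (g : ρ ⟶ σ)
    (hg : ∀ x ∈ ρ.cone, real g x ∈ PointedCone.map (real φ) τ.cone) :
    ∃ l : ρ ⟶ τ, l ≫ φ = g := by
  let G : σ.Face := ⟨_, h.isFace⟩
  -- Integrality of the lift: `faceLift` puts the values of `g` into the lattice of the image face,
  -- which `range_eq` identifies with the range of `φ.lin`.
  have hr : ∀ n, g.lin n ∈ LinearMap.range φ.lin := by
    intro n
    rw [h.range_eq]
    exact ((faceLift G g hg).lin n).2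
  let l : ρ.N →ₗ[ℤ] τ.N := (LinearEquiv.ofInjective φ.lin h.injective).symm.toLinearMap ∘ₗ
    g.lin.codRestrict _ hr
  have hl : φ.lin ∘ₗ l = g.lin := by
    ext n
    exact congrArg Subtype.val ((LinearEquiv.ofInjective φ.lin h.injective).apply_symm_apply
      (g.lin.codRestrict _ hr n))
  refine ⟨⟨l, fun x hx => ?_⟩, Hom.ext hl⟩
  have h1 := hg x hx
  rw [PointedCone.mem_map] at h1
  obtain ⟨y, hy, hyx⟩ := h1
  have h2 : real φ (l.baseChange ℝ x) = real g x := by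
    unfold real
    rw [← LinearMap.comp_apply, ← LinearMap.baseChange_comp, hl]
  rw [← h2] at hyx
  exact h.real_injective hyx ▸ hy

/-- The preimage of `G` in `τ` is a face that contains the image of the interior morphism `g`, hence
it is all of `τ`. -/
theorem Interior.map_le {ρ τ σ : RPC} {g : ρ ⟶ τ} (hg : Interior g) (φ : τ ⟶ σ)
    {G : PointedCone ℝ (ℝ ⊗[ℤ] σ.N)} (hG : G.IsFaceOf σ.cone)
    (h : ∀ x ∈ ρ.cone, real (g ≫ φ) x ∈ G) : PointedCone.map (real φ) τ.cone ≤ G := by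
  intro x hx
  rw [PointedCone.mem_map] at hx
  obtain ⟨y, hy, rfl⟩ := hx
  have := hg _ (isFaceOf_preimage φ hG) fun x hx => ⟨real_mem g hx, by
    have := h x hx
    rw [real_comp] at this
    exact this⟩
  rw [← this] at hy
  exact hy.2

theorem comp_mem_map {ρ τ σ : RPC} (g : ρ ⟶ τ) (φ : τ ⟶ σ) {x} (hx : x ∈ ρ.cone) :
    real (g ≫ φ) x ∈ PointedCone.map (real φ) τ.cone := by
  rw [real_comp]
  exact PointedCone.mem_map.2 ⟨_, real_mem g hx, rfl⟩

theorem Interior.of_isIso {σ τ : RPC} (f : σ ⟶ τ) [IsIso f] : Interior f := by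
  intro F hF h
  refine le_antisymm hF.le fun x hx => ?_
  have := h _ (real_mem (inv f) hx)
  rwa [← real_comp_apply, IsIso.inv_hom_id, real_id] at this

/-- A functional that is non-negative on `τ` and vanishes on `σ` is zero, if `σ ⟶ τ` is interior. -/
theorem Interior.pullback_eq_zero {σ τ : RPC} {f : σ ⟶ τ} (hf : Interior f) {u : τ.dualMonoid}
    (h : pullback f u = 0) : u = 0 := by
  refine Subtype.ext (eq_zero_of_zeroFace_eq (hu := u.2) (hf _ (zeroFace _ _ _).2 fun x hx =>
    mem_zeroFace.2 ⟨real_mem f hx, ?_⟩))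
  rw [← realExt_comp]
  exact realExt_eq_zero (congrArg Subtype.val h) x

theorem faceι_toTop (σ : RPC) : σ.faceι σ.topFace ≫ σ.toTop = 𝟙 _ :=
  comp_faceι_inj _ (by
    rw [Category.assoc, toTop, faceLift_faceι, Category.comp_id, Category.id_comp])

@[simp] theorem toTop_faceι (σ : RPC) : σ.toTop ≫ σ.faceι σ.topFace = 𝟙 _ := faceLift_faceι _ _ _

instance (σ : RPC) : IsIso σ.toTop := ⟨⟨_, toTop_faceι σ, faceι_toTop σ⟩⟩

theorem isFaceMorphism_faceι (σ : RPC) (F : σ.Face) : IsFaceMorphism (σ.faceι F) where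
  isFace := by rw [map_faceι]; exact F.2
  injective := faceι_injective σ F
  range_eq := by rw [map_faceι]; exact Submodule.range_subtype _

/-! ### Sublattices that meet the interior of a cone -/

/-- The points of a cone in a sublattice. -/
def sectionCone (σ : RPC) (K : Submodule ℤ σ.N) : PointedCone ℝ (ℝ ⊗[ℤ] K) :=
  σ.cone.comap (K.subtype.baseChange ℝ)

/-- The sublattice `K` is not contained in the span of a proper face: no proper face contains all
points of the cone in `K`. -/
def MeetsInterior (σ : RPC) (K : Submodule ℤ σ.N) : Prop :=
  ∀ F : PointedCone ℝ (ℝ ⊗[ℤ] σ.N), F.IsFaceOf σ.cone →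
    (∀ x ∈ σ.sectionCone K, K.subtype.baseChange ℝ x ∈ F) → F = σ.cone

/-- An interior point of the ambient cone that lies in the image of `A` can be moved in all
directions of `K` without leaving the section, so it is interior to the section as well. -/
theorem MeetsInterior.exists_interior {σ : RPC} {K : Submodule ℤ σ.N}
    (A : PointedCone ℝ (ℝ ⊗[ℤ] K)) (hA : A ≤ σ.sectionCone K)
    (h : ∀ F : PointedCone ℝ (ℝ ⊗[ℤ] σ.N), F.IsFaceOf σ.cone →
      (∀ x ∈ A, K.subtype.baseChange ℝ x ∈ F) → F = σ.cone) :
    ∃ x ∈ A, ∀ z, ∃ ε : ℝ, 0 < ε ∧ x + ε • z ∈ σ.sectionCone K := by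
  obtain ⟨x, hx, hz⟩ := RPC.exists_interior (σ := σ)
    (A := A.map (K.subtype.baseChange ℝ))
    (by
      intro x hx
      rw [PointedCone.mem_map] at hx
      obtain ⟨y, hy, rfl⟩ := hx
      exact hA hy)
    (fun F hF hAF => h F hF fun x hx => hAF (PointedCone.mem_map.2 ⟨x, hx, rfl⟩))
  rw [PointedCone.mem_map] at hx
  obtain ⟨y, hy, rfl⟩ := hx
  refine ⟨y, hy, fun z => ?_⟩
  obtain ⟨ε, h0, hε⟩ := hz (K.subtype.baseChange ℝ z)
  refine ⟨ε, h0, ?_⟩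
  change K.subtype.baseChange ℝ _ ∈ σ.cone
  rwa [map_add, map_smul]

/-- The intersection of a cone with a sublattice that meets its interior. -/
def ofSublattice (σ : RPC) (K : Submodule ℤ σ.N) (hK : σ.MeetsInterior K) : RPC where
  N := K
  cone := σ.sectionCone K
  rational := by
    classical
    obtain ⟨s, hs⟩ := σ.rational
    refine ⟨s.image (fun u => u ∘ₗ K.subtype), fun x => ?_⟩
    change K.subtype.baseChange ℝ x ∈ σ.cone ↔ _
    rw [hs]
    simp only [Finset.mem_image, forall_exists_index, and_imp, forall_apply_eq_imp_iff₂,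
      realExt_subtype]
  salient := fun x hx hnx => by
    apply baseChange_subtype_injective σ K
    rw [map_zero]
    refine σ.salient _ hx ?_
    rw [← map_neg]
    exact hnx
  span_eq_top := by
    -- With an interior point `x`, any vector `z` is a multiple of the difference of the points `x +
    -- ε z` and `x` of the section.
    obtain ⟨x, hx, hz⟩ := MeetsInterior.exists_interior (σ.sectionCone K) le_rfl hK
    rw [eq_top_iff]
    rintro z -
    obtain ⟨ε, h0, hε⟩ := hz z
    have h1 := Submodule.smul_mem _ ε⁻¹ (Submodule.sub_mem _ (Submodule.subset_span (R := ℝ) hε)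
      (Submodule.subset_span (R := ℝ) hx))
    rwa [add_sub_cancel_left, smul_smul, inv_mul_cancel₀ h0.ne', one_smul] at h1

section OfSublattice

variable {σ : RPC} {K : Submodule ℤ σ.N} (hK : σ.MeetsInterior K)

/-- The inclusion of a section of a cone. -/
def sublatticeι : σ.ofSublattice K hK ⟶ σ where
  lin := K.subtype
  mapsTo := fun _ hx => hx

theorem interior_sublatticeι : Interior (sublatticeι hK) := hK

theorem sublatticeι_lin_injective : Function.Injective (sublatticeι hK).lin :=
  Subtype.val_injective

theorem sublatticeι_cancel {ρ : RPC} {f g : ρ ⟶ σ.ofSublattice K hK}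
    (hfg : f ≫ sublatticeι hK = g ≫ sublatticeι hK) : f = g :=
  hom_ext fun n => sublatticeι_lin_injective hK (congrArg (fun k : ρ ⟶ σ => k.lin n) hfg)

/-- A morphism that maps the lattice into the sublattice factors through the section. -/
def sublatticeLift {ρ : RPC} (f : ρ ⟶ σ) (hf : ∀ n, f.lin n ∈ K) :
    ρ ⟶ σ.ofSublattice K hK where
  lin := f.lin.codRestrict K hf
  mapsTo x hx := by
    have key : ∀ g : ρ.N →ₗ[ℤ] K, K.subtype ∘ₗ g = f.lin →
        K.subtype.baseChange ℝ (g.baseChange ℝ x) ∈ σ.cone := by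
      intro g hg
      rw [← LinearMap.comp_apply, ← LinearMap.baseChange_comp, hg]
      exact f.mapsTo x hx
    exact key _ rfl

@[simp] theorem sublatticeLift_ι {ρ : RPC} (f : ρ ⟶ σ) (hf : ∀ n, f.lin n ∈ K) :
    sublatticeLift hK f hf ≫ sublatticeι hK = f := rfl

/-- A face of a section that is not contained in a proper face of the cone is improper. -/
theorem face_ofSublattice_eq {F : PointedCone ℝ (ℝ ⊗[ℤ] (σ.ofSublattice K hK).N)}
    (hF : F.IsFaceOf (σ.ofSublattice K hK).cone)
    (h : ∀ G : PointedCone ℝ (ℝ ⊗[ℤ] σ.N), G.IsFaceOf σ.cone →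
      (∀ x ∈ F, real (sublatticeι hK) x ∈ G) → G = σ.cone) : F = (σ.ofSublattice K hK).cone := by
  obtain ⟨x, hx, hz⟩ : ∃ x ∈ F, ∀ z, ∃ ε : ℝ, 0 < ε ∧ x + ε • z ∈ (σ.ofSublattice K hK).cone :=
    MeetsInterior.exists_interior (σ := σ) (K := K) F hF.le h
  refine le_antisymm hF.le fun z hzc => ?_
  -- The point `x` of the face is the sum of `ε z` and `x - ε z`, both in the section, so `z` lies
  -- in the face.
  obtain ⟨ε, h0, hε⟩ := hz (-z)
  refine hF.mem_of_smul_add_mem (y := x + ε • -z) hzc hε h0 ?_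
  rw [smul_neg, add_comm x, add_neg_cancel_left]
  exact hx

end OfSublattice

/-- A face containing the section contains the image of `f`. In this way morphisms into a complex
whose values satisfy the linear conditions produce admissible sections. -/
theorem MeetsInterior.of_interior {ρ σ : RPC} {f : ρ ⟶ σ} (hf : Interior f) {K : Submodule ℤ σ.N}
    (hK : ∀ n, f.lin n ∈ K) : σ.MeetsInterior K := by
  intro F hF h
  refine hf F hF fun x hx => ?_
  have h1 : real f x = K.subtype.baseChange ℝ ((f.lin.codRestrict K hK).baseChange ℝ x) := by
    rw [← LinearMap.comp_apply, ← LinearMap.baseChange_comp, LinearMap.subtype_comp_codRestrict]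
    rfl
  rw [h1]
  refine h _ ?_
  change K.subtype.baseChange ℝ _ ∈ σ.cone
  rw [← h1]
  exact real_mem f hx

theorem meetsInterior_top (σ : RPC) : σ.MeetsInterior ⊤ :=
  MeetsInterior.of_interior (Interior.id σ) fun _ => trivial

theorem isIso_sublatticeι_top {σ : RPC} {K : Submodule ℤ σ.N} (hK : σ.MeetsInterior K)
    (h : K = ⊤) : IsIso (sublatticeι hK) :=
  ⟨sublatticeLift hK (𝟙 σ) fun n => by rw [h]; trivial, sublatticeι_cancel hK rfl, rfl⟩

/-- A morphism of sections over a face morphism whose sublattice is the preimage is a face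
morphism. -/
theorem isFaceMorphism_ofSublattice {τ σ : RPC} {φ : τ ⟶ σ} (hφ : IsFaceMorphism φ)
    {L : Submodule ℤ τ.N} {K : Submodule ℤ σ.N} (hL : τ.MeetsInterior L) (hK : σ.MeetsInterior K)
    (hLK : ∀ n, n ∈ L ↔ φ.lin n ∈ K) {ψ : τ.ofSublattice L hL ⟶ σ.ofSublattice K hK}
    (hψ : ψ ≫ sublatticeι hK = sublatticeι hL ≫ φ) : IsFaceMorphism ψ := by
  have hinj : Function.Injective ψ.lin := fun m n h =>
    sublatticeι_lin_injective hL (hφ.injective (by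
      have := congrArg (fun k : τ.ofSublattice L hL ⟶ σ => k.lin m = k.lin n) hψ
      exact this.mp (congrArg (sublatticeι hK).lin h)))
  have hreal : ∀ x, real (sublatticeι hK) (real ψ x) = real φ (real (sublatticeι hL) x) := by
    intro x
    rw [← real_comp_apply, hψ, real_comp_apply]
  -- The hypothesis that `L` is the full preimage of `K` enters here.
  have hlift : ∀ n : (σ.ofSublattice K hK).N, (sublatticeι hK).lin n ∈ LinearMap.range φ.lin →
      n ∈ LinearMap.range ψ.lin := by
    rintro n ⟨m, hm⟩
    have hmL : m ∈ L := (hLK m).2 (hm ▸ n.2)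
    refine ⟨⟨m, hmL⟩, sublatticeι_lin_injective hK ?_⟩
    rw [← hm]
    exact congrArg (fun k : τ.ofSublattice L hL ⟶ σ => k.lin ⟨m, hmL⟩) hψ
  -- points of the section in the image of `φ` are in the span of the image of `ψ`
  have hmem : ∀ x : ℝ ⊗[ℤ] (σ.ofSublattice K hK).N,
      x ∈ PointedCone.map (real ψ) (τ.ofSublattice L hL).cone ↔
        real (sublatticeι hK) x ∈ PointedCone.map (real φ) τ.cone := by
    intro x
    constructor
    · intro hx
      rw [PointedCone.mem_map] at hx
      obtain ⟨y, hy, rfl⟩ := hx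
      rw [hreal]
      exact PointedCone.mem_map.2 ⟨_, real_mem _ hy, rfl⟩
    · intro hx
      rw [PointedCone.mem_map] at hx
      obtain ⟨y, hy, hyx⟩ := hx
      -- `K/L → N/φ` is injective, hence stays so after tensoring
      let q : (σ.ofSublattice K hK).N →ₗ[ℤ] (σ.N ⧸ LinearMap.range φ.lin) :=
        (LinearMap.range φ.lin).mkQ ∘ₗ (sublatticeι hK).lin
      have hq : x ∈ LinearMap.ker (AlgebraTensorModule.lTensor ℝ ℝ q) := by
        rw [LinearMap.mem_ker]
        have h1 : q.baseChange ℝ x = (LinearMap.range φ.lin).mkQ.baseChange ℝ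
            (real (sublatticeι hK) x) := by
          simp only [q, LinearMap.baseChange_comp]; rfl
        have h2 : (LinearMap.range φ.lin).mkQ.baseChange ℝ (real φ y) = 0 := by
          unfold real
          rw [← LinearMap.comp_apply, ← LinearMap.baseChange_comp, LinearMap.range_mkQ_comp]
          simp
        change q.baseChange ℝ x = 0
        rw [h1, ← hyx, h2]
      rw [Module.Flat.ker_lTensor_eq] at hq
      obtain ⟨z, hz⟩ := hq
      have hqk : ∀ n : LinearMap.ker q, n.1 ∈ LinearMap.range ψ.lin := fun n =>
        hlift _ (by
          have := n.2
          rw [LinearMap.mem_ker] at this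
          exact (Submodule.Quotient.mk_eq_zero _).1 this)
      let r : LinearMap.ker q →ₗ[ℤ] (τ.ofSublattice L hL).N :=
        (LinearEquiv.ofInjective ψ.lin hinj).symm.toLinearMap ∘ₗ
          (LinearMap.ker q).subtype.codRestrict _ hqk
      have hr : ψ.lin ∘ₗ r = (LinearMap.ker q).subtype := by
        ext n
        exact congrArg Subtype.val ((LinearEquiv.ofInjective ψ.lin hinj).apply_symm_apply
          ((LinearMap.ker q).subtype.codRestrict _ hqk n))
      have hx : real ψ (r.baseChange ℝ z) = x := by
        unfold real
        rw [← LinearMap.comp_apply, ← LinearMap.baseChange_comp, hr]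
        exact hz
      rw [PointedCone.mem_map]
      refine ⟨_, ?_, hx⟩
      change real (sublatticeι hL) _ ∈ τ.cone
      -- The real preimage just found lies in the cone because it has the same image under the
      -- injective map `real φ` as `y`.
      have h3 : real φ (real (sublatticeι hL) (r.baseChange ℝ z)) = real φ y := by
        rw [← hreal, hx, hyx]
      rw [hφ.real_injective h3]
      exact hy
  have hface : (PointedCone.map (real ψ) (τ.ofSublattice L hL).cone).IsFaceOf
      (σ.ofSublattice K hK).cone :=
    { le := by
        intro x hx
        rw [PointedCone.mem_map] at hx
        obtain ⟨y, hy, rfl⟩ := hx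
        exact real_mem ψ hy
      mem_of_smul_add_mem := by
        intro x y a hx hy ha h
        rw [hmem] at h ⊢
        rw [map_add, map_smul] at h
        exact hφ.isFace.mem_of_smul_add_mem (real_mem (sublatticeι hK) hx)
          (real_mem (sublatticeι hK) hy) ha h }
  refine ⟨hface, hinj, le_antisymm ?_ ?_⟩
  · rintro _ ⟨m, rfl⟩
    rw [mem_faceLattice]
    have h1 : (1 : ℝ) ⊗ₜ[ℤ] m ∈ Submodule.span ℝ ((τ.ofSublattice L hL).cone : Set _) := by
      rw [span_eq_top]; trivial
    have h2 := Submodule.mem_map_of_mem (f := real ψ) h1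
    rw [Submodule.map_span] at h2
    simpa [← PointedCone.coe_map] using h2
  · intro n hn
    apply hlift
    rw [hφ.range_eq, mem_faceLattice]
    rw [mem_faceLattice] at hn
    have h2 := Submodule.mem_map_of_mem (f := real (sublatticeι hK)) hn
    rw [Submodule.map_span, real_tmul] at h2
    refine Submodule.span_mono ?_ h2
    rintro _ ⟨x, hx, rfl⟩
    exact (hmem x).1 hx

end RPC

end Trop

end

/-! ### Morphisms from cones to cone complexes -/

noncomputable section

namespace Trop

namespace RPCC

open RPC

theorem cancel_mor {S : RPCC} {ρ : RPC} {α β} {φ : S.cone α ⟶ S.cone β} (hφ : φ ∈ S.mor α β)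
    {f g : ρ ⟶ S.cone α} (h : f ≫ φ = g ≫ φ) : f = g :=
  (S.isFaceMorphism hφ).cancel h

/-- Every morphism to a cone of a complex factors through an interior morphism to a face. -/
theorem exists_factor {S : RPCC} {ρ : RPC} {β} (f : ρ ⟶ S.cone β) :
    ∃ α, ∃ φ ∈ S.mor α β, ∃ g : ρ ⟶ S.cone α, Interior g ∧ g ≫ φ = f := by
  -- Take the smallest face that contains the image of `f`; its minimality is the interiority of the
  -- lift.
  obtain ⟨⟨α, φ⟩, ⟨hφ, hF⟩, -⟩ := S.face_unique β _ (imageFace f ρ.topFace).2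
  have hface := S.isFaceMorphism hφ
  obtain ⟨g, hg⟩ := hface.exists_lift f fun x hx => by
    rw [hF]; exact real_mem_imageFace f ρ.topFace hx
  refine ⟨α, φ, hφ, g, fun F' hF' h => ?_, hg⟩
  have hle : (imageFace f ρ.topFace).1 ≤ PointedCone.map (real φ) F' := by
    refine imageFace_le (G := ⟨_, hface.isFaceOf_map hF'⟩) fun x hx => ?_
    rw [← hg, real_comp_apply]
    exact PointedCone.mem_map.2 ⟨_, h x hx, rfl⟩
  rw [← hF] at hle
  refine le_antisymm hF'.le fun x hx => ?_
  have := hle (PointedCone.mem_map.2 ⟨x, hx, rfl⟩)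
  rw [PointedCone.mem_map] at this
  obtain ⟨y, hy, hyx⟩ := this
  exact hface.real_injective hyx ▸ hy

/-- The factorization through an interior morphism is unique. -/
theorem factor_unique {S : RPCC} {ρ : RPC} {α α' β} {g : ρ ⟶ S.cone α} {g' : ρ ⟶ S.cone α'}
    {φ : S.cone α ⟶ S.cone β} {φ' : S.cone α' ⟶ S.cone β} (hg : Interior g) (hg' : Interior g')
    (hφ : φ ∈ S.mor α β) (hφ' : φ' ∈ S.mor α' β) (h : g ≫ φ = g' ≫ φ') :
    (⟨α, g, φ⟩ : Σ α, (ρ ⟶ S.cone α) × (S.cone α ⟶ S.cone β)) = ⟨α', g', φ'⟩ := by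
  -- Each of the two images is the smallest face that contains the image of `ρ`, so they coincide,
  -- and `face_unique` identifies the face morphisms.
  have hF : PointedCone.map (real φ) (S.cone α).cone = PointedCone.map (real φ') (S.cone α').cone :=
    le_antisymm
      (hg.map_le φ (S.isFaceMorphism hφ').isFace fun x hx => by rw [h]; exact comp_mem_map _ _ hx)
      (hg'.map_le φ' (S.isFaceMorphism hφ).isFace fun x hx => by
        rw [← h]; exact comp_mem_map _ _ hx)
  have h1 : (⟨α, φ⟩ : Σ α, S.cone α ⟶ S.cone β) = ⟨α', φ'⟩ :=
    (S.face_unique β _ (S.isFaceMorphism hφ).isFace).unique ⟨hφ, rfl⟩ ⟨hφ', hF.symm⟩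
  cases h1
  rw [cancel_mor hφ h]

theorem interior_topHom {σ : RPC} {S : RPCC} (j : toRPCC.obj σ ⟶ S) : Interior (topHom j) :=
  (Interior.of_isIso _).comp (j.interior _)

/-- The morphism `j` from a cone to a complex is given by the morphism `g` to a cone of the
complex. -/
def RepBy {S : RPCC} {ρ : RPC} (j : toRPCC.obj ρ ⟶ S) (α : S.Idx) (g : ρ ⟶ S.cone α) : Prop :=
  ∃ φ ∈ S.mor (topIdx j) α, topHom j ≫ φ = g

section RepBy

variable {S : RPCC} {ρ : RPC}

theorem repBy_self (j : toRPCC.obj ρ ⟶ S) : RepBy j (topIdx j) (topHom j) :=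
  ⟨_, S.id_mem _, Category.comp_id _⟩

theorem RepBy.hom_unique {j : toRPCC.obj ρ ⟶ S} {α} {g g' : ρ ⟶ S.cone α} (h : RepBy j α g)
    (h' : RepBy j α g') : g = g' := by
  obtain ⟨φ, hφ, rfl⟩ := h
  obtain ⟨φ', hφ', rfl⟩ := h'
  rw [S.mor_subsingleton _ _ hφ hφ']

/-- An interior representative followed by the identity and `topHom j` followed by a face morphism
are two interior factorizations of the same morphism, so every interior representative is `topHom
j`. -/
theorem RepBy.sigma_eq {j : toRPCC.obj ρ ⟶ S} {α α'} {g : ρ ⟶ S.cone α} {g' : ρ ⟶ S.cone α'}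
    (h : RepBy j α g) (hg : Interior g) (h' : RepBy j α' g') (hg' : Interior g') :
    (⟨α, g⟩ : Σ α, (ρ ⟶ S.cone α)) = ⟨α', g'⟩ := by
  have key : ∀ {α} {g : ρ ⟶ S.cone α}, RepBy j α g → Interior g →
      (⟨topIdx j, topHom j⟩ : Σ α, (ρ ⟶ S.cone α)) = ⟨α, g⟩ := by
    rintro α g ⟨φ, hφ, h⟩ hg
    have := factor_unique (interior_topHom j) hg hφ (S.id_mem α) (by rw [h, Category.comp_id])
    exact congrArg (fun p : Σ β, (ρ ⟶ S.cone β) × (S.cone β ⟶ S.cone α) =>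
      (⟨p.1, p.2.1⟩ : Σ α, (ρ ⟶ S.cone α))) this
  rw [← key h hg, ← key h' hg']

theorem RepBy.comp_mor {j : toRPCC.obj ρ ⟶ S} {α β} {g : ρ ⟶ S.cone α} (h : RepBy j α g)
    {φ : S.cone α ⟶ S.cone β} (hφ : φ ∈ S.mor α β) : RepBy j β (g ≫ φ) := by
  obtain ⟨ψ, hψ, rfl⟩ := h
  exact ⟨_, S.comp_mem hψ hφ, (Category.assoc _ _ _).symm⟩

/-- The components of the morphism represented by `g`. -/
theorem RepBy.exists_hom {j : toRPCC.obj ρ ⟶ S} {α} {g : ρ ⟶ S.cone α} (h : RepBy j α g)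
    (F : ρ.Face) : ∃ χ ∈ S.mor (j.idx F) α, j.hom F ≫ χ = ρ.faceι F ≫ g := by
  obtain ⟨φ, hφ, rfl⟩ := h
  have hι := faceLift_faceι ρ.topFace (ρ.faceι F) fun x hx => F.2.le (faceι_mem ρ F hx)
  obtain ⟨ψ, hψ, h⟩ := j.exists_mor _ hι
  have aux : ∀ {X Y Z : RPC} (a : ρ.ofFace F ⟶ X) (b : ρ.ofFace ρ.topFace ⟶ Y) (ψ : X ⟶ Y)
      (φ : Y ⟶ Z) (l : ρ.ofFace F ⟶ ρ.ofFace ρ.topFace), l ≫ ρ.faceι ρ.topFace = ρ.faceι F →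
      l ≫ b = a ≫ ψ → a ≫ ψ ≫ φ = ρ.faceι F ≫ (ρ.toTop ≫ b) ≫ φ := by
    intro X Y Z a b ψ φ l hl h
    rw [← Category.assoc, ← h, ← hl]
    simp only [Category.assoc]
    rw [← Category.assoc (ρ.faceι _) ρ.toTop, faceι_toTop, Category.id_comp]
  exact ⟨_, S.comp_mem hψ hφ, aux _ _ _ φ _ hι h⟩

/-- On each face `F` the component of `j` is interior, and a face morphism into the cone `α` turns
it into the restriction of `g`. Such a factorization is unique. -/
theorem RepBy.unique {j j' : toRPCC.obj ρ ⟶ S} {α} {g : ρ ⟶ S.cone α} (h : RepBy j α g)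
    (h' : RepBy j' α g) : j = j' := by
  have key : ∀ F, (⟨j.idx F, j.hom F⟩ : Σ α, (ρ.ofFace F ⟶ S.cone α)) = ⟨j'.idx F, j'.hom F⟩ := by
    intro F
    obtain ⟨χ, hχ, e⟩ := h.exists_hom F
    obtain ⟨χ', hχ', e'⟩ := h'.exists_hom F
    have := factor_unique (j.interior F) (j'.interior F) hχ hχ' (e.trans e'.symm)
    exact congrArg (fun p : Σ β, (ρ.ofFace F ⟶ S.cone β) × (S.cone β ⟶ S.cone α) =>
      (⟨p.1, p.2.1⟩ : Σ α, (ρ.ofFace F ⟶ S.cone α))) this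
  exact Hom.ext' (fun F => congrArg Sigma.fst (key F)) fun F => (Sigma.mk.inj (key F)).2

/-- A face `F` of `ρ` is sent to the smallest face of the cone `α` that contains its image under
`g`. Compatibility with inclusions of faces follows from uniqueness of interior factorizations. -/
theorem exists_repBy (α : S.Idx) (g : ρ ⟶ S.cone α) : ∃ j : toRPCC.obj ρ ⟶ S, RepBy j α g := by
  choose idx φ hφ h hint hh using fun F : ρ.Face => exists_factor (ρ.faceι F ≫ g)
  let j : Hom (toRPCC.obj ρ) S :=
    { idx := idx
      hom := h
      interior := hint
      exists_mor := by
        intro F G χ hχ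
        obtain ⟨γ, ψ, hψ, l, hl, hlψ⟩ := exists_factor (χ ≫ h G)
        have hχ' : χ ≫ ρ.faceι G = ρ.faceι F := hχ
        have aux : ∀ (F G : ρ.Face) (χ : ρ.ofFace F ⟶ ρ.ofFace G) (l : ρ.ofFace F ⟶ S.cone γ)
            (ψ : S.cone γ ⟶ S.cone (idx G)), χ ≫ ρ.faceι G = ρ.faceι F → l ≫ ψ = χ ≫ h G →
            l ≫ ψ ≫ φ G = h F ≫ φ F := by
          intro F G χ l ψ hχ hl
          rw [← Category.assoc, hl, Category.assoc, hh, hh, ← Category.assoc, hχ]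
        have := factor_unique hl (hint F) (S.comp_mem hψ (hφ G)) (hφ F) (aux F G χ l ψ hχ' hlψ)
        obtain rfl : γ = idx F := congrArg Sigma.fst this
        obtain rfl : l = h F := congrArg Prod.fst (eq_of_heq (Sigma.mk.inj this).2)
        exact ⟨ψ, hψ, hlψ.symm⟩ }
  refine ⟨j, φ _, hφ _, ?_⟩
  change (ρ.toTop ≫ h ρ.topFace) ≫ φ _ = g
  rw [Category.assoc, hh, ← Category.assoc, toTop_faceι, Category.id_comp]

theorem RepBy.precomp {j : toRPCC.obj ρ ⟶ S} {α} {g : ρ ⟶ S.cone α} (h : RepBy j α g) {ρ' : RPC}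
    (m : ρ' ⟶ ρ) : RepBy (toRPCC.map m ≫ j) α (m ≫ g) := by
  obtain ⟨χ, hχ, e⟩ := h.exists_hom (imageFace m ρ'.topFace)
  have aux : ∀ {X Z : RPC} (a : ρ.ofFace (imageFace m ρ'.topFace) ⟶ X) (χ : X ⟶ Z) (g : ρ ⟶ Z),
      a ≫ χ = ρ.faceι _ ≫ g → (ρ'.toTop ≫ faceMap m ρ'.topFace ≫ a) ≫ χ = m ≫ g := by
    intro X Z a χ g e
    rw [Category.assoc, Category.assoc, e, ← Category.assoc (faceMap _ _), faceMap_faceι,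
      Category.assoc, ← Category.assoc, toTop_faceι, Category.id_comp]
  exact ⟨χ, hχ, aux _ _ _ e⟩

theorem RepBy.postcomp {T : RPCC} {j : toRPCC.obj ρ ⟶ S} {α} {g : ρ ⟶ S.cone α}
    (h : RepBy j α g) (f : S ⟶ T) : RepBy (j ≫ f) (f.idx α) (g ≫ f.hom α) := by
  obtain ⟨φ, hφ, rfl⟩ := h
  obtain ⟨ψ, hψ, e⟩ := f.exists_mor φ hφ
  refine ⟨ψ, hψ, ?_⟩
  rw [Category.assoc, e]
  rfl

/-- The morphism from a cone to a complex given by a morphism to a cone of the complex. -/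
def ofCone (α : S.Idx) (g : ρ ⟶ S.cone α) : toRPCC.obj ρ ⟶ S := (exists_repBy α g).choose

theorem repBy_ofCone (α : S.Idx) (g : ρ ⟶ S.cone α) : RepBy (ofCone α g) α g :=
  (exists_repBy α g).choose_spec

theorem map_comp_ofCone {ρ' : RPC} (m : ρ' ⟶ ρ) (α : S.Idx) (g : ρ ⟶ S.cone α) :
    toRPCC.map m ≫ ofCone α g = ofCone α (m ≫ g) :=
  ((repBy_ofCone α g).precomp m).unique (repBy_ofCone _ _)

theorem ofCone_comp {T : RPCC} (α : S.Idx) (g : ρ ⟶ S.cone α) (f : S ⟶ T) :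
    ofCone α g ≫ f = ofCone (f.idx α) (g ≫ f.hom α) :=
  ((repBy_ofCone α g).postcomp f).unique (repBy_ofCone _ _)

theorem ofCone_mor {α β : S.Idx} (g : ρ ⟶ S.cone α) {φ : S.cone α ⟶ S.cone β}
    (hφ : φ ∈ S.mor α β) : ofCone β (g ≫ φ) = ofCone α g :=
  (repBy_ofCone _ _).unique ((repBy_ofCone α g).comp_mor hφ)

theorem ofCone_topHom (j : toRPCC.obj ρ ⟶ S) : ofCone (topIdx j) (topHom j) = j :=
  (repBy_ofCone _ _).unique (repBy_self j)

/-- Every morphism from a cone factors through the canonical morphism of a cone of `S`. This reduces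
statements about all morphisms from cones to the generating covering. -/
theorem map_topHom_comp_ofCone (j : toRPCC.obj ρ ⟶ S) :
    toRPCC.map (topHom j) ≫ ofCone (topIdx j) (𝟙 _) = j := by
  rw [map_comp_ofCone, Category.comp_id, ofCone_topHom]

theorem map_mor_comp_ofCone {α β : S.Idx} {φ : S.cone α ⟶ S.cone β} (hφ : φ ∈ S.mor α β) :
    toRPCC.map φ ≫ ofCone β (𝟙 _) = ofCone α (𝟙 _) := by
  rw [map_comp_ofCone, Category.comp_id, ← ofCone_mor (𝟙 _) hφ, Category.id_comp]

/-- The cones in which `j'` and `j` are interior may differ; the face morphism obtained here is the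
one along which families are restricted. -/
theorem exists_mor_of_comp {ρ' : RPC} {m : ρ' ⟶ ρ} {j' : toRPCC.obj ρ' ⟶ S}
    {j : toRPCC.obj ρ ⟶ S} (h : toRPCC.map m ≫ j = j') :
    ∃ ψ ∈ S.mor (topIdx j') (topIdx j), topHom j' ≫ ψ = m ≫ topHom j := by
  subst h
  exact (repBy_self j).precomp m

/-- The components of a morphism are interior, so index and component over a cone can be read off
from the composition with the canonical morphism of that cone. -/
theorem hom_ext {T : RPCC} {f f' : S ⟶ T}
    (h : ∀ α, ofCone α (𝟙 (S.cone α)) ≫ f = ofCone α (𝟙 _) ≫ f') : f = f' := by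
  have key : ∀ α, (⟨f.idx α, f.hom α⟩ : Σ β, (S.cone α ⟶ T.cone β)) = ⟨f'.idx α, f'.hom α⟩ := by
    intro α
    have h1 := (repBy_ofCone α (𝟙 _)).postcomp f
    have h2 := (repBy_ofCone α (𝟙 _)).postcomp f'
    rw [← h] at h2
    rw [Category.id_comp] at h1 h2
    exact h1.sigma_eq (f.interior α) h2 (f'.interior α)
  exact Hom.ext' (fun F => congrArg Sigma.fst (key F)) fun F => (Sigma.mk.inj (key F)).2

/-- Morphisms of cone complexes can be glued from morphisms on the cones. -/
def glue {T : RPCC} (j : ∀ α, toRPCC.obj (S.cone α) ⟶ T)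
    (hj : ∀ {γ α} (φ : S.cone γ ⟶ S.cone α), φ ∈ S.mor γ α → toRPCC.map φ ≫ j α = j γ) :
    S ⟶ T where
  idx α := topIdx (j α)
  hom α := topHom (j α)
  interior α := interior_topHom _
  exists_mor φ hφ := by
    obtain ⟨ψ, hψ, h⟩ := exists_mor_of_comp (hj φ hφ)
    exact ⟨ψ, hψ, h.symm⟩

theorem ofCone_comp_glue {T : RPCC} (j : ∀ α, toRPCC.obj (S.cone α) ⟶ T)
    (hj : ∀ {γ α} (φ : S.cone γ ⟶ S.cone α), φ ∈ S.mor γ α → toRPCC.map φ ≫ j α = j γ) (α) :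
    ofCone α (𝟙 _) ≫ glue j hj = j α := by
  rw [ofCone_comp, Category.id_comp]
  exact ofCone_topHom _

end RepBy

theorem repBy_id (σ : RPC) : RepBy (𝟙 (toRPCC.obj σ)) σ.topFace σ.toTop :=
  ⟨_, (toRPCC.obj σ).id_mem _, rfl⟩

/-- The morphism of cones underlying a morphism of complexes of faces. -/
def toRPCCPreimage {ρ σ : RPC} (j : toRPCC.obj ρ ⟶ toRPCC.obj σ) : ρ ⟶ σ :=
  topHom j ≫ σ.faceι (topIdx j)

/-- Fullness of the embedding `toRPCC`. -/
theorem map_toRPCCPreimage {ρ σ : RPC} (j : toRPCC.obj ρ ⟶ toRPCC.obj σ) :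
    toRPCC.map (toRPCCPreimage j) = j := by
  have h1 := (repBy_id σ).precomp (toRPCCPreimage j)
  rw [Category.comp_id] at h1
  refine h1.unique ⟨σ.faceι (topIdx j) ≫ σ.toTop, ?_, ?_⟩
  · change (_ ≫ _) ≫ _ = _
    rw [Category.assoc, toTop_faceι, Category.comp_id]
  · exact (Category.assoc (W := ρ) (X := σ.ofFace (topIdx j)) _ _ _).symm

/-- Faithfulness: the representative of a morphism in the improper face is unique, and `toTop` is an
isomorphism. -/
theorem toRPCC_injective {ρ σ : RPC} {m m' : ρ ⟶ σ} (h : toRPCC.map m = toRPCC.map m') :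
    m = m' := by
  have h1 := (repBy_id σ).precomp m
  have h2 := (repBy_id σ).precomp m'
  rw [← h] at h2
  exact (cancel_mono σ.toTop).1 (h1.hom_unique h2)

/-! ### Complexes of sections -/

/-- A collection of sections of the cones of a complex by sublattices which is compatible with face
morphisms. -/
structure SectionData (S : RPCC) where
  -- The discrete choices over a cone. The linear conditions imposed by a choice define the
  -- sublattice `K`, and `R` says that the first choice is the restriction of the second to a face.
  I : S.Idx → Type
  K : ∀ {α}, I α → Submodule ℤ (S.cone α).N
  R : ∀ {γ α} {φ : S.cone γ ⟶ S.cone α}, φ ∈ S.mor γ α → I γ → I α → Prop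
  R_id : ∀ {α} (i : I α), R (S.id_mem α) i i
  R_comp : ∀ {α β γ} {φ : S.cone α ⟶ S.cone β} {ψ : S.cone β ⟶ S.cone γ} {hφ : φ ∈ S.mor α β}
    {hψ : ψ ∈ S.mor β γ} {i j k}, R hφ i j → R hψ j k → R (S.comp_mem hφ hψ) i k
  R_unique : ∀ {γ α} {φ : S.cone γ ⟶ S.cone α} {hφ : φ ∈ S.mor γ α} {i i' j}, R hφ i j →
    R hφ i' j → i = i'
  mem_K_iff : ∀ {γ α} {φ : S.cone γ ⟶ S.cone α} {hφ : φ ∈ S.mor γ α} {i j}, R hφ i j →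
    ∀ n, n ∈ K i ↔ φ.lin n ∈ K j
  -- A choice has to restrict to a face only if the linear conditions can be satisfied in the
  -- interior of that face.
  exists_R : ∀ {γ α} {φ : S.cone γ ⟶ S.cone α} (hφ : φ ∈ S.mor γ α) (j : I α),
    (S.cone γ).MeetsInterior ((K j).comap φ.lin) → ∃ i, R hφ i j

namespace SectionData

variable {S : RPCC} (D : SectionData S)

/-- The cone complex of all sections. -/
def complex : RPCC where
  Idx := Σ α, {i : D.I α // (S.cone α).MeetsInterior (D.K i)}
  cone p := (S.cone p.1).ofSublattice (D.K p.2.1) p.2.2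
  mor p q := {ψ | ∃ φ, ∃ hφ : φ ∈ S.mor p.1 q.1, D.R hφ p.2.1 q.2.1 ∧
    ψ ≫ sublatticeι q.2.2 = sublatticeι p.2.2 ≫ φ}
  isFaceMorphism := by
    rintro p q ψ ⟨φ, hφ, hR, h⟩
    exact isFaceMorphism_ofSublattice (S.isFaceMorphism hφ) _ _ (D.mem_K_iff hR) h
  id_mem p := ⟨_, S.id_mem _, D.R_id _, by rw [Category.id_comp, Category.comp_id]⟩
  comp_mem := by
    rintro p q r ψ ψ' ⟨φ, hφ, hR, h⟩ ⟨φ', hφ', hR', h'⟩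
    refine ⟨_, S.comp_mem hφ hφ', D.R_comp hR hR', ?_⟩
    rw [Category.assoc, h', ← Category.assoc, h, Category.assoc]
  mor_subsingleton := by
    rintro p q ψ ⟨φ, hφ, hR, h⟩ ψ' ⟨φ', hφ', hR', h'⟩
    apply sublatticeι_cancel
    rw [h, h', S.mor_subsingleton _ _ hφ hφ']
  face_unique := by
    rintro ⟨α, i, hi⟩ F hF
    let τ := (S.cone α).ofSublattice (D.K i) hi
    let F' : τ.Face := ⟨F, hF⟩
    let e : τ.ofFace F' ⟶ S.cone α := τ.faceι F' ≫ sublatticeι hi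
    -- a face morphism whose image is the given face
    have key : ∀ {γ} {φ : S.cone γ ⟶ S.cone α} {k : D.I γ} {hk : (S.cone γ).MeetsInterior (D.K k)}
        (hφ : φ ∈ S.mor γ α) (ψ : (S.cone γ).ofSublattice (D.K k) hk ⟶ τ),
        ψ ≫ sublatticeι hi = sublatticeι hk ≫ φ → IsFaceMorphism ψ →
        (PointedCone.map (real ψ) ((S.cone γ).ofSublattice (D.K k) hk).cone = F →
          ∃ g : τ.ofFace F' ⟶ S.cone γ, Interior g ∧ g ≫ φ = e) := by
      intro γ φ k hk hφ ψ hψ hfm hF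
      obtain ⟨l, hl⟩ := hfm.exists_lift (τ.faceι F') fun x hx => by
        rw [hF]; exact faceι_mem τ F' hx
      have : IsIso l := by
        obtain ⟨l', hl'⟩ := (isFaceMorphism_faceι τ F').exists_lift ψ fun x hx => by
          rw [map_faceι]
          change _ ∈ F
          rw [← hF]
          exact PointedCone.mem_map.2 ⟨x, hx, rfl⟩
        refine ⟨l', comp_faceι_inj F' ?_, hfm.cancel ?_⟩
        · rw [Category.assoc, hl', hl, Category.id_comp]
        · rw [Category.assoc, hl, hl', Category.id_comp]
      refine ⟨l ≫ sublatticeι hk, (Interior.of_isIso l).comp (interior_sublatticeι hk), ?_⟩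
      rw [Category.assoc, ← hψ, ← Category.assoc, hl]
    -- There is a unique face `γ` of the cone `α` in whose interior the face `F` of the section
    -- lies. The claim is that `F` is the whole section of `γ` given by the restriction `k` of `i`.
    obtain ⟨γ, φ, hφ, g, hg, hge⟩ := exists_factor e
    have hgK : ∀ n, g.lin n ∈ (D.K i).comap φ.lin := fun n => by
      have := congrArg (fun k : τ.ofFace F' ⟶ S.cone α => k.lin n) hge
      change φ.lin (g.lin n) ∈ D.K i
      have h2 : φ.lin (g.lin n) = _ := this
      rw [h2]
      exact ((τ.faceι F').lin n).2
    obtain ⟨k, hk⟩ := D.exists_R hφ i (MeetsInterior.of_interior hg hgK)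
    have hKk := D.mem_K_iff hk
    have hgk : ∀ n, g.lin n ∈ D.K k := fun n => (hKk _).2 (hgK n)
    have hmk : (S.cone γ).MeetsInterior (D.K k) := MeetsInterior.of_interior hg hgk
    let ψ : (S.cone γ).ofSublattice (D.K k) hmk ⟶ τ :=
      sublatticeLift hi (sublatticeι hmk ≫ φ) fun n => (hKk _).1 n.2
    have hψ : ψ ≫ sublatticeι hi = sublatticeι hmk ≫ φ := rfl
    have hfm : IsFaceMorphism ψ := isFaceMorphism_ofSublattice (S.isFaceMorphism hφ) _ _ hKk hψ
    let l : τ.ofFace F' ⟶ (S.cone γ).ofSublattice (D.K k) hmk := sublatticeLift hmk g hgk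
    have hl : l ≫ ψ = τ.faceι F' := by
      apply sublatticeι_cancel hi
      rw [Category.assoc, hψ, ← Category.assoc, sublatticeLift_ι, hge]
    have hlint : Interior (l ≫ sublatticeι hmk) := hg
    -- The part of the section of `γ` that `ψ` maps into `F` is a face which lies in no proper face
    -- of `γ`, so it is the whole section.
    have hpre : ((S.cone γ).ofSublattice (D.K k) hmk).cone ⊓ F.comap (real ψ) =
        ((S.cone γ).ofSublattice (D.K k) hmk).cone := by
      refine face_ofSublattice_eq hmk (isFaceOf_preimage ψ hF) fun G hG h => hlint G hG ?_
      intro x hx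
      rw [real_comp_apply]
      refine h _ ⟨real_mem l hx, ?_⟩
      change real ψ (real l x) ∈ F
      rw [← real_comp_apply, hl]
      exact faceι_mem τ F' hx
    have hmap : PointedCone.map (real ψ) ((S.cone γ).ofSublattice (D.K k) hmk).cone = F := by
      apply le_antisymm
      · intro x hx
        rw [PointedCone.mem_map] at hx
        obtain ⟨y, hy, rfl⟩ := hx
        rw [← hpre] at hy
        exact hy.2
      · intro x hx
        have hx' : x ∈ F'.1 := hx
        rw [← map_faceι τ F', PointedCone.mem_map] at hx'
        obtain ⟨y, hy, rfl⟩ := hx'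
        rw [← hl]
        exact comp_mem_map _ _ hy
    refine ⟨⟨⟨γ, k, hmk⟩, ψ⟩, ⟨⟨φ, hφ, hk, hψ⟩, hmap⟩, ?_⟩
    rintro ⟨⟨γ', k', hk'⟩, ψ'⟩ ⟨⟨φ', hφ', hR', hψ'⟩, hF'⟩
    -- Any other candidate also yields an interior factorization of `e`, so it lives over the same
    -- `γ`; then `R_unique` identifies the choices.
    obtain ⟨g', hg', hge'⟩ := key hφ' ψ' hψ'
      (isFaceMorphism_ofSublattice (S.isFaceMorphism hφ') _ _ (D.mem_K_iff hR') hψ') hF'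
    have := factor_unique hg' hg hφ' hφ (hge'.trans hge.symm)
    have hγ : γ' = γ := congrArg Sigma.fst this
    clear this hge' hg' key
    clear_value l ψ
    subst hγ
    obtain rfl : φ' = φ := S.mor_subsingleton _ _ hφ' hφ
    obtain rfl : k' = k := D.R_unique hR' hk
    obtain rfl : ψ' = ψ := sublatticeι_cancel hi (hψ'.trans hψ.symm)
    rfl

/-- The projection of the complex of sections. -/
def proj : D.complex ⟶ S where
  idx p := p.1
  hom p := sublatticeι p.2.2
  interior p := interior_sublatticeι p.2.2
  exists_mor := by
    rintro p q ψ ⟨φ, hφ, -, h⟩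
    exact ⟨φ, hφ, h⟩

theorem strict_proj (h : ∀ {α} (i : D.I α), D.K i = ⊤) : strict D.proj :=
  fun p => isIso_sublatticeι_top p.2.2 (h p.2.1)

/-- The projection is injective on lattices, so only the indices remain to be compared. -/
theorem proj_ext {T : RPCC} {f f' : T ⟶ D.complex} (h : f ≫ D.proj = f' ≫ D.proj)
    (h' : ∀ β, f.idx β = f'.idx β) : f = f' := by
  obtain ⟨fi, fh, _, _⟩ := f
  obtain ⟨gi, gh, _, _⟩ := f'
  obtain rfl : fi = gi := funext h'
  obtain rfl : fh = gh := by
    funext β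
    apply sublatticeι_cancel
    have := congrArg (fun k : T ⟶ S => (⟨k.idx, k.hom⟩ : Σ i : T.Idx → S.Idx,
      ∀ β, T.cone β ⟶ S.cone (i β))) h
    exact congrFun (eq_of_heq (Sigma.mk.inj this).2) β
  rfl

variable {D}

/-- The universal property of the complex of sections. -/
def lift {T : RPCC} (f : T ⟶ S) (i : ∀ β, D.I (f.idx β))
    (hi : ∀ β n, (f.hom β).lin n ∈ D.K (i β))
    (hR : ∀ {β β'} (φ : T.cone β ⟶ T.cone β'), φ ∈ T.mor β β' →
      ∀ (ψ : S.cone (f.idx β) ⟶ S.cone (f.idx β')) (hψ : ψ ∈ S.mor (f.idx β) (f.idx β')),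
        φ ≫ f.hom β' = f.hom β ≫ ψ → D.R hψ (i β) (i β')) : T ⟶ D.complex where
  idx β := ⟨f.idx β, i β, MeetsInterior.of_interior (f.interior β) (hi β)⟩
  hom β := sublatticeLift (MeetsInterior.of_interior (f.interior β) (hi β)) (f.hom β) (hi β)
  interior β := by
    have hm := MeetsInterior.of_interior (f.interior β) (hi β)
    intro F hF h
    -- Interiority in the section is tested against faces of the ambient cone, where `f` is interior
    -- by assumption.
    refine face_ofSublattice_eq hm hF fun G hG hG' => f.interior β G hG fun x hx => ?_
    have := hG' _ (h x hx)
    have h2 := real_comp_apply (sublatticeLift hm (f.hom β) (hi β)) (sublatticeι hm) x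
    rw [sublatticeLift_ι] at h2
    rw [h2]
    exact this
  exists_mor {β β'} φ hφ := by
    have hm := MeetsInterior.of_interior (f.interior β) (hi β)
    have hm' := MeetsInterior.of_interior (f.interior β') (hi β')
    obtain ⟨ψ, hψ, h⟩ := f.exists_mor φ hφ
    have hR' := hR φ hφ ψ hψ h
    refine ⟨sublatticeLift hm' (sublatticeι hm ≫ ψ) fun n => (D.mem_K_iff hR' _).1 n.2,
      ⟨ψ, hψ, hR', rfl⟩, ?_⟩
    apply sublatticeι_cancel hm'
    exact h

end SectionData

end RPCC

end Trop

end

/-! ### Graph morphisms, their factorization, and contraction of edges -/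

noncomputable section

namespace Trop

namespace WeightedGraph

variable {G : WeightedGraph}

theorem joined_symm {S : Set G.X} (hi : ∀ x ∈ S, G.inv x ∈ S) {v w : G.Vertices S}
    (h : G.Joined S v w) : G.Joined S w v := by
  obtain ⟨f, hf, h1, h2⟩ := h
  exact ⟨G.inv f, hi f hf, h2, by rwa [G.inv_inv]⟩

/-- The first Betti number of a connected subgraph is non-negative. -/
theorem bettiOn_nonneg {S : Set G.X} (hS : G.ConnectedOn S) (hi : ∀ x ∈ S, G.inv x ∈ S) :
    0 ≤ G.bettiOn S := by
  classical
  -- Forgetting loops and multiplicities keeps the graph connected, so the simple graph has at least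
  -- one edge less than vertices. Its edges inject into those of `S`, since an edge of `S`
  -- determines its pair of end points.
  let Γ : SimpleGraph (G.Vertices S) := SimpleGraph.fromRel (G.Joined S)
  have hconn : Γ.Connected := by
    have : Nonempty (G.Vertices S) := hS.1
    refine ⟨fun v w => ?_⟩
    induction hS.2 v w with
    | refl => exact SimpleGraph.Reachable.refl _
    | @tail b c _ hbc ih =>
      by_cases h : b = c
      · exact h ▸ ih
      · exact ih.trans (SimpleGraph.Adj.reachable ((SimpleGraph.fromRel_adj _ _ _).2
          ⟨h, Or.inl hbc⟩))
  have h1 := hconn.card_vert_le_card_edgeSet_add_one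
  have hex : ∀ e : Γ.edgeSet, ∃ e' ∈ {e ∈ G.edgeSet | ∀ f ∈ e, f ∈ S},
      Sym2.map G.r e' = Sym2.map (fun v : G.Vertices S => v.1.1) e.1 := by
    rintro ⟨e, he⟩
    induction e using Sym2.ind with | _ v w =>
    rw [SimpleGraph.mem_edgeSet, SimpleGraph.fromRel_adj] at he
    have key : ∀ v w : G.Vertices S, v ≠ w → G.Joined S v w →
        ∃ e' ∈ {e ∈ G.edgeSet | ∀ f ∈ e, f ∈ S},
          Sym2.map G.r e' = Sym2.map (fun v : G.Vertices S => v.1.1) s(v, w) := by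
      rintro v w hvw ⟨f, hf, h1, h2⟩
      refine ⟨s(f, G.inv f), ⟨⟨f, fun h => hvw ?_, rfl⟩, fun x hx => ?_⟩, ?_⟩
      · rw [h, h1] at h2
        exact Subtype.ext (Subtype.ext h2)
      · rcases Sym2.mem_iff.1 hx with rfl | rfl
        · exact hf
        · exact hi _ hf
      · rw [Sym2.map_mk, Sym2.map_mk, h1, h2]
    rcases he.2 with h | h
    · exact key v w he.1 h
    · obtain ⟨e', he', h'⟩ := key w v he.1.symm h
      exact ⟨e', he', by rw [h', Sym2.eq_swap]⟩
  choose F hF hFr using hex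
  have h2 : Nat.card Γ.edgeSet ≤ {e ∈ G.edgeSet | ∀ f ∈ e, f ∈ S}.ncard := by
    rw [← Nat.card_coe_set_eq]
    have : Finite {e ∈ G.edgeSet | ∀ f ∈ e, f ∈ S} := Set.toFinite _
    refine Nat.card_le_card_of_injective (fun e => ⟨F e, hF e⟩) fun e e' h => Subtype.ext ?_
    have h3 : F e = F e' := congrArg Subtype.val h
    have h4 := hFr e
    rw [h3, hFr e'] at h4
    exact (Sym2.map.injective fun a b h => Subtype.ext (Subtype.ext h)) h4.symm
  rw [bettiOn, card_quot_joined hS]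
  have h3 : (Nat.card (G.Vertices S) : ℤ) ≤ Nat.card Γ.edgeSet + 1 := by exact_mod_cast h1
  have h4 : (Nat.card Γ.edgeSet : ℤ) ≤ ({e ∈ G.edgeSet | ∀ f ∈ e, f ∈ S}.ncard : ℤ) := by
    exact_mod_cast h2
  push_cast
  linarith

theorem genusOn_nonneg {S : Set G.X} (hS : G.ConnectedOn S) (hi : ∀ x ∈ S, G.inv x ∈ S) :
    0 ≤ G.genusOn S :=
  add_nonneg (bettiOn_nonneg hS hi) (finsum_nonneg fun _ => Int.natCast_nonneg _)

theorem inv_not_isVertex {x : G.X} (hx : ¬ G.IsVertex x) : ¬ G.IsVertex (G.inv x) := fun h => by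
  have := inv_vertex h
  rw [G.inv_inv] at this
  exact hx (this ▸ h)

theorem inv_inv_ne {x : G.X} (hx : G.inv x ≠ x) : G.inv (G.inv x) ≠ G.inv x := by
  rw [G.inv_inv]; exact hx.symm

theorem not_isVertex_of_inv_ne {x : G.X} (hx : G.inv x ≠ x) : ¬ G.IsVertex x :=
  fun h => hx (inv_vertex h)

end WeightedGraph

namespace MarkedGraph

variable {n : ℕ}

namespace Hom

variable {G H K : MarkedGraph n}

theorem surjective (π : Hom G H) : Function.Surjective π.toFun := by
  intro y
  by_cases hy : H.IsVertex y
  · obtain ⟨⟨v⟩, -⟩ := π.connected y hy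
    exact ⟨v.1.1, v.2⟩
  · exact (π.existsUnique_flag y hy).exists

/-- A flag that is mapped to a vertex belongs to a contracted edge. -/
theorem isVertex_iff_of_inv_eq (π : Hom G H) {x : G.X} (hx : G.inv x = x) :
    H.IsVertex (π.toFun x) ↔ G.IsVertex x := by
  refine ⟨fun h => ?_, π.isVertex_map⟩
  by_contra hv
  obtain ⟨i, hi⟩ := G.mark.surjective ⟨x, hv, hx⟩
  have := π.map_mark i
  rw [hi] at this
  exact (H.mark i).2.1 (this ▸ h)

/-- The image of a connected subgraph is connected. -/
theorem connectedOn_of_preimage (π : Hom G H) {S : Set H.X} (h : G.ConnectedOn (π.toFun ⁻¹' S)) :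
    H.ConnectedOn S := by
  let F : G.Vertices (π.toFun ⁻¹' S) → H.Vertices S :=
    fun v => ⟨⟨π.toFun v.1.1, π.isVertex_map v.1.2⟩, v.2⟩
  have hF : Function.Surjective F := by
    intro w
    obtain ⟨⟨v⟩, -⟩ := π.connected w.1.1 w.1.2
    have hv : π.toFun v.1.1 = w.1.1 := v.2
    refine ⟨⟨v.1, ?_⟩, Subtype.ext (Subtype.ext hv)⟩
    rw [Set.mem_preimage, hv]
    exact w.2
  refine ⟨h.1.map F, fun a b => ?_⟩
  obtain ⟨a, rfl⟩ := hF a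
  obtain ⟨b, rfl⟩ := hF b
  refine Relation.ReflTransGen.lift F ?_ _ _ (h.2 a b)
  rintro v w ⟨f, hf, h1, h2⟩
  refine ⟨π.toFun f, hf, ?_, ?_⟩
  · rw [← π.map_r, h1]
  · rw [← π.map_inv, ← π.map_r, h2]

/-- The fiber of `π` over a flag is a point. The fiber over a vertex is connected by flags that `π`,
and hence `ψ`, sends to vertices, so `ψ` does not change along a path in the fiber. -/
theorem eq_of_map_eq (π : Hom G H) (ψ : Hom G K)
    (h : ∀ x, H.IsVertex (π.toFun x) → K.IsVertex (ψ.toFun x)) {x y : G.X}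
    (hxy : π.toFun x = π.toFun y) : ψ.toFun x = ψ.toFun y := by
  by_cases hv : H.IsVertex (π.toFun x)
  · have hr : ∀ z, H.IsVertex (π.toFun z) → ψ.toFun z = ψ.toFun (G.r z) := fun z hz => by
      rw [ψ.map_r]; exact (h z hz).symm
    rw [hr x hv, hr y (hxy ▸ hv)]
    have hrr : ∀ z, H.IsVertex (π.toFun z) → π.toFun (G.r z) = π.toFun z := fun z hz => by
      rw [π.map_r]; exact hz
    have := (π.connected _ hv).2 ⟨⟨G.r x, G.r_r x⟩, hrr x hv⟩
      ⟨⟨G.r y, G.r_r y⟩, (hrr y (hxy ▸ hv)).trans hxy.symm⟩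
    suffices H : ∀ a b : G.Vertices (π.toFun ⁻¹' {π.toFun x}),
        Relation.ReflTransGen (G.Joined _) a b → ψ.toFun a.1.1 = ψ.toFun b.1.1 from H _ _ this
    intro a b hab
    induction hab with
    | refl => rfl
    | @tail b c _ hbc ih =>
      obtain ⟨f, hf, h1, h2⟩ := hbc
      have hfv : H.IsVertex (π.toFun f) := by
        have : π.toFun f = π.toFun x := hf
        rwa [this]
      have hψ := h f hfv
      rw [ih, ← h1, ← h2, ψ.map_r, ψ.map_r, ψ.map_inv, WeightedGraph.inv_vertex hψ]
  · rw [(π.existsUnique_flag _ hv).unique rfl hxy.symm]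

/-- A morphism that contracts all edges that are contracted by `π` factors through `π`. -/
theorem exists_factor (π : Hom G H) (ψ : Hom G K)
    (h : ∀ x, H.IsVertex (π.toFun x) → K.IsVertex (ψ.toFun x)) : ∃ ρ : Hom H K, π.comp ρ = ψ := by
  let ρ : H.X → K.X := fun y => ψ.toFun (π.surjective y).choose
  have hρ : ∀ x, ρ (π.toFun x) = ψ.toFun x := fun x =>
    eq_of_map_eq π ψ h (π.surjective (π.toFun x)).choose_spec
  have hpre : ∀ v, π.toFun ⁻¹' (ρ ⁻¹' {v}) = ψ.toFun ⁻¹' {v} := fun v => by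
    ext x
    simp only [Set.mem_preimage, hρ]
  have hr : ∀ y, ρ (H.r y) = K.r (ρ y) := fun y => by
    obtain ⟨x, rfl⟩ := π.surjective y
    rw [← π.map_r, hρ, hρ, ψ.map_r]
  have hi : ∀ y, ρ (H.inv y) = K.inv (ρ y) := fun y => by
    obtain ⟨x, rfl⟩ := π.surjective y
    rw [← π.map_inv, hρ, hρ, ψ.map_inv]
  have hconn : ∀ v, K.IsVertex v → H.ConnectedOn (ρ ⁻¹' {v}) := fun v hv =>
    π.connectedOn_of_preimage (by rw [hpre]; exact ψ.connected v hv)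
  refine ⟨⟨ρ, hr, hi, fun i => ?_, fun f hf => ?_, hconn, fun v => ?_⟩, Hom.ext (funext hρ)⟩
  · rw [← π.map_mark, hρ, ψ.map_mark]
  · obtain ⟨x, hx, hux⟩ := ψ.existsUnique_flag f hf
    refine ⟨π.toFun x, (hρ x).trans hx, fun y hy => ?_⟩
    obtain ⟨z, rfl⟩ := π.surjective y
    rw [hux z ((hρ z).symm.trans hy)]
  -- The genus of the fiber of `ρ` equals that of its preimage under `π`, which is the fiber of `ψ`.
  · rw [← π.genusOn_preimage (S := ρ ⁻¹' {v.1}), hpre]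
    · exact ψ.genus_eq v
    · intro x hx
      rw [Set.mem_preimage, Set.mem_singleton_iff] at hx ⊢
      rw [hr, hx]; exact v.2
    · intro x hx
      rw [Set.mem_preimage, Set.mem_singleton_iff] at hx ⊢
      rw [hi, hx, WeightedGraph.inv_vertex v.2]
    · exact hconn v.1 v.2

/-- The image of a stable graph is stable. -/
theorem stable (π : Hom G H) (hG : G.Stable) : H.Stable := by
  classical
  have : Fintype G.X := Fintype.ofFinite _
  have : Fintype H.X := Fintype.ofFinite _
  intro v
  obtain ⟨⟨u₀⟩, -⟩ := π.connected v.1 v.2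
  -- The stability inequalities are summed over the vertices `A` in the fiber of `v`. The flags `B`
  -- at these vertices are either contracted to `v` (`B₁`) or mapped bijectively to the flags at `v`
  -- (`B₂`).
  let s : G.X → ℤ := fun x => if hx : G.r x = x then 2 * (G.h ⟨x, hx⟩ : ℤ) - 2 else 0
  let A := Finset.univ.filter fun x : G.X => G.r x = x ∧ π.toFun x = v.1
  let B := Finset.univ.filter fun x : G.X => ¬ G.IsVertex x ∧ π.toFun (G.r x) = v.1
  have hval : ∀ u : G.X, G.valence u =
      (Finset.univ.filter fun x : G.X => ¬ G.IsVertex x ∧ G.r x = u).card := fun u => by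
    rw [WeightedGraph.valence, ← Set.ncard_coe_finset]; simp
  have h1 : 0 < ∑ u ∈ A, (s u + G.valence u) := by
    refine Finset.sum_pos (fun u hu => ?_) ⟨u₀.1.1, by simpa [A] using ⟨u₀.1.2, u₀.2⟩⟩
    have hu' : G.r u = u := (Finset.mem_filter.1 hu).2.1
    have := hG ⟨u, hu'⟩
    simpa [s, hu'] using this
  have h2 : (B.card : ℤ) = ∑ u ∈ A, (G.valence u : ℤ) := by
    rw [Finset.card_eq_sum_card_fiberwise (f := G.r) (t := A), Nat.cast_sum]
    · refine Finset.sum_congr rfl fun u hu => ?_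
      rw [hval]
      congr 2
      ext x
      simp only [B, Finset.mem_filter, Finset.mem_univ, true_and]
      constructor
      · rintro ⟨⟨h1, -⟩, h2⟩
        exact ⟨h1, h2⟩
      · rintro ⟨h1, rfl⟩
        exact ⟨⟨h1, (Finset.mem_filter.1 hu).2.2⟩, rfl⟩
    · intro x hx
      have hx' := (Finset.mem_filter.1 hx).2
      exact Finset.mem_coe.2 (Finset.mem_filter.2 ⟨Finset.mem_univ _, G.r_r x, hx'.2⟩)
  let B₁ := Finset.univ.filter fun x : G.X => ¬ G.IsVertex x ∧ π.toFun x = v.1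
  let B₂ := Finset.univ.filter fun x : G.X => ¬ H.IsVertex (π.toFun x) ∧ H.r (π.toFun x) = v.1
  have h3 : B.card = B₁.card + B₂.card := by
    rw [← Finset.card_union_of_disjoint]
    · congr 1
      ext x
      simp only [B, B₁, B₂, Finset.mem_union, Finset.mem_filter, Finset.mem_univ, true_and]
      rw [π.map_r]
      constructor
      · rintro ⟨h1, h2⟩
        by_cases h : H.IsVertex (π.toFun x)
        · exact Or.inl ⟨h1, by rwa [show H.r (π.toFun x) = π.toFun x from h] at h2⟩
        · exact Or.inr ⟨h, h2⟩
      · rintro (⟨h1, h2⟩ | ⟨h1, h2⟩)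
        · exact ⟨h1, by rw [h2]; exact v.2⟩
        · exact ⟨π.not_isVertex_of_map h1, h2⟩
    · rw [Finset.disjoint_left]
      intro x hx hx'
      have e1 := (Finset.mem_filter.1 hx).2
      have e2 := (Finset.mem_filter.1 hx').2
      exact e2.1 (by rw [e1.2]; exact v.2)
  have h4 : B₂.card = H.valence v.1 := by
    have : H.valence v.1 =
        (Finset.univ.filter fun x : H.X => ¬ H.IsVertex x ∧ H.r x = v.1).card := by
      rw [WeightedGraph.valence, ← Set.ncard_coe_finset]; simp
    rw [this]
    refine Finset.card_bij (fun x _ => π.toFun x) (fun x hx => by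
      simpa [B₂] using hx) (fun x hx y hy hxy => ?_) (fun y hy => ?_)
    · exact (π.existsUnique_flag _ (Finset.mem_filter.1 hx).2.1).unique rfl hxy.symm
    · have hy' := (Finset.mem_filter.1 hy).2
      obtain ⟨x, rfl⟩ := π.surjective y
      exact ⟨x, Finset.mem_filter.2 ⟨Finset.mem_univ _, hy'⟩, rfl⟩
  -- The genus condition for the fiber: a vertex contributes `2h - 2`, and each contracted flag
  -- contributes one because it is half an edge. Legs do not occur among the contracted flags.
  have h5 : ∑ u ∈ A, s u + B₁.card = 2 * (H.h v : ℤ) - 2 := by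
    have h6 := π.sum_contribution v.1
    have h7 : H.contribution v.1 = 2 * (H.h v : ℤ) - 2 := dif_pos v.2
    rw [h7] at h6
    rw [← h6, finsum_eq_sum_of_fintype,
      ← Finset.sum_subtype (Finset.univ.filter fun x : G.X => π.toFun x = v.1)
        (f := G.contribution) (fun x => by simp)]
    have h8 : ∑ u ∈ A, s u = ∑ x ∈ Finset.univ.filter (fun x : G.X => π.toFun x = v.1), s x := by
      refine Finset.sum_subset (fun x hx => ?_) (fun x hx hx' => ?_)
      · exact Finset.mem_filter.2 ⟨Finset.mem_univ _, (Finset.mem_filter.1 hx).2.2⟩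
      · have h9 : ¬ G.r x = x := fun h => hx' (Finset.mem_filter.2 ⟨Finset.mem_univ _, h,
          (Finset.mem_filter.1 hx).2⟩)
        simp [s, h9]
    have h9 : (B₁.card : ℤ) = ∑ x ∈ Finset.univ.filter (fun x : G.X => π.toFun x = v.1),
        if G.r x = x then (0 : ℤ) else 1 := by
      rw [Finset.sum_ite, Finset.sum_const_zero, zero_add, Finset.sum_const, nsmul_eq_mul, mul_one,
        Finset.filter_filter]
      congr 2
      ext x
      simp only [B₁, Finset.mem_filter, Finset.mem_univ, true_and]
      exact and_comm
    rw [h8, h9, ← Finset.sum_add_distrib]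
    refine Finset.sum_congr rfl fun x hx => ?_
    have hxv : π.toFun x = v.1 := (Finset.mem_filter.1 hx).2
    unfold WeightedGraph.contribution
    by_cases hr : G.r x = x
    · simp [s, hr]
    · have : G.inv x ≠ x := fun h => hr ((π.isVertex_iff_of_inv_eq h).1 (by rw [hxv]; exact v.2))
      simp [s, hr, this]
  rw [Finset.sum_add_distrib, ← h2, h3] at h1
  push_cast at h1
  rw [← h4]
  linarith

end Hom

/-! ### Contraction of edges -/

section Contraction

variable (G : MarkedGraph n) (A : Set G.X)

/-- Two vertices are related if they are joined by a flag of `A`. -/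
def ContractRel (v w : {v : G.X // G.r v = v}) : Prop :=
  ∃ f ∈ A, G.r f = v.1 ∧ G.r (G.inv f) = w.1

/-- The vertices and flags of the contracted graph. -/
abbrev ContractX : Type := Quot (G.ContractRel A) ⊕ {x : G.X // ¬ G.IsVertex x ∧ x ∉ A}

open Classical in
/-- The contraction map. -/
def contractMap (x : G.X) : G.ContractX A :=
  if h : ¬ G.IsVertex x ∧ x ∉ A then Sum.inr ⟨x, h⟩ else Sum.inl (Quot.mk _ ⟨G.r x, G.r_r x⟩)

variable {G A}

theorem contractMap_of {x : G.X} (h : ¬ G.IsVertex x ∧ x ∉ A) :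
    G.contractMap A x = Sum.inr ⟨x, h⟩ := dif_pos h

theorem contractMap_of_not {x : G.X} (h : ¬ (¬ G.IsVertex x ∧ x ∉ A)) :
    G.contractMap A x = Sum.inl (Quot.mk _ ⟨G.r x, G.r_r x⟩) := dif_neg h

theorem contractMap_vertex (v : {v : G.X // G.r v = v}) :
    G.contractMap A v.1 = Sum.inl (Quot.mk _ v) := by
  rw [contractMap_of_not fun h => h.1 v.2]
  congr 2
  exact Subtype.ext v.2

theorem inv_mem_iff (hA : ∀ x ∈ A, G.inv x ∈ A) (x : G.X) : G.inv x ∈ A ↔ x ∈ A :=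
  ⟨fun h => by simpa [G.inv_inv] using hA _ h, hA x⟩

/-- The underlying root map of the contracted graph. -/
def contractR : G.ContractX A → G.ContractX A
  | Sum.inl q => Sum.inl q
  | Sum.inr x => Sum.inl (Quot.mk _ ⟨G.r x.1, G.r_r x.1⟩)

/-- The underlying involution of the contracted graph. -/
def contractInv (hA : ∀ x ∈ A, G.inv x ∈ A) : G.ContractX A → G.ContractX A
  | Sum.inl q => Sum.inl q
  | Sum.inr x => Sum.inr ⟨G.inv x.1, WeightedGraph.inv_not_isVertex x.2.1,
      fun h => x.2.2 ((inv_mem_iff hA _).1 h)⟩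

theorem contractMap_r (x : G.X) : G.contractMap A (G.r x) = contractR (G.contractMap A x) := by
  by_cases h : ¬ G.IsVertex x ∧ x ∉ A
  · rw [contractMap_of h]
    exact contractMap_vertex ⟨G.r x, G.r_r x⟩
  · rw [contractMap_of_not h]
    exact contractMap_vertex ⟨G.r x, G.r_r x⟩

theorem contractMap_inv (hA : ∀ x ∈ A, G.inv x ∈ A) (x : G.X) :
    G.contractMap A (G.inv x) = contractInv hA (G.contractMap A x) := by
  by_cases h : ¬ G.IsVertex x ∧ x ∉ A
  · rw [contractMap_of h]
    exact contractMap_of ⟨WeightedGraph.inv_not_isVertex h.1,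
      fun h' => h.2 ((inv_mem_iff hA _).1 h')⟩
  · rw [contractMap_of_not h]
    by_cases hv : G.IsVertex x
    · rw [WeightedGraph.inv_vertex hv, contractMap_of_not h]
      rfl
    · have hx : x ∈ A := by_contra fun h' => h ⟨hv, h'⟩
      rw [contractMap_of_not fun h' => h'.2 (hA x hx)]
      refine congrArg Sum.inl (Quot.sound ?_).symm
      exact ⟨x, hx, rfl, rfl⟩

theorem contractMap_mark (hA' : ∀ x ∈ A, G.inv x ≠ x) (i : Fin n) :
    ¬ G.IsVertex (G.mark i).1 ∧ (G.mark i).1 ∉ A :=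
  ⟨(G.mark i).2.1, fun h => hA' _ h (G.mark i).2.2⟩

/-- The graph obtained from `G` by contracting the edges whose flags belong to `A`. -/
def contract (hA : ∀ x ∈ A, G.inv x ∈ A) (hA' : ∀ x ∈ A, G.inv x ≠ x) : MarkedGraph n where
  X := G.ContractX A
  r := contractR
  inv := contractInv hA
  r_r x := by rcases x with q | x <;> rfl
  inv_inv x := by
    rcases x with q | x
    · rfl
    · exact congrArg Sum.inr (Subtype.ext (G.inv_inv x.1))
  inv_r x := by rcases x with q | x <;> rfl
  -- The truncation does no harm: the fibers are connected, so their genus is non-negative.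
  h v := (G.genusOn (G.contractMap A ⁻¹' {v.1})).toNat
  mark := Equiv.ofBijective (fun i => ⟨G.contractMap A (G.mark i), by
      rw [contractMap_of (contractMap_mark hA' i)]
      refine ⟨fun h => Sum.inl_ne_inr h, congrArg Sum.inr (Subtype.ext (G.mark i).2.2)⟩⟩) (by
    constructor
    · intro i j h
      have h1 := congrArg Subtype.val h
      simp only [contractMap_of (contractMap_mark hA' _)] at h1
      have h2 := Sum.inr.inj h1
      have h3 : (G.mark i).1 = (G.mark j).1 := Subtype.mk.inj h2
      exact G.mark.injective (Subtype.ext h3)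
    · rintro ⟨q | x, hx, hx'⟩
      · exact absurd rfl hx
      · have hleg : x.1 ∈ G.legSet := ⟨x.2.1, congrArg Subtype.val (Sum.inr.inj hx')⟩
        refine ⟨G.mark.symm ⟨x.1, hleg⟩, Subtype.ext ?_⟩
        simp only [Equiv.apply_symm_apply]
        exact contractMap_of x.2)

/-- Vertices with the same image are linked by a chain of flags of `A`, traversed in either
direction, and all these flags lie in the fiber. -/
theorem connectedOn_contractMap (hA : ∀ x ∈ A, G.inv x ∈ A) (q : Quot (G.ContractRel A)) :
    G.ConnectedOn (G.contractMap A ⁻¹' {Sum.inl q}) := by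
  have hinv : ∀ x ∈ G.contractMap A ⁻¹' {Sum.inl q}, G.inv x ∈ G.contractMap A ⁻¹' {Sum.inl q} := by
    intro x hx
    rw [Set.mem_preimage, Set.mem_singleton_iff] at hx ⊢
    rw [contractMap_inv hA, hx]
    rfl
  constructor
  · obtain ⟨v, rfl⟩ := Quot.exists_rep q
    exact ⟨⟨v, contractMap_vertex v⟩⟩
  · rintro ⟨v, hv⟩ ⟨w, hw⟩
    have hmk : ∀ {v : {v : G.X // G.r v = v}}, v.1 ∈ G.contractMap A ⁻¹' {Sum.inl q} ↔
        Quot.mk _ v = q := by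
      intro v
      rw [Set.mem_preimage, contractMap_vertex, Set.mem_singleton_iff]
      exact ⟨fun h => Sum.inl.inj h, fun h => congrArg Sum.inl h⟩
    have hgen : Relation.EqvGen (G.ContractRel A) v w :=
      Quot.eqvGen_exact ((hmk.1 hv).trans (hmk.1 hw).symm)
    induction hgen with
    | rel v w h =>
      obtain ⟨f, hf, h1, h2⟩ := h
      refine Relation.ReflTransGen.single ⟨f, ?_, h1, h2⟩
      rw [Set.mem_preimage, contractMap_of_not fun h => h.2 hf, ← hmk.1 hv]
      refine congrArg (fun v => Sum.inl (Quot.mk _ v)) (Subtype.ext h1)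
    | refl v => exact .refl
    | symm v w _ ih =>
      have : Std.Symm (G.Joined (G.contractMap A ⁻¹' {Sum.inl q})) :=
        ⟨fun _ _ h => WeightedGraph.joined_symm hinv h⟩
      exact Relation.ReflTransGen.stdSymm.symm _ _ (ih hw hv)
    | trans v u w h1 _ ih1 ih2 =>
      have hu := hmk.2 ((Quot.eqvGen_sound h1).symm.trans (hmk.1 hv))
      exact (ih1 hv hu).trans (ih2 hu hw)

/-- The contraction, as a morphism of graphs. -/
def contractHom (hA : ∀ x ∈ A, G.inv x ∈ A) (hA' : ∀ x ∈ A, G.inv x ≠ x) :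
    Hom G (contract hA hA') where
  toFun := G.contractMap A
  map_r := contractMap_r
  map_inv := contractMap_inv hA
  map_mark _ := rfl
  existsUnique_flag := by
    rintro (q | x) hf
    · exact absurd rfl hf
    · refine ⟨x.1, contractMap_of x.2, fun y hy => ?_⟩
      have hy : G.contractMap A y = Sum.inr x := hy
      by_cases h : ¬ G.IsVertex y ∧ y ∉ A
      · rw [contractMap_of h] at hy
        exact congrArg Subtype.val (Sum.inr.inj hy)
      · rw [contractMap_of_not h] at hy
        exact absurd hy Sum.inl_ne_inr
  connected := by
    rintro (q | x) hv
    · exact connectedOn_contractMap hA q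
    · exact absurd hv Sum.inl_ne_inr
  genus_eq := by
    rintro ⟨q | x, hv⟩
    · refine (Int.toNat_of_nonneg (WeightedGraph.genusOn_nonneg (connectedOn_contractMap hA q)
        fun x hx => ?_)).symm
      rw [Set.mem_preimage, Set.mem_singleton_iff] at hx ⊢
      rw [contractMap_inv hA, hx]
      rfl
    · exact absurd hv Sum.inl_ne_inr

theorem isVertex_contractMap_iff (hA : ∀ x ∈ A, G.inv x ∈ A) (hA' : ∀ x ∈ A, G.inv x ≠ x)
    (x : G.X) :
    (contract hA hA').IsVertex ((contractHom hA hA').toFun x) ↔ G.IsVertex x ∨ x ∈ A := by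
  by_cases h : ¬ G.IsVertex x ∧ x ∉ A
  · have h1 : (contractHom hA hA').toFun x = Sum.inr ⟨x, h⟩ := contractMap_of h
    rw [h1]
    exact ⟨fun h' => absurd h' Sum.inl_ne_inr, fun h' => absurd h' (by tauto)⟩
  · have h1 : (contractHom hA hA').toFun x = Sum.inl (Quot.mk _ ⟨G.r x, G.r_r x⟩) :=
      contractMap_of_not h
    rw [h1]
    exact ⟨fun _ => by tauto, fun _ => rfl⟩

end Contraction

end MarkedGraph

end Trop

end

/-! ### Stable graphs, edge lengths, and pullback of tropical curves -/

noncomputable section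

namespace Trop

variable {g n : ℕ}

namespace StableGraph

/-- The map of vertices and flags underlying a morphism of graphs. -/
def ap {G H : StableGraph g n} (π : G ⟶ H) (x : G.graph.X) : H.graph.X :=
  MarkedGraph.Hom.toFun π x

variable {G H K : StableGraph g n}

@[simp] theorem ap_comp (π : G ⟶ H) (ρ : H ⟶ K) (x : G.graph.X) :
    ap (π ≫ ρ) x = ap ρ (ap π x) := rfl

theorem hom_ext {π ρ : G ⟶ H} (h : ∀ x, ap π x = ap ρ x) : π = ρ :=
  MarkedGraph.Hom.ext (funext h)

theorem ap_surjective (π : G ⟶ H) : Function.Surjective (ap π) :=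
  MarkedGraph.Hom.surjective π

/-- Source of the uniqueness of lifts and of the functoriality of all restriction maps below. -/
instance epi (π : G ⟶ H) : Epi π := ⟨fun ρ ρ' h => hom_ext fun y => by
  obtain ⟨x, rfl⟩ := ap_surjective π y
  rw [← ap_comp, ← ap_comp, h]⟩

theorem ap_inv (π : G ⟶ H) (x : G.graph.X) : ap π (G.graph.inv x) = H.graph.inv (ap π x) :=
  MarkedGraph.Hom.map_inv π x

theorem isVertex_ap (π : G ⟶ H) {x : G.graph.X} (h : G.graph.IsVertex x) :
    H.graph.IsVertex (ap π x) := MarkedGraph.Hom.isVertex_map π h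

theorem isVertex_ap_iff_of_inv_eq (π : G ⟶ H) {x : G.graph.X} (h : G.graph.inv x = x) :
    H.graph.IsVertex (ap π x) ↔ G.graph.IsVertex x :=
  MarkedGraph.Hom.isVertex_iff_of_inv_eq π h

theorem inv_ap_eq_iff (π : G ⟶ H) {x : G.graph.X} (hx : ¬ H.graph.IsVertex (ap π x)) :
    G.graph.inv x = x ↔ H.graph.inv (ap π x) = ap π x :=
  MarkedGraph.Hom.inv_eq_iff π hx

theorem exists_factor (π : G ⟶ H) (ψ : G ⟶ K)
    (h : ∀ x, H.graph.IsVertex (ap π x) → K.graph.IsVertex (ap ψ x)) : ∃ ρ : H ⟶ K, π ≫ ρ = ψ :=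
  MarkedGraph.Hom.exists_factor (G := G.graph) (H := H.graph) (K := K.graph) π ψ h

/-- If `π` contracts nothing, then the identity factors through `π`. The resulting left inverse is
two-sided since `π` is an epimorphism. -/
theorem isIso_of_isVertex (π : G ⟶ H) (h : ∀ x, H.graph.IsVertex (ap π x) → G.graph.IsVertex x) :
    IsIso π := by
  obtain ⟨ρ, hρ⟩ := exists_factor π (𝟙 G) h
  refine ⟨ρ, hρ, ?_⟩
  rw [← cancel_epi π, ← Category.assoc, hρ, Category.id_comp, Category.comp_id]

theorem isVertex_of_isIso (π : G ⟶ H) [IsIso π] {x : G.graph.X} (h : H.graph.IsVertex (ap π x)) :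
    G.graph.IsVertex x := by
  have := isVertex_ap (inv π) h
  rwa [← ap_comp, IsIso.hom_inv_id] at this

/-- The contraction of a stable graph. -/
theorem exists_contraction (G : StableGraph g n) (A : Set G.graph.X)
    (hA : ∀ x ∈ A, G.graph.inv x ∈ A) (hA' : ∀ x ∈ A, G.graph.inv x ≠ x) :
    ∃ (H : StableGraph g n) (π : G ⟶ H),
      ∀ x, H.graph.IsVertex (ap π x) ↔ G.graph.IsVertex x ∨ x ∈ A := by
  let π := MarkedGraph.contractHom hA hA'
  have hconn : (MarkedGraph.contract hA hA').Connected :=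
    π.connectedOn_of_preimage (S := Set.univ) G.connected
  refine ⟨⟨MarkedGraph.contract hA hA', hconn, ?_, π.stable G.stable⟩, π,
    MarkedGraph.isVertex_contractMap_iff hA hA'⟩
  rw [← G.genus_eq]
  exact (π.genusOn_preimage (S := Set.univ) (fun _ _ => trivial) (fun _ _ => trivial) hconn).symm

end StableGraph

open StableGraph

namespace TropCurve

open Classical in
/-- The length of the edge to which a flag belongs (zero for vertices and legs). -/
def len {σ : RPC} (Γ : TropCurve g n σ) (x : Γ.graph.graph.X) : σ.dualMonoid :=
  if h : Γ.graph.graph.inv x ≠ x then Γ.length ⟨s(x, Γ.graph.graph.inv x), x, h, rfl⟩ else 0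

variable {σ τ : RPC}

theorem len_of_ne (Γ : TropCurve g n σ) {x : Γ.graph.graph.X} (h : Γ.graph.graph.inv x ≠ x) :
    Γ.len x = Γ.length ⟨s(x, Γ.graph.graph.inv x), x, h, rfl⟩ := dif_pos h

theorem len_eq_zero_iff (Γ : TropCurve g n σ) {x : Γ.graph.graph.X} :
    Γ.len x = 0 ↔ Γ.graph.graph.inv x = x := by
  by_cases h : Γ.graph.graph.inv x = x
  · simp [len, h]
  · rw [len_of_ne Γ h]
    exact ⟨fun h' => absurd h' (Γ.length_ne_zero _), fun h' => absurd h' h⟩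

theorem len_of_isVertex (Γ : TropCurve g n σ) {x : Γ.graph.graph.X}
    (h : Γ.graph.graph.IsVertex x) : Γ.len x = 0 :=
  Γ.len_eq_zero_iff.2 (WeightedGraph.inv_vertex h)

theorem len_inv (Γ : TropCurve g n σ) (x : Γ.graph.graph.X) :
    Γ.len (Γ.graph.graph.inv x) = Γ.len x := by
  by_cases h : Γ.graph.graph.inv x = x
  · rw [h]
  · rw [len_of_ne Γ h, len_of_ne Γ (WeightedGraph.inv_inv_ne h)]
    have h2 : s(Γ.graph.graph.inv x, Γ.graph.graph.inv (Γ.graph.graph.inv x)) =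
        s(x, Γ.graph.graph.inv x) := by rw [WeightedGraph.inv_inv, Sym2.eq_swap]
    exact congrArg Γ.length (Subtype.ext h2)

variable {f : σ ⟶ τ} {Γ : TropCurve g n σ} {Γ' : TropCurve g n τ} {π : Γ'.graph ⟶ Γ.graph}

theorem contracts_iff_isVertex (e : Γ'.graph.Edge) {x : Γ'.graph.graph.X}
    (he : e.1 = s(x, Γ'.graph.graph.inv x)) :
    MarkedGraph.Hom.Contracts π e ↔ Γ.graph.graph.IsVertex (ap π x) := by
  constructor
  · rintro ⟨v, hv, h⟩
    rw [he, Sym2.map_mk, Sym2.eq_iff] at h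
    have : ap π x = v := by rcases h with h | h <;> exact h.1
    rw [this]; exact hv
  · intro h
    refine ⟨ap π x, h, ?_⟩
    rw [he, Sym2.map_mk]
    change s(ap π x, ap π (Γ'.graph.graph.inv x)) = _
    rw [ap_inv, WeightedGraph.inv_vertex h]

/-- A morphism of graphs defines a morphism of tropical curves if and only if it preserves the
lengths of all flags. -/
theorem isHomOver_iff : IsHomOver f Γ Γ' π ↔ ∀ x, RPC.pullback f (Γ'.len x) = Γ.len (ap π x) := by
  constructor
  · intro h x
    by_cases hx : Γ'.graph.graph.inv x = x
    · rw [Γ'.len_eq_zero_iff.2 hx, map_zero, Γ.len_eq_zero_iff.2 (by rw [← ap_inv, hx])]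
    rw [len_of_ne Γ' hx]
    by_cases hv : Γ.graph.graph.IsVertex (ap π x)
    · rw [Γ.len_of_isVertex hv]
      exact (h.contracts_iff _).1 ((contracts_iff_isVertex _ rfl).2 hv)
    · have hne : Γ.graph.graph.inv (ap π x) ≠ ap π x := fun h' => hx ((inv_ap_eq_iff π hv).2 h')
      rw [len_of_ne Γ hne]
      refine h.length_eq _ _ ?_
      rw [Sym2.map_mk]
      change s(ap π x, ap π (Γ'.graph.graph.inv x)) = _
      rw [ap_inv]
  · intro h
    constructor
    · rintro ⟨_, x, hx, rfl⟩
      rw [contracts_iff_isVertex (x := x) _ rfl, ← len_of_ne Γ' hx, h, len_eq_zero_iff]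
      refine ⟨WeightedGraph.inv_vertex, fun h' => ?_⟩
      by_contra hv
      exact hx ((inv_ap_eq_iff π hv).2 h')
    · rintro ⟨_, x, hx, rfl⟩ ⟨e, he⟩ hxe
      have hxe' : e = s(ap π x, Γ.graph.graph.inv (ap π x)) := by
        rw [← ap_inv]; exact hxe.symm
      subst hxe'
      have hne : Γ.graph.graph.inv (ap π x) ≠ ap π x := by
        obtain ⟨y, hy, hxy⟩ := he
        rcases Sym2.eq_iff.1 hxy with ⟨h1, -⟩ | ⟨h1, -⟩
        · rwa [h1]
        · rw [h1, WeightedGraph.inv_inv]; exact hy.symm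
      rw [← len_of_ne Γ' hx, h, len_of_ne Γ hne]

theorem IsHomOver.len_ap (h : IsHomOver f Γ Γ' π) (x) :
    RPC.pullback f (Γ'.len x) = Γ.len (ap π x) := isHomOver_iff.1 h x

/-- Precisely the flags whose lengths become zero are contracted. -/
theorem IsHomOver.isVertex_iff (h : IsHomOver f Γ Γ' π) (x) :
    Γ.graph.graph.IsVertex (ap π x) ↔
      Γ'.graph.graph.IsVertex x ∨ Γ'.graph.graph.inv x ≠ x ∧ RPC.pullback f (Γ'.len x) = 0 := by
  by_cases hx : Γ'.graph.graph.inv x = x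
  · rw [isVertex_ap_iff_of_inv_eq π hx]; tauto
  · rw [h.len_ap, len_eq_zero_iff]
    constructor
    · exact fun hv => Or.inr ⟨hx, WeightedGraph.inv_vertex hv⟩
    · rintro (hv | ⟨-, h'⟩)
      · exact isVertex_ap π hv
      · by_contra hv
        exact hx ((inv_ap_eq_iff π hv).2 h')

/-- An interior `f` pulls no nonzero length back to zero, so `π` contracts nothing. -/
theorem IsHomOver.isIso (h : IsHomOver f Γ Γ' π) (hf : RPC.Interior f) : IsIso π :=
  isIso_of_isVertex π fun x hx => by
    rcases (h.isVertex_iff x).1 hx with hv | ⟨h1, h2⟩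
    · exact hv
    · exact absurd (Γ'.len_eq_zero_iff.1 (hf.pullback_eq_zero h2)) h1

/-- Every tropical curve can be pulled back. -/
theorem exists_isHomOver (f : σ ⟶ τ) (Γ' : TropCurve g n τ) :
    ∃ (Γ : TropCurve g n σ) (π : Γ'.graph ⟶ Γ.graph), IsHomOver f Γ Γ' π := by
  -- The edges to be contracted are forced: those whose length pulls back to zero.
  obtain ⟨H, π, hπ⟩ := exists_contraction Γ'.graph
    {x | Γ'.graph.graph.inv x ≠ x ∧ RPC.pullback f (Γ'.len x) = 0}
    (fun x hx => ⟨WeightedGraph.inv_inv_ne hx.1, by rw [len_inv]; exact hx.2⟩) (fun x hx => hx.1)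
  -- An edge of the contraction is the image of an edge of the original graph, from which its length
  -- is taken.
  have hedge : ∀ e : H.Edge, ∃ x, ¬ H.graph.IsVertex (ap π x) ∧ Γ'.graph.graph.inv x ≠ x ∧
      e.1 = s(ap π x, H.graph.inv (ap π x)) := by
    rintro ⟨_, y, hy, rfl⟩
    obtain ⟨x, rfl⟩ := ap_surjective π y
    have hv := WeightedGraph.not_isVertex_of_inv_ne hy
    exact ⟨x, hv, fun h => hy ((inv_ap_eq_iff π hv).1 h), rfl⟩
  choose F hF1 hF2 hF3 using hedge
  let Γ : TropCurve g n σ :=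
    { graph := H
      length := fun e => RPC.pullback f (Γ'.len (F e))
      length_ne_zero := fun e h => hF1 e ((hπ _).2 (Or.inr ⟨hF2 e, h⟩)) }
  refine ⟨Γ, π, isHomOver_iff.2 fun x => ?_⟩
  by_cases hx : Γ'.graph.graph.inv x = x
  · rw [Γ'.len_eq_zero_iff.2 hx, map_zero, Γ.len_eq_zero_iff.2]
    change H.graph.inv _ = _
    rw [← ap_inv, hx]
  by_cases hv : H.graph.IsVertex (ap π x)
  · rw [Γ.len_of_isVertex hv]
    exact (((hπ x).1 hv).resolve_left (WeightedGraph.not_isVertex_of_inv_ne hx)).2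
  · have hne : H.graph.inv (ap π x) ≠ ap π x := fun h' => hx ((inv_ap_eq_iff π hv).2 h')
    rw [len_of_ne Γ hne]
    have h3 := hF3 ⟨s(ap π x, H.graph.inv (ap π x)), ap π x, hne, rfl⟩
    change _ = RPC.pullback f (Γ'.len (F ⟨s(ap π x, H.graph.inv (ap π x)), ap π x, hne, rfl⟩))
    generalize F ⟨s(ap π x, H.graph.inv (ap π x)), ap π x, hne, rfl⟩ = y at h3 ⊢
    change s(ap π x, H.graph.inv (ap π x)) = s(ap π y, H.graph.inv (ap π y)) at h3
    -- The chosen flag `y` is either `x` or the opposite flag of the same edge; both have the same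
    -- length.
    rcases Sym2.eq_iff.1 h3 with ⟨h4, -⟩ | ⟨-, h4⟩
    · rw [(MarkedGraph.Hom.existsUnique_flag π _ hv).unique rfl h4.symm]
    · rw [← ap_inv] at h4
      have hv' : ¬ H.graph.IsVertex (ap π (Γ'.graph.graph.inv x)) := by
        rw [ap_inv]; exact WeightedGraph.inv_not_isVertex hv
      rw [← (MarkedGraph.Hom.existsUnique_flag π _ hv').unique rfl h4.symm, len_inv]

end TropCurve

end Trop

end

/-! ### Fibrations in groupoids: tropical curves over cones and over complexes -/

noncomputable section

namespace Trop

section Fibered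

universe v u v₁ u₁

variable {C : Type u} [Category.{v} C] {𝒳 : Type u₁} [Category.{v₁} 𝒳] {p : 𝒳 ⥤ C}

/-- Strong cartesianness of `a`, expressed by equations between morphisms of the base. -/
theorem IsFiberedInGroupoids.existsUnique (hp : IsFiberedInGroupoids p) {x y z : 𝒳} (a : y ⟶ x)
    (b : z ⟶ x) (f : p.obj z ⟶ p.obj y) (h : f ≫ p.map a = p.map b) :
    ∃! c : z ⟶ y, p.map c = f ∧ c ≫ a = b := by
  have := hp.isStronglyCartesian a
  have hb : p.IsHomLift (f ≫ p.map a) b := by rw [h]; infer_instance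
  obtain ⟨c, ⟨hc, hca⟩, hu⟩ :=
    Functor.IsStronglyCartesian.universal_property' (p := p) (f := p.map a) (φ := a) f b
  refine ⟨c, ⟨(IsHomLift.eq_of_isHomLift p f c).symm, hca⟩, ?_⟩
  rintro c' ⟨rfl, h'⟩
  exact hu c' ⟨inferInstance, h'⟩

theorem IsFiberedInGroupoids.of_existsUnique
    (h : ∀ (x : 𝒳) {V : C} (f : V ⟶ p.obj x), ∃ (y : 𝒳) (φ : y ⟶ x), p.IsHomLift f φ)
    (h' : ∀ {x y z : 𝒳} (a : y ⟶ x) (b : z ⟶ x) (f : p.obj z ⟶ p.obj y),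
      f ≫ p.map a = p.map b → ∃! c : z ⟶ y, p.map c = f ∧ c ≫ a = b) :
    IsFiberedInGroupoids p where
  exists_lift := h
  isStronglyCartesian {x y} φ :=
    { universal_property' := fun {z} f b hb => by
        obtain ⟨c, ⟨rfl, hc⟩, hu⟩ := h' φ b f (IsHomLift.eq_of_isHomLift p _ b)
        refine ⟨c, ⟨inferInstance, hc⟩, ?_⟩
        rintro c' ⟨_, hc'⟩
        exact hu c' ⟨(IsHomLift.eq_of_isHomLift p _ c').symm, hc'⟩ }

/-- Lifting the identity along `a` gives a right inverse, and uniqueness of lifts makes it a left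
inverse. -/
theorem IsFiberedInGroupoids.isIso (hp : IsFiberedInGroupoids p) {x y : 𝒳} (a : x ⟶ y)
    [IsIso (p.map a)] : IsIso a := by
  obtain ⟨c, ⟨hc, hca⟩, -⟩ := hp.existsUnique a (𝟙 y) (inv (p.map a)) (by simp)
  refine ⟨c, (hp.existsUnique a a (𝟙 _) (Category.id_comp _)).unique ⟨?_, ?_⟩
    ⟨p.map_id x, Category.id_comp a⟩, hca⟩
  · rw [p.map_comp, hc, IsIso.hom_inv_id]
  · rw [Category.assoc, hca, Category.comp_id]

theorem IsFiberedInGroupoids.cancel (hp : IsFiberedInGroupoids p) {x y z : 𝒳} (a : y ⟶ x)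
    {b c : z ⟶ y} (h : b ≫ a = c ≫ a) (h' : p.map b = p.map c) : b = c :=
  (hp.existsUnique a (c ≫ a) (p.map c) (p.map_comp _ _).symm).unique ⟨h', h⟩ ⟨rfl, rfl⟩

end Fibered

variable {g n : ℕ}

open StableGraph

namespace TropCurve

variable {ρ σ τ : RPC}

/-- A length that vanishes after pullback along `m` also vanishes along `f ≫ m`. So `ψ` contracts
whatever `π` contracts and factors through it; lengths are compatible because `π` is surjective on
flags. -/
theorem IsHomOver.exists_lift {f : ρ ⟶ σ} {m : σ ⟶ τ} {h : ρ ⟶ τ} {Γ : TropCurve g n σ}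
    {Γ' : TropCurve g n τ} {Δ : TropCurve g n ρ} {π : Γ'.graph ⟶ Γ.graph} {ψ : Γ'.graph ⟶ Δ.graph}
    (hp : IsHomOver m Γ Γ' π) (hq : IsHomOver h Δ Γ' ψ) (hh : f ≫ m = h) :
    ∃ χ : Γ.graph ⟶ Δ.graph, π ≫ χ = ψ ∧ IsHomOver f Δ Γ χ := by
  subst hh
  obtain ⟨χ, hχ⟩ := exists_factor π ψ fun x hx => by
    rw [hp.isVertex_iff] at hx
    rw [hq.isVertex_iff, RPC.pullback_comp]
    exact hx.imp_right fun h => ⟨h.1, by rw [h.2, map_zero]⟩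
  refine ⟨χ, hχ, isHomOver_iff.2 fun y => ?_⟩
  obtain ⟨x, rfl⟩ := ap_surjective π y
  rw [← hp.len_ap, ← RPC.pullback_comp, hq.len_ap, ← hχ, ap_comp]

/-- The pullback along an interior morphism. -/
def pull (Γ : TropCurve g n τ) (f : σ ⟶ τ) (hf : RPC.Interior f) : TropCurve g n σ where
  graph := Γ.graph
  length e := RPC.pullback f (Γ.length e)
  length_ne_zero e h := Γ.length_ne_zero e (hf.pullback_eq_zero h)

theorem len_pull (Γ : TropCurve g n τ) (f : σ ⟶ τ) (hf : RPC.Interior f) (x) :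
    (Γ.pull f hf).len x = RPC.pullback f (Γ.len x) := by
  by_cases h : Γ.graph.graph.inv x = x
  · have h1 := Γ.len_eq_zero_iff.2 h
    rw [h1, map_zero]
    exact (Γ.pull f hf).len_eq_zero_iff.2 h
  · rw [len_of_ne _ h, len_of_ne (Γ.pull f hf) h]
    rfl

theorem isHomOver_pull (Γ : TropCurve g n τ) (f : σ ⟶ τ) (hf : RPC.Interior f) :
    IsHomOver f (Γ.pull f hf) Γ (𝟙 Γ.graph) :=
  isHomOver_iff.2 fun x => (Γ.len_pull f hf x).symm

theorem IsHomOver.pull {τ' : RPC} {Γ : TropCurve g n τ} {Γ' : TropCurve g n τ'} {φ : τ' ⟶ τ}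
    {π : Γ.graph ⟶ Γ'.graph} (h : IsHomOver φ Γ' Γ π) {f : σ ⟶ τ} (hf : RPC.Interior f)
    {f' : ρ ⟶ τ'} (hf' : RPC.Interior f') {m : ρ ⟶ σ} (hm : m ≫ f = f' ≫ φ) :
    IsHomOver m (Γ'.pull f' hf') (Γ.pull f hf) π := by
  refine isHomOver_iff.2 fun x => (congrArg _ (Γ.len_pull f hf x)).trans
    (Eq.trans ?_ (Γ'.len_pull f' hf' _).symm)
  rw [← RPC.pullback_comp, hm, RPC.pullback_comp]
  exact congrArg _ (h.len_ap x)

end TropCurve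

open TropCurve

theorem MtropRPC.isFiberedInGroupoids : IsFiberedInGroupoids (MtropRPC.proj g n) := by
  refine .of_existsUnique (fun X V f => ?_) fun {X Y Z} a b f h => ?_
  · obtain ⟨Γ, π, h⟩ := exists_isHomOver f X.curve
    exact ⟨⟨V, Γ⟩, ⟨f, π, h⟩, inferInstanceAs ((MtropRPC.proj g n).IsHomLift
      ((MtropRPC.proj g n).map (⟨f, π, h⟩ : MtropRPC.Hom ⟨V, Γ⟩ X)) _)⟩
  · obtain ⟨χ, hχ, hf⟩ := a.isHomOver.exists_lift b.isHomOver h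
    refine ⟨⟨f, χ, hf⟩, ⟨rfl, MtropRPC.Hom.ext h hχ⟩, ?_⟩
    rintro c ⟨h1, h2⟩
    refine MtropRPC.Hom.ext h1 ?_
    rw [← cancel_epi a.graph, hχ, ← h2]
    rfl

namespace Mtrop

open RPCC

theorem res_eq_id (X : Mtrop g n) {α} (φ : X.base.cone α ⟶ X.base.cone α)
    (hφ : φ ∈ X.base.mor α α) : X.res φ hφ = 𝟙 _ := by
  obtain rfl : φ = 𝟙 _ := X.base.mor_subsingleton _ _ hφ (X.base.id_mem _)
  exact X.res_id _

theorem res_eq_comp (X : Mtrop g n) {α β γ} (φ : X.base.cone α ⟶ X.base.cone β)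
    (hφ : φ ∈ X.base.mor α β) (ψ : X.base.cone β ⟶ X.base.cone γ) (hψ : ψ ∈ X.base.mor β γ)
    (χ : X.base.cone α ⟶ X.base.cone γ) (hχ : χ ∈ X.base.mor α γ) :
    X.res χ hχ = X.res ψ hψ ≫ X.res φ hφ := by
  obtain rfl : χ = φ ≫ ψ := X.base.mor_subsingleton _ _ hχ (X.base.comp_mem hφ hψ)
  exact X.res_comp _ _ _ _

/-- The pullback of a family of tropical curves. -/
def pull (X : Mtrop g n) {T : RPCC} (h : T ⟶ X.base) : Mtrop g n where
  base := T
  curve α := (X.curve (h.idx α)).pull (h.hom α) (h.interior α)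
  -- Interior pullback leaves the graphs unchanged, so the restriction maps of `X` can be used
  -- again. There is at most one face morphism between two cones, so the choice is immaterial.
  res φ hφ := X.res (h.exists_mor φ hφ).choose (h.exists_mor φ hφ).choose_spec.1
  res_isHomOver φ hφ := (X.res_isHomOver _ (h.exists_mor φ hφ).choose_spec.1).pull _ _
    (h.exists_mor φ hφ).choose_spec.2
  res_id _ := X.res_eq_id _ _
  res_comp _ _ _ _ := X.res_eq_comp _ _ _ _ _ _

theorem pull_res (X : Mtrop g n) {T : RPCC} (h : T ⟶ X.base) {α β} (φ : T.cone α ⟶ T.cone β)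
    (hφ : φ ∈ T.mor α β) (ψ : X.base.cone (h.idx α) ⟶ X.base.cone (h.idx β))
    (hψ : ψ ∈ X.base.mor (h.idx α) (h.idx β)) : (X.pull h).res φ hφ = X.res ψ hψ := by
  change X.res _ _ = _
  have h1 := (h.exists_mor φ hφ).choose_spec.1
  congr 1
  exact X.base.mor_subsingleton _ _ h1 hψ

/-- The projection of the pullback of a family to the family. -/
def pullHom (X : Mtrop g n) {T : RPCC} (h : T ⟶ X.base) : X.pull h ⟶ X :=
  (⟨h, fun α => 𝟙 (X.curve (h.idx α)).graph, fun α => isHomOver_pull _ _ (h.interior α),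
    fun φ hφ ψ hψ => by
      rw [pull_res X h φ hφ ψ hψ]
      rfl⟩ : Hom (X.pull h) X)

theorem comp_base {X Y Z : Mtrop g n} (p : X ⟶ Y) (q : Y ⟶ Z) :
    (p ≫ q).base = p.base ≫ q.base := rfl

theorem hom_mk_ext {X Y : Mtrop g n} {b : X.base ⟶ Y.base}
    {p q : ∀ α, (Y.curve (b.idx α)).graph ⟶ (X.curve α).graph} {hp hp' hq hq'}
    (h : ∀ α, p α = q α) : (⟨b, p, hp, hp'⟩ : Hom X Y) = ⟨b, q, hq, hq'⟩ := by
  obtain rfl : p = q := funext h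
  rfl

/-- The lifts are found cone by cone. Uniqueness and compatibility with restriction follow by
cancelling the epimorphisms `p.graph`. -/
theorem existsUnique_lift {X Y Z : Mtrop g n} (p : Y ⟶ X) (q : Z ⟶ X) (f : Z.base ⟶ Y.base)
    (h : f ≫ p.base = q.base) : ∃! c : Z ⟶ Y, c.base = f ∧ c ≫ p = q := by
  obtain ⟨qb, qg, hq, hq'⟩ := q
  change f ≫ p.base = qb at h
  subst h
  choose c hc hc' using fun α => (p.isHomOver (f.idx α)).exists_lift (hq α) rfl
  refine ⟨⟨f, c, hc', ?_⟩, ⟨rfl, ?_⟩, ?_⟩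
  · intro α β φ hφ ψ hψ
    obtain ⟨χ, hχ, -⟩ := p.base.exists_mor ψ hψ
    rw [← cancel_epi (p.graph _), ← Category.assoc, hc, hq' φ hφ χ hχ, ← Category.assoc,
      p.naturality ψ hψ χ hχ, Category.assoc, hc]
  · exact hom_mk_ext hc
  · rintro ⟨cb, cg, h1, h2⟩ ⟨h3, h4⟩
    change cb = f at h3
    subst h3
    refine hom_mk_ext fun α => ?_
    rw [← cancel_epi (p.graph _), hc]
    exact congrFun (eq_of_heq (Hom.mk.inj h4).2) α

theorem isFiberedInGroupoids : IsFiberedInGroupoids (Mtrop.proj g n) :=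
  .of_existsUnique (fun X _ f => ⟨X.pull f, X.pullHom f, inferInstanceAs
    ((Mtrop.proj g n).IsHomLift ((Mtrop.proj g n).map (X.pullHom f)) _)⟩) existsUnique_lift

/-! ### Evaluation at morphisms from cones -/

variable {X Y Z : Mtrop g n} {ρ σ : RPC}

/-- The pullback of a family along a morphism from a cone, as a tropical curve over the cone. -/
def ev (X : Mtrop g n) (j : RPC.toRPCC.obj σ ⟶ X.base) : TropCurve g n σ :=
  (X.curve (topIdx j)).pull (topHom j) (interior_topHom j)

/-- The comparison of a tropical curve of the family with the pullback along a morphism which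
is given by a morphism to the cone of this curve. -/
def toEv (X : Mtrop g n) {j : RPC.toRPCC.obj σ ⟶ X.base} {α} {f : σ ⟶ X.base.cone α}
    (h : RepBy j α f) : (X.curve α).graph ⟶ (X.ev j).graph :=
  X.res h.choose h.choose_spec.1

theorem toEv_eq {j : RPC.toRPCC.obj σ ⟶ X.base} {α} {f : σ ⟶ X.base.cone α}
    (h : RepBy j α f) {φ : X.base.cone (topIdx j) ⟶ X.base.cone α}
    (hφ : φ ∈ X.base.mor (topIdx j) α) : X.toEv h = X.res φ hφ := by
  have h1 := h.choose_spec.1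
  unfold toEv
  congr 1
  exact X.base.mor_subsingleton _ _ h1 hφ

theorem isHomOver_toEv {j : RPC.toRPCC.obj σ ⟶ X.base} {α} {f : σ ⟶ X.base.cone α}
    (h : RepBy j α f) : IsHomOver f (X.ev j) (X.curve α) (X.toEv h) := by
  have h' := h
  obtain ⟨φ, hφ, rfl⟩ := h'
  rw [toEv_eq h hφ]
  have := (isHomOver_pull (X.curve (topIdx j)) (topHom j) (interior_topHom j)).comp
    (X.res_isHomOver φ hφ)
  exact this

theorem isIso_toEv {j : RPC.toRPCC.obj σ ⟶ X.base} {α} {f : σ ⟶ X.base.cone α}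
    (h : RepBy j α f) (hf : RPC.Interior f) : IsIso (X.toEv h) :=
  (isHomOver_toEv h).isIso hf

/-- The functoriality of `ev` in the cone. -/
def evRes (X : Mtrop g n) (m : ρ ⟶ σ) {j' : RPC.toRPCC.obj ρ ⟶ X.base}
    {j : RPC.toRPCC.obj σ ⟶ X.base} (h : RPC.toRPCC.map m ≫ j = j') :
    (X.ev j).graph ⟶ (X.ev j').graph :=
  X.res (exists_mor_of_comp h).choose (exists_mor_of_comp h).choose_spec.1

theorem evRes_eq {m : ρ ⟶ σ} {j' : RPC.toRPCC.obj ρ ⟶ X.base}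
    {j : RPC.toRPCC.obj σ ⟶ X.base} (h : RPC.toRPCC.map m ≫ j = j')
    {φ : X.base.cone (topIdx j') ⟶ X.base.cone (topIdx j)}
    (hφ : φ ∈ X.base.mor (topIdx j') (topIdx j)) : X.evRes m h = X.res φ hφ := by
  have h1 := (exists_mor_of_comp h).choose_spec.1
  unfold evRes
  congr 1
  exact X.base.mor_subsingleton _ _ h1 hφ

theorem isHomOver_evRes {m : ρ ⟶ σ} {j' : RPC.toRPCC.obj ρ ⟶ X.base}
    {j : RPC.toRPCC.obj σ ⟶ X.base} (h : RPC.toRPCC.map m ≫ j = j') :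
    IsHomOver m (X.ev j') (X.ev j) (X.evRes m h) := by
  obtain ⟨φ, hφ, e⟩ := exists_mor_of_comp h
  rw [evRes_eq h hφ]
  exact (X.res_isHomOver φ hφ).pull _ _ e.symm

theorem evRes_id (j : RPC.toRPCC.obj σ ⟶ X.base) (h : RPC.toRPCC.map (𝟙 σ) ≫ j = j) :
    X.evRes (𝟙 σ) h = 𝟙 _ := by
  rw [evRes_eq h (X.base.id_mem _)]
  exact X.res_id _

theorem evRes_comp {τ : RPC} (m : ρ ⟶ σ) (m' : σ ⟶ τ) {j₁ : RPC.toRPCC.obj ρ ⟶ X.base}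
    {j₂ : RPC.toRPCC.obj σ ⟶ X.base} {j₃ : RPC.toRPCC.obj τ ⟶ X.base}
    (h : RPC.toRPCC.map m ≫ j₂ = j₁) (h' : RPC.toRPCC.map m' ≫ j₃ = j₂)
    (h'' : RPC.toRPCC.map (m ≫ m') ≫ j₃ = j₁) :
    X.evRes (m ≫ m') h'' = X.evRes m' h' ≫ X.evRes m h := by
  obtain ⟨φ, hφ, e⟩ := exists_mor_of_comp h
  obtain ⟨φ', hφ', e'⟩ := exists_mor_of_comp h'
  rw [evRes_eq h hφ, evRes_eq h' hφ', evRes_eq h'' (X.base.comp_mem hφ hφ')]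
  exact X.res_comp _ _ _ _

theorem toEv_evRes (m : ρ ⟶ σ) {j' : RPC.toRPCC.obj ρ ⟶ X.base}
    {j : RPC.toRPCC.obj σ ⟶ X.base} (h : RPC.toRPCC.map m ≫ j = j') {α} {f : σ ⟶ X.base.cone α}
    (hj : RepBy j α f) {f' : ρ ⟶ X.base.cone α} (hj' : RepBy j' α f') :
    X.toEv hj ≫ X.evRes m h = X.toEv hj' := by
  obtain ⟨φ, hφ, e⟩ := exists_mor_of_comp h
  have hj1 := hj
  obtain ⟨φ', hφ', e'⟩ := hj1
  rw [evRes_eq h hφ, toEv_eq hj hφ', toEv_eq hj' (X.base.comp_mem hφ hφ')]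
  exact (X.res_comp _ _ _ _).symm

theorem res_toEv {j : RPC.toRPCC.obj σ ⟶ X.base} {α β} {f : σ ⟶ X.base.cone α}
    (hj : RepBy j α f) (φ : X.base.cone α ⟶ X.base.cone β) (hφ : φ ∈ X.base.mor α β)
    {f' : σ ⟶ X.base.cone β} (hj' : RepBy j β f') : X.res φ hφ ≫ X.toEv hj = X.toEv hj' := by
  have hj1 := hj
  obtain ⟨φ', hφ', e'⟩ := hj1
  rw [toEv_eq hj hφ', toEv_eq hj' (X.base.comp_mem hφ' hφ)]
  exact (X.res_comp _ _ _ _).symm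

/-- The functoriality of `ev` in the family. -/
def evHom (q : X ⟶ Y) (j : RPC.toRPCC.obj σ ⟶ X.base) :
    (Y.ev (j ≫ q.base)).graph ⟶ (X.ev j).graph := q.graph (topIdx j)

theorem isHomOver_evHom (q : X ⟶ Y) (j : RPC.toRPCC.obj σ ⟶ X.base) :
    IsHomOver (𝟙 σ) (X.ev j) (Y.ev (j ≫ q.base)) (evHom q j) :=
  (q.isHomOver (topIdx j)).pull _ _ ((Category.id_comp _).trans (Category.assoc _ _ _).symm)

theorem toEv_evHom (q : X ⟶ Y) {j : RPC.toRPCC.obj σ ⟶ X.base} {α} {f : σ ⟶ X.base.cone α}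
    (hj : RepBy j α f) {f' : σ ⟶ Y.base.cone (q.base.idx α)}
    (hj' : RepBy (j ≫ q.base) (q.base.idx α) f') :
    Y.toEv hj' ≫ evHom q j = q.graph α ≫ X.toEv hj := by
  have hj1 := hj
  obtain ⟨φ, hφ, e⟩ := hj1
  obtain ⟨ψ, hψ, e'⟩ := q.base.exists_mor φ hφ
  rw [toEv_eq hj hφ, toEv_eq hj' hψ]
  exact (q.naturality φ hφ ψ hψ).symm

theorem evRes_evHom (q : X ⟶ Y) (m : ρ ⟶ σ) {j' : RPC.toRPCC.obj ρ ⟶ X.base}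
    {j : RPC.toRPCC.obj σ ⟶ X.base} (h : RPC.toRPCC.map m ≫ j = j')
    (h' : RPC.toRPCC.map m ≫ j ≫ q.base = j' ≫ q.base) :
    Y.evRes m h' ≫ evHom q j' = evHom q j ≫ X.evRes m h := by
  obtain ⟨φ, hφ, e⟩ := exists_mor_of_comp h
  obtain ⟨ψ, hψ, e'⟩ := q.base.exists_mor φ hφ
  rw [evRes_eq h hφ, evRes_eq h' hψ]
  exact (q.naturality φ hφ ψ hψ).symm

/-- A morphism of families over a given morphism of cone complexes can be constructed from a
natural family of morphisms between the pullbacks to cones. -/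
theorem existsUnique_hom (X Y : Mtrop g n) (f : X.base ⟶ Y.base)
    (K : ∀ {σ : RPC} (j : RPC.toRPCC.obj σ ⟶ X.base), (Y.ev (j ≫ f)).graph ⟶ (X.ev j).graph)
    (hK : ∀ {σ : RPC} (j : RPC.toRPCC.obj σ ⟶ X.base),
      IsHomOver (𝟙 σ) (X.ev j) (Y.ev (j ≫ f)) (K j))
    (hK' : ∀ {ρ σ : RPC} (m : ρ ⟶ σ) {j' : RPC.toRPCC.obj ρ ⟶ X.base}
      {j : RPC.toRPCC.obj σ ⟶ X.base} (h : RPC.toRPCC.map m ≫ j = j')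
      (h' : RPC.toRPCC.map m ≫ j ≫ f = j' ≫ f), Y.evRes m h' ≫ K j' = K j ≫ X.evRes m h) :
    ∃! q : X ⟶ Y, ∃ h : q.base = f, ∀ {σ : RPC} (j : RPC.toRPCC.obj σ ⟶ X.base),
      Y.evRes (𝟙 σ) (by rw [h]; simp) ≫ evHom q j = K j := by
  have hX : ∀ α, RepBy (ofCone α (𝟙 (X.base.cone α))) α (𝟙 _) := fun α => repBy_ofCone α _
  have hY : ∀ α, RepBy (ofCone α (𝟙 (X.base.cone α)) ≫ f) (f.idx α) (𝟙 _ ≫ f.hom α) :=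
    fun α => (hX α).postcomp f
  have hiso : ∀ α, IsIso (X.toEv (hX α)) := fun α => isIso_toEv _ (.id _)
  -- On the cone `α` the morphism is dictated by the value of `K` at the canonical morphism of that
  -- cone, since `toEv` is invertible there.
  obtain ⟨G, hG⟩ : ∃ G : ∀ α, (Y.curve (f.idx α)).graph ⟶ (X.curve α).graph,
      ∀ α, G α ≫ X.toEv (hX α) = Y.toEv (hY α) ≫ K (ofCone α (𝟙 _)) :=
    ⟨fun α => Y.toEv (hY α) ≫ K (ofCone α (𝟙 _)) ≫ inv (X.toEv (hX α)), fun α => by simp⟩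
  have hGh : ∀ α, IsHomOver (f.hom α) (X.curve α) (Y.curve (f.idx α)) (G α) := by
    intro α
    have h1 := (hK (ofCone α (𝟙 _))).comp (isHomOver_toEv (hY α))
    rw [← hG] at h1
    have h2 := isHomOver_toEv (hX α)
    refine isHomOver_iff.2 fun x => ?_
    have h3 := h1.len_ap x
    rw [ap_comp, ← h2.len_ap, RPC.pullback_id] at h3
    simpa using h3
  have hGn : ∀ {α β} (φ : X.base.cone α ⟶ X.base.cone β) (hφ : φ ∈ X.base.mor α β)
      (ψ : Y.base.cone (f.idx α) ⟶ Y.base.cone (f.idx β))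
      (hψ : ψ ∈ Y.base.mor (f.idx α) (f.idx β)), G β ≫ X.res φ hφ = Y.res ψ hψ ≫ G α := by
    intro α β φ hφ ψ hψ
    have hm := map_mor_comp_ofCone hφ
    have hφ' : RepBy (ofCone α (𝟙 (X.base.cone α))) β (𝟙 _ ≫ φ) := (hX α).comp_mor hφ
    have hψ' := (hY α).comp_mor hψ
    -- After the comparison with the value at the canonical morphism of `α`, this is the naturality
    -- of `K` along `φ`.
    rw [← cancel_mono (X.toEv (hX α)), Category.assoc, Category.assoc, hG, res_toEv (hX α) φ hφ hφ',
      ← Category.assoc, res_toEv (hY α) ψ hψ hψ', ← toEv_evRes φ hm (hX β) hφ',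
      ← Category.assoc, hG, Category.assoc, ← hK' φ hm (by rw [← hm, Category.assoc]),
      ← Category.assoc, toEv_evRes]
  refine ⟨⟨f, G, hGh, hGn⟩, ⟨rfl, fun {σ} j => ?_⟩, ?_⟩
  · have hf : RPC.toRPCC.map (𝟙 σ) ≫ j ≫ f = j ≫ f := by simp
    let q : X ⟶ Y := ⟨f, G, hGh, hGn⟩
    change Y.evRes (𝟙 σ) hf ≫ evHom q j = K j
    rw [evRes_id _ hf, Category.id_comp]
    -- Naturality of `K` along `topHom j` reduces the claim for `j` to the canonical morphism of a
    -- cone, where it is the definition of `G`.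
    have hm := map_topHom_comp_ofCone j
    have hm' : RPC.toRPCC.map (topHom j) ≫ ofCone (topIdx j) (𝟙 _) ≫ f = j ≫ f := by
      rw [← Category.assoc, hm]
    rw [← cancel_epi (Y.evRes _ hm'), hK' _ hm hm']
    refine (evRes_evHom q _ hm hm').trans ?_
    congr 1
    rw [← cancel_epi (Y.toEv (hY _)), ← hG]
    exact toEv_evHom q (hX _) (hY _)
  · rintro ⟨b, q, hq, hq'⟩ ⟨h, hj⟩
    change b = f at h
    subst h
    refine hom_mk_ext fun α => ?_
    have h1 := toEv_evHom (⟨b, q, hq, hq'⟩ : X ⟶ Y) (hX α) (hY α)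
    have h2 := hj (ofCone α (𝟙 _))
    rw [evRes_id, Category.id_comp] at h2
    rw [h2, ← hG] at h1
    exact ((cancel_mono _).1 h1).symm

end Mtrop

end Trop

end

/-! ### Families described by their values at cones; gluing of morphisms -/

noncomputable section

namespace Trop

variable {g n : ℕ}

open StableGraph TropCurve

theorem TropCurve.IsHomOver.inv {σ : RPC} {Γ Γ' : TropCurve g n σ} {π : Γ'.graph ⟶ Γ.graph}
    [IsIso π] (h : IsHomOver (𝟙 σ) Γ Γ' π) : IsHomOver (𝟙 σ) Γ' Γ (inv π) := by
  obtain ⟨χ, hχ, h'⟩ := h.exists_lift (IsHomOver.id Γ') (Category.comp_id _)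
  rwa [← IsIso.eq_inv_of_hom_inv_id hχ]

namespace Mtrop

open RPCC
open RPC (toRPCC)

variable {X Y Z : Mtrop g n} {ρ σ τ : RPC}

/-- The functoriality of `ev` in the cone and the family. -/
def evMap (q : X ⟶ Y) (m : ρ ⟶ σ) {j' : toRPCC.obj ρ ⟶ X.base} {j : toRPCC.obj σ ⟶ Y.base}
    (h : toRPCC.map m ≫ j = j' ≫ q.base) : (Y.ev j).graph ⟶ (X.ev j').graph :=
  Y.evRes m h ≫ evHom q j'

theorem isHomOver_evMap (q : X ⟶ Y) (m : ρ ⟶ σ) {j' : toRPCC.obj ρ ⟶ X.base}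
    {j : toRPCC.obj σ ⟶ Y.base} (h : toRPCC.map m ≫ j = j' ≫ q.base) :
    IsHomOver m (X.ev j') (Y.ev j) (evMap q m h) := by
  have := (isHomOver_evHom q j').comp (isHomOver_evRes h)
  rwa [Category.id_comp] at this

theorem isIso_evMap (q : X ⟶ Y) (m : ρ ⟶ σ) {j' : toRPCC.obj ρ ⟶ X.base}
    {j : toRPCC.obj σ ⟶ Y.base} (h : toRPCC.map m ≫ j = j' ≫ q.base) (hm : RPC.Interior m) :
    IsIso (evMap q m h) := (isHomOver_evMap q m h).isIso hm

theorem evMap_comp (q : X ⟶ Y) (q' : Y ⟶ Z) (m : ρ ⟶ σ) (m' : σ ⟶ τ)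
    {j₁ : toRPCC.obj ρ ⟶ X.base} {j₂ : toRPCC.obj σ ⟶ Y.base} {j₃ : toRPCC.obj τ ⟶ Z.base}
    (h : toRPCC.map m ≫ j₂ = j₁ ≫ q.base) (h' : toRPCC.map m' ≫ j₃ = j₂ ≫ q'.base)
    (h'' : toRPCC.map (m ≫ m') ≫ j₃ = j₁ ≫ (q ≫ q').base) :
    evMap (q ≫ q') (m ≫ m') h'' = evMap q' m' h' ≫ evMap q m h := by
  have h3 : toRPCC.map m ≫ j₂ ≫ q'.base = (j₁ ≫ q.base) ≫ q'.base := by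
    rw [← Category.assoc, h]
  have h4 : toRPCC.map (m ≫ m') ≫ j₃ = (j₁ ≫ q.base) ≫ q'.base := by
    rw [h'', Category.assoc]; rfl
  have e1 : evMap (q ≫ q') (m ≫ m') h'' =
      Z.evRes (m ≫ m') h4 ≫ evHom q' (j₁ ≫ q.base) ≫ evHom q j₁ := rfl
  rw [e1, evRes_comp m m' h3 h' h4]
  simp only [evMap, Category.assoc]
  rw [← Category.assoc (Z.evRes m h3), evRes_evHom q' m h h3, Category.assoc]

theorem evMap_congr {q q' : X ⟶ Y} (hq : q = q') {m m' : ρ ⟶ σ} (hm : m = m')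
    {j' : toRPCC.obj ρ ⟶ X.base} {j : toRPCC.obj σ ⟶ Y.base}
    (h : toRPCC.map m ≫ j = j' ≫ q.base) (h' : toRPCC.map m' ≫ j = j' ≫ q'.base) :
    evMap q m h = evMap q' m' h' := by
  subst hq hm
  rfl

theorem evMap_id (j : toRPCC.obj σ ⟶ X.base) (h : toRPCC.map (𝟙 σ) ≫ j = j ≫ Hom.base (𝟙 X)) :
    evMap (𝟙 X) (𝟙 σ) h = 𝟙 _ := by
  have h' : toRPCC.map (𝟙 σ) ≫ j = j := by simp
  have := evRes_id j h'
  exact this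

/-- `evMap_comp` up to equalities of morphisms. -/
theorem evMap_comp' {q : X ⟶ Y} {q' : Y ⟶ Z} {q'' : X ⟶ Z} {m : ρ ⟶ σ} {m' : σ ⟶ τ} {m'' : ρ ⟶ τ}
    {j₁ : toRPCC.obj ρ ⟶ X.base} {j₂ : toRPCC.obj σ ⟶ Y.base} {j₃ : toRPCC.obj τ ⟶ Z.base}
    (h : toRPCC.map m ≫ j₂ = j₁ ≫ q.base) (h' : toRPCC.map m' ≫ j₃ = j₂ ≫ q'.base)
    (h'' : toRPCC.map m'' ≫ j₃ = j₁ ≫ q''.base) (hq : q ≫ q' = q'') (hm : m ≫ m' = m'') :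
    evMap q' m' h' ≫ evMap q m h = evMap q'' m'' h'' := by
  subst hq hm
  exact (evMap_comp q q' m m' h h' h'').symm

/-- The values at the canonical morphisms of the cones suffice, because there the comparison `toEv`
is an isomorphism. -/
theorem hom_ext_evMap {q q' : X ⟶ Y} (h : q.base = q'.base)
    (h' : ∀ {σ : RPC} (j : toRPCC.obj σ ⟶ X.base) (u : toRPCC.obj σ ⟶ Y.base)
      (hu : toRPCC.map (𝟙 σ) ≫ u = j ≫ q.base) (hu' : toRPCC.map (𝟙 σ) ≫ u = j ≫ q'.base),
      evMap q (𝟙 σ) hu = evMap q' (𝟙 σ) hu') : q = q' := by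
  obtain ⟨b, G, hG, hG'⟩ := q
  obtain ⟨b', G', _, _⟩ := q'
  change b = b' at h
  subst h
  refine hom_mk_ext fun α => ?_
  let q : X ⟶ Y := ⟨b, G, hG, hG'⟩
  have hX := repBy_ofCone α (𝟙 (X.base.cone α))
  have hY := hX.postcomp b
  have := isIso_toEv hX (.id _)
  have hu : toRPCC.map (𝟙 (X.base.cone α)) ≫ ofCone α (𝟙 _) ≫ b = ofCone α (𝟙 _) ≫ b := by simp
  have h1 := h' (ofCone α (𝟙 _)) _ hu hu
  simp only [evMap, evRes_id _ hu, Category.id_comp] at h1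
  have h2 := toEv_evHom q hX hY
  have h3 := toEv_evHom (⟨b, G', ‹_›, ‹_›⟩ : X ⟶ Y) hX hY
  rw [h1, h3] at h2
  exact ((cancel_mono _).1 h2).symm

theorem exists_hom (X Y : Mtrop g n) (f : X.base ⟶ Y.base)
    (K : ∀ {σ : RPC} (j : toRPCC.obj σ ⟶ X.base), (Y.ev (j ≫ f)).graph ⟶ (X.ev j).graph)
    (hK : ∀ {σ : RPC} (j : toRPCC.obj σ ⟶ X.base),
      IsHomOver (𝟙 σ) (X.ev j) (Y.ev (j ≫ f)) (K j))
    (hK' : ∀ {ρ σ : RPC} (m : ρ ⟶ σ) {j' : toRPCC.obj ρ ⟶ X.base}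
      {j : toRPCC.obj σ ⟶ X.base} (h : toRPCC.map m ≫ j = j')
      (h' : toRPCC.map m ≫ j ≫ f = j' ≫ f), Y.evRes m h' ≫ K j' = K j ≫ X.evRes m h) :
    ∃ q : X ⟶ Y, q.base = f ∧ ∀ {σ : RPC} (j : toRPCC.obj σ ⟶ X.base)
      (hj : toRPCC.map (𝟙 σ) ≫ j ≫ f = j ≫ q.base), evMap q (𝟙 σ) hj = K j := by
  obtain ⟨q, ⟨h, hq⟩, -⟩ := existsUnique_hom X Y f K hK hK'
  exact ⟨q, h, fun j _ => hq j⟩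

/-! ### Families given by their pullbacks to cones -/

/-- A compatible family of tropical curves, indexed by the morphisms from cones to a complex. -/
structure ConeFamily (g n : ℕ) (S : RPCC) where
  curve : ∀ {σ : RPC}, (toRPCC.obj σ ⟶ S) → TropCurve g n σ
  res : ∀ {ρ σ : RPC} (m : ρ ⟶ σ) {j' : toRPCC.obj ρ ⟶ S} {j : toRPCC.obj σ ⟶ S},
    toRPCC.map m ≫ j = j' → ((curve j).graph ⟶ (curve j').graph)
  isHomOver : ∀ {ρ σ : RPC} (m : ρ ⟶ σ) {j' : toRPCC.obj ρ ⟶ S} {j : toRPCC.obj σ ⟶ S}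
    (h : toRPCC.map m ≫ j = j'), IsHomOver m (curve j') (curve j) (res m h)
  res_id : ∀ {σ : RPC} {j : toRPCC.obj σ ⟶ S} (h : toRPCC.map (𝟙 σ) ≫ j = j), res (𝟙 σ) h = 𝟙 _
  res_comp : ∀ {ρ σ τ : RPC} (m : ρ ⟶ σ) (m' : σ ⟶ τ) {j₁ : toRPCC.obj ρ ⟶ S}
    {j₂ : toRPCC.obj σ ⟶ S} {j₃ : toRPCC.obj τ ⟶ S} (h : toRPCC.map m ≫ j₂ = j₁)
    (h' : toRPCC.map m' ≫ j₃ = j₂) (h'' : toRPCC.map (m ≫ m') ≫ j₃ = j₁),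
    res (m ≫ m') h'' = res m' h' ≫ res m h

namespace ConeFamily

variable {S : RPCC} (E : ConeFamily g n S)

/-- The object of the moduli stack defined by a family. -/
def toMtrop : Mtrop g n where
  base := S
  curve α := E.curve (ofCone α (𝟙 (S.cone α)))
  res φ hφ := E.res φ (map_mor_comp_ofCone hφ)
  res_isHomOver φ hφ := E.isHomOver φ (map_mor_comp_ofCone hφ)
  res_id _ := E.res_id _
  res_comp _ _ _ _ := E.res_comp _ _ _ _ _

/-- The comparison of the object defined by a family with the family. -/
def compare (j : toRPCC.obj σ ⟶ S) : (E.toMtrop.ev j).graph ⟶ (E.curve j).graph :=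
  E.res (topHom j) (map_topHom_comp_ofCone j)

theorem isHomOver_compare (j : toRPCC.obj σ ⟶ S) :
    IsHomOver (𝟙 σ) (E.curve j) (E.toMtrop.ev j) (E.compare j) := by
  refine isHomOver_iff.2 fun x => ?_
  rw [RPC.pullback_id]
  exact (len_pull _ _ _ _).trans ((E.isHomOver _ (map_topHom_comp_ofCone j)).len_ap x)

theorem evRes_compare (m : ρ ⟶ σ) {j' : toRPCC.obj ρ ⟶ S} {j : toRPCC.obj σ ⟶ S}
    (h : toRPCC.map m ≫ j = j') :
    E.toMtrop.evRes (j' := j') (j := j) m h ≫ E.compare j' = E.compare j ≫ E.res m h := by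
  obtain ⟨ψ, hψ, e⟩ := exists_mor_of_comp h
  have h1 : toRPCC.map (m ≫ topHom j) ≫ ofCone (topIdx j) (𝟙 _) = j' := by
    rw [Functor.map_comp, Category.assoc, map_topHom_comp_ofCone, h]
  have h2 : toRPCC.map (topHom j' ≫ ψ) ≫ ofCone (topIdx j) (𝟙 _) = j' := by rw [e]; exact h1
  have h3 : E.res (topHom j' ≫ ψ) h2 = E.res (m ≫ topHom j) h1 := by congr 1
  have h4 := E.res_comp (topHom j') ψ (map_topHom_comp_ofCone j') (map_mor_comp_ofCone hψ) h2
  have h5 := E.res_comp m (topHom j) h (map_topHom_comp_ofCone j) h1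
  rw [evRes_eq (X := E.toMtrop) (j' := j') (j := j) h hψ]
  exact (h4.symm.trans h3).trans h5

end ConeFamily

/-! ### The stack property -/

/-- The identity, as a morphism from a cone to the base of the pullback of a family to the cone. -/
def pullTop (X : Mtrop g n) (j : toRPCC.obj σ ⟶ X.base) : toRPCC.obj σ ⟶ (X.pull j).base :=
  𝟙 (toRPCC.obj σ)

/-- All morphisms `j` from cones belong to the sieve, so the datum `m` can be applied to the
pullback of `x` along `j`. As this pullback has the same value at the cone as `x`, the value of the
glued morphism at `j` is determined, and `exists_hom` assembles the values. -/
theorem existsUnique_hom_of_sieve (x y : Mtrop g n) (f : x.base ⟶ y.base) (S : Sieve x.base)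
    (hS : ∀ (σ : RPC) (j : toRPCC.obj σ ⟶ x.base), S j)
    (m : ∀ {z : Mtrop g n} (φ : z ⟶ x), S φ.base → (z ⟶ y))
    (hm : ∀ {z : Mtrop g n} (φ : z ⟶ x) (h : S φ.base), (m φ h).base = φ.base ≫ f)
    (hm' : ∀ {w z : Mtrop g n} (ψ : w ⟶ z) (φ : z ⟶ x) (h : S φ.base) (h' : S (ψ ≫ φ).base),
        m (ψ ≫ φ) h' = ψ ≫ m φ h) :
    ∃! k : x ⟶ y, k.base = f ∧ ∀ {z : Mtrop g n} (φ : z ⟶ x) (h : S φ.base), φ ≫ k = m φ h := by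
  have hmP : ∀ {σ : RPC} (j : toRPCC.obj σ ⟶ x.base), j ≫ f =
      x.pullTop j ≫ (m (x.pullHom j) (hS σ j)).base := fun j =>
    (hm (x.pullHom j) (hS _ j)).symm.trans (Category.id_comp _).symm
  let P : ∀ {σ : RPC} (j : toRPCC.obj σ ⟶ x.base), x.pull j ⟶ x := fun j => x.pullHom j
  let M : ∀ {σ : RPC} (j : toRPCC.obj σ ⟶ x.base), x.pull j ⟶ y := fun j => m (P j) (hS _ j)
  have hP : ∀ {σ : RPC} (j : toRPCC.obj σ ⟶ x.base),
      toRPCC.map (𝟙 σ) ≫ j = x.pullTop j ≫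
        (P j).base := fun j => by
    rw [CategoryTheory.Functor.map_id, Category.id_comp]; exact (Category.id_comp j).symm
  have hM : ∀ {σ : RPC} (j : toRPCC.obj σ ⟶ x.base),
      toRPCC.map (𝟙 σ) ≫ j ≫ f = x.pullTop j ≫
        (M j).base := fun j => by
    rw [CategoryTheory.Functor.map_id, Category.id_comp]; exact hmP j
  have hiso : ∀ {σ : RPC} (j : toRPCC.obj σ ⟶ x.base), IsIso (evMap (P j) (𝟙 σ) (hP j)) :=
    fun j => isIso_evMap _ _ _ (.id _)
  -- the comparison with a factorization of `j` through the sieve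
  have key : ∀ {ρ σ : RPC} {z : Mtrop g n} (φ : z ⟶ x) (hφ : S φ.base) (l : ρ ⟶ σ)
      (k : toRPCC.obj ρ ⟶ z.base) (j : toRPCC.obj σ ⟶ x.base)
      (h : toRPCC.map l ≫ j = k ≫ φ.base)
      (h' : toRPCC.map l ≫ j ≫ f = k ≫ (m φ hφ).base),
      (evMap (M j) (𝟙 σ) (hM j) ≫ inv (evMap (P j) (𝟙 σ) (hP j))) ≫ evMap φ l h =
        evMap (m φ hφ) l h' := by
    intro ρ σ z φ hφ l k j h h'
    -- The pullback of `x` along `k ≫ φ.base` maps to `z` and to the pullback along `j`.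
    -- Compatibility of `m` with these two morphisms `w` and `v` reduces the claim to this common
    -- refinement.
    obtain ⟨w, ⟨hw, hwφ⟩, -⟩ := existsUnique_lift φ (P (k ≫ φ.base)) k rfl
    obtain ⟨v, ⟨hv, hvφ⟩, -⟩ := existsUnique_lift (P j) (P (k ≫ φ.base)) (toRPCC.map l) h
    have hw1 : toRPCC.map (𝟙 ρ) ≫ k = x.pullTop (k ≫ φ.base) ≫ w.base := by
      rw [hw, CategoryTheory.Functor.map_id]; rfl
    have hv1 : toRPCC.map l ≫ x.pullTop j =
        x.pullTop (k ≫ φ.base) ≫ v.base := by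
      rw [hv]
      exact (Category.comp_id (toRPCC.map l)).trans (Category.id_comp (toRPCC.map l)).symm
    have : IsIso (evMap w (𝟙 ρ) hw1) := isIso_evMap _ _ _ (.id _)
    have h3 : toRPCC.map l ≫ j = x.pullTop (k ≫ φ.base) ≫ (P (k ≫ φ.base)).base :=
      h.trans (Category.id_comp (k ≫ φ.base)).symm
    have h4 : toRPCC.map l ≫ j ≫ f = x.pullTop (k ≫ φ.base) ≫ (M (k ≫ φ.base)).base := by
      rw [← Category.assoc, h]
      exact hmP _
    have hMw : w ≫ m φ hφ = M (k ≫ φ.base) := by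
      rw [← hm' w φ hφ (by rw [hwφ]; exact hS _ _)]
      congr 1
    have hMv : v ≫ M j = M (k ≫ φ.base) := by
      rw [← hm' v (P j) (hS _ j) (by rw [hvφ]; exact hS _ _)]
      congr 1
    rw [← cancel_mono (evMap w (𝟙 ρ) hw1), Category.assoc, Category.assoc,
      evMap_comp' hw1 h h3 hwφ (Category.id_comp _),
      evMap_comp' hw1 h' h4 hMw (Category.id_comp _),
      ← evMap_comp' hv1 (hP j) h3 hvφ (Category.comp_id _), IsIso.inv_hom_id_assoc]
    exact evMap_comp' hv1 (hM j) h4 hMv (Category.comp_id _)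
  obtain ⟨q, hq, hqK⟩ := exists_hom x y f
    (fun {σ} j => evMap (M j) (𝟙 σ) (hM j) ≫ inv (evMap (P j) (𝟙 σ) (hP j))) (fun {σ} j => by
      have := (isHomOver_evMap (P j) (𝟙 σ) (hP j)).inv.comp (isHomOver_evMap (M j) (𝟙 σ) (hM j))
      rwa [Category.id_comp] at this) (fun {ρ σ} l j' j h h' => by
      have h1 : toRPCC.map l ≫ j = x.pullTop j' ≫ (P j').base := h.trans (Category.id_comp j').symm
      have h2 : toRPCC.map l ≫ j ≫ f = x.pullTop j' ≫ (M j').base := by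
        rw [h']
        exact hmP _
      have h5 : toRPCC.map l ≫ j = j' ≫ Hom.base (𝟙 x) := h.trans (Category.comp_id j').symm
      have h6 : toRPCC.map l ≫ j ≫ f = (j' ≫ f) ≫ Hom.base (𝟙 y) :=
        h'.trans (Category.comp_id _).symm
      have e1 : x.evRes l h = evMap (𝟙 x) l h5 := rfl
      have e2 : y.evRes l h' = evMap (𝟙 y) l h6 := rfl
      rw [e1, e2, ← cancel_mono (evMap (P j') (𝟙 ρ) (hP j'))]
      simp only [Category.assoc, IsIso.inv_hom_id, Category.comp_id]
      rw [evMap_comp' (hP j') h5 h1 (Category.comp_id _) (Category.id_comp _),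
        evMap_comp' (hM j') h6 h2 (Category.comp_id _) (Category.id_comp _),
        ← key (P j') (hS _ j') l _ j h1 h2, Category.assoc])
  refine ⟨q, ⟨hq, fun {z} φ hφ => hom_ext_evMap ?_ ?_⟩, ?_⟩
  · rw [hm, comp_base, hq]
  · intro σ j u hu hu'
    obtain rfl : u = (j ≫ φ.base) ≫ f := by
      rw [hm, ← Category.assoc] at hu'
      simpa using hu'
    have h1 : toRPCC.map (𝟙 σ) ≫ (j ≫ φ.base) ≫ f = (j ≫ φ.base) ≫ q.base := by rw [hq]; simp
    have h2 : toRPCC.map (𝟙 σ) ≫ j ≫ φ.base = j ≫ φ.base := by simp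
    rw [← evMap_comp' h2 h1 hu rfl (Category.comp_id _), hqK, key φ hφ (𝟙 σ) j _ h2 hu']
  · rintro q' ⟨hq', hqm⟩
    refine hom_ext_evMap (hq'.trans hq.symm) ?_
    intro σ j u hu hu'
    obtain rfl : u = j ≫ f := by
      rw [hq] at hu'
      simpa using hu'
    rw [hqK, ← cancel_mono (evMap (P j) (𝟙 σ) (hP j)), Category.assoc, IsIso.inv_hom_id,
      Category.comp_id]
    exact evMap_comp' (hP j) hu (hM j) (hqm _ _) (Category.comp_id _)

end Mtrop

end Trop

end

/-! ### Effectivity of descent, and restriction to cones -/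

noncomputable section

namespace Trop

variable {g n : ℕ}

open StableGraph TropCurve

namespace Mtrop

open RPCC
open RPC (toRPCC)

variable {X Y Z : Mtrop g n} {ρ σ τ : RPC}

theorem comp_base_id {S : RPCC} (j : S ⟶ X.base) : j ≫ Hom.base (𝟙 X) = j := Category.comp_id j

theorem _root_.Trop.TropCurve.IsHomOver.congr {f f' : ρ ⟶ σ} {Γ : TropCurve g n ρ}
    {Γ' : TropCurve g n σ} {π : Γ'.graph ⟶ Γ.graph} (h : IsHomOver f Γ Γ' π) (hf : f = f') :
    IsHomOver f' Γ Γ' π := hf ▸ h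

section Descent

variable {U : RPCC} {S : Sieve U} (hS : ∀ (σ : RPC) (j : toRPCC.obj σ ⟶ U), S j)
  (D : S.arrows.category ⥤ Mtrop g n) (a : D ⋙ proj g n ≅ S.arrows.diagram)

/-- A morphism from a cone, as an object of a covering sieve. -/
def sieveObj (j : toRPCC.obj σ ⟶ U) : S.arrows.category := S.arrows.categoryMk j (hS σ j)

/-- The morphism to an object of a covering sieve given by a factorization. -/
def sieveHom (j : toRPCC.obj σ ⟶ U) (s : S.arrows.category) (k : toRPCC.obj σ ⟶ s.obj.left)
    (h : k ≫ s.obj.hom = j) : sieveObj hS j ⟶ s :=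
  ObjectProperty.homMk (Over.homMk k h)

theorem sieve_hom_ext {s t : S.arrows.category} {φ ψ : s ⟶ t}
    (h : φ.hom.left = ψ.hom.left) : φ = ψ :=
  InducedCategory.Hom.ext (Over.OverMorphism.ext h)

/-- The inverse of the given identification of the base of the descent datum. -/
def descInv (s : S.arrows.category) : s.obj.left ⟶ (D.obj s).base := a.inv.app s

/-- The given identification of the base of the descent datum. -/
def descHom (s : S.arrows.category) : (D.obj s).base ⟶ s.obj.left := a.hom.app s

theorem descHom_inv (s : S.arrows.category) : descHom D a s ≫ descInv D a s = 𝟙 _ :=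
  a.hom_inv_id_app s

theorem descInv_naturality {s t : S.arrows.category} (φ : s ⟶ t) :
    φ.hom.left ≫ descInv D a t = descInv D a s ≫ (D.map φ).base := a.inv.naturality φ

theorem descHom_naturality {s t : S.arrows.category} (φ : s ⟶ t) :
    (D.map φ).base ≫ descHom D a t = descHom D a s ≫ φ.hom.left := a.hom.naturality φ

/-- The family of tropical curves defined by a descent datum. -/
def descFamily : ConeFamily g n U where
  curve j := (D.obj (sieveObj hS j)).ev (descInv D a (sieveObj hS j))
  res m _ j h := evMap (D.map (sieveHom hS _ (sieveObj hS j) (toRPCC.map m) h)) m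
    (descInv_naturality D a (sieveHom hS _ (sieveObj hS j) (toRPCC.map m) h))
  isHomOver m _ _ _ := isHomOver_evMap _ m _
  res_id {σ j} h := by
    have h1 : D.map (sieveHom hS j (sieveObj hS j) (toRPCC.map (𝟙 σ)) h) = 𝟙 _ := by
      rw [← D.map_id]
      congr 1
      exact sieve_hom_ext (toRPCC.map_id σ)
    have h2 : toRPCC.map (𝟙 σ) ≫ descInv D a (sieveObj hS j) =
        descInv D a (sieveObj hS j) ≫ Hom.base (𝟙 (D.obj (sieveObj hS j))) := by
      rw [toRPCC.map_id, comp_base_id]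
      exact Category.id_comp _
    exact (evMap_congr h1 rfl _ h2).trans (evMap_id _ h2)
  res_comp m m' j₁ j₂ j₃ h h' h'' := by
    refine (evMap_comp' _ _ _ ?_ rfl).symm
    rw [← D.map_comp]
    congr 1
    exact sieve_hom_ext (toRPCC.map_comp m m').symm

/-- If the values of `Y` agree naturally with those of the descent datum at cones, then `Y` is its
gluing. Each cone mapping to the base of `D.obj s` also defines an object of the sieve, and the
functor `D` compares the two values; the comparison `L` is natural in `s` and in the cone. -/
theorem exists_descent_of_compare {Y : Mtrop g n} {S : Sieve Y.base}
    (hS : ∀ (σ : RPC) (j : toRPCC.obj σ ⟶ Y.base), S j) (D : S.arrows.category ⥤ Mtrop g n)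
    (a : D ⋙ proj g n ≅ S.arrows.diagram) (E : ConeFamily g n Y.base) (hE : E = descFamily hS D a)
    (compare : ∀ {σ : RPC} (j : toRPCC.obj σ ⟶ Y.base), (Y.ev j).graph ⟶ (E.curve j).graph)
    (hcompare : ∀ {σ : RPC} (j : toRPCC.obj σ ⟶ Y.base),
      IsHomOver (𝟙 σ) (E.curve j) (Y.ev j) (compare j))
    (hcompare' : ∀ {ρ σ : RPC} (m : ρ ⟶ σ) {j' : toRPCC.obj ρ ⟶ Y.base}
      {j : toRPCC.obj σ ⟶ Y.base} (h : toRPCC.map m ≫ j = j'),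
      Y.evRes m h ≫ compare j' = compare j ≫ E.res m h) :
    ∃ (c : ∀ s, D.obj s ⟶ Y), (∀ {s t} (h : s ⟶ t), D.map h ≫ c t = c s) ∧
      ∀ s, (c s).base = a.hom.app s ≫ s.obj.hom := by
  subst hE
  let E := descFamily hS D a
  have hinv : ∀ {σ : RPC} (s : S.arrows.category) (j : toRPCC.obj σ ⟶ (D.obj s).base)
      (u : toRPCC.obj σ ⟶ Y.base) (h : (j ≫ descHom D a s) ≫ s.obj.hom = u),
      toRPCC.map (𝟙 σ) ≫ j = descInv D a (sieveObj hS u) ≫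
        (D.map (sieveHom hS u s (j ≫ descHom D a s) h)).base := by
    intro σ s j u h
    rw [← descInv_naturality]
    refine Eq.trans ?_ (Category.assoc j (descHom D a s) (descInv D a s)).symm
    rw [descHom_inv]
    simp
  -- the comparison of the descent datum with the family
  let L : ∀ {σ : RPC} (s : S.arrows.category) (j : toRPCC.obj σ ⟶ (D.obj s).base)
      (u : toRPCC.obj σ ⟶ Y.base) (h : (j ≫ descHom D a s) ≫ s.obj.hom = u),
      ((D.obj s).ev j).graph ⟶ (E.curve u).graph := fun {σ} s j u h =>
    evMap (D.map (sieveHom hS u s (j ≫ descHom D a s) h)) (𝟙 σ) (hinv s j u h)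
  have hL : ∀ {σ : RPC} (s : S.arrows.category) (j : toRPCC.obj σ ⟶ (D.obj s).base)
      (u : toRPCC.obj σ ⟶ Y.base) (h : (j ≫ descHom D a s) ≫ s.obj.hom = u), IsIso (L s j u h) :=
    fun s j u h => isIso_evMap _ _ _ (.id _)
  have hLm : ∀ {ρ σ : RPC} (m : ρ ⟶ σ) (s t : S.arrows.category) (φ : s ⟶ t)
      (j : toRPCC.obj σ ⟶ (D.obj t).base) (j' : toRPCC.obj ρ ⟶ (D.obj s).base)
      (u : toRPCC.obj σ ⟶ Y.base) (u' : toRPCC.obj ρ ⟶ Y.base)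
      (h : (j ≫ descHom D a t) ≫ t.obj.hom = u) (h' : (j' ≫ descHom D a s) ≫ s.obj.hom = u')
      (hj : toRPCC.map m ≫ j = j' ≫ (D.map φ).base) (hu : toRPCC.map m ≫ u = u'),
      evMap (D.map φ) m hj ≫ L s j' u' h' = L t j u h ≫ E.res m hu := by
    intro ρ σ m s t φ j j' u u' h h' hj hu
    have h1 : toRPCC.map m ≫ j = descInv D a (sieveObj hS u') ≫
        (D.map (sieveHom hS u' s (j' ≫ descHom D a s) h' ≫ φ)).base := by
      have := hinv s j' u' h'
      rw [CategoryTheory.Functor.map_id, Category.id_comp] at this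
      rw [D.map_comp, comp_base, ← Category.assoc, ← this]
      exact hj
    refine (evMap_comp' _ _ h1 (D.map_comp _ _).symm (Category.id_comp _)).trans
      (evMap_comp' _ _ h1 ?_ (Category.comp_id _)).symm
    rw [← D.map_comp]
    congr 1
    refine sieve_hom_ext ?_
    change toRPCC.map m ≫ j ≫ descHom D a t = (j' ≫ descHom D a s) ≫ φ.hom.left
    rw [Category.assoc, ← descHom_naturality, ← Category.assoc, hj, Category.assoc]
  -- The morphism from `D.obj s` is prescribed at each cone: the comparison for `Y` followed by the
  -- inverse of `L`.
  have hbase : ∀ s, ∃ c : D.obj s ⟶ Y, c.base = descHom D a s ≫ s.obj.hom ∧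
      ∀ {σ : RPC} (j : toRPCC.obj σ ⟶ (D.obj s).base) (u : toRPCC.obj σ ⟶ Y.base)
        (h : (j ≫ descHom D a s) ≫ s.obj.hom = u)
        (hu : toRPCC.map (𝟙 σ) ≫ u = j ≫ c.base),
        evMap c (𝟙 σ) (j := u) hu ≫ L s j u h = compare u := by
    intro s
    have hs : ∀ {σ : RPC} (j : toRPCC.obj σ ⟶ (D.obj s).base),
        (j ≫ descHom D a s) ≫ s.obj.hom = j ≫ descHom D a s ≫ s.obj.hom :=
      fun j => Category.assoc _ _ _
    obtain ⟨c, hc, hc'⟩ := exists_hom (D.obj s) Y (descHom D a s ≫ s.obj.hom)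
      (fun {σ} j => compare (j ≫ descHom D a s ≫ s.obj.hom) ≫ inv (L s j _ (hs j)))
      (fun {σ} j => by
        have h1 : IsHomOver (𝟙 σ) _ _ (L s j _ (hs j)) := isHomOver_evMap _ _ _
        have h2 := h1.inv.comp (hcompare (j ≫ descHom D a s ≫ s.obj.hom))
        rwa [Category.id_comp] at h2) (fun {ρ σ} m j' j h h' => by
        rw [← cancel_mono (L s j' _ (hs j'))]
        simp only [Category.assoc, IsIso.inv_hom_id, Category.comp_id]
        have hj : toRPCC.map m ≫ j = j' ≫ (D.map (𝟙 s)).base := by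
          rw [h, D.map_id]; exact (Category.comp_id j').symm
        have h3 := hLm m s s (𝟙 s) j j' _ _ (hs j) (hs j') hj h'
        have h4 : evMap (D.map (𝟙 s)) m hj = (D.obj s).evRes m h :=
          evMap_congr (D.map_id s) rfl _ (h.trans (Category.comp_id j').symm)
        rw [h4] at h3
        rw [h3, IsIso.inv_hom_id_assoc]
        exact hcompare' m h')
    refine ⟨c, hc, fun {σ} j u h hu => ?_⟩
    obtain rfl : u = j ≫ descHom D a s ≫ s.obj.hom := by rw [← h, Category.assoc]
    rw [hc' j hu, Category.assoc, IsIso.inv_hom_id, Category.comp_id]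
  choose c hc hcL using hbase
  refine ⟨c, fun {s t} φ => ?_, fun s => ?_⟩
  · have hb : (D.map φ ≫ c t).base = (c s).base := by
      rw [comp_base, hc, hc, ← Category.assoc, descHom_naturality, Category.assoc]
      congr 1
      exact Over.w φ.hom
    refine hom_ext_evMap hb fun {σ} j u hu hu' => ?_
    have h1 : toRPCC.map (𝟙 σ) ≫ j ≫ (D.map φ).base = j ≫ (D.map φ).base := by simp
    have h2 : toRPCC.map (𝟙 σ) ≫ u = (j ≫ (D.map φ).base) ≫ (c t).base := by
      rw [hu, comp_base, Category.assoc]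
    have h3 : (j ≫ descHom D a s) ≫ s.obj.hom = u := by
      rw [hc] at hu'
      simpa using hu'.symm
    have h4 : ((j ≫ (D.map φ).base) ≫ descHom D a t) ≫ t.obj.hom = u := by
      rw [hc] at h2
      simpa using h2.symm
    have h5 : toRPCC.map (𝟙 σ) ≫ u = u := by simp
    rw [← cancel_mono (L s j u h3), hcL s j u h3 hu', ← evMap_comp' h1 h2 hu rfl
      (Category.comp_id _), Category.assoc, hLm (𝟙 σ) s t φ _ j u u h4 h3 h1 h5, E.res_id,
      Category.comp_id, hcL]
  · exact hc s

/-- All morphisms from cones are objects of the sieve. The values of `D` at them form a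
`ConeFamily`, whose associated family is the gluing. -/
theorem exists_descent (hS : ∀ (σ : RPC) (j : toRPCC.obj σ ⟶ U), S j)
    (D : S.arrows.category ⥤ Mtrop g n) (a : D ⋙ proj g n ≅ S.arrows.diagram) :
    ∃ (x : Mtrop g n) (e : x.base ≅ U) (c : ∀ s, D.obj s ⟶ x),
    (∀ {s t} (h : s ⟶ t), D.map h ≫ c t = c s) ∧
      ∀ s, (c s).base ≫ e.hom = a.hom.app s ≫ s.obj.hom := by
  let E := descFamily hS D a
  obtain ⟨c, hc, hc'⟩ := exists_descent_of_compare (Y := E.toMtrop) (S := S) hS D a E rfl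
    (fun j => E.compare j) (fun j => E.isHomOver_compare j) fun m _ _ h => E.evRes_compare m h
  exact ⟨E.toMtrop, Iso.refl U, c, hc, fun s => (Category.comp_id (c s).base).trans (hc' s)⟩

end Descent

theorem isStack : IsStack faceTopology (proj g n) where
  fibered := isFiberedInGroupoids
  existsUnique_hom x y f S hS m hm hm' := existsUnique_hom_of_sieve x y f S hS m hm hm'
  exists_obj _ _ hS D a := exists_descent hS D a

/-! ### Restriction to cones -/

/-- The restriction of the moduli stack to cones. -/
def restriction (g n : ℕ) :
    Limits.CategoricalPullback toRPCC (proj g n) ⥤ MtropRPC g n where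
  obj z := ⟨z.fst, z.snd.ev z.iso.hom⟩
  map F := (⟨F.fst, evMap F.snd F.fst F.w, isHomOver_evMap _ _ _⟩ : MtropRPC.Hom _ _)
  map_id _ := MtropRPC.Hom.ext rfl (evMap_id _ _)
  map_comp _ _ := MtropRPC.Hom.ext rfl (evMap_comp _ _ _ _ _ _ _)

/-- The morphism of cones given by a morphism of complexes. -/
theorem exists_map_comp_iso {S : RPCC} (e : toRPCC.obj σ ≅ S) (j : toRPCC.obj ρ ⟶ S) :
    ∃ m : ρ ⟶ σ, toRPCC.map m ≫ e.hom = j :=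
  ⟨toRPCCPreimage (j ≫ e.inv), by rw [map_toRPCCPreimage]; simp⟩

/-- Faithfulness of the restriction: since `toRPCC` is full, every morphism from a cone to the base
factors through `i`, so the value at `i` determines all others. -/
theorem eq_of_evMap_eq (i : toRPCC.obj σ ≅ X.base) (i' : toRPCC.obj τ ≅ Y.base) {b : σ ⟶ τ}
    {q q' : X ⟶ Y} (h : toRPCC.map b ≫ i'.hom = i.hom ≫ q.base)
    (h' : toRPCC.map b ≫ i'.hom = i.hom ≫ q'.base) (he : evMap q b h = evMap q' b h') : q = q' := by
  refine hom_ext_evMap ?_ ?_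
  · rw [← cancel_epi i.hom, ← h, h']
  · intro σ j u hu hu'
    obtain ⟨m, rfl⟩ := exists_map_comp_iso i j
    have e1 : toRPCC.map m ≫ i.hom = (toRPCC.map m ≫ i.hom) ≫ Hom.base (𝟙 X) :=
      (comp_base_id _).symm
    have e2 : toRPCC.map (m ≫ b) ≫ i'.hom = (toRPCC.map m ≫ i.hom) ≫ q.base := by
      rw [Functor.map_comp, Category.assoc, h, Category.assoc]
    have e3 : toRPCC.map (m ≫ b) ≫ i'.hom = (toRPCC.map m ≫ i.hom) ≫ q'.base := by
      rw [Functor.map_comp, Category.assoc, h', Category.assoc]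
    have e4 : toRPCC.map (m ≫ b) ≫ i'.hom = u ≫ Hom.base (𝟙 Y) := by
      rw [e2, ← hu, comp_base_id, CategoryTheory.Functor.map_id, Category.id_comp]
    have k1 := evMap_comp' e1 h e2 (Category.id_comp _) rfl
    have k2 := evMap_comp' e1 h' e3 (Category.id_comp _) rfl
    have k3 := evMap_comp' hu e4 e2 (Category.comp_id _) (Category.id_comp _)
    have k4 := evMap_comp' hu' e4 e3 (Category.comp_id _) (Category.id_comp _)
    rw [← cancel_epi (evMap (𝟙 _) (m ≫ b) e4), k3, ← k1, he, k2, ← k4]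

/-- Fullness of the restriction: restricting `π` along the factorizations through `i` gives a
candidate at every morphism from a cone, and cancelling epimorphisms shows that the candidates are
natural. -/
theorem exists_evMap_eq (i : toRPCC.obj σ ≅ X.base) (i' : toRPCC.obj τ ≅ Y.base) (b : σ ⟶ τ)
    (π : (Y.ev i'.hom).graph ⟶ (X.ev i.hom).graph)
    (hπ : IsHomOver b (X.ev i.hom) (Y.ev i'.hom) π) :
    ∃ (q : X ⟶ Y) (h : toRPCC.map b ≫ i'.hom = i.hom ≫ q.base), evMap q b h = π := by
  let f : X.base ⟶ Y.base := i.inv ≫ toRPCC.map b ≫ i'.hom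
  have hif : i.hom ≫ f = toRPCC.map b ≫ i'.hom := by simp [f]
  choose m hm using fun (σ : RPC) (j : toRPCC.obj σ ⟶ X.base) => exists_map_comp_iso i j
  have hY : ∀ {σ : RPC} (j : toRPCC.obj σ ⟶ X.base),
      toRPCC.map (m σ j ≫ b) ≫ i'.hom = j ≫ f := fun {σ} j => by
    rw [Functor.map_comp, Category.assoc, ← hif, ← Category.assoc, hm]
  choose K hK hK' using fun (σ : RPC) (j : toRPCC.obj σ ⟶ X.base) =>
    (isHomOver_evRes (hY j)).exists_lift ((isHomOver_evRes (hm σ j)).comp hπ)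
      (Category.id_comp _)
  obtain ⟨q, hq, hqK⟩ := exists_hom X Y f (fun {σ} j => K σ j) (fun {σ} j => hK' σ j)
    (fun {ρ σ} l j' j h h' => by
      have hl : m ρ j' = l ≫ m σ j := by
        apply toRPCC_injective
        rw [← cancel_mono i.hom, hm, Functor.map_comp, Category.assoc, hm, h]
      have e1 : toRPCC.map (l ≫ m σ j ≫ b) ≫ i'.hom = j' ≫ f := by
        rw [← Category.assoc, ← hl]; exact hY j'
      have e2 : toRPCC.map (l ≫ m σ j) ≫ i.hom = j' := by rw [← hl]; exact hm ρ j'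
      have k1 : Y.evRes (m ρ j' ≫ b) (hY j') = Y.evRes (l ≫ m σ j ≫ b) e1 := by
        congr 1; rw [hl, Category.assoc]
      have k2 : X.evRes (m ρ j') (hm ρ j') = X.evRes (l ≫ m σ j) e2 := by
        congr 1
      rw [← cancel_epi (Y.evRes _ (hY j)), ← Category.assoc, ← evRes_comp _ _ h' (hY j) e1, ← k1,
        hK, k2, evRes_comp _ _ h (hm σ j) e2, ← Category.assoc, ← hK, Category.assoc])
  have hw : toRPCC.map b ≫ i'.hom = i.hom ≫ q.base := by rw [hq, hif]
  refine ⟨q, hw, ?_⟩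
  have h1 : m _ i.hom = 𝟙 _ := by
    apply toRPCC_injective
    rw [← cancel_mono i.hom, hm]
    simp
  have e1 : toRPCC.map (𝟙 _) ≫ i.hom ≫ f = i.hom ≫ q.base := by rw [hq]; simp
  have e2 : toRPCC.map (m _ i.hom ≫ b) ≫ i'.hom = (i.hom ≫ f) ≫ Hom.base (𝟙 Y) :=
    (hY i.hom).trans (comp_base_id _).symm
  rw [← evMap_comp' e1 e2 hw (Category.comp_id _) (by rw [h1]; simp), hqK]
  have h3 := hK _ i.hom
  have e3 : toRPCC.map (𝟙 _) ≫ i.hom = i.hom := by simp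
  have h4 : X.evRes (m _ i.hom) (hm _ i.hom) = 𝟙 _ := by
    rw [← evRes_id i.hom e3]
    congr 1
  rw [h4, Category.comp_id] at h3
  exact h3

instance : (restriction g n).Faithful where
  map_injective {z z'} F F' h := by
    obtain ⟨b, q, hq⟩ := F
    obtain ⟨b', q', hq'⟩ := F'
    obtain rfl : b = b' := congrArg MtropRPC.Hom.base h
    obtain rfl : q = q' := eq_of_evMap_eq z.iso z'.iso hq hq' (congrArg MtropRPC.Hom.graph h)
    rfl

instance : (restriction g n).Full where
  map_surjective {z z'} K := by
    obtain ⟨q, h, hq⟩ := exists_evMap_eq z.iso z'.iso K.base K.graph K.isHomOver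
    exact ⟨⟨K.base, q, h⟩, MtropRPC.Hom.ext rfl hq⟩

/-- A tropical curve over a cone defines a family over its faces. -/
theorem exists_coneFamily (Γ : TropCurve g n σ) :
    ∃ (E : ConeFamily g n (toRPCC.obj σ)), ∀ j : toRPCC.obj σ ⟶ toRPCC.obj σ,
      toRPCCPreimage j = 𝟙 σ → ∃ π : Γ.graph ⟶ (E.curve j).graph,
        IsHomOver (𝟙 σ) (E.curve j) Γ π := by
  -- Pullbacks are chosen independently for all morphisms from cones. The transition maps are the
  -- unique lifts, so they are functorial.
  choose C π hπ using fun (ρ : RPC) (j : toRPCC.obj ρ ⟶ toRPCC.obj σ) =>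
    exists_isHomOver (toRPCCPreimage j) Γ
  have hm : ∀ {ρ τ : RPC} (m : ρ ⟶ τ) {j' : toRPCC.obj ρ ⟶ toRPCC.obj σ}
      {j : toRPCC.obj τ ⟶ toRPCC.obj σ}, toRPCC.map m ≫ j = j' →
      m ≫ toRPCCPreimage j = toRPCCPreimage j' := by
    intro ρ τ m j' j h
    apply toRPCC_injective
    rw [Functor.map_comp, map_toRPCCPreimage, map_toRPCCPreimage, h]
  choose R hR hR' using fun (ρ τ : RPC) (m : ρ ⟶ τ) (j' : toRPCC.obj ρ ⟶ toRPCC.obj σ)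
    (j : toRPCC.obj τ ⟶ toRPCC.obj σ) (h : toRPCC.map m ≫ j = j') =>
      (hπ τ j).exists_lift (hπ ρ j') (hm m h)
  refine ⟨⟨fun j => C _ j, fun m j' j h => R _ _ m j' j h, fun m j' j h => hR' _ _ m j' j h,
    fun h => ?_, fun m m' j₁ j₂ j₃ h h' h'' => ?_⟩, fun j hj => ?_⟩
  · rw [← cancel_epi (π _ _), hR, Category.comp_id]
  · rw [← cancel_epi (π _ j₃), ← Category.assoc, hR, hR, hR]
  · have := hπ σ j
    rw [hj] at this
    exact ⟨_, this⟩

instance : (restriction g n).EssSurj where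
  mem_essImage := by
    rintro ⟨σ, Γ⟩
    obtain ⟨E, hE⟩ := exists_coneFamily Γ
    obtain ⟨π, hπ⟩ := hE (𝟙 _)
      (toRPCC_injective (by rw [map_toRPCCPreimage, CategoryTheory.Functor.map_id]))
    let u : (⟨σ, E.curve (𝟙 _)⟩ : MtropRPC g n) ⟶ ⟨σ, Γ⟩ := (⟨𝟙 σ, π, hπ⟩ : MtropRPC.Hom _ _)
    let v : (⟨σ, E.curve (𝟙 _)⟩ : MtropRPC g n) ⟶
        (restriction g n).obj ⟨σ, E.toMtrop, Iso.refl _⟩ :=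
      (⟨𝟙 σ, E.compare _, E.isHomOver_compare _⟩ : MtropRPC.Hom _ _)
    have hu : IsIso u := by
      have : IsIso ((MtropRPC.proj g n).map u) := inferInstanceAs (IsIso (𝟙 σ))
      exact MtropRPC.isFiberedInGroupoids.isIso u
    have hv : IsIso v := by
      have : IsIso ((MtropRPC.proj g n).map v) := inferInstanceAs (IsIso (𝟙 σ))
      exact MtropRPC.isFiberedInGroupoids.isIso v
    exact ⟨_, ⟨(asIso v).symm ≪≫ asIso u⟩⟩

instance : (restriction g n).IsEquivalence where

theorem exists_restriction_equivalence :
    ∃ (E : Limits.CategoricalPullback toRPCC (proj g n) ≌ MtropRPC g n)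
      (c : E.functor ⋙ MtropRPC.proj g n ≅ Limits.CategoricalPullback.π₁ toRPCC (proj g n)),
      ∀ z, IsPullback (τ := z.fst) z.snd (c.hom.app z) z.iso.hom (E.functor.obj z).curve :=
  ⟨(restriction g n).asEquivalence, NatIso.ofComponents (fun z => Iso.refl z.fst) (fun F => by
    simp only [Iso.refl_hom]
    exact (Category.comp_id _).trans (Category.id_comp _).symm), fun z => ⟨𝟙 _,
      (isHomOver_pull _ _ (interior_topHom z.iso.hom)).congr (Category.id_comp _).symm⟩⟩

end Mtrop

end Trop

end

/-! ### Equalizers, coproducts, and spaces of isomorphisms -/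

noncomputable section

namespace Trop

namespace RPCC

open RPC (Interior sublatticeι interior_sublatticeι)

variable {S T : RPCC} {ρ : RPC}

theorem exists_mor_of_factor {α α' β} {g : ρ ⟶ S.cone α} {g' : ρ ⟶ S.cone α'}
    {φ : S.cone α ⟶ S.cone β} {φ' : S.cone α' ⟶ S.cone β} (hg : Interior g) (hg' : Interior g')
    (hφ : φ ∈ S.mor α β) (hφ' : φ' ∈ S.mor α' β) (h : g ≫ φ = g' ≫ φ') :
    ∃ χ ∈ S.mor α α', g ≫ χ = g' := by
  have := factor_unique hg hg' hφ hφ' h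
  obtain rfl : α = α' := congrArg Sigma.fst this
  obtain rfl : g = g' := congrArg Prod.fst (eq_of_heq (Sigma.mk.inj this).2)
  exact ⟨_, S.id_mem _, Category.comp_id _⟩

/-- Equality of components, expressed by a face morphism so that no transport along an equality of
indices is needed. -/
theorem exists_mor_of_eq {f g : T ⟶ S} (h : f = g) (α) :
    ∃ χ ∈ S.mor (f.idx α) (g.idx α), f.hom α ≫ χ = g.hom α := by
  subst h
  exact ⟨_, S.id_mem _, Category.comp_id _⟩

theorem SectionData.idx_ext {D : SectionData S} {p q : D.complex.Idx}
    (h : (⟨p.1, p.2.1⟩ : Σ α, D.I α) = ⟨q.1, q.2.1⟩) : p = q := by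
  obtain ⟨α, i, hi⟩ := p
  obtain ⟨α', i', hi'⟩ := q
  cases h
  rfl

/-- The section data that define the equalizer of two morphisms. -/
def equalizerData (f g : T ⟶ S) : SectionData T where
  -- At most one choice. It replaces the equation `f.idx α = g.idx α`: where the section meets the
  -- interior, agreement after composition with `χ` forces this equation.
  I α := {χ // χ ∈ S.mor (f.idx α) (g.idx α)}
  K {α} χ := LinearMap.eqLocus (f.hom α ≫ χ.1).lin (g.hom α).lin
  R _ _ _ := True
  R_id _ := trivial
  R_comp _ _ := trivial
  R_unique _ _ := Subtype.ext (S.mor_subsingleton _ _ (Subtype.prop _) (Subtype.prop _))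
  mem_K_iff {γ α φ hφ χ χ'} _ m := by
    obtain ⟨ψ, hψ, e⟩ := f.exists_mor φ hφ
    obtain ⟨ψ', hψ', e'⟩ := g.exists_mor φ hφ
    have h : ψ ≫ χ'.1 = χ.1 ≫ ψ' :=
      S.mor_subsingleton _ _ (S.comp_mem hψ χ'.2) (S.comp_mem χ.2 hψ')
    have h1 : (f.hom α ≫ χ'.1).lin (φ.lin m) = ψ'.lin ((f.hom γ ≫ χ.1).lin m) := by
      change (φ ≫ f.hom α ≫ χ'.1).lin m = ((f.hom γ ≫ χ.1) ≫ ψ').lin m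
      rw [← Category.assoc, e, Category.assoc, h, Category.assoc]
    have h2 : (g.hom α).lin (φ.lin m) = ψ'.lin ((g.hom γ).lin m) := by
      change (φ ≫ g.hom α).lin m = (g.hom γ ≫ ψ').lin m
      rw [e']
    rw [LinearMap.mem_eqLocus, LinearMap.mem_eqLocus, h1, h2]
    exact ((S.isFaceMorphism hψ').injective.eq_iff).symm
  exists_R {γ α φ} hφ χ hm := by
    obtain ⟨ψ, hψ, e⟩ := f.exists_mor φ hφ
    obtain ⟨ψ', hψ', e'⟩ := g.exists_mor φ hφ
    -- On the section of the face, both sides are interior morphisms followed by face morphisms.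
    -- Uniqueness of such factorizations supplies the comparison over `γ`.
    have h : (sublatticeι hm ≫ f.hom γ) ≫ ψ ≫ χ.1 = (sublatticeι hm ≫ g.hom γ) ≫ ψ' := by
      rw [Category.assoc, Category.assoc, ← e', ← Category.assoc (f.hom γ), ← e]
      exact RPC.hom_ext fun m => m.2
    obtain ⟨χ', hχ', -⟩ := exists_mor_of_factor ((interior_sublatticeι hm).comp (f.interior γ))
      ((interior_sublatticeι hm).comp (g.interior γ)) (S.comp_mem hψ χ.2) hψ' h
    exact ⟨⟨χ', hχ'⟩, trivial⟩

/-- Needed for the diagonals of representable sheaves and of sheaves that are representable over a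
geometric space. -/
theorem exists_equalizer (f g : T ⟶ S) : ∃ (E : RPCC) (e : E ⟶ T), e ≫ f = e ≫ g ∧
    ∀ {T' : RPCC} (t : T' ⟶ T), t ≫ f = t ≫ g → ∃! h, h ≫ e = t := by
  let D := equalizerData f g
  refine ⟨D.complex, D.proj, hom_ext fun p => ?_, fun {T'} t ht => ?_⟩
  · have h : ∀ f : T ⟶ S, ofCone p (𝟙 (D.complex.cone p)) ≫ D.proj ≫ f =
        ofCone (f.idx p.1) (sublatticeι p.2.2 ≫ f.hom p.1) := fun f => by
      rw [ofCone_comp, Category.id_comp]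
      rfl
    rw [h, h, ← ofCone_mor _ p.2.1.2, Category.assoc]
    congr 1
    exact RPC.hom_ext fun m => m.2
  · choose χ hχ e using exists_mor_of_eq ht
    refine ⟨SectionData.lift (D := D) t (fun β => ⟨χ β, hχ β⟩) (fun β m => ?_)
      (fun _ _ _ _ _ => trivial), rfl, fun h hh => SectionData.proj_ext D hh fun β => ?_⟩
    · have := e β
      exact congrArg (fun k : T'.cone β ⟶ _ => k.lin m) ((Category.assoc _ _ _).symm.trans this)
    · have h1 : (h.idx β).1 = t.idx β := congrArg (fun k : T' ⟶ T => k.idx β) hh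
      have aux : ∀ {α α'} (h : α = α') (i : D.I α) (i' : D.I α'),
          (⟨α, i⟩ : Σ α, D.I α) = ⟨α', i'⟩ := by
        rintro α _ rfl i i'
        rw [Subtype.ext (S.mor_subsingleton _ _ i.2 i'.2)]
      exact SectionData.idx_ext (aux h1 _ _)

/-! ### Coproducts -/

/-- The face morphisms of a coproduct of cone complexes. -/
inductive SigmaMor {I : Type} (S : I → RPCC) :
    ∀ p q : (Σ i, (S i).Idx), ((S p.1).cone p.2 ⟶ (S q.1).cone q.2) → Prop
  | mk {i : I} {α β : (S i).Idx} (φ : (S i).cone α ⟶ (S i).cone β) (hφ : φ ∈ (S i).mor α β) :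
    SigmaMor S ⟨i, α⟩ ⟨i, β⟩ φ

/-- The coproduct of cone complexes. -/
def sigma {I : Type} (S : I → RPCC) : RPCC where
  Idx := Σ i, (S i).Idx
  cone p := (S p.1).cone p.2
  mor p q := {φ | SigmaMor S p q φ}
  isFaceMorphism := by
    rintro _ _ _ ⟨φ, hφ⟩
    exact (S _).isFaceMorphism hφ
  id_mem p := .mk _ ((S p.1).id_mem p.2)
  comp_mem := by
    rintro _ _ _ _ _ ⟨φ, hφ⟩ ⟨ψ, hψ⟩
    exact .mk _ ((S _).comp_mem hφ hψ)
  face_unique := by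
    rintro ⟨i, β⟩ F hF
    obtain ⟨⟨α, φ⟩, ⟨h1, h2⟩, hu⟩ := (S i).face_unique β F hF
    refine ⟨⟨⟨i, α⟩, φ⟩, ⟨.mk _ h1, h2⟩, ?_⟩
    rintro ⟨⟨i', α'⟩, φ'⟩ ⟨h1', h2'⟩
    cases h1' with
    | mk φ' hφ' => cases hu ⟨α', φ'⟩ ⟨hφ', h2'⟩; rfl
  mor_subsingleton := by
    rintro ⟨i, α⟩ ⟨i', β⟩ φ hφ ψ hψ
    cases hφ with
    | mk φ hφ =>
      cases hψ with
      | mk ψ hψ => exact (S i).mor_subsingleton _ _ hφ hψ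

/-- The inclusions into the coproduct. -/
def sigmaι {I : Type} (S : I → RPCC) (i : I) : S i ⟶ sigma S :=
  (⟨fun α => ⟨i, α⟩, fun α => 𝟙 ((S i).cone α), fun _ => .id _, fun φ hφ =>
    ⟨φ, .mk φ hφ, (Category.comp_id φ).trans (Category.id_comp φ).symm⟩⟩ : Hom (S i) (sigma S))

/-- A morphism from a coproduct. -/
def sigmaDesc {I : Type} {S : I → RPCC} (f : ∀ i, S i ⟶ T) : sigma S ⟶ T :=
  (⟨fun p => (f p.1).idx p.2, fun p => (f p.1).hom p.2, fun p => (f p.1).interior p.2, by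
    rintro _ _ _ ⟨φ, hφ⟩
    exact (f _).exists_mor φ hφ⟩ : Hom (sigma S) T)

theorem sigmaι_desc {I : Type} {S : I → RPCC} (f : ∀ i, S i ⟶ T) (i : I) :
    sigmaι S i ≫ sigmaDesc f = f i :=
  Hom.ext' (fun _ => rfl) fun _ => heq_of_eq (Category.id_comp _)

theorem sigma_hom_ext {I : Type} {S : I → RPCC} {f g : sigma S ⟶ T}
    (h : ∀ i, sigmaι S i ≫ f = sigmaι S i ≫ g) : f = g := by
  refine Hom.ext' (fun p => congrArg (fun k : S p.1 ⟶ T => k.idx p.2) (h p.1)) fun p => ?_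
  have h1 : HEq ((sigmaι S p.1 ≫ f).hom p.2) ((sigmaι S p.1 ≫ g).hom p.2) := by rw [h]
  have h2 : ∀ f : sigma S ⟶ T, (sigmaι S p.1 ≫ f).hom p.2 = f.hom p := fun f => Category.id_comp _
  rwa [h2, h2] at h1

theorem isColimit_sigma {I : Type} (S : I → RPCC) :
    Nonempty (Limits.IsColimit (Limits.Cofan.mk (sigma S) (sigmaι S))) :=
  ⟨Limits.Cofan.IsColimit.mk _ (fun s => sigmaDesc s.inj) (fun s i => sigmaι_desc s.inj i)
    fun s _ hm => sigma_hom_ext fun i => (hm i).trans (sigmaι_desc s.inj i).symm⟩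

end RPCC

variable {g n : ℕ}

open StableGraph TropCurve RPCC

namespace Mtrop

open RPC (toRPCC)

variable {X Y Z : Mtrop g n}

/-- The sublattice on which the edge lengths of two tropical curves, whose graphs are identified,
are equal. -/
def isomLattice (f : X.base ⟶ Y.base) {α}
    (π : (Y.curve (f.idx α)).graph ⟶ (X.curve α).graph) : Submodule ℤ (X.base.cone α).N :=
  ⨅ x, LinearMap.eqLocus (RPC.pullback (f.hom α) ((Y.curve (f.idx α)).len x)).1
    ((X.curve α).len (ap π x)).1

theorem mem_isomLattice {f : X.base ⟶ Y.base} {α}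
    {π : (Y.curve (f.idx α)).graph ⟶ (X.curve α).graph} {m : (X.base.cone α).N} :
    m ∈ isomLattice f π ↔ ∀ x, (RPC.pullback (f.hom α) ((Y.curve (f.idx α)).len x)).1 m =
      ((X.curve α).len (ap π x)).1 m := by
  simp only [isomLattice, Submodule.mem_iInf, LinearMap.mem_eqLocus]

/-- The section data that define the space of isomorphisms over a morphism. -/
def isomData (X Y : Mtrop g n) (f : X.base ⟶ Y.base) : SectionData X.base where
  I α := {π : (Y.curve (f.idx α)).graph ⟶ (X.curve α).graph // IsIso π}
  K π := isomLattice f π.1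
  -- There is exactly one such `ψ`, so the quantifier is neither vacuous nor restrictive.
  R {γ α φ} hφ i j := ∀ (ψ : Y.base.cone (f.idx γ) ⟶ Y.base.cone (f.idx α))
    (hψ : ψ ∈ Y.base.mor (f.idx γ) (f.idx α)), Y.res ψ hψ ≫ i.1 = j.1 ≫ X.res φ hφ
  R_id i ψ hψ := by rw [res_eq_id, res_eq_id, Category.id_comp, Category.comp_id]
  R_comp {α β γ φ ψ hφ hψ i j k} h1 h2 χ hχ := by
    obtain ⟨φ', hφ', -⟩ := f.exists_mor φ hφ
    obtain ⟨ψ', hψ', -⟩ := f.exists_mor ψ hψ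
    rw [Y.res_eq_comp φ' hφ' ψ' hψ' χ hχ, X.res_eq_comp φ hφ ψ hψ, Category.assoc, h1 φ' hφ',
      ← Category.assoc, h2 ψ' hψ', Category.assoc]
  R_unique {γ α φ hφ i i' j} h1 h2 := by
    obtain ⟨ψ, hψ, -⟩ := f.exists_mor φ hφ
    apply Subtype.ext
    rw [← cancel_epi (Y.res ψ hψ), h1 ψ hψ, h2 ψ hψ]
  mem_K_iff {γ α φ hφ i j} h m := by
    obtain ⟨ψ, hψ, e⟩ := f.exists_mor φ hφ
    have h' := h ψ hψ
    have key : ∀ x, (RPC.pullback (f.hom γ) ((Y.curve (f.idx γ)).len (ap (Y.res ψ hψ) x))).1 m =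
          ((X.curve γ).len (ap i.1 (ap (Y.res ψ hψ) x))).1 m ↔
        (RPC.pullback (f.hom α) ((Y.curve (f.idx α)).len x)).1 (φ.lin m) =
          ((X.curve α).len (ap j.1 x)).1 (φ.lin m) := by
      intro x
      rw [← (Y.res_isHomOver ψ hψ).len_ap, ← ap_comp, h', ap_comp,
        ← (X.res_isHomOver φ hφ).len_ap, ← RPC.pullback_comp, ← e, RPC.pullback_comp]
      rfl
    rw [mem_isomLattice, mem_isomLattice]
    refine ⟨fun H x => (key x).1 (H _), fun H y => ?_⟩
    obtain ⟨x, rfl⟩ := ap_surjective (Y.res ψ hψ) y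
    exact (key x).2 (H x)
  exists_R {γ α φ} hφ j hm := by
    obtain ⟨ψ, hψ, e⟩ := f.exists_mor φ hφ
    have hj := j.2
    have hι := RPC.interior_sublatticeι hm
    -- Corresponding lengths agree on the section of the face. The section meets the interior of the
    -- face, so one length vanishes on the face exactly when the other does. Hence both restriction
    -- maps contract the same edges, and `j` descends to an isomorphism over the face.
    have hK : ∀ x, RPC.pullback (RPC.sublatticeι hm) (RPC.pullback (f.hom γ)
        (RPC.pullback ψ ((Y.curve (f.idx α)).len x))) =
        RPC.pullback (RPC.sublatticeι hm) (RPC.pullback φ ((X.curve α).len (ap j.1 x))) := by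
      intro x
      rw [← RPC.pullback_comp (f.hom γ), ← e, RPC.pullback_comp]
      refine Subtype.ext (LinearMap.ext fun m => ?_)
      have h1 : φ.lin m.1 ∈ isomLattice f j.1 := m.2
      exact mem_isomLattice.1 h1 x
    have hv : ∀ x, (Y.curve (f.idx γ)).graph.graph.IsVertex (ap (Y.res ψ hψ) x) ↔
        (X.curve γ).graph.graph.IsVertex (ap (j.1 ≫ X.res φ hφ) x) := by
      intro x
      have h1 : RPC.pullback ψ ((Y.curve (f.idx α)).len x) = 0 ↔
          RPC.pullback φ ((X.curve α).len (ap j.1 x)) = 0 := by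
        constructor
        · intro h
          have := hK x
          rw [h, map_zero, map_zero] at this
          exact hι.pullback_eq_zero this.symm
        · intro h
          have := hK x
          rw [h, map_zero] at this
          exact (f.interior γ).pullback_eq_zero (hι.pullback_eq_zero this)
      have h2 : (Y.curve (f.idx α)).graph.graph.IsVertex x ↔
          (X.curve α).graph.graph.IsVertex (ap j.1 x) :=
        ⟨isVertex_ap j.1, isVertex_of_isIso j.1⟩
      have h3 : (Y.curve (f.idx α)).graph.graph.inv x = x ↔
          (X.curve α).graph.graph.inv (ap j.1 x) = ap j.1 x := by
        rw [← ap_inv]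
        exact ⟨congrArg _, fun h => by
          have := congrArg (ap (inv j.1)) h
          rwa [← ap_comp, ← ap_comp, IsIso.hom_inv_id] at this⟩
      rw [ap_comp, (Y.res_isHomOver ψ hψ).isVertex_iff, (X.res_isHomOver φ hφ).isVertex_iff, h1, h2]
      simp only [ne_eq, h3]
    obtain ⟨i, hi⟩ := exists_factor (Y.res ψ hψ) (j.1 ≫ X.res φ hφ) fun x => (hv x).1
    have : IsIso i := isIso_of_isVertex i fun y hy => by
      obtain ⟨x, rfl⟩ := ap_surjective (Y.res ψ hψ) y
      rw [hv, ← hi]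
      exact hy
    refine ⟨⟨i, this⟩, fun ψ' hψ' => ?_⟩
    obtain rfl : ψ' = ψ := Y.base.mor_subsingleton _ _ hψ' hψ
    exact hi

theorem graph_congr {p q : X ⟶ Y} (h : p = q) (α) :
    (⟨p.base.idx α, p.graph α⟩ : Σ i, (Y.curve i).graph ⟶ (X.curve α).graph) =
      ⟨q.base.idx α, q.graph α⟩ := by rw [h]

/-- The isomorphisms over a given morphism between the bases are representable. -/
theorem exists_isom (X Y : Mtrop g n) (f : X.base ⟶ Y.base) :
    ∃ (Z : Mtrop g n) (e : Z ⟶ X) (k : Z ⟶ Y), k.base = e.base ≫ f ∧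
      ∀ {Z' : Mtrop g n} (e' : Z' ⟶ X) (k' : Z' ⟶ Y), k'.base = e'.base ≫ f →
        ∃! h : Z' ⟶ Z, h ≫ e = e' ∧ h ≫ k = k' := by
  let D := isomData X Y f
  let k : X.pull D.proj ⟶ Y := (⟨D.proj ≫ f, fun p => p.2.1.1, fun p => isHomOver_iff.2 fun x => by
      refine Eq.trans ?_ (len_pull (X.curve p.1) (RPC.sublatticeι p.2.2)
        (RPC.interior_sublatticeι p.2.2) (ap p.2.1.1 x)).symm
      refine (RPC.pullback_comp (RPC.sublatticeι p.2.2) (f.hom p.1) _).trans ?_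
      refine Subtype.ext (LinearMap.ext fun m => ?_)
      have h1 : m.1 ∈ isomLattice f p.2.1.1 := m.2
      exact mem_isomLattice.1 h1 x,
    fun {p q} χ hχ ψ hψ => by
      obtain ⟨φ, hφ, hR, -⟩ := id hχ
      rw [pull_res X D.proj χ hχ φ hφ]
      exact (hR ψ hψ).symm⟩ : Hom (X.pull D.proj) Y)
  refine ⟨X.pull D.proj, X.pullHom D.proj, k, rfl, fun {Z'} e' k' hk => ?_⟩
  obtain ⟨b, kg, hkg, hkn⟩ := k'
  change b = _ at hk
  subst hk
  have hiso : ∀ β, IsIso (e'.graph β) := fun β => (e'.isHomOver β).isIso (e'.base.interior β)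
  have hiso' : ∀ β, IsIso (kg β) := fun β => (hkg β).isIso (Hom.interior _ β)
  -- Over an interior morphism all graph maps are invertible, so the pair `e'`, `k'` amounts to a
  -- graph isomorphism on each cone. The cone lies in the sublattice of that isomorphism because
  -- both maps preserve lengths.
  let l : Z'.base ⟶ D.complex := SectionData.lift (D := D) e'.base
    (fun β => ⟨kg β ≫ inv (e'.graph β), inferInstance⟩) (fun β m => by
      refine mem_isomLattice.2 fun x => ?_
      have h1 := (hkg β).len_ap x
      have h2 := (e'.isHomOver β).len_ap (ap (kg β ≫ inv (e'.graph β)) x)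
      rw [← ap_comp, Category.assoc, IsIso.inv_hom_id, Category.comp_id, ← h1] at h2
      have h3 : (e'.base ≫ f).hom β = e'.base.hom β ≫ f.hom _ := rfl
      rw [h3, RPC.pullback_comp] at h2
      exact congrArg (fun u : (Z'.base.cone β).dualMonoid => u.1 m) h2.symm)
    (fun {β β'} φ hφ ψ hψ _ χ hχ => by
      rw [← cancel_mono (e'.graph β)]
      simp only [Category.assoc, IsIso.inv_hom_id, Category.comp_id]
      rw [← e'.naturality φ hφ ψ hψ, IsIso.inv_hom_id_assoc]
      exact (hkn φ hφ χ hχ).symm)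
  obtain ⟨h, ⟨hl, he⟩, -⟩ := existsUnique_lift (X.pullHom D.proj) e' l rfl
  refine ⟨h, ⟨he, ?_⟩, ?_⟩
  · obtain ⟨hb, hg, hh, hn⟩ := h
    change hb = l at hl
    subst hl
    refine hom_mk_ext fun β => ?_
    have h1 := graph_congr he β
    have h2 : hg β = e'.graph β :=
      (Category.id_comp (hg β)).symm.trans (eq_of_heq (Sigma.mk.inj h1).2)
    change (kg β ≫ inv (e'.graph β)) ≫ hg β = kg β
    rw [h2, Category.assoc, IsIso.inv_hom_id, Category.comp_id]
  · rintro h' ⟨he', hk'⟩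
    have hk : h' ≫ k = h ≫ k := by
      rw [hk']
      obtain ⟨hb, hg, hh, hn⟩ := h
      change hb = l at hl
      subst hl
      refine hom_mk_ext fun β => ?_
      have h1 := graph_congr he β
      have h2 : hg β = e'.graph β :=
        (Category.id_comp (hg β)).symm.trans (eq_of_heq (Sigma.mk.inj h1).2)
      change kg β = (kg β ≫ inv (e'.graph β)) ≫ hg β
      rw [h2, Category.assoc, IsIso.inv_hom_id, Category.comp_id]
    refine (isFiberedInGroupoids.cancel (X.pullHom D.proj) (he'.trans he.symm)
      (SectionData.proj_ext D ?_ fun β => SectionData.idx_ext ?_) : h' = h)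
    · exact congrArg Hom.base (he'.trans he.symm)
    · have h1 := graph_congr (he'.trans he.symm) β
      have h2 := graph_congr hk β
      have hi := (h'.isHomOver β).isIso (h'.base.interior β)
      -- The cone `α` is read off from the composition with the projection, and the isomorphism from
      -- the composition with `k`, by cancelling the invertible graph map `u`.
      have aux : ∀ {α α' : X.base.Idx} {G : StableGraph g n}
          (π : {π : (Y.curve (f.idx α)).graph ⟶ (X.curve α).graph // IsIso π})
          (π' : {π : (Y.curve (f.idx α')).graph ⟶ (X.curve α').graph // IsIso π})
          (u : (X.curve α).graph ⟶ G) (u' : (X.curve α').graph ⟶ G), IsIso u →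
          (⟨α, u⟩ : Σ i, (X.curve i).graph ⟶ G) = ⟨α', u'⟩ →
          (⟨f.idx α, π.1 ≫ u⟩ : Σ i, (Y.curve i).graph ⟶ G) = ⟨f.idx α', π'.1 ≫ u'⟩ →
          (⟨α, π⟩ : Σ α, D.I α) = ⟨α', π'⟩ := by
        intro α α' G π π' u u' hu e1 e2
        cases e1
        have e3 := eq_of_heq (Sigma.mk.inj e2).2
        rw [cancel_mono] at e3
        rw [Subtype.ext e3]
      exact aux (h'.base.idx β).2.1 (h.base.idx β).2.1 (h'.graph β) (h.graph β) hi
        (by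
          have e1 : (h' ≫ X.pullHom D.proj).graph β = h'.graph β := Category.id_comp (h'.graph β)
          have e2 : (h ≫ X.pullHom D.proj).graph β = h.graph β := Category.id_comp (h.graph β)
          rw [e1, e2] at h1
          exact h1) h2

end Mtrop

end Trop

end

/-! ### The atlas of orthants and its product with a family -/

noncomputable section

namespace Trop

variable {g n : ℕ}

open StableGraph TropCurve RPCC
open RPC (toRPCC)

/-! ### Markings by a family of graphs -/

section Marking

variable {I : Type} (G : I → StableGraph g n)

/-- A morphism to a graph from a graph of a given family. -/
abbrev Marking (H : StableGraph g n) : Type := Σ i, (G i ⟶ H)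

namespace Marking

variable {G} {H K L : StableGraph g n}

/-- The composition of a marking with a morphism. -/
def map (ρ : H ⟶ K) (μ : Marking G H) : Marking G K := ⟨μ.1, μ.2 ≫ ρ⟩

theorem map_id (μ : Marking G H) : map (𝟙 H) μ = μ := by
  simp [map]

theorem map_map (ρ : H ⟶ K) (ρ' : K ⟶ L) (μ : Marking G H) :
    map ρ' (map ρ μ) = map (ρ ≫ ρ') μ := by
  simp [map]

theorem eq_of_map_eq {ρ ρ' : H ⟶ K} {μ : Marking G H} (h : map ρ μ = map ρ' μ) : ρ = ρ' := by
  have := eq_of_heq (Sigma.mk.inj h).2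
  rwa [cancel_epi] at this

end Marking

end Marking

/-! ### Tropical curves as pullbacks of tautological curves -/

/-- A morphism of complexes is a covering if cones can be lifted along it. -/
theorem RPCC.isLocallySurjective {S T : RPCC} {f : S ⟶ T}
    (h : ∀ {σ : RPC} (j : toRPCC.obj σ ⟶ T), ∃ k, k ≫ f = j) :
    Presheaf.IsLocallySurjective faceTopology (yoneda.map f) where
  imageSieve_mem s _ j := h (j ≫ s)

namespace TropCurve

variable {ρ σ : RPC} {G : StableGraph g n}

/-- The length of `e` in the tautological curve is the coordinate at `e`. So the coordinate of `f`
at `e` has to be the length of the image of `e`, which is zero if `e` is contracted. -/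
theorem isHomOver_tautological_iff {Γ : TropCurve g n σ} {f : σ ⟶ orthant G.Edge}
    {π : G ⟶ Γ.graph} : IsHomOver f Γ (tautological G) π ↔
      ∀ (e : G.Edge) (x : G.graph.X), e.1 = s(x, G.graph.inv x) →
        ∀ m, (show G.Edge → ℤ from f.lin m) e = (Γ.len (ap π x)).1 m := by
  refine (isHomOver_iff (Γ' := tautological G)).trans ?_
  have key : ∀ (e : G.Edge) (x : G.graph.X), e.1 = s(x, G.graph.inv x) → ∀ m,
      (RPC.pullback f ((tautological G).len x)).1 m = (show G.Edge → ℤ from f.lin m) e := by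
    rintro ⟨_, he⟩ x rfl m
    have hx : G.graph.inv x ≠ x := by
      obtain ⟨y, hy, h⟩ := he
      rcases Sym2.eq_iff.1 h with ⟨h1, -⟩ | ⟨h1, -⟩
      · rwa [h1]
      · rw [h1, WeightedGraph.inv_inv]; exact hy.symm
    rw [len_of_ne (tautological G) hx]
    rfl
  constructor
  · intro h e x he m
    rw [← key e x he m]
    exact congrArg (fun u : σ.dualMonoid => u.1 m) (h x)
  · intro h (x : G.graph.X)
    by_cases hx : G.graph.inv x = x
    · have h1 : (tautological G).len x = 0 := (tautological G).len_eq_zero_iff.2 hx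
      have h2 : Γ.len (ap π x) = 0 := Γ.len_eq_zero_iff.2 (by rw [← ap_inv, hx])
      rw [h1, map_zero]
      exact h2.symm
    · refine Subtype.ext (LinearMap.ext fun m => ?_)
      exact (key ⟨s(x, G.graph.inv x), x, hx, rfl⟩ x rfl m).trans (h _ x rfl m)

theorem eq_of_isHomOver_tautological {Γ : TropCurve g n σ} {f f' : σ ⟶ orthant G.Edge}
    {π : G ⟶ Γ.graph} (h : IsHomOver f Γ (tautological G) π)
    (h' : IsHomOver f' Γ (tautological G) π) : f = f' := by
  refine RPC.hom_ext fun m => ?_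
  change (show G.Edge → ℤ from f.lin m) = (show G.Edge → ℤ from f'.lin m)
  funext e
  obtain ⟨x, -, hx⟩ := e.2
  exact (isHomOver_tautological_iff.1 h e x hx m).trans
    (isHomOver_tautological_iff.1 h' e x hx m).symm

/-- A morphism to an orthant is an arbitrary tuple of elements of the dual monoid, so the lengths of
the images of the edges define one; either flag of an edge gives the same length. Thus a morphism to
the orthant is no more data than the graph morphism `π`. -/
theorem exists_isHomOver_tautological (Γ : TropCurve g n σ) (π : G ⟶ Γ.graph) :
    ∃ f : σ ⟶ orthant G.Edge, IsHomOver f Γ (tautological G) π := by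
  choose x hx using fun e : G.Edge => e.2
  let l : σ.N →ₗ[ℤ] (G.Edge → ℤ) := LinearMap.pi fun e => (Γ.len (ap π (x e))).1
  refine ⟨⟨l, fun y hy e => ?_⟩, isHomOver_tautological_iff.2 fun e y he m => ?_⟩
  · have h1 : realExt (LinearMap.proj e) (l.baseChange ℝ y) =
        realExt ((LinearMap.proj e : (G.Edge → ℤ) →ₗ[ℤ] ℤ) ∘ₗ l) y := by
      simp [realExt, LinearMap.baseChange_comp]
    exact le_of_le_of_eq ((Γ.len (ap π (x e))).2 y hy) h1.symm
  · change (Γ.len (ap π (x e))).1 m = _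
    have h1 := (hx e).2.symm.trans he
    rcases Sym2.eq_iff.1 h1 with ⟨h2, -⟩ | ⟨h2, -⟩
    · rw [h2]
    · rw [h2, ap_inv, len_inv]

/-- The morphism to an orthant given by the lengths of the edges of a tropical curve. -/
def toOrthant (Γ : TropCurve g n σ) (π : G ⟶ Γ.graph) : σ ⟶ orthant G.Edge :=
  (Γ.exists_isHomOver_tautological π).choose

theorem isHomOver_toOrthant (Γ : TropCurve g n σ) (π : G ⟶ Γ.graph) :
    IsHomOver (Γ.toOrthant π) Γ (tautological G) π :=
  (Γ.exists_isHomOver_tautological π).choose_spec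

end TropCurve

namespace Mtrop

variable {I : Type} (G : I → StableGraph g n) {ρ σ : RPC}

/-- The coproduct of the orthants that belong to a family of graphs. -/
def atlas : RPCC := sigma fun i => toRPCC.obj (orthant (G i).Edge)

/-- The inclusions of the orthants. -/
def atlasι (i : I) : toRPCC.obj (orthant (G i).Edge) ⟶ atlas G :=
  sigmaι (fun i => toRPCC.obj (orthant (G i).Edge)) i

/-- The inclusion of a face into its orthant. -/
def atlasFace (p : (atlas G).Idx) : (atlas G).cone p ⟶ orthant (G p.1).Edge :=
  (orthant (G p.1).Edge).faceι p.2

variable {G}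

/-- Every cone of the atlas is a face of a single orthant, so morphisms from a cone to the atlas
come from morphisms to an orthant. -/
theorem ofCone_atlas (p : (atlas G).Idx) (h : σ ⟶ (atlas G).cone p) :
    ofCone p h = toRPCC.map (h ≫ atlasFace G p) ≫ atlasι G p.1 := by
  obtain ⟨i, F⟩ := p
  have h1 := ((repBy_id (orthant (G i).Edge)).precomp (h ≫ atlasFace G ⟨i, F⟩)).postcomp
    (atlasι G i)
  rw [Category.comp_id] at h1
  have hm : (orthant (G i).Edge).faceι F ≫ (orthant (G i).Edge).toTop ∈
      (toRPCC.obj (orthant (G i).Edge)).mor F (orthant (G i).Edge).topFace := by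
    change (_ ≫ _) ≫ _ = _
    rw [Category.assoc, RPC.toTop_faceι, Category.comp_id]
  have h2 := (repBy_ofCone (S := atlas G) ⟨i, F⟩ h).comp_mor (SigmaMor.mk _ hm)
  have h3 : (h ≫ atlasFace G ⟨i, F⟩) ≫ (orthant (G i).Edge).toTop =
      h ≫ (orthant (G i).Edge).faceι F ≫ (orthant (G i).Edge).toTop :=
    Category.assoc (W := σ) (X := (orthant (G i).Edge).ofFace F) _ _ _
  refine h2.unique ?_
  exact h3 ▸ h1

/-- The morphism to the atlas given by a marking of the graph of a tropical curve. -/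
def toAtlas (Γ : TropCurve g n σ) (μ : Marking G Γ.graph) : toRPCC.obj σ ⟶ atlas G :=
  toRPCC.map (Γ.toOrthant μ.2) ≫ atlasι G μ.1

/-- Lengths pull back to lengths, and a morphism to the orthant is determined by them. -/
theorem map_comp_toAtlas {Γ : TropCurve g n ρ} {Γ' : TropCurve g n σ} {f : ρ ⟶ σ}
    {π : Γ'.graph ⟶ Γ.graph} (h : IsHomOver f Γ Γ' π) (μ : Marking G Γ'.graph) :
    toRPCC.map f ≫ toAtlas Γ' μ = toAtlas Γ (μ.map π) := by
  have h1 : f ≫ Γ'.toOrthant μ.2 = Γ.toOrthant (μ.2 ≫ π) :=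
    eq_of_isHomOver_tautological (h.comp (Γ'.isHomOver_toOrthant μ.2)) (Γ.isHomOver_toOrthant _)
  change _ = toRPCC.map (Γ.toOrthant (μ.2 ≫ π)) ≫ atlasι G μ.1
  rw [← h1, Functor.map_comp, Category.assoc]
  rfl

theorem topHom_toAtlas (Γ : TropCurve g n σ) (μ : Marking G Γ.graph) :
    topHom (toAtlas Γ μ) ≫ atlasFace G (topIdx (toAtlas Γ μ)) = Γ.toOrthant μ.2 := by
  have h : ∀ {τ : RPC} (m : σ ⟶ τ), (σ.toTop ≫ RPC.faceMap m σ.topFace ≫ 𝟙 _) ≫ τ.faceι _ = m := by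
    intro τ m
    rw [Category.comp_id, Category.assoc, RPC.faceMap_faceι, ← Category.assoc, RPC.toTop_faceι,
      Category.id_comp]
  exact h _

variable (G)

/-- The tropical curves over the cones of the atlas. -/
def univCurve (p : (atlas G).Idx) : TropCurve g n ((atlas G).cone p) :=
  (exists_isHomOver (atlasFace G p) (tautological (G p.1))).choose

/-- The markings of the tropical curves over the cones of the atlas. -/
def univMarking (p : (atlas G).Idx) : Marking G (univCurve G p).graph :=
  ⟨p.1, (exists_isHomOver (atlasFace G p) (tautological (G p.1))).choose_spec.choose⟩

theorem isHomOver_univMarking (p : (atlas G).Idx) :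
    IsHomOver (atlasFace G p) (univCurve G p) (tautological (G p.1)) (univMarking G p).2 :=
  (exists_isHomOver (atlasFace G p) (tautological (G p.1))).choose_spec.choose_spec

theorem exists_univRes {p q : (atlas G).Idx} (φ : (atlas G).cone p ⟶ (atlas G).cone q)
    (hφ : φ ∈ (atlas G).mor p q) : ∃ R : (univCurve G q).graph ⟶ (univCurve G p).graph,
      (univMarking G q).map R = univMarking G p ∧
        IsHomOver φ (univCurve G p) (univCurve G q) R := by
  cases hφ with
  | mk φ hφ =>
    rename_i i F F'
    obtain ⟨R, hR, h⟩ := (isHomOver_univMarking G ⟨i, F'⟩).exists_lift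
      (isHomOver_univMarking G ⟨i, F⟩) (f := φ) hφ
    exact ⟨R, congrArg (Sigma.mk i) hR, h⟩

/-- The family of tropical curves over the atlas. -/
def univ : Mtrop g n where
  base := atlas G
  curve := univCurve G
  res φ hφ := (exists_univRes G φ hφ).choose
  res_isHomOver φ hφ := (exists_univRes G φ hφ).choose_spec.2
  -- A marking is an epimorphism, so graph morphisms out of a marked graph are determined by the
  -- image of the marking.
  res_id p := Marking.eq_of_map_eq (μ := univMarking G p) (by
    rw [(exists_univRes G _ ((atlas G).id_mem p)).choose_spec.1, Marking.map_id])
  res_comp {p q r} φ hφ ψ hψ := Marking.eq_of_map_eq (μ := univMarking G r) (by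
    rw [(exists_univRes G _ ((atlas G).comp_mem hφ hψ)).choose_spec.1, ← Marking.map_map,
      (exists_univRes G _ hψ).choose_spec.1, (exists_univRes G _ hφ).choose_spec.1])

theorem map_univ_res {p q : (atlas G).Idx} (φ : (atlas G).cone p ⟶ (atlas G).cone q)
    (hφ : φ ∈ (atlas G).mor p q) :
    (univMarking G q).map ((univ G).res φ hφ) = univMarking G p :=
  (exists_univRes G φ hφ).choose_spec.1

variable {G} {X Y : Mtrop g n}

/-- The markings of the tropical curves of a family defined by a morphism to the universal
family. -/
def homMarking (q : X ⟶ univ G) (β : X.base.Idx) : Marking G (X.curve β).graph :=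
  (univMarking G (q.base.idx β)).map (q.graph β)

theorem homMarking_res (q : X ⟶ univ G) {β β' : X.base.Idx} (φ : X.base.cone β ⟶ X.base.cone β')
    (hφ : φ ∈ X.base.mor β β') : (homMarking q β').map (X.res φ hφ) = homMarking q β := by
  obtain ⟨ψ, hψ, -⟩ := q.base.exists_mor φ hφ
  have h := map_univ_res G ψ hψ
  exact (Marking.map_map _ _ _).trans <|
    (congrArg (fun ρ => Marking.map ρ (univMarking G (q.base.idx β')))
      (q.naturality φ hφ ψ hψ)).trans <|
    (Marking.map_map _ _ _).symm.trans (congrArg (Marking.map (q.graph β)) h)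

theorem homMarking_comp (p : X ⟶ Y) (q : Y ⟶ univ G) (β : X.base.Idx) :
    homMarking (p ≫ q) β = (homMarking q (p.base.idx β)).map (p.graph β) :=
  (Marking.map_map _ _ _).symm

/-- The morphism of bases is recovered from the markings: its coordinates are the lengths of the
images of the edges. -/
theorem ofCone_comp_base (q : X ⟶ univ G) (β : X.base.Idx) :
    ofCone β (𝟙 _) ≫ q.base = toAtlas (X.curve β) (homMarking q β) := by
  have h1 : q.base.hom β ≫ atlasFace G (q.base.idx β) =
      (X.curve β).toOrthant (homMarking q β).2 :=
    eq_of_isHomOver_tautological ((q.isHomOver β).comp (isHomOver_univMarking G _))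
      (isHomOver_toOrthant _ _)
  rw [ofCone_comp, Category.id_comp]
  refine (ofCone_atlas (G := G) _ _).trans ?_
  rw [toAtlas, ← h1]
  rfl

/-- The markings determine the base morphism on each cone and then, being epimorphisms, the graph
maps. -/
theorem hom_univ_ext {q q' : X ⟶ univ G} (h : ∀ β, homMarking q β = homMarking q' β) : q = q' := by
  have hb : q.base = q'.base := RPCC.hom_ext fun β => by
    rw [ofCone_comp_base, ofCone_comp_base, h]
  obtain ⟨b, G, hG, hG'⟩ := q
  obtain ⟨b', G', _, _⟩ := q'
  change b = b' at hb
  subst hb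
  exact hom_mk_ext fun β => Marking.eq_of_map_eq (h β)

/-- A morphism to the universal family is given by a compatible system of markings. -/
theorem exists_hom_univ (X : Mtrop g n) (ν : ∀ β, Marking G (X.curve β).graph)
    (hν : ∀ {β β'} (φ : X.base.cone β ⟶ X.base.cone β') (hφ : φ ∈ X.base.mor β β'),
      (ν β').map (X.res φ hφ) = ν β) : ∃ q : X ⟶ univ G, ∀ β, homMarking q β = ν β := by
  let f : X.base ⟶ atlas G := glue (fun β => toAtlas (X.curve β) (ν β)) fun φ hφ => by
    rw [map_comp_toAtlas (X.res_isHomOver φ hφ), hν]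
  have hR : ∀ β, ∃ R : (univCurve G (f.idx β)).graph ⟶ (X.curve β).graph,
      (univMarking G (f.idx β)).map R = ν β ∧
        IsHomOver (f.hom β) (X.curve β) (univCurve G (f.idx β)) R := fun β => by
    obtain ⟨R, hR, h⟩ := (isHomOver_univMarking G (f.idx β)).exists_lift
      ((X.curve β).isHomOver_toOrthant (ν β).2) (topHom_toAtlas (X.curve β) (ν β))
    exact ⟨R, congrArg (Sigma.mk (ν β).1) hR, h⟩
  choose R hR hR' using hR
  refine ⟨⟨f, R, hR', fun {α β} φ hφ ψ hψ => ?_⟩, hR⟩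
  refine Marking.eq_of_map_eq (μ := univMarking G (f.idx β)) ?_
  exact (Marking.map_map (R β) (X.res φ hφ) (univMarking G (f.idx β))).symm.trans <|
    (congrArg (Marking.map (X.res φ hφ)) (hR β)).trans <| (hν φ hφ).trans <| (hR _).symm.trans <|
    (congrArg (Marking.map _) (map_univ_res G ψ hψ).symm).trans (Marking.map_map _ _ _)

/-! ### Products with the universal family -/

/-- The section data that define the product with the universal family. -/
def productData (G : I → StableGraph g n) (Y : Mtrop g n) : SectionData Y.base where
  I α := Marking G (Y.curve α).graph
  -- A marking determines a morphism to the atlas without any condition on lengths, so the sections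
  -- are full cones and the projection is strict.
  K _ := ⊤
  R {_ _ φ} hφ i j := j.map (Y.res φ hφ) = i
  R_id i := by rw [Y.res_id, Marking.map_id]
  R_comp {_ _ _ φ ψ hφ hψ i j k} h h' := by
    rw [Y.res_comp φ hφ ψ hψ, ← Marking.map_map, h', h]
  R_unique h h' := h.symm.trans h'
  mem_K_iff _ _ := by simp only [Submodule.mem_top]
  exists_R _ _ _ := ⟨_, rfl⟩

/-- A morphism to the universal family is a compatible system of markings. Given a morphism to `Y`,
markings can be moved to the curves of `Y` along the invertible graph maps, so the pair is a lift to
the complex of marked cones of `Y`. -/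
theorem exists_product (G : I → StableGraph g n) (hG : ∀ H, ∃ i, Nonempty (H ≅ G i))
    (Y : Mtrop g n) :
    ∃ (P : Mtrop g n) (a : P ⟶ univ G) (b : P ⟶ Y),
      (∀ {X : Mtrop g n} (a' : X ⟶ univ G) (b' : X ⟶ Y), ∃! h : X ⟶ P, h ≫ a = a' ∧ h ≫ b = b') ∧
      strict b.base ∧
      Presheaf.IsLocallySurjective faceTopology (yoneda.map b.base) := by
  let D := productData G Y
  obtain ⟨a, ha⟩ := exists_hom_univ (G := G) (Y.pull D.proj) (fun p => p.2.1) (by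
    rintro p q χ hχ
    obtain ⟨φ, hφ, hR, -⟩ := id hχ
    rw [pull_res Y D.proj χ hχ φ hφ]
    exact hR)
  refine ⟨Y.pull D.proj, a, Y.pullHom D.proj, fun {X} a' b' => ?_, D.strict_proj fun _ => rfl,
    RPCC.isLocallySurjective (f := D.proj) fun {σ} j => ?_⟩
  · have hka : ∀ (k : X ⟶ Y.pull D.proj), k ≫ a = a' → ∀ β : X.base.Idx,
        (k.base.idx β).2.1.map (k.graph β) = homMarking a' β := by
      rintro k rfl β
      exact (congrArg (Marking.map (k.graph β)) (ha _)).symm.trans (homMarking_comp k a β).symm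
    have hiso : ∀ β, IsIso (b'.graph β) := fun β => (b'.isHomOver β).isIso (b'.base.interior β)
    let l : X.base ⟶ D.complex := SectionData.lift (D := D) b'.base
      (fun β => (homMarking a' β).map (inv (b'.graph β))) (fun _ _ => Submodule.mem_top)
      (fun {β β'} φ hφ ψ hψ _ => by
        change Marking.map (Y.res ψ hψ) _ = _
        rw [← homMarking_res a' φ hφ, Marking.map_map, Marking.map_map]
        congr 1
        rw [IsIso.inv_comp_eq, ← Category.assoc, IsIso.eq_comp_inv]
        exact (b'.naturality φ hφ ψ hψ).symm)
    obtain ⟨h, ⟨hl, hb⟩, -⟩ := existsUnique_lift (Y.pullHom D.proj) b' l rfl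
    have hla : ∀ β, (h.base.idx β).2.1.map (h.graph β) = homMarking a' β := by
      obtain ⟨hb', hg, hh, hn⟩ := h
      change hb' = l at hl
      subst hl
      intro β
      have h1 := graph_congr hb β
      have h2 : hg β = b'.graph β :=
        (Category.id_comp (hg β)).symm.trans (eq_of_heq (Sigma.mk.inj h1).2)
      change ((homMarking a' β).map (inv (b'.graph β))).map (hg β) = _
      exact (Marking.map_map _ _ _).trans <| (congrArg (fun ρ => Marking.map ρ (homMarking a' β))
        ((congrArg (fun u => inv (b'.graph β) ≫ u) h2).trans (IsIso.inv_hom_id _))).trans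
        (Marking.map_id _)
    have hha : h ≫ a = a' := hom_univ_ext fun β => by
      rw [homMarking_comp, ha]
      exact hla β
    refine ⟨h, ⟨hha, hb⟩, ?_⟩
    rintro h' ⟨ha', hb'⟩
    refine (isFiberedInGroupoids.cancel (Y.pullHom D.proj) (hb'.trans hb.symm)
      (SectionData.proj_ext D ?_ fun β => SectionData.idx_ext ?_) : h' = h)
    · exact congrArg Hom.base (hb'.trans hb.symm)
    · have h1 := graph_congr (hb'.trans hb.symm) β
      have h2 : (h'.base.idx β).2.1.map (h'.graph β) = (h.base.idx β).2.1.map (h.graph β) := by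
        exact (hka h' ha' β).trans (hla β).symm
      have hi := (h'.isHomOver β).isIso (h'.base.interior β)
      have aux : ∀ {α α' : Y.base.Idx} {H : StableGraph g n} (μ : Marking G (Y.curve α).graph)
          (μ' : Marking G (Y.curve α').graph) (u : (Y.curve α).graph ⟶ H)
          (u' : (Y.curve α').graph ⟶ H), IsIso u →
          (⟨α, u⟩ : Σ i, (Y.curve i).graph ⟶ H) = ⟨α', u'⟩ → μ.map u = μ'.map u' →
          (⟨α, μ⟩ : Σ α, D.I α) = ⟨α', μ'⟩ := by
        intro α α' H μ μ' u u' hu e1 e2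
        cases e1
        have e3 := congrArg (Marking.map (inv u)) e2
        rw [Marking.map_map, Marking.map_map, IsIso.hom_inv_id, Marking.map_id,
          Marking.map_id] at e3
        rw [e3]
      have e1 : (h' ≫ Y.pullHom D.proj).graph β = h'.graph β := Category.id_comp (h'.graph β)
      have e2 : (h ≫ Y.pullHom D.proj).graph β = h.graph β := Category.id_comp (h.graph β)
      rw [e1, e2] at h1
      exact aux (h'.base.idx β).2.1 (h.base.idx β).2.1 (h'.graph β) (h.graph β) hi h1 h2
  -- The graph of the curve at the cone of `j` is isomorphic to some `G i`; this isomorphism is a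
  -- marking, and the corresponding cone maps isomorphically to the cone of `j`.
  · obtain ⟨i, ⟨e⟩⟩ := hG (Y.curve (topIdx j)).graph
    let p : D.complex.Idx := ⟨topIdx j, ⟨i, e.inv⟩, RPC.meetsInterior_top _⟩
    obtain ⟨r, -, hr⟩ := (D.strict_proj (fun _ => rfl) p).out
    refine ⟨ofCone (S := D.complex) p (topHom j ≫ r), ?_⟩
    have h1 : (topHom j ≫ r) ≫ D.proj.hom p = topHom j :=
      (Category.assoc _ _ _).trans ((congrArg (fun u => topHom j ≫ u) hr).trans
        (Category.comp_id _))
    exact (ofCone_comp (S := D.complex) p _ D.proj).trans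
      ((congrArg (ofCone (S := Y.base) (topIdx j)) h1).trans (ofCone_topHom j))

end Mtrop

end Trop

end

/-! ### Representability of fiber products over a fibered category -/

noncomputable section

namespace Trop

section Representable

open Limits Opposite

universe v u v₁ u₁

variable {C : Type u} [Category.{v} C] {𝒳 : Type u₁} [Category.{v₁} 𝒳]

/-- A category over `C` is represented by a presheaf `W` if its objects define elements of `W` in a
fully faithful and essentially surjective way. -/
theorem exists_representation (r : 𝒳 ⥤ C) (W : Cᵒᵖ ⥤ Type v) (w : ∀ z, yoneda.obj (r.obj z) ⟶ W)
    (hw : ∀ {z z'} (f : z ⟶ z'), yoneda.map (r.map f) ≫ w z' = w z)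
    (hf : ∀ {z z'} (m : r.obj z ⟶ r.obj z'), yoneda.map m ≫ w z' = w z →
      ∃! f : z ⟶ z', r.map f = m)
    (hs : ∀ T (t : yoneda.obj T ⟶ W), ∃ z, ∃ e : r.obj z ≅ T, w z = yoneda.map e.hom ≫ t) :
    ∃ ρ : Representation r W,
      ∀ z, (ρ.equiv.functor.obj z).hom = yoneda.map (ρ.comm.hom.app z) ≫ w z := by
  let Φ : 𝒳 ⥤ CostructuredArrow yoneda W :=
    { obj z := CostructuredArrow.mk (w z)
      map f := CostructuredArrow.homMk (r.map f) (hw f) }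
  have h1 : Φ.Faithful := ⟨fun {z z'} f f' h =>
    (hf (r.map f) (hw f)).unique rfl (congrArg CommaMorphism.left h).symm⟩
  have h2 : Φ.Full := ⟨fun {z z'} k => by
    obtain ⟨f, h, -⟩ := hf k.left (CostructuredArrow.w k)
    exact ⟨f, CostructuredArrow.hom_ext _ _ h⟩⟩
  have h3 : Φ.EssSurj := ⟨fun c => by
    obtain ⟨z, e, he⟩ := hs c.left c.hom
    exact ⟨z, ⟨CostructuredArrow.isoMk e he.symm⟩⟩⟩
  have h4 : Φ.IsEquivalence := {}
  refine ⟨⟨Φ.asEquivalence, NatIso.ofComponents (fun z => Iso.refl _) fun f => ?_⟩, fun z => ?_⟩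
  · exact (Category.comp_id _).trans (Category.id_comp _).symm
  · exact ((congrArg (fun u => u ≫ w z) (yoneda.map_id _)).trans (Category.id_comp (w z))).symm

/-- The morphism to a category fibered in groupoids that is defined by an object. -/
theorem IsFiberedInGroupoids.exists_overFunctor {p : 𝒳 ⥤ C} (hp : IsFiberedInGroupoids p) (ξ : 𝒳) :
    ∃ (F : OverFunctor (overProj (yoneda.obj (p.obj ξ))) p) (κ : ∀ u, F.functor.obj u ⟶ ξ),
      (∀ {u u'} (f : u ⟶ u'), F.functor.map f ≫ κ u' = κ u) ∧
        ∀ u, yoneda.map (p.map (κ u)) = yoneda.map (F.comm.hom.app u) ≫ u.hom := by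
  -- The Yoneda construction: choose a pullback of `ξ` for every `u`; uniqueness of lifts then
  -- provides the functor on morphisms.
  have H : ∀ u : CostructuredArrow yoneda (yoneda.obj (p.obj ξ)), ∃ (y : 𝒳) (φ : y ⟶ ξ)
      (e : p.obj y ≅ u.left), yoneda.map (p.map φ) = yoneda.map e.hom ≫ u.hom := fun u => by
    obtain ⟨f, hf⟩ := yoneda.map_surjective u.hom
    obtain ⟨y, φ, hφ⟩ := hp.exists_lift ξ f
    refine ⟨y, φ, eqToIso (IsHomLift.domain_eq p f φ), ?_⟩
    have h1 := IsHomLift.fac' p f φ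
    rw [← hf, ← Functor.map_comp]
    exact congrArg yoneda.map (by rw [h1]; simp)
  choose y φ e h using H
  have h' : ∀ {u u' : CostructuredArrow yoneda (yoneda.obj (p.obj ξ))} (m : u ⟶ u'),
      ((e u).hom ≫ m.left ≫ (e u').inv) ≫ p.map (φ u') =
      p.map (φ u) := fun {u u'} m => yoneda.map_injective (by
    rw [Functor.map_comp, Functor.map_comp, Functor.map_comp, h, h, ← CostructuredArrow.w m,
      Category.assoc, Category.assoc, ← Functor.map_comp_assoc yoneda (e u').inv, Iso.inv_hom_id,
      CategoryTheory.Functor.map_id, Category.id_comp])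
  choose m hm using fun (u u' : CostructuredArrow yoneda (yoneda.obj (p.obj ξ)))
    (m : u ⟶ u') => (hp.existsUnique (φ u') (φ u) _ (h' m)).exists
  let Φ : CostructuredArrow yoneda (yoneda.obj (p.obj ξ)) ⥤ 𝒳 :=
    { obj := y
      map {u u'} k := m u u' k
      map_id u := hp.cancel (φ u) (by rw [(hm _ _ _).2, Category.id_comp])
        (by rw [(hm _ _ _).1]; simp)
      map_comp {u u' u''} k l := hp.cancel (φ u'')
        (by rw [(hm _ _ _).2, Category.assoc, (hm _ _ _).2, (hm _ _ _).2])
        (by rw [(hm _ _ _).1, Functor.map_comp, (hm _ _ _).1, (hm _ _ _).1]; simp) }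
  refine ⟨⟨Φ, NatIso.ofComponents e fun {u u'} k => ?_⟩, φ, fun k => (hm _ _ k).2, h⟩
  change p.map (m u u' k) ≫ _ = _
  rw [(hm _ _ _).1, Category.assoc, Category.assoc]
  exact congrArg (fun x => (e u).hom ≫ x)
    ((congrArg (fun x => k.left ≫ x) (e u').inv_hom_id).trans (Category.comp_id _))

/-- A morphism from a representable presheaf to a category fibered in groupoids is a covering in
`P` if this holds for the projections from the products with the corresponding object. -/
theorem IsFiberedInGroupoids.isRepresentableCoveringIn {J : GrothendieckTopology C}
    {P : MorphismProperty C} [P.RespectsIso] {p : 𝒳 ⥤ C} (hp : IsFiberedInGroupoids p) {ξ : 𝒳}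
    (F : OverFunctor (overProj (yoneda.obj (p.obj ξ))) p) (κ : ∀ u, F.functor.obj u ⟶ ξ)
    (hκ : ∀ {u u'} (f : u ⟶ u'), F.functor.map f ≫ κ u' = κ u)
    (hκ' : ∀ u, yoneda.map (p.map (κ u)) = yoneda.map (F.comm.hom.app u) ≫ u.hom)
    (hprod : ∀ η : 𝒳, ∃ (X : 𝒳) (a : X ⟶ ξ) (b : X ⟶ η),
      (∀ {z : 𝒳} (a' : z ⟶ ξ) (b' : z ⟶ η), ∃! h : z ⟶ X, h ≫ a = a' ∧ h ≫ b = b') ∧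
        P (p.map b) ∧ Presheaf.IsLocallySurjective J (yoneda.map (p.map b))) :
    IsRepresentableCoveringIn J P F := by
  intro S G
  let s₀ : CostructuredArrow yoneda (yoneda.obj S) := CostructuredArrow.mk (𝟙 _)
  obtain ⟨X, a, b, hX, hb, hb'⟩ := hprod (G.functor.obj s₀)
  let τ : ∀ v : CostructuredArrow yoneda (yoneda.obj S), v ⟶ s₀ := fun v =>
    CostructuredArrow.homMk (yoneda.preimage v.hom) (by simp [s₀])
  have hτ : ∀ v, yoneda.map (τ v).left = v.hom := fun v => yoneda.map_preimage v.hom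
  have hτ' : ∀ {v v'} (f : v ⟶ v'), f ≫ τ v' = τ v := fun {v v'} f =>
    CostructuredArrow.hom_ext _ _ (yoneda.map_injective (by
      rw [Comma.comp_left, Functor.map_comp, hτ, hτ, CostructuredArrow.w]))
  have hG : ∀ {v v' : CostructuredArrow yoneda (yoneda.obj S)} (f : v ⟶ v'),
      p.map (G.functor.map f) ≫ G.comm.hom.app v' = G.comm.hom.app v ≫ f.left := fun f =>
    G.comm.hom.naturality f
  have hF : ∀ {u u' : CostructuredArrow yoneda (yoneda.obj (p.obj ξ))} (f : u ⟶ u'),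
      p.map (F.functor.map f) ≫ F.comm.hom.app u' = F.comm.hom.app u ≫ f.left := fun f =>
    F.comm.hom.naturality f
  let cG : ∀ v, p.obj (G.functor.obj v) ≅ v.left := fun v => G.comm.app v
  let cF : ∀ v, p.obj (F.functor.obj v) ≅ v.left := fun v => F.comm.app v
  replace hG : ∀ {v v' : CostructuredArrow yoneda (yoneda.obj S)} (f : v ⟶ v'),
      p.map (G.functor.map f) ≫ (cG v').hom = (cG v).hom ≫ f.left := hG
  replace hF : ∀ {v v' : CostructuredArrow yoneda (yoneda.obj (p.obj ξ))} (f : v ⟶ v'),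
      p.map (F.functor.map f) ≫ (cF v').hom = (cF v).hom ≫ f.left := hF
  replace hκ' : ∀ u, yoneda.map (p.map (κ u)) = yoneda.map (cF u).hom ≫ u.hom := hκ'
  -- A point of the fiber product gives morphisms from `G.functor.obj z.snd` to `ξ` and to
  -- `G.functor.obj s₀`, hence one to their product `X`. Its image in the base is the point of the
  -- representing object.
  choose h hha hhb using fun z : CategoricalPullback F.functor G.functor =>
    (hX (z.iso.inv ≫ κ z.fst) (G.functor.map (τ z.snd))).exists
  have hu : ∀ {y : 𝒳} (k k' : y ⟶ X), k ≫ a = k' ≫ a → k ≫ b = k' ≫ b → k = k' :=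
    fun k k' h1 h2 => (hX (k' ≫ a) (k' ≫ b)).unique ⟨h1, h2⟩ ⟨rfl, rfl⟩
  have hn : ∀ {z z' : CategoricalPullback F.functor G.functor} (f : z ⟶ z'),
      G.functor.map f.snd ≫ h z' = h z := fun {z z'} f => hu _ _
    (by rw [Category.assoc, hha, hha, CategoricalPullback.Hom.w'_assoc, hκ])
    (by rw [Category.assoc, hhb, hhb, ← Functor.map_comp, hτ'])
  have hpb : ∀ z : CategoricalPullback F.functor G.functor,
      (cG z.snd).inv ≫ p.map (h z) ≫ p.map b ≫ (cG s₀).hom = (τ z.snd).left := fun z => by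
    rw [← Functor.map_comp_assoc, hhb, hG, Iso.inv_hom_id_assoc]
  let w : ∀ z, (fiberProductProj F G).obj z ⟶ p.obj X := fun z => (cG z.snd).inv ≫ p.map (h z)
  have hpw : ∀ z, w z ≫ p.map b ≫ (cG s₀).hom = (τ z.snd).left := fun z =>
    (Category.assoc _ _ _).trans (hpb z)
  suffices H : ∃ ρ : Representation (fiberProductProj F G) (yoneda.obj (p.obj X)),
      ∀ z, (ρ.equiv.functor.obj z).hom = yoneda.map (ρ.comm.hom.app z) ≫ yoneda.map (w z) by
    obtain ⟨ρ, hρ⟩ := H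
    refine ⟨p.obj X, ρ, p.map b ≫ (cG s₀).hom, fun z => ?_, ?_, ?_⟩
    · rw [hρ]
      refine (Category.assoc _ _ _).trans (congrArg (fun u => yoneda.map (ρ.comm.hom.app z) ≫ u) ?_)
      exact (yoneda.map_comp _ _).symm.trans ((congrArg yoneda.map (hpw z)).trans (hτ z.snd))
    · rw [Functor.map_comp]
      infer_instance
    · exact MorphismProperty.RespectsIso.postcomp P _ _ hb
  refine exists_representation _ _ _ ?_ ?_ ?_
  · intro z z' f
    rw [← Functor.map_comp]
    refine congrArg yoneda.map ?_
    change f.snd.left ≫ (cG z'.snd).inv ≫ p.map (h z') = (cG z.snd).inv ≫ p.map (h z)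
    rw [← hn f, Functor.map_comp, Iso.eq_inv_comp, ← Category.assoc, ← hG]
    simp
  -- Full faithfulness: `m` determines the component over `S`. Carried over by the isomorphisms of
  -- `z` and `z'` it commutes with the maps to `ξ`, and therefore determines the other component.
  · intro z z' m hm
    rw [← Functor.map_comp] at hm
    replace hm := yoneda.map_injective hm
    change z.snd.left ⟶ z'.snd.left at m
    replace hm : m ≫ (cG z'.snd).inv ≫ p.map (h z') = (cG z.snd).inv ≫ p.map (h z) := hm
    have hm' : m ≫ (τ z'.snd).left = (τ z.snd).left := by
      rw [← hpb, ← hpb, ← reassoc_of% hm]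
    let fs : z.snd ⟶ z'.snd := CostructuredArrow.homMk m (by
      rw [← hτ, ← hτ, ← Functor.map_comp, hm'])
    have hfs : G.functor.map fs ≫ h z' = h z := hp.cancel b
      (by rw [Category.assoc, hhb, hhb, ← Functor.map_comp, hτ'])
      (by
        have h1 : (cG z.snd).inv ≫ p.map (G.functor.map fs) = m ≫ (cG z'.snd).inv := by
          rw [Iso.inv_comp_eq, ← Category.assoc, Iso.eq_comp_inv]
          exact hG fs
        rw [Functor.map_comp, ← cancel_epi (cG z.snd).inv, ← hm, reassoc_of% h1])
    let k : F.functor.obj z.fst ⟶ F.functor.obj z'.fst :=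
      z.iso.hom ≫ G.functor.map fs ≫ z'.iso.inv
    have hk : k ≫ κ z'.fst = κ z.fst := by
      simp only [k, Category.assoc]
      rw [← hha, reassoc_of% hfs, hha, Iso.hom_inv_id_assoc]
    let ff : z.fst ⟶ z'.fst := CostructuredArrow.homMk ((cF _).inv ≫ p.map k ≫ (cF _).hom) (by
      rw [Functor.map_comp, Functor.map_comp, Category.assoc, Category.assoc, ← hκ',
        ← Functor.map_comp, ← Functor.map_comp, ← Functor.map_comp p, hk, Functor.map_comp, hκ',
        ← Functor.map_comp_assoc yoneda, Iso.inv_hom_id, CategoryTheory.Functor.map_id,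
          Category.id_comp])
    have hff : F.functor.map ff = k := hp.cancel (κ z'.fst) (by rw [hκ, hk]) (by
      rw [← cancel_mono (cF z'.fst).hom, hF]
      simp [ff])
    refine ⟨⟨ff, fs, ?_⟩, rfl, fun f hf => ?_⟩
    · rw [hff]
      simp [k]
    · have h1 : f.snd = fs := CostructuredArrow.hom_ext _ _ hf
      refine CategoricalPullback.hom_ext (CostructuredArrow.hom_ext _ _ ?_) h1
      have h2 : F.functor.map f.fst = k := by
        simp only [k, ← h1]
        rw [← Category.assoc, Iso.eq_comp_inv]
        exact f.w
      rw [← cancel_epi (cF z.fst).hom, ← hF, h2]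
      simp [ff]
  -- Essential surjectivity: `t` lifts to a morphism `l` from a pullback of `G.functor.obj s₀` to
  -- `X`. Its composition with `a` defines a morphism to the atlas, and the comparison with the
  -- chosen pullback of `ξ` is invertible.
  · intro T t
    obtain ⟨t, rfl⟩ := yoneda.map_surjective t
    let v : CostructuredArrow yoneda (yoneda.obj S) :=
      CostructuredArrow.mk (yoneda.map (t ≫ p.map b ≫ (cG s₀).hom))
    have hv : (τ v).left = t ≫ p.map b ≫ (cG s₀).hom := yoneda.map_injective (hτ v)
    obtain ⟨l, hl, hl'⟩ := (hp.existsUnique b (G.functor.map (τ v)) ((cG v).hom ≫ t) (by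
      rw [← cancel_mono (cG s₀).hom, hG, hv]
      simp)).exists
    let w : CostructuredArrow yoneda (yoneda.obj (p.obj ξ)) :=
      CostructuredArrow.mk (yoneda.map (p.map (l ≫ a)))
    have hw : p.map (κ w) = (cF w).hom ≫ p.map (l ≫ a) := yoneda.map_injective (by
      rw [hκ', Functor.map_comp]; rfl)
    obtain ⟨k, hk, hk'⟩ := (hp.existsUnique (l ≫ a) (κ w) (cF w).hom hw.symm).exists
    have : IsIso (p.map k) := by rw [hk]; infer_instance
    have : IsIso k := hp.isIso k
    let z : CategoricalPullback F.functor G.functor := ⟨w, v, asIso k⟩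
    have hz : h z = l := hu _ _
      ((hha z).trans ((Iso.inv_comp_eq (asIso k)).2 hk'.symm)) (by rw [hhb, hl'])
    refine ⟨z, Iso.refl T, ?_⟩
    have h1 : (cG v).inv ≫ p.map (h z) = t := by
      rw [Iso.inv_comp_eq, ← hl]
      exact congrArg p.map hz
    exact (congrArg yoneda.map h1).trans
      ((congrArg (fun u => u ≫ yoneda.map t) (yoneda.map_id T)).trans (Category.id_comp _)).symm

end Representable

end Trop

end

/-! ### Representable diagonals, and presheaves over a category of elements -/

noncomputable section

namespace Trop

section Presheaves

open Limits Opposite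

universe v u

variable {C : Type u} [Category.{v} C]

/-- By the Yoneda lemma, tests on representable presheaves are tests on sections. -/
theorem isPullback_of_yoneda {P X Y Z : Cᵒᵖ ⥤ Type v} {fst : P ⟶ X} {snd : P ⟶ Y} {f : X ⟶ Z}
    {g : Y ⟶ Z} (w : fst ≫ f = snd ≫ g)
    (h : ∀ {T : C} (x : yoneda.obj T ⟶ X) (y : yoneda.obj T ⟶ Y), x ≫ f = y ≫ g →
      ∃! t : yoneda.obj T ⟶ P, t ≫ fst = x ∧ t ≫ snd = y) : IsPullback fst snd f g := by
  refine IsPullback.of_forall_isPullback_app fun T => ?_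
  rw [Types.isPullback_iff]
  refine ⟨NatTrans.congr_app w T, fun x y hxy => ?_, fun x y hxy => ?_⟩
  · have h1 : ∀ {Q : Cᵒᵖ ⥤ Type v} (q : P ⟶ Q), q.app T x = q.app T y →
        yonedaEquiv.symm x ≫ q = yonedaEquiv.symm y ≫ q := fun q hq =>
      (yonedaEquiv_symm_naturality_right T.unop q x).trans
        ((congrArg _ hq).trans (yonedaEquiv_symm_naturality_right T.unop q y).symm)
    refine yonedaEquiv.symm.injective ((h (T := T.unop) _ _ ?_).unique ⟨h1 _ hxy.1, h1 _ hxy.2⟩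
      ⟨rfl, rfl⟩)
    rw [Category.assoc, Category.assoc, w]
  · obtain ⟨t, ⟨h1, h2⟩, -⟩ := h (T := T.unop) (yonedaEquiv.symm x) (yonedaEquiv.symm y) (by
      rw [yonedaEquiv_symm_naturality_right, yonedaEquiv_symm_naturality_right]
      exact congrArg _ hxy)
    refine ⟨yonedaEquiv t, ?_, ?_⟩
    · exact (yonedaEquiv_comp t fst).symm.trans (by rw [h1]; exact Equiv.apply_symm_apply _ _)
    · exact (yonedaEquiv_comp t snd).symm.trans (by rw [h2]; exact Equiv.apply_symm_apply _ _)

theorem relativelyRepresentable_of_exists {X Y : Cᵒᵖ ⥤ Type v} {f : X ⟶ Y}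
    (h : ∀ {a : C} (g : yoneda.obj a ⟶ Y), ∃ (b : C) (q : b ⟶ a) (w : yoneda.obj b ⟶ X),
      w ≫ f = yoneda.map q ≫ g ∧ ∀ {T : C} (r : T ⟶ a) (t : yoneda.obj T ⟶ X),
        t ≫ f = yoneda.map r ≫ g → ∃! d : T ⟶ b, yoneda.map d ≫ w = t ∧ d ≫ q = r) :
    yoneda.relativelyRepresentable f := fun a g => by
  obtain ⟨b, q, w, hw, hu⟩ := h g
  refine ⟨b, q, w, isPullback_of_yoneda hw fun {T} t r htr => ?_⟩
  obtain ⟨r, rfl⟩ := yoneda.map_surjective r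
  obtain ⟨d, ⟨h1, h2⟩, h3⟩ := hu r t htr
  refine ⟨yoneda.map d, ⟨h1, by rw [← Functor.map_comp, h2]⟩, ?_⟩
  rintro d' ⟨h4, h5⟩
  obtain ⟨d', rfl⟩ := yoneda.map_surjective d'
  rw [← Functor.map_comp] at h5
  rw [h3 d' ⟨h4, yoneda.map_injective h5⟩]

/-- The diagonal of a presheaf is representable if and only if the equalizers of its elements are
representable. -/
theorem relativelyRepresentable_diag_iff {X : Cᵒᵖ ⥤ Type v} :
    yoneda.relativelyRepresentable (diag X) ↔
      ∀ {T : C} (s t : yoneda.obj T ⟶ X), ∃ (E : C) (e : E ⟶ T),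
        yoneda.map e ≫ s = yoneda.map e ≫ t ∧ ∀ {T' : C} (h : T' ⟶ T),
          yoneda.map h ≫ s = yoneda.map h ≫ t → ∃! k : T' ⟶ E, k ≫ e = h := by
  have d1 : diag X ≫ prod.fst = 𝟙 X := prod.lift_fst _ _
  have d2 : diag X ≫ prod.snd = 𝟙 X := prod.lift_snd _ _
  constructor
  · intro H T s t
    have l1 : prod.lift s t ≫ prod.fst = s := prod.lift_fst _ _
    have l2 : prod.lift s t ≫ prod.snd = t := prod.lift_snd _ _
    obtain ⟨E, e, w, hE⟩ := H (prod.lift s t)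
    have h1 : w = yoneda.map e ≫ s := by
      rw [← l1, ← hE.w_assoc, d1, Category.comp_id]
    have h2 : w = yoneda.map e ≫ t := by
      rw [← l2, ← hE.w_assoc, d2, Category.comp_id]
    refine ⟨E, e, h1.symm.trans h2, fun {T'} h hh => ?_⟩
    obtain ⟨k, hk⟩ := yoneda.map_surjective
      (hE.lift (yoneda.map h ≫ s) (yoneda.map h) (by
        refine Limits.prod.hom_ext ?_ ?_
        · rw [Category.assoc, d1, Category.comp_id, Category.assoc, l1]
        · rw [Category.assoc, d2, Category.comp_id, Category.assoc, l2, hh]))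
    have hk' : k ≫ e = h := yoneda.map_injective (by rw [Functor.map_comp, hk, hE.lift_snd])
    refine ⟨k, hk', fun l hl => yoneda.map_injective (hE.hom_ext ?_ ?_)⟩
    · rw [h1, ← Functor.map_comp_assoc, ← Functor.map_comp_assoc, hk', hl]
    · rw [← Functor.map_comp, ← Functor.map_comp, hk', hl]
  · intro H
    refine relativelyRepresentable_of_exists fun {T} g => ?_
    obtain ⟨E, e, he, hu⟩ := H (g ≫ prod.fst) (g ≫ prod.snd)
    refine ⟨E, e, yoneda.map e ≫ g ≫ prod.fst, ?_, fun {T'} r t ht => ?_⟩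
    · refine Limits.prod.hom_ext ?_ ?_
      · rw [Category.assoc, d1, Category.comp_id, Category.assoc]
      · rw [Category.assoc, d2, Category.comp_id, Category.assoc, he]
    · have h1 : t = yoneda.map r ≫ g ≫ prod.fst := by
        rw [← Category.assoc, ← ht, Category.assoc, d1, Category.comp_id]
      have h2 : t = yoneda.map r ≫ g ≫ prod.snd := by
        rw [← Category.assoc, ← ht, Category.assoc, d2, Category.comp_id]
      obtain ⟨k, hk, hk'⟩ := hu r (h1.symm.trans h2)
      refine ⟨k, ⟨?_, hk⟩, fun l hl => hk' l hl.2⟩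
      rw [← Functor.map_comp_assoc, hk, h1]

/-- A presheaf that is representable over a presheaf with representable diagonal has a representable
diagonal. -/
theorem relativelyRepresentable_diag_of_hom {W V : Cᵒᵖ ⥤ Type v} (π : W ⟶ V)
    (hπ : yoneda.relativelyRepresentable π) (hV : yoneda.relativelyRepresentable (diag V))
    (hC : ∀ {S T : C} (f g : T ⟶ S), ∃ (E : C) (e : E ⟶ T), e ≫ f = e ≫ g ∧
      ∀ {T' : C} (t : T' ⟶ T), t ≫ f = t ≫ g → ∃! h : T' ⟶ E, h ≫ e = t) :
    yoneda.relativelyRepresentable (diag W) := by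
  rw [relativelyRepresentable_diag_iff] at hV ⊢
  intro T s t
  -- Over the equalizer `E` of the images in `V`, both elements become sections of the base change
  -- of `π`, which is an object `A` over `E`. Their equalizer exists in `C`.
  obtain ⟨E, e, he, hE⟩ := hV (s ≫ π) (t ≫ π)
  obtain ⟨A, q, w, hA⟩ := hπ (yoneda.map e ≫ s ≫ π)
  obtain ⟨ks, hks⟩ := yoneda.map_surjective
    (hA.lift (yoneda.map e ≫ s) (𝟙 _) (by simp))
  obtain ⟨kt, hkt⟩ := yoneda.map_surjective
    (hA.lift (yoneda.map e ≫ t) (𝟙 _) (by simp [he]))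
  have hs1 : yoneda.map ks ≫ w = yoneda.map e ≫ s := by rw [hks, hA.lift_fst]
  have ht1 : yoneda.map kt ≫ w = yoneda.map e ≫ t := by rw [hkt, hA.lift_fst]
  have hs2 : yoneda.map ks ≫ yoneda.map q = 𝟙 _ := by rw [hks, hA.lift_snd]
  have ht2 : yoneda.map kt ≫ yoneda.map q = 𝟙 _ := by rw [hkt, hA.lift_snd]
  obtain ⟨D, d, hd, hD⟩ := hC ks kt
  refine ⟨D, d ≫ e, ?_, fun {T'} h hh => ?_⟩
  · rw [Functor.map_comp, Category.assoc, Category.assoc, ← hs1, ← ht1, ← Functor.map_comp_assoc,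
      ← Functor.map_comp_assoc, hd]
  · obtain ⟨k, hk, hku⟩ := hE h (by rw [reassoc_of% hh])
    obtain ⟨l, hl, hlu⟩ := hD k (yoneda.map_injective (hA.hom_ext
      (by rw [Functor.map_comp, Functor.map_comp, Category.assoc, Category.assoc, hs1, ht1,
        ← Functor.map_comp_assoc, ← Functor.map_comp_assoc, hk, hh])
      (by rw [Functor.map_comp, Functor.map_comp, Category.assoc, Category.assoc, hs2, ht2])))
    refine ⟨l, (Category.assoc l d e).symm.trans ((congrArg (fun u => u ≫ e) hl).trans hk),
      fun l' hl' => hlu _ (hku _ ?_)⟩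
    exact (Category.assoc _ _ _).trans hl'

theorem isLocallySurjective_of_isPullback {J : GrothendieckTopology C} {A B W V : Cᵒᵖ ⥤ Type v}
    {f : A ⟶ W} {q : A ⟶ B} {π : W ⟶ V} {a : B ⟶ V} (h : IsPullback f q π a)
    (ha : Presheaf.IsLocallySurjective J a) : Presheaf.IsLocallySurjective J f where
  imageSieve_mem {T} s := by
    refine J.superset_covering ?_ (Presheaf.imageSieve_mem J a (π.app _ s))
    rintro T' i ⟨t, ht⟩
    have h1 : (yonedaEquiv.symm (W.map i.op s)) ≫ π = yonedaEquiv.symm t ≫ a := by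
      rw [yonedaEquiv_symm_naturality_right, yonedaEquiv_symm_naturality_right]
      exact congrArg _ ((NatTrans.naturality_apply π i.op s).trans ht.symm)
    refine ⟨yonedaEquiv (h.lift _ _ h1), ?_⟩
    rw [← yonedaEquiv_comp, h.lift_fst, Equiv.apply_symm_apply]

/-- A representable presheaf is a geometric space. -/
theorem isGeometricSpace_yoneda {J : GrothendieckTopology C} {P : MorphismProperty C}
    [P.RespectsIso] (S : C) (hS : Presheaf.IsSheaf J (yoneda.obj S)) (hP : ∀ T : C, P (𝟙 T))
    (hC : ∀ {T : C} (f g : T ⟶ S), ∃ (E : C) (e : E ⟶ T), e ≫ f = e ≫ g ∧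
      ∀ {T' : C} (t : T' ⟶ T), t ≫ f = t ≫ g → ∃! h : T' ⟶ E, h ≫ e = t) :
    IsGeometricSpace J P (yoneda.obj S) where
  isSheaf := hS
  diag := by
    rw [relativelyRepresentable_diag_iff]
    intro T s t
    obtain ⟨s, rfl⟩ := yoneda.map_surjective s
    obtain ⟨t, rfl⟩ := yoneda.map_surjective t
    obtain ⟨E, e, he, hE⟩ := hC s t
    refine ⟨E, e, by rw [← Functor.map_comp, he, Functor.map_comp], fun h hh => hE h ?_⟩
    rw [← Functor.map_comp, ← Functor.map_comp] at hh
    exact yoneda.map_injective hh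
  atlas := ⟨S, 𝟙 _, MorphismProperty.relative.of_exists fun a g =>
    ⟨a, g, 𝟙 a, by rw [CategoryTheory.Functor.map_id]; exact IsPullback.id_vert g, hP a⟩,
      inferInstance⟩

/-- A presheaf that is representable over a geometric space is a geometric space, if it is a
sheaf. -/
theorem IsGeometricSpace.of_hom {J : GrothendieckTopology C} {P : MorphismProperty C}
    {W V : Cᵒᵖ ⥤ Type v} (hV : IsGeometricSpace J P V) (π : W ⟶ V)
    (hπ : yoneda.relativelyRepresentable π) (hW : Presheaf.IsSheaf J W)
    (hC : ∀ {S T : C} (f g : T ⟶ S), ∃ (E : C) (e : E ⟶ T), e ≫ f = e ≫ g ∧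
      ∀ {T' : C} (t : T' ⟶ T), t ≫ f = t ≫ g → ∃! h : T' ⟶ E, h ≫ e = t) :
    IsGeometricSpace J P W where
  isSheaf := hW
  diag := relativelyRepresentable_diag_of_hom π hπ hV.diag hC
  atlas := by
    obtain ⟨U, a, ha, ha'⟩ := hV.atlas
    -- The atlas is the base change of the atlas of `V`.
    obtain ⟨b, q, f, h⟩ := hπ a
    have := MorphismProperty.relative_isStableUnderBaseChange (F := yoneda (C := C)) P
    exact ⟨b, f, MorphismProperty.of_isPullback h.flip ha, isLocallySurjective_of_isPullback h ha'⟩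

end Presheaves

/-! ### Presheaves over a presheaf -/

section Total

open Limits Opposite

universe v u

variable {C : Type u} [Category.{v} C] {V : Cᵒᵖ ⥤ Type v}
  (H : (CostructuredArrow yoneda V)ᵒᵖ ⥤ Type v)

/-- An element of a presheaf, as an object of its category of elements. -/
abbrev elt {T : C} (x : V.obj (op T)) : CostructuredArrow yoneda V :=
  CostructuredArrow.mk (yonedaEquiv.symm x)

/-- The restriction of an element, as a morphism of the category of elements. -/
def eltHom {T T' : C} (f : T' ⟶ T) (x : V.obj (op T)) : elt (V.map f.op x) ⟶ elt x :=
  CostructuredArrow.homMk f (yonedaEquiv_symm_naturality_left f V x)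

/-- The morphism `m` over the identity replaces transport along the equality of base points. -/
theorem sigma_elt_ext {T : C} {w w' : Σ x : V.obj (op T), H.obj (op (elt x))} (h : w.1 = w'.1)
    (m : elt w.1 ⟶ elt w'.1) (hm : m.left = 𝟙 T) (h' : H.map m.op w'.2 = w.2) : w = w' := by
  obtain ⟨x, k⟩ := w
  obtain ⟨x', k'⟩ := w'
  obtain rfl : x = x' := h
  obtain rfl : m = 𝟙 _ := CostructuredArrow.hom_ext _ _ hm
  obtain rfl : k' = k := (by simpa using h')
  rfl

/-- The presheaf on `C` associated to a presheaf on the category of elements of a presheaf `V`. -/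
def total : Cᵒᵖ ⥤ Type v where
  obj T := Σ x : V.obj (op T.unop), H.obj (op (elt x))
  map f := ↾fun w => ⟨V.map f.unop.op w.1, H.map (eltHom f.unop w.1).op w.2⟩
  map_id T := by
    refine ConcreteCategory.hom_ext _ _ fun w => ?_
    have h : V.map (𝟙 T.unop).op w.1 = w.1 := by
      rw [op_id, CategoryTheory.Functor.map_id]; rfl
    exact sigma_elt_ext H h (eltHom (𝟙 _) _) rfl rfl
  map_comp {T T' T''} f g := by
    refine ConcreteCategory.hom_ext _ _ fun w => ?_
    have h : V.map (g.unop ≫ f.unop).op w.1 = V.map g.unop.op (V.map f.unop.op w.1) := by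
      rw [op_comp, Functor.map_comp]; rfl
    let m : elt (V.map (g.unop ≫ f.unop).op w.1) ⟶ elt (V.map g.unop.op (V.map f.unop.op w.1)) :=
      CostructuredArrow.homMk (𝟙 _) (by rw [h]; simp)
    refine sigma_elt_ext H h m rfl ?_
    have h1 : eltHom (g.unop ≫ f.unop) w.1 = m ≫ eltHom g.unop _ ≫ eltHom f.unop w.1 :=
      CostructuredArrow.hom_ext _ _ (Category.id_comp _).symm
    have h2 := ConcreteCategory.congr_hom (congrArg (fun u => H.map u.op) h1) w.2
    simp only [op_comp, Functor.map_comp, ConcreteCategory.comp_apply] at h2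
    exact h2.symm

namespace total

variable {H}

/-- The projection to the base presheaf. -/
def π : total H ⟶ V where
  app T := ↾fun w => w.1

/-- The element of the total presheaf given by a section over an element of the base presheaf. -/
def elem {T : C} (x : V.obj (op T)) (k : H.obj (op (elt x))) : (total H).obj (op T) := ⟨x, k⟩

theorem symm_elem_π {T : C} (x : V.obj (op T)) (k : H.obj (op (elt x))) :
    yonedaEquiv.symm (elem x k) ≫ π = yonedaEquiv.symm x :=
  yonedaEquiv_symm_naturality_right T π _

theorem map_symm_elem {T T' : C} (f : T' ⟶ T) (x : V.obj (op T)) (k : H.obj (op (elt x))) :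
    yoneda.map f ≫ yonedaEquiv.symm (elem x k) =
      yonedaEquiv.symm (elem (V.map f.op x) (H.map (eltHom f x).op k)) :=
  yonedaEquiv_symm_naturality_left f _ _

/-- The element of the total presheaf given by a section over an element of the base presheaf. -/
def mk {c : CostructuredArrow yoneda V} (k : H.obj (op c)) : yoneda.obj c.left ⟶ total H :=
  yonedaEquiv.symm (elem (yonedaEquiv c.hom) (H.map (CostructuredArrow.homMk (𝟙 _) (by simp) :
    elt (yonedaEquiv c.hom) ⟶ c).op k))

theorem mk_π {c : CostructuredArrow yoneda V} (k : H.obj (op c)) : mk k ≫ π = c.hom := by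
  rw [mk, symm_elem_π]
  exact yonedaEquiv.symm_apply_apply _

theorem map_mk {c c' : CostructuredArrow yoneda V} (n : c' ⟶ c) (k : H.obj (op c)) :
    yoneda.map n.left ≫ mk k = mk (H.map n.op k) := by
  rw [mk, map_symm_elem]
  refine congrArg yonedaEquiv.symm ?_
  have h : V.map n.left.op (yonedaEquiv c.hom) = yonedaEquiv c'.hom := by
    rw [yonedaEquiv_naturality, CostructuredArrow.w]
  let m : elt (V.map n.left.op (yonedaEquiv c.hom)) ⟶ elt (yonedaEquiv c'.hom) :=
    CostructuredArrow.homMk (𝟙 _) (by rw [h]; simp)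
  refine sigma_elt_ext H h m rfl ?_
  have h1 : eltHom n.left (yonedaEquiv c.hom) ≫ (CostructuredArrow.homMk (𝟙 _) (by simp) :
      elt (yonedaEquiv c.hom) ⟶ c) = m ≫ (CostructuredArrow.homMk (𝟙 _) (by simp) :
      elt (yonedaEquiv c'.hom) ⟶ c') ≫ n :=
    CostructuredArrow.hom_ext _ _ (by simp [eltHom, m])
  have h2 := ConcreteCategory.congr_hom (congrArg (fun u => H.map u.op) h1) k
  simp only [op_comp, Functor.map_comp, ConcreteCategory.comp_apply] at h2
  exact h2.symm

theorem mk_injective {c : CostructuredArrow yoneda V} {k k' : H.obj (op c)} (h : mk k = mk k') :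
    k = k' := by
  have h1 := eq_of_heq (Sigma.mk.inj (yonedaEquiv.symm.injective h)).2
  let m : c ⟶ elt (yonedaEquiv c.hom) := CostructuredArrow.homMk (𝟙 _) (by simp)
  have h2 : ∀ k : H.obj (op c), H.map m.op (H.map (CostructuredArrow.homMk (𝟙 _) (by simp) :
      elt (yonedaEquiv c.hom) ⟶ c).op k) = k := fun k => by
    rw [← ConcreteCategory.comp_apply, ← Functor.map_comp, ← op_comp]
    have : m ≫ (CostructuredArrow.homMk (𝟙 _) (by simp) : elt (yonedaEquiv c.hom) ⟶ c) = 𝟙 c :=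
      CostructuredArrow.hom_ext _ _ (Category.comp_id _)
    rw [this, op_id, CategoryTheory.Functor.map_id]
    rfl
  rw [← h2 k, h1, h2]

/-- Translates equations in the total presheaf into equations over the category of elements, where
families of objects live. -/
theorem map_mk_eq_iff {c c' : CostructuredArrow yoneda V} {f : c'.left ⟶ c.left}
    {k : H.obj (op c)} {k' : H.obj (op c')} :
    yoneda.map f ≫ mk k = mk k' ↔ ∃ n : c' ⟶ c, n.left = f ∧ H.map n.op k = k' := by
  constructor
  · intro h
    let n : c' ⟶ c := CostructuredArrow.homMk f (by rw [← mk_π k, reassoc_of% h, mk_π])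
    refine ⟨n, rfl, mk_injective ?_⟩
    rw [← map_mk, ← h]
    rfl
  · rintro ⟨n, rfl, rfl⟩
    exact map_mk n k

theorem exists_mk {T : C} (t : yoneda.obj T ⟶ total H) :
    ∃ k : H.obj (op (CostructuredArrow.mk (t ≫ π))), mk k = t := by
  obtain ⟨⟨x, k⟩, rfl⟩ := yonedaEquiv.symm.surjective t
  have aux : ∀ (c : CostructuredArrow yoneda V) (e : c = elt x),
      ∃ k' : H.obj (op c), yoneda.map (eqToHom (congrArg Comma.left e.symm)) ≫ mk k' =
        yonedaEquiv.symm (elem x k) := by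
    rintro _ rfl
    refine ⟨k, ?_⟩
    have h : yonedaEquiv (elt x).hom = x := yonedaEquiv.apply_symm_apply x
    let m : elt (yonedaEquiv (elt x).hom) ⟶ elt x := CostructuredArrow.homMk (𝟙 _) (by rw [h]; simp)
    rw [eqToHom_refl, CategoryTheory.Functor.map_id, Category.id_comp]
    exact congrArg yonedaEquiv.symm (sigma_elt_ext H h m rfl rfl)
  obtain ⟨k', hk'⟩ := aux (CostructuredArrow.mk (yonedaEquiv.symm (elem x k) ≫ π))
    (congrArg CostructuredArrow.mk (symm_elem_π x k))
  refine ⟨k', ?_⟩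
  rw [eqToHom_refl, CategoryTheory.Functor.map_id, Category.id_comp] at hk'
  exact hk'

end total

end Total

end Trop

end

/-! ### The sheaf of isomorphisms between two families over a presheaf -/

noncomputable section

namespace Trop

open Limits Opposite

universe v u u₁ u₂ v₂

variable {C : Type u} [Category.{v} C] {V : Cᵒᵖ ⥤ Type v} {J : GrothendieckTopology C}

theorem total.exists_mk_eq {H : (CostructuredArrow yoneda V)ᵒᵖ ⥤ Type v}
    {c : CostructuredArrow yoneda V} (t : yoneda.obj c.left ⟶ total H) (h : t ≫ total.π = c.hom) :
    ∃ k : H.obj (op c), total.mk k = t := by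
  have aux : ∀ {T : C} (t : yoneda.obj T ⟶ total H) (f : yoneda.obj T ⟶ V), t ≫ total.π = f →
      ∃ k : H.obj (op (CostructuredArrow.mk f)), total.mk k = t := by
    rintro T t _ rfl
    exact total.exists_mk t
  exact aux t c.hom h

/-- The base point is glued first, using that `V` is a sheaf; the sections are then glued over this
fixed base point. -/
theorem total.isSheaf {H : (CostructuredArrow yoneda V)ᵒᵖ ⥤ Type v} (hV : Presheaf.IsSheaf J V)
    (hH : ∀ c : CostructuredArrow yoneda V, ∀ R ∈ J c.left,
      ∀ x : ∀ {c'} (m : c' ⟶ c), R m.left → H.obj (op c'),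
      (∀ {c' c''} (n : c'' ⟶ c') (m : c' ⟶ c) (h : R m.left) (h' : R (n ≫ m).left),
        x (n ≫ m) h' = H.map n.op (x m h)) →
      ∃! k, ∀ {c'} (m : c' ⟶ c) (h : R m.left), H.map m.op k = x m h) :
    Presheaf.IsSheaf J (total H) := by
  rw [isSheaf_iff_isSheaf_of_type] at hV ⊢
  intro T R hR y hy
  rw [Presieve.compatible_iff_sieveCompatible] at hy
  have hyπ : ∀ {T' : C} (f : T' ⟶ T) (hf : R f) (v : V.obj (op T')),
      v = (y f hf).1 → yonedaEquiv.symm (y f hf) ≫ total.π = yonedaEquiv.symm v := by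
    rintro T' f hf _ rfl
    exact yonedaEquiv_symm_naturality_right T' total.π _
  obtain ⟨v, hv, hvu⟩ := hV R hR (fun _ f hf => (y f hf).1)
    ((Presieve.compatible_iff_sieveCompatible _).2 fun Y Z f g hf =>
      congrArg Sigma.fst (hy f g hf))
  have hx : ∀ {c'} (m : c' ⟶ elt v) (h : R m.left), ∃ k : H.obj (op c'),
      total.mk k = yonedaEquiv.symm (y m.left h) := fun {c'} m h => total.exists_mk_eq _ (by
    rw [hyπ _ h _ (hv m.left h), ← CostructuredArrow.w m]
    exact (yonedaEquiv_symm_naturality_left m.left V v).symm)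
  choose x hx using @hx
  obtain ⟨k, hk, hku⟩ := hH (elt v) R hR (fun {c'} m h => x m h) (fun {c' c''} n m h h' => by
    refine total.mk_injective ?_
    rw [hx, ← total.map_mk, hx, yonedaEquiv_symm_naturality_left]
    exact congrArg yonedaEquiv.symm (hy m.left n.left h))
  refine ⟨yonedaEquiv (total.mk k), fun T' f hf => yonedaEquiv.symm.injective ?_, fun t ht => ?_⟩
  · let m : CostructuredArrow.mk (yoneda.map f ≫ (elt v).hom) ⟶ elt v :=
      CostructuredArrow.homMk f rfl
    rw [← yonedaEquiv_symm_naturality_left, Equiv.symm_apply_apply]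
    exact (total.map_mk m k).trans ((congrArg total.mk (hk m hf)).trans (hx m hf))
  · obtain ⟨t, rfl⟩ := yonedaEquiv.surjective t
    refine congrArg yonedaEquiv ?_
    have h1 : yonedaEquiv (t ≫ total.π) = v := hvu _ fun T' f hf => by
      have h2 := congrArg Sigma.fst (ht f hf)
      refine Eq.trans ?_ h2
      rw [yonedaEquiv_comp]
      rfl
    obtain ⟨k', rfl⟩ := total.exists_mk_eq (c := elt v) t (by
      rw [← h1]; exact (yonedaEquiv.symm_apply_apply _).symm)
    refine congrArg total.mk (hku k' fun {c'} m h => total.mk_injective ?_)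
    rw [hx, ← total.map_mk, ← ht m.left h, ← yonedaEquiv_symm_naturality_left,
      Equiv.symm_apply_apply]

/-! ### Isomorphisms of objects of a category fibered in groupoids -/

section Isom

variable {𝒳 : Type u₁} [Category.{v} 𝒳] {𝒟 : Type u₂} [Category.{v₂} 𝒟] {p : 𝒳 ⥤ C}

theorem IsFiberedInGroupoids.exists_restriction (hp : IsFiberedInGroupoids p) {A B : 𝒟 ⥤ 𝒳}
    (θ : A ⋙ p ≅ B ⋙ p) {c c' : 𝒟} (m : c ⟶ c')
    (k : {k : A.obj c' ⟶ B.obj c' // p.map k = θ.hom.app c'}) :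
    ∃ k' : {k : A.obj c ⟶ B.obj c // p.map k = θ.hom.app c}, k'.1 ≫ B.map m = A.map m ≫ k.1 := by
  obtain ⟨k', ⟨h, h'⟩, -⟩ := hp.existsUnique (B.map m) (A.map m ≫ k.1) (θ.hom.app c) (by
    rw [Functor.map_comp, k.2]
    exact (θ.hom.naturality m).symm)
  exact ⟨⟨k', h⟩, h'⟩

theorem IsFiberedInGroupoids.restriction_unique (hp : IsFiberedInGroupoids p) {A B : 𝒟 ⥤ 𝒳}
    {θ : A ⋙ p ≅ B ⋙ p} {c c' : 𝒟} {m : c ⟶ c'} {f : A.obj c ⟶ B.obj c'}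
    {k k' : {k : A.obj c ⟶ B.obj c // p.map k = θ.hom.app c}} (h : k.1 ≫ B.map m = f)
    (h' : k'.1 ≫ B.map m = f) : k = k' :=
  Subtype.ext (hp.cancel (B.map m) (h.trans h'.symm) (k.2.trans k'.2.symm))

/-- The presheaf of isomorphisms between two families of objects over a given isomorphism. -/
def isomPresheaf (hp : IsFiberedInGroupoids p) {A B : 𝒟 ⥤ 𝒳} (θ : A ⋙ p ≅ B ⋙ p) :
    𝒟ᵒᵖ ⥤ Type v where
  obj c := {k : A.obj c.unop ⟶ B.obj c.unop // p.map k = θ.hom.app c.unop}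
  -- The choice is harmless, since restrictions are unique by cartesianness.
  map m := ↾fun k => (hp.exists_restriction θ m.unop k).choose
  map_id c := by
    refine ConcreteCategory.hom_ext _ _ fun k => ?_
    refine hp.restriction_unique (hp.exists_restriction θ (𝟙 c.unop) k).choose_spec ?_
    rw [A.map_id, B.map_id, Category.id_comp, Category.comp_id]
    rfl
  map_comp {c c' c''} m m' := by
    refine ConcreteCategory.hom_ext _ _ fun k => ?_
    refine hp.restriction_unique (hp.exists_restriction θ (m'.unop ≫ m.unop) k).choose_spec ?_
    have h1 := (hp.exists_restriction θ m.unop k).choose_spec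
    have h2 := (hp.exists_restriction θ m'.unop
      (hp.exists_restriction θ m.unop k).choose).choose_spec
    rw [A.map_comp, B.map_comp, Category.assoc, ← h1, ← reassoc_of% h2]
    rfl

theorem isomPresheaf_map_eq_iff (hp : IsFiberedInGroupoids p) {A B : 𝒟 ⥤ 𝒳} (θ : A ⋙ p ≅ B ⋙ p)
    {c c' : 𝒟} (m : c ⟶ c') (k : (isomPresheaf hp θ).obj (op c'))
    (k' : (isomPresheaf hp θ).obj (op c)) :
    (isomPresheaf hp θ).map m.op k = k' ↔ k'.1 ≫ B.map m = A.map m ≫ k.1 := by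
  have h := (hp.exists_restriction θ m k).choose_spec
  constructor
  · rintro rfl
    exact h
  · exact fun h' => hp.restriction_unique h h'

/-- Sections over elements of a covering extend to a matching family indexed by all morphisms `φ`
into `A.obj c`: factor `φ` through the family `A` and apply the section there. The result does not
depend on the factorization (`key`), so the gluing property of morphisms applies. -/
theorem IsStack.isSheaf_total (hp : IsStack J p) {A B : CostructuredArrow yoneda V ⥤ 𝒳}
    (θ : A ⋙ p ≅ B ⋙ p) (e : A ⋙ p ≅ overProj V) (hV : Presheaf.IsSheaf J V) :
    Presheaf.IsSheaf J (total (isomPresheaf hp.fibered θ)) := by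
  refine total.isSheaf hV fun c R hR x hx => ?_
  let e' : ∀ c, p.obj (A.obj c) ≅ c.left := fun c => e.app c
  have he : ∀ {c c' : CostructuredArrow yoneda V} (m : c ⟶ c'),
      p.map (A.map m) ≫ (e' c').hom = (e' c).hom ≫ m.left := fun m => e.hom.naturality m
  have hθ : ∀ {c c' : CostructuredArrow yoneda V} (m : c ⟶ c'),
      p.map (A.map m) ≫ θ.hom.app c' = θ.hom.app c ≫ p.map (B.map m) :=
    fun m => θ.hom.naturality m
  let d : ∀ {z : 𝒳} (φ : z ⟶ A.obj c), CostructuredArrow yoneda V := fun φ =>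
    CostructuredArrow.mk (yoneda.map (p.map φ ≫ (e' c).hom) ≫ c.hom)
  let m : ∀ {z : 𝒳} (φ : z ⟶ A.obj c), d φ ⟶ c := fun φ => CostructuredArrow.homMk _ rfl
  have hl : ∀ {z : 𝒳} (φ : z ⟶ A.obj c), ∃ l : z ⟶ A.obj (d φ),
      p.map l = (e' (d φ)).inv ∧ l ≫ A.map (m φ) = φ := fun φ =>
    (hp.fibered.existsUnique (A.map (m φ)) φ (e' (d φ)).inv (by
      rw [Iso.inv_comp_eq, ← cancel_mono (e' c).hom, he, Category.assoc]
      rfl)).exists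
  choose l hl hl' using @hl
  let k : ∀ {z : 𝒳} (φ : z ⟶ A.obj c), R (p.map φ ≫ (e' c).hom) → (z ⟶ B.obj c) :=
    fun φ h => l φ ≫ (x (m φ) h).1 ≫ B.map (m φ)
  have key : ∀ {z : 𝒳} {c'} (m' : c' ⟶ c) (h' : R m'.left) (l' : z ⟶ A.obj c')
      (φ : z ⟶ A.obj c) (h : R (p.map φ ≫ (e' c).hom)), l' ≫ A.map m' = φ →
      k φ h = l' ≫ (x m' h').1 ≫ B.map m' := by
    rintro z c' m' h' l' φ h hφ
    have h0 : (p.map l' ≫ (e' c').hom) ≫ m'.left = p.map φ ≫ (e' c).hom := by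
      rw [Category.assoc, ← he, ← hφ, Functor.map_comp, Category.assoc]
    let n : d φ ⟶ c' := CostructuredArrow.homMk (p.map l' ≫ (e' c').hom) (by
      change _ = yoneda.map (p.map φ ≫ (e' c).hom) ≫ c.hom
      rw [← h0, yoneda.map_comp (p.map l' ≫ (e' c').hom) m'.left, Category.assoc,
        CostructuredArrow.w])
    have hn : n ≫ m' = m φ := CostructuredArrow.hom_ext _ _ h0
    have hxn : ∀ (m₁ : d φ ⟶ c) (h₁ : R m₁.left), n ≫ m' = m₁ →
        (isomPresheaf hp.fibered θ).map n.op (x m' h') = x m₁ h₁ := by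
      rintro _ h₁ rfl
      exact (hx n m' h' h₁).symm
    have h1 := (isomPresheaf_map_eq_iff hp.fibered θ n _ _).1 (hxn (m φ) h hn)
    have h2 : l φ ≫ A.map n = l' := hp.fibered.cancel (A.map m')
      (by rw [Category.assoc, ← A.map_comp, hn, hl', hφ])
      (by
        rw [Functor.map_comp, hl, Iso.inv_comp_eq, ← cancel_mono (e' c').hom, he, Category.assoc]
        rfl)
    change l φ ≫ (x (m φ) h).1 ≫ B.map (m φ) = _
    have h3 : B.map n ≫ B.map m' = B.map (m φ) := by rw [← B.map_comp, hn]
    rw [← h3, reassoc_of% h1, reassoc_of% h2]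
  have hS : R.pullback (e' c).hom ∈ J (p.obj (A.obj c)) := J.pullback_stable _ hR
  obtain ⟨K, ⟨hK, hK'⟩, hu⟩ := hp.existsUnique_hom (A.obj c) (B.obj c) (θ.hom.app c) _ hS
    (fun φ h => k φ h)
    (fun φ h => by
      change p.map (l φ ≫ (x (m φ) h).1 ≫ B.map (m φ)) = _
      rw [Functor.map_comp, Functor.map_comp, (x (m φ) h).2]
      refine (congrArg (fun u => p.map (l φ) ≫ u) (hθ (m φ)).symm).trans ?_
      rw [← Category.assoc, ← Functor.map_comp, hl'])
    (fun ψ φ h h' => by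
      rw [key (m φ) h (ψ ≫ l φ) (ψ ≫ φ) h' (by rw [Category.assoc, hl']), Category.assoc])
  refine ⟨⟨K, hK⟩, fun {c'} m' h' => ?_, fun K' hK₂ => Subtype.ext (hu K'.1 ⟨K'.2, fun φ h => ?_⟩)⟩
  · have h1 : R (p.map (A.map m') ≫ (e' c).hom) := by
      rw [he]
      exact R.downward_closed h' _
    refine (isomPresheaf_map_eq_iff hp.fibered θ m' _ _).2 ?_
    have h2 := (hK' (A.map m') h1).trans
      (key m' h' (𝟙 _) (A.map m') h1 (Category.id_comp _))
    rw [Category.id_comp] at h2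
    exact h2.symm
  · have h1 := (isomPresheaf_map_eq_iff hp.fibered θ (m φ) _ _).1 (hK₂ (m φ) h)
    change _ = l φ ≫ (x (m φ) h).1 ≫ B.map (m φ)
    rw [h1, ← Category.assoc, hl']

/-- Over an element `c` of `V` the isomorphisms between `A.obj c` and `B.obj c` are represented by
the base of the object `Z` given by `hI`. Its universal pair of morphisms provides the universal
section `K`. -/
theorem IsFiberedInGroupoids.relativelyRepresentable_total (hp : IsFiberedInGroupoids p)
    {A B : CostructuredArrow yoneda V ⥤ 𝒳} (θ : A ⋙ p ≅ B ⋙ p) (e : A ⋙ p ≅ overProj V)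
    (hI : ∀ (X Y : 𝒳) (f : p.obj X ⟶ p.obj Y), ∃ (Z : 𝒳) (a : Z ⟶ X) (b : Z ⟶ Y),
      p.map b = p.map a ≫ f ∧ ∀ {Z' : 𝒳} (a' : Z' ⟶ X) (b' : Z' ⟶ Y),
        p.map b' = p.map a' ≫ f → ∃! h : Z' ⟶ Z, h ≫ a = a' ∧ h ≫ b = b') :
    yoneda.relativelyRepresentable (total.π (H := isomPresheaf hp θ)) := by
  let e' : ∀ c, p.obj (A.obj c) ≅ c.left := fun c => e.app c
  have he : ∀ {c c' : CostructuredArrow yoneda V} (m : c ⟶ c'),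
      p.map (A.map m) ≫ (e' c').hom = (e' c).hom ≫ m.left := fun m => e.hom.naturality m
  have hθ : ∀ {c c' : CostructuredArrow yoneda V} (m : c ⟶ c'),
      p.map (A.map m) ≫ θ.hom.app c' = θ.hom.app c ≫ p.map (B.map m) :=
    fun m => θ.hom.naturality m
  refine relativelyRepresentable_of_exists fun {S} g => ?_
  let c : CostructuredArrow yoneda V := CostructuredArrow.mk g
  obtain ⟨Z, a, b, hab, hZ⟩ := hI (A.obj c) (B.obj c) (θ.hom.app c)
  let q : p.obj Z ⟶ c.left := p.map a ≫ (e' c).hom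
  let c' : CostructuredArrow yoneda V := CostructuredArrow.mk (yoneda.map q ≫ g)
  let m : c' ⟶ c := CostructuredArrow.homMk q rfl
  let ec' : p.obj (A.obj c') ≅ p.obj Z := e' c'
  have hec' : ∀ {c''} (n : c'' ⟶ c'), p.map (A.map n) ≫ ec'.hom = (e' c'').hom ≫ n.left :=
    fun n => he n
  obtain ⟨l, ⟨hl, hl'⟩, -⟩ := hp.existsUnique a (A.map m) ec'.hom (by
    rw [← cancel_mono (e' c).hom, he, Category.assoc]
    rfl)
  obtain ⟨k, ⟨hk, hk'⟩, -⟩ := hp.existsUnique (B.map m) (l ≫ b) (θ.hom.app c') (by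
    rw [Functor.map_comp, hab, ← hθ, ← hl', Functor.map_comp, Category.assoc])
  let K : (isomPresheaf hp θ).obj (op c') := ⟨k, hk⟩
  refine ⟨p.obj Z, q, total.mk K, total.mk_π K, fun {T} r t ht => ?_⟩
  let c₁ : CostructuredArrow yoneda V := CostructuredArrow.mk (yoneda.map r ≫ g)
  let m₁ : c₁ ⟶ c := CostructuredArrow.homMk r rfl
  obtain ⟨K₁, hK₁⟩ := total.exists_mk_eq (c := c₁) t ht
  let e₁ : p.obj (A.obj c₁) ≅ T := e' c₁
  have hK₁' : p.map K₁.1 = θ.hom.app c₁ := K₁.2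
  obtain ⟨h, ⟨ha, hb⟩, hu⟩ := hZ (A.map m₁) (K₁.1 ≫ B.map m₁) (by
    rw [Functor.map_comp, hθ, hK₁'])
  have hr : p.map (A.map m₁) ≫ (e' c).hom = e₁.hom ≫ r := he m₁
  have hd : (e₁.inv ≫ p.map h) ≫ q = r := by
    rw [Category.assoc, Iso.inv_comp_eq, ← hr, ← ha, Functor.map_comp, Category.assoc]
  refine ⟨e₁.inv ≫ p.map h, ⟨?_, hd⟩, ?_⟩
  · rw [← hK₁]
    let n : c₁ ⟶ c' := CostructuredArrow.homMk (e₁.inv ≫ p.map h) (by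
      change yoneda.map (e₁.inv ≫ p.map h) ≫ yoneda.map q ≫ g = yoneda.map r ≫ g
      rw [← yoneda.map_comp_assoc, hd])
    have hn : n ≫ m = m₁ := CostructuredArrow.hom_ext _ _ hd
    refine total.map_mk_eq_iff.2 ⟨n, rfl, (isomPresheaf_map_eq_iff hp θ n _ _).2 ?_⟩
    have h1 : A.map n ≫ l = h := hp.cancel a
      (by rw [Category.assoc, hl', ← A.map_comp, hn, ha]) (by
        rw [Functor.map_comp, hl, hec']
        exact Iso.hom_inv_id_assoc e₁ _)
    refine hp.cancel (B.map m) ?_ ?_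
    · change (K₁.1 ≫ B.map n) ≫ B.map m = (A.map n ≫ k) ≫ B.map m
      rw [Category.assoc, Category.assoc, hk', ← B.map_comp, hn, reassoc_of% h1, hb]
    · change p.map (K₁.1 ≫ B.map n) = p.map (A.map n ≫ k)
      rw [Functor.map_comp, Functor.map_comp, hK₁', hk, hθ]
  · rintro d ⟨hd₁, hd₂⟩
    rw [← hK₁] at hd₁
    obtain ⟨n, rfl, hn⟩ := (total.map_mk_eq_iff (c := c') (c' := c₁) (f := d)).1 hd₁
    replace hn : K₁.1 ≫ B.map n = A.map n ≫ k := (isomPresheaf_map_eq_iff hp θ n _ _).1 hn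
    have hnm : n ≫ m = m₁ := CostructuredArrow.hom_ext _ _ hd₂
    have h1 : A.map n ≫ l = h := hu _ ⟨by rw [Category.assoc, hl', ← A.map_comp, hnm], by
      rw [Category.assoc, ← hk', ← reassoc_of% hn, ← B.map_comp, hnm]⟩
    rw [Iso.eq_inv_comp, ← h1, Functor.map_comp, hl]
    exact (hec' n).symm

end Isom

end Trop

end

/-! ### The diagonal of a stack, and complexes as sheaves -/

noncomputable section

namespace Trop

open Limits Opposite

section Diagonal

universe v u u₁

variable {C : Type u} [Category.{v} C] {J : GrothendieckTopology C} {𝒳 : Type u₁}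
  [Category.{v} 𝒳] {p : 𝒳 ⥤ C}

/-- The diagonal of a stack is representable by geometric spaces if the isomorphisms between
two objects are representable. -/
theorem IsStack.representableByGeometricSpaces_diagonal (hp : IsStack J p)
    (P : MorphismProperty C)
    (hC : ∀ {S T : C} (f g : T ⟶ S), ∃ (E : C) (e : E ⟶ T), e ≫ f = e ≫ g ∧
      ∀ {T' : C} (t : T' ⟶ T), t ≫ f = t ≫ g → ∃! h : T' ⟶ E, h ≫ e = t)
    (hI : ∀ (X Y : 𝒳) (f : p.obj X ⟶ p.obj Y), ∃ (Z : 𝒳) (a : Z ⟶ X) (b : Z ⟶ Y),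
      p.map b = p.map a ≫ f ∧ ∀ {Z' : 𝒳} (a' : Z' ⟶ X) (b' : Z' ⟶ Y),
        p.map b' = p.map a' ≫ f → ∃! h : Z' ⟶ Z, h ≫ a = a' ∧ h ≫ b = b') :
    RepresentableByGeometricSpaces J P (diagonal p) := by
  -- A morphism from `V` to the square is a pair of families `A`, `B` with an identification `θ` of
  -- their bases. The base change of the diagonal is the sheaf of isomorphisms from `A` to `B` over
  -- `θ`.
  intro V hV G
  let A : CostructuredArrow yoneda V ⥤ 𝒳 := G.functor ⋙ CategoricalPullback.π₁ p p
  let B : CostructuredArrow yoneda V ⥤ 𝒳 := G.functor ⋙ CategoricalPullback.π₂ p p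
  let θ : A ⋙ p ≅ B ⋙ p :=
    Functor.isoWhiskerLeft G.functor (CategoricalPullback.catCommSq p p).iso
  let e : A ⋙ p ≅ overProj V := G.comm
  let H := isomPresheaf hp.fibered θ
  refine ⟨total H, hV.of_hom _ (hp.fibered.relativelyRepresentable_total θ e hI)
    (hp.isSheaf_total θ e hV.isSheaf) hC, ?_⟩
  let α : ∀ z : CategoricalPullback (diagonal p).functor G.functor, z.fst ⟶ A.obj z.snd :=
    fun z => z.iso.hom.fst
  let α' : ∀ z : CategoricalPullback (diagonal p).functor G.functor, A.obj z.snd ⟶ z.fst :=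
    fun z => z.iso.inv.fst
  let β : ∀ z : CategoricalPullback (diagonal p).functor G.functor, z.fst ⟶ B.obj z.snd :=
    fun z => z.iso.hom.snd
  have hα : ∀ z, α z ≫ α' z = 𝟙 _ := fun z =>
    congrArg CategoricalPullback.Hom.fst z.iso.hom_inv_id
  have hα' : ∀ z, α' z ≫ α z = 𝟙 _ := fun z =>
    congrArg CategoricalPullback.Hom.fst z.iso.inv_hom_id
  have hβ : ∀ z, p.map (α z) ≫ θ.hom.app z.snd = p.map (β z) := fun z =>
    z.iso.hom.w.trans (Category.id_comp _)
  have hfα : ∀ {z z' : CategoricalPullback (diagonal p).functor G.functor} (f : z ⟶ z'),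
      f.fst ≫ α z' = α z ≫ A.map f.snd := fun f =>
    congrArg CategoricalPullback.Hom.fst f.w
  have hfβ : ∀ {z z' : CategoricalPullback (diagonal p).functor G.functor} (f : z ⟶ z'),
      f.fst ≫ β z' = β z ≫ B.map f.snd := fun f =>
    congrArg CategoricalPullback.Hom.snd f.w
  let k : ∀ z : CategoricalPullback (diagonal p).functor G.functor, H.obj (op z.snd) := fun z =>
    ⟨α' z ≫ β z, by
      rw [Functor.map_comp, ← hβ, ← Category.assoc, ← Functor.map_comp, hα',
        CategoryTheory.Functor.map_id]
      exact Category.id_comp _⟩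
  obtain ⟨ρ, -⟩ := exists_representation (fiberProductProj (diagonal p) G) (total H)
    (fun z => total.mk (k z))
    (fun {z z'} f => by
      refine total.map_mk_eq_iff.2 ⟨f.snd, rfl, (isomPresheaf_map_eq_iff _ θ f.snd _ _).2 ?_⟩
      change (α' z ≫ β z) ≫ B.map f.snd = A.map f.snd ≫ α' z' ≫ β z'
      have h1 : A.map f.snd = α' z ≫ f.fst ≫ α z' := by
        rw [hfα, ← Category.assoc, hα', Category.id_comp]
      have h2 : α z' ≫ α' z' ≫ β z' = β z' := by rw [← Category.assoc, hα, Category.id_comp]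
      rw [h1, Category.assoc, Category.assoc, Category.assoc, h2, hfβ])
    (fun {z z'} m hm => by
      have hm' : ∃ n : z.snd ⟶ z'.snd, n.left = m ∧ H.map n.op (k z') = k z :=
        total.map_mk_eq_iff.1 hm
      obtain ⟨n, rfl, hn⟩ := hm'
      replace hn : (α' z ≫ β z) ≫ B.map n = A.map n ≫ α' z' ≫ β z' :=
        (isomPresheaf_map_eq_iff hp.fibered θ n _ _).1 hn
      have h1 : (α z ≫ A.map n ≫ α' z') ≫ α z' = α z ≫ A.map n := by
        rw [Category.assoc, Category.assoc, hα', Category.comp_id]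
      have h2 : (α z ≫ A.map n ≫ α' z') ≫ β z' = β z ≫ B.map n := by
        rw [Category.assoc, Category.assoc, ← hn, ← Category.assoc, ← Category.assoc, hα,
          Category.id_comp]
      refine ⟨⟨α z ≫ A.map n ≫ α' z', n, CategoricalPullback.hom_ext h1 h2⟩, rfl,
        fun f hf => CategoricalPullback.hom_ext ?_ (CostructuredArrow.hom_ext _ _ hf)⟩
      have hfn : f.snd = n := CostructuredArrow.hom_ext _ _ hf
      have h3 : f.fst = α z ≫ A.map n ≫ α' z' := by
        rw [← hfn, ← Category.assoc, ← hfα, Category.assoc, hα, Category.comp_id]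
      exact h3)
    (fun T t => by
      let c : CostructuredArrow yoneda V := CostructuredArrow.mk (t ≫ total.π)
      obtain ⟨κ, hκ⟩ := total.exists_mk_eq (c := c) t rfl
      let κ' : A.obj c ⟶ B.obj c := κ.1
      have hκ' : p.map κ' = θ.hom.app c := κ.2
      have : IsIso (p.map κ') := by rw [hκ']; infer_instance
      have : IsIso κ' := hp.fibered.isIso κ'
      let i : A.obj c ≅ B.obj c := asIso κ'
      let ι : (diagonal p).functor.obj (A.obj c) ≅ G.functor.obj c :=
        CategoricalPullback.mkIso (Iso.refl (A.obj c)) i (by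
          change p.map (𝟙 (A.obj c)) ≫ θ.hom.app c = 𝟙 (p.obj (A.obj c)) ≫ p.map κ'
          rw [hκ', CategoryTheory.Functor.map_id])
      let z : CategoricalPullback (diagonal p).functor G.functor := ⟨A.obj c, c, ι⟩
      refine ⟨z, Iso.refl T, ?_⟩
      have hz' : α' z ≫ β z = κ' := Category.id_comp κ'
      have hz : k z = κ := Subtype.ext hz'
      exact ((congrArg total.mk hz).trans hκ).trans
        ((congrArg (fun u => u ≫ t) (yoneda.map_id T)).trans (Category.id_comp t)).symm)
  exact ⟨ρ⟩

end Diagonal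

/-! ### Cone complexes -/

namespace RPCC

open RPC (toRPCC)

/-- The canonical morphisms of the cones belong to every covering sieve, and a matching family is
compatible with face morphisms, so its values on cones glue. -/
theorem isSheaf_yoneda (S : RPCC) : Presheaf.IsSheaf faceTopology (yoneda.obj S) := by
  rw [isSheaf_iff_isSheaf_of_type]
  intro T R hR x hx
  rw [Presieve.compatible_iff_sieveCompatible] at hx
  have hx' : ∀ {T' T'' : RPCC} (f : T' ⟶ T) (g : T'' ⟶ T') (hf : R f) (h : T'' ⟶ T) (hh : R h),
      g ≫ f = h → x h hh = g ≫ x f hf := by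
    rintro T' T'' f g hf _ hh rfl
    exact hx f g hf
  let j : ∀ α : T.Idx, toRPCC.obj (T.cone α) ⟶ S := fun α => x (ofCone α (𝟙 _)) (hR _ _)
  refine ⟨glue j fun {α β} φ hφ => (hx' _ _ _ _ _ (map_mor_comp_ofCone hφ)).symm,
    fun T' f hf => ?_, fun t ht => ?_⟩
  · refine RPCC.hom_ext fun β => ?_
    have h1 : toRPCC.map (f.hom β) ≫ ofCone (f.idx β) (𝟙 _) = ofCone β (𝟙 _) ≫ f := by
      rw [map_comp_ofCone, ofCone_comp, Category.comp_id, Category.id_comp]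
    change ofCone β (𝟙 _) ≫ f ≫ glue j _ = ofCone β (𝟙 _) ≫ x f hf
    rw [← Category.assoc, ← h1, Category.assoc, ofCone_comp_glue, ← hx' f _ hf _ (hR _ _) rfl]
    exact (hx' _ _ _ _ _ h1).symm
  · refine RPCC.hom_ext fun α => ?_
    rw [ofCone_comp_glue]
    exact ht (ofCone α (𝟙 _)) (hR _ _)

/-- The component of the inverse ends in a cone whose index is only equal to `α`; the face morphism
`χ` corrects for this. -/
theorem isIso_hom {S T : RPCC} (f : S ⟶ T) [IsIso f] (α : S.Idx) : IsIso (f.hom α) := by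
  obtain ⟨g, hfg, hgf⟩ := IsIso.out (f := f)
  obtain ⟨χ, hχ, h⟩ := exists_mor_of_eq hfg α
  obtain ⟨χ', hχ', h'⟩ := exists_mor_of_eq hgf (f.idx α)
  obtain ⟨ψ, hψ, hψ'⟩ := f.exists_mor χ hχ
  obtain rfl : ψ = χ' := T.mor_subsingleton _ _ hψ hχ'
  refine ⟨g.hom (f.idx α) ≫ χ, (Category.assoc _ _ _).symm.trans h, ?_⟩
  exact (Category.assoc _ _ _).trans ((congrArg (fun u => g.hom (f.idx α) ≫ u) hψ').trans
    ((Category.assoc _ _ _).symm.trans h'))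

instance : strict.RespectsIso :=
  MorphismProperty.RespectsIso.mk _
    (fun e f hf α => by
      have := isIso_hom e.hom α
      have := hf (e.hom.idx α)
      exact IsIso.comp_isIso (f := e.hom.hom α) (h := f.hom (e.hom.idx α)))
    (fun e f hf α => by
      have := isIso_hom e.hom (f.idx α)
      have := hf α
      exact IsIso.comp_isIso (f := f.hom α) (h := e.hom.hom (f.idx α)))

end RPCC

end Trop

end

/-! ### Representatives of graphs and the conclusion -/

noncomputable section

namespace Trop

section

open Limits Opposite

universe v u u₁ v₁ u₂ v₂

variable {C : Type u} [Category.{v} C] {J : GrothendieckTopology C} {P : MorphismProperty C}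

theorem presheaf_id [P.RespectsIso] (hP : ∀ T : C, P (𝟙 T)) (S : C) :
    P.presheaf (𝟙 (yoneda.obj S)) :=
  MorphismProperty.relative.of_exists fun a g =>
    ⟨a, g, 𝟙 a, by rw [CategoryTheory.Functor.map_id]; exact IsPullback.id_vert g, hP a⟩

/-- A representable presheaf is a geometric space that is its own atlas. -/
theorem IsRepresentableCoveringIn.isCoveringIn [P.RespectsIso] {𝒳 : Type u₁} [Category.{v₁} 𝒳]
    {𝒵 : Type u₂} [Category.{v₂} 𝒵] {p : 𝒳 ⥤ C} {r : 𝒵 ⥤ C} {F : OverFunctor p r}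
    (hF : IsRepresentableCoveringIn J P F) (hP : ∀ T : C, P (𝟙 T))
    (hJ : ∀ S : C, IsGeometricSpace J P (yoneda.obj S)) : IsCoveringIn J P F := fun S G => by
  obtain ⟨W, ρ, f, hρ, hf, hf'⟩ := hF S G
  exact ⟨yoneda.obj W, hJ W, ρ, yoneda.map f, hρ, hf, W, 𝟙 _, presheaf_id hP W, inferInstance, f,
    hf', (Category.id_comp _).symm⟩

end

namespace StableGraph

variable {g n : ℕ} {G H : StableGraph g n}

/-- Graphs are isomorphic if there is a bijection of vertices and flags that preserves all data. -/
theorem nonempty_iso (f : G.graph.X ≃ H.graph.X) (hr : ∀ x, f (G.graph.r x) = H.graph.r (f x))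
    (hi : ∀ x, f (G.graph.inv x) = H.graph.inv (f x))
    (hh : ∀ x (hx : G.graph.r x = x) (hx' : H.graph.r (f x) = f x),
      G.graph.h ⟨x, hx⟩ = H.graph.h ⟨f x, hx'⟩)
    (hm : ∀ i, f (G.graph.mark i) = H.graph.mark i) : Nonempty (G ≅ H) := by
  have hv : ∀ {x}, H.graph.IsVertex (f x) → G.graph.IsVertex x := fun {x} hx =>
    f.injective ((hr x).trans hx)
  have hc : ∀ x (_ : G.graph.IsVertex x), G.graph.ConnectedOn (f ⁻¹' {f x}) := fun x hx =>
    ⟨⟨⟨⟨x, hx⟩, rfl⟩⟩, fun a b => by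
      obtain rfl : a = b :=
        Subtype.ext (Subtype.ext (f.injective (Eq.trans a.2 (Eq.symm b.2))))
      exact .refl⟩
  let π : G ⟶ H :=
    { toFun := f
      map_r := hr
      map_inv := hi
      map_mark := hm
      existsUnique_flag y _ := f.bijective.existsUnique y
      connected v hv' := by
        obtain ⟨x, rfl⟩ := f.surjective v
        exact hc x (hv hv')
      genus_eq := by
        rintro ⟨v, hv'⟩
        obtain ⟨x, rfl⟩ := f.surjective v
        have hx : G.graph.r x = x := hv hv'
        have h1 := WeightedGraph.two_mul_genusOn (G := G.graph.toWeightedGraph)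
          (S := f ⁻¹' {f x}) (fun y hy => by
            obtain rfl : y = x := f.injective hy
            exact (congrArg f (WeightedGraph.inv_vertex hx) : _)) (hc x hx)
        let _ : Unique (f ⁻¹' {f x}) := ⟨⟨⟨x, rfl⟩⟩, fun z => Subtype.ext (f.injective z.2)⟩
        rw [finsum_unique] at h1
        have h2 : G.graph.contribution x = 2 * (G.graph.h ⟨x, hx⟩ : ℤ) - 2 := dif_pos hx
        change 2 * _ = G.graph.contribution x + 2 at h1
        rw [h2, hh x hx hv'] at h1
        change G.graph.genusOn (f ⁻¹' {f x}) = _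
        linarith }
  have : IsIso π := isIso_of_isVertex π fun x hx => hv hx
  exact ⟨asIso π⟩

variable (g n) in
/-- There is a set of representatives of the isomorphism classes of graphs. -/
theorem exists_representatives : ∃ (I : Type) (G : I → StableGraph g n),
    ∀ H, ∃ i, Nonempty (H ≅ G i) := by
  -- A finite graph can be moved to a standard set `Fin m`. The transported data determine it up to
  -- isomorphism and form a type small enough to index an atlas.
  let D := Σ m, (Fin m → Fin m) × (Fin m → Fin m) × (Fin m → ℕ) × (Fin n → Fin m)
  let Q : StableGraph g n → D → Prop := fun H d => ∃ e : H.graph.X ≃ Fin d.1,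
    (∀ x, d.2.1 (e x) = e (H.graph.r x)) ∧ (∀ x, d.2.2.1 (e x) = e (H.graph.inv x)) ∧
      (∀ x (hx : H.graph.r x = x), d.2.2.2.1 (e x) = H.graph.h ⟨x, hx⟩) ∧
        ∀ i, d.2.2.2.2 i = e (H.graph.mark i)
  have h1 : ∀ H, ∃ d, Q H d := fun H => by
    classical
    let e := Finite.equivFin H.graph.X
    refine ⟨⟨_, fun a => e (H.graph.r (e.symm a)), fun a => e (H.graph.inv (e.symm a)),
      -- The weight is set to zero off the vertices; `Q` compares weights at vertices only.
      fun a => if h : H.graph.r (e.symm a) = e.symm a then H.graph.h ⟨_, h⟩ else 0,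
      fun i => e (H.graph.mark i)⟩, e, fun x => ?_, fun x => ?_, fun x hx => ?_, fun i => rfl⟩
    · simp only [Equiv.symm_apply_apply]
    · simp only [Equiv.symm_apply_apply]
    · have : ∀ y, y = x → (if h : H.graph.r y = y then H.graph.h ⟨y, h⟩ else 0) =
          H.graph.h ⟨x, hx⟩ := by
        rintro _ rfl
        exact dif_pos hx
      exact this _ (e.symm_apply_apply x)
  have h2 : ∀ H H' d, Q H d → Q H' d → Nonempty (H ≅ H') := by
    rintro H H' d ⟨e, hr, hi, hh, hm⟩ ⟨e', hr', hi', hh', hm'⟩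
    have he : ∀ x, e' ((e.trans e'.symm) x) = e x := fun x => e'.apply_symm_apply (e x)
    refine nonempty_iso (e.trans e'.symm) (fun x => e'.injective ?_) (fun x => e'.injective ?_)
      (fun x hx hx' => ?_) fun i => e'.injective ?_
    · rw [he, ← hr', he, hr]
    · rw [he, ← hi', he, hi]
    · rw [← hh, ← hh', he]
    · rw [he, ← hm, ← hm']
  choose rep hrep using fun d : {d // ∃ H, Q H d} => d.2
  refine ⟨{d // ∃ H, Q H d}, rep, fun H => ?_⟩
  obtain ⟨d, hd⟩ := h1 H
  exact ⟨⟨d, H, hd⟩, h2 H _ d hd (hrep ⟨d, H, hd⟩)⟩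

end StableGraph

namespace Mtrop

open TropCurve RPCC
open RPC (toRPCC)

variable {g n : ℕ}

/-- Morphisms of families are cartesian, so a pullback of `Y` along a composed morphism is already a
pullback of `X`. -/
theorem IsPullback.of_hom {X Y : Mtrop g n} (q : X ⟶ Y) {σ τ : RPC} {f : σ ⟶ τ}
    {j : toRPCC.obj τ ⟶ X.base} {j' : toRPCC.obj τ ⟶ Y.base} (hj : j ≫ q.base = j')
    {Γ : TropCurve g n σ} (h : Y.IsPullback f j' Γ) : X.IsPullback f j Γ := by
  subst hj
  obtain ⟨π, hπ⟩ := h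
  obtain ⟨χ, -, hχ⟩ := (q.isHomOver (topIdx j)).exists_lift (f := f ≫ topHom j) hπ
    (Category.assoc _ _ _)
  exact ⟨χ, hχ⟩

theorem isPullback_univ {I : Type} (G : I → StableGraph g n) (i : I) :
    (univ G).IsPullback (𝟙 _) (atlasι G i) (tautological (G i)) := by
  have h : ∀ {τ : RPC}, (𝟙 τ ≫ τ.toTop ≫ 𝟙 _) ≫ τ.faceι τ.topFace = 𝟙 τ := by
    intro τ
    rw [Category.id_comp, Category.comp_id, RPC.toTop_faceι]
  obtain ⟨χ, -, hχ⟩ := (isHomOver_univMarking G ⟨i, (orthant (G i).Edge).topFace⟩).exists_lift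
    (f := 𝟙 _ ≫ topHom (atlasι G i)) (IsHomOver.id (tautological (G i))) h
  exact ⟨χ, hχ⟩

/-- The universal family over the atlas defines the morphism to the stack, and its base changes are
the products computed by `exists_product`. -/
theorem exists_covering {I : Type} (G : I → StableGraph g n)
    (hG : ∀ H, ∃ i, Nonempty (H ≅ G i)) :
    ∃ F : OverFunctor (overProj (yoneda.obj (atlas G))) (proj g n),
      IsRepresentableCoveringIn faceTopology strict F ∧
        ∀ i, IsPullback (F.functor.obj (CostructuredArrow.mk (𝟙 _))) (𝟙 _)
          (atlasι G i ≫ F.comm.inv.app (CostructuredArrow.mk (𝟙 _))) (tautological (G i)) := by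
  obtain ⟨F, κ, hκ, hκ'⟩ := isFiberedInGroupoids.exists_overFunctor (univ G)
  refine ⟨F, isFiberedInGroupoids.isRepresentableCoveringIn F κ hκ hκ' fun η =>
    exists_product G hG η, fun i => IsPullback.of_hom (κ _) ?_ (isPullback_univ G i)⟩
  have h1 : (κ (CostructuredArrow.mk (𝟙 _))).base = F.comm.hom.app _ :=
    yoneda.map_injective ((hκ' (CostructuredArrow.mk (𝟙 _))).trans (Category.comp_id _))
  have h2 := Iso.inv_hom_id_app F.comm (CostructuredArrow.mk (𝟙 (yoneda.obj (atlas G))))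
  exact (Category.assoc _ _ _).trans ((congrArg (fun f => atlasι G i ≫ _ ≫ f) h1).trans
    ((congrArg (fun f => atlasι G i ≫ f) h2).trans (Category.comp_id _)))

theorem isConeStack (g n : ℕ) : IsConeStack (proj g n) where
  isStack := isStack
  diagonal := isStack.representableByGeometricSpaces_diagonal _ exists_equalizer exists_isom
  atlas := by
    obtain ⟨I, G, hG⟩ := StableGraph.exists_representatives g n
    obtain ⟨F, hF, -⟩ := exists_covering G hG
    have hP : ∀ T : RPCC, strict (𝟙 T) := fun T α => by
      change IsIso (𝟙 (T.cone α))
      infer_instance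
    have hJ : ∀ S : RPCC, IsGeometricSpace faceTopology strict (yoneda.obj S) := fun S =>
      isGeometricSpace_yoneda S (isSheaf_yoneda S) hP exists_equalizer
    exact ⟨_, F, hJ _, hF.isCoveringIn hP hJ⟩

end Mtrop

end Trop

end

theorem theorem1 (g n : ℕ) (hgn : 0 < 2 * (g : ℤ) - 2 + n) :
    -- the functor of stable tropical curves over `RPC` is fibered in groupoids,
    Trop.IsFiberedInGroupoids (Trop.MtropRPC.proj g n) ∧
    -- it is the restriction to `RPC` of the moduli stack over `RPCC`,
    (∃ (E : CategoryTheory.Limits.CategoricalPullback Trop.RPC.toRPCC (Trop.Mtrop.proj g n) ≌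
          Trop.MtropRPC g n)
        (c : E.functor ⋙ Trop.MtropRPC.proj g n ≅
          CategoryTheory.Limits.CategoricalPullback.π₁ Trop.RPC.toRPCC (Trop.Mtrop.proj g n)),
      ∀ z, Trop.Mtrop.IsPullback (τ := z.fst) z.snd (c.hom.app z) z.iso.hom
        (E.functor.obj z).curve) ∧
    -- the moduli stack over `RPCC` is a cone stack,
    Trop.IsConeStack (Trop.Mtrop.proj g n) ∧
    -- and the coproduct `U` of the cones `ℝ_{≥0}^{E(G)}` is a strict cover of it, representable by
    -- cone complexes, such that `ℝ_{≥0}^{E(G)} → U → M` is the tautological tropical curve.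
    ∀ (I : Type) (G : I → Trop.StableGraph g n), (∀ H, ∃ i, Nonempty (H ≅ G i)) →
      ∃ (U : Trop.RPCC)
        (inj : ∀ i, Trop.RPC.toRPCC.obj (Trop.orthant (G i).Edge) ⟶ U)
        (F : Trop.OverFunctor (Trop.overProj (CategoryTheory.yoneda.obj U)) (Trop.Mtrop.proj g n)),
        Nonempty (CategoryTheory.Limits.IsColimit (CategoryTheory.Limits.Cofan.mk U inj)) ∧
        Trop.IsRepresentableCoveringIn Trop.RPCC.faceTopology Trop.RPCC.strict F ∧
        ∀ i, Trop.Mtrop.IsPullback (F.functor.obj (CategoryTheory.CostructuredArrow.mk (𝟙 _)))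
          (𝟙 _) (inj i ≫ F.comm.inv.app (CategoryTheory.CostructuredArrow.mk (𝟙 _)))
          (Trop.tautological (G i)) := by
  refine ⟨Trop.MtropRPC.isFiberedInGroupoids, Trop.Mtrop.exists_restriction_equivalence,
    Trop.Mtrop.isConeStack g n, fun I G hG => ?_⟩
  obtain ⟨F, hF, hF'⟩ := Trop.Mtrop.exists_covering G hG
  exact ⟨Trop.Mtrop.atlas G, Trop.Mtrop.atlasι G, F, Trop.RPCC.isColimit_sigma _, hF, hF'⟩
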